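/- **Setting.** Let $M$ be a closed smooth Riemannian manifold of dimension $d\ge 2$ and diameter $<1$ (with its Riemannian distance), and let $f:M\to M$ be $C^1$ with non-empty singular set $\Gamma_\infty=\{x: d_xf \text{ is degenerate}\}$. Fix constants $0<\beta\le 1$, $a,K>1$, $\Gamma>0$, $\gamma>20/\beta$. *Scale and frames.* Fix $r\in(0,1)$ such that every $\exp_x$ is a smooth diffeomorphism from $\{\xi\in T_xM:|\xi|<r\}$ onto $B(x,r)$, it and its inverse being 2-Lipschitz; and a countable family $\mathcal D$ of balls of radius $<r$ with a Lebesgue number $\delta>0$ (every ball $B(x,\delta)$, $x\notin\Gamma_\infty$, lies in some $D\in\mathcal D$), each $D$ with a smooth $\Theta_D:TD\to\mathbb R^d$ that is a linear isometry on each fibre; put $\nu_y=(\Theta_D|_{T_yM})^{-1}$. For a constant $L\ge 1$, uniformly in $D$: $(y,u)\mapsto\exp_y(\nu_yu)$ is smooth and $L$-Lipschitz on $D\times B_r(0)$; $y\mapsto\nu_y^{-1}\exp_y^{-1}(z)$ is $L$-Lipschitz where it is defined; and the differentials, read in the frames, $\Theta_D\, d_u(\exp_y\circ\nu_y)$ and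 $\Theta_D\, d_z(\exp_y^{-1})\,\nu_z$ are $L$-Lipschitz in $(y,u)$ and in $(y,z)$, where they are defined. *Assumptions on $f$.* For every $x$ with $x,f(x)\notin\Gamma_\infty$ there is $\tau(x)$ with $\min\{d(x,\Gamma_\infty)^a,d(f(x),\Gamma_\infty)^a\}<\tau(x)<1$ such that, with $D_x=B(x,2\tau(x))$ and $\mathfrak E_x=B(f(x),2\tau(x))$: (A1) $f|_{D_x}$ is a $C^1$ diffeomorphism onto its image, and there is an inverse branch $f_x^{-1}$ of $f$ on $\mathfrak E_x$, with $f_x^{-1}(f(x))=x$, that is a $C^1$ diffeomorphism onto its image; (A2) $d(x,\Gamma_\infty)^a\le\|d_yf\|,\ \|d_zf_x^{-1}\|\le d(x,\Gamma_\infty)^{-a}$ for $y\in D_x$, $z\in\mathfrak E_x$; (A3) the differentials of $f$ on $D_x$ and of $f_x^{-1}$ on $\mathfrak E_x$, read in the frames $\Theta_D$ (for all pairs $D,D'\in\mathcal D$ containing the points and their images, respectively), are $\beta$-Hölder with constant $K$. *Summable points.* Let $M^f$ be the set of full orbits $\tilde x=(x_i)_{i\in\mathbb Z}$, $f(x_i)=x_{i+1}$,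 with shift $\hat f$. An orbit avoiding $\Gamma_\infty$ is *summable* if there is a unique decomposition $T_{x_0}M=E^s\oplus E^u$ such that $\sum_{m\ge0}|d\hat f^m\xi|^2$ is bounded over unit $\xi\in E^s$ and $\sum_{m\ge0}|d\hat f^{-m}\xi|^2$ is bounded over unit $\xi\in E^u$. Put $d_s(\tilde x)=\dim E^s$, $d_u(\tilde x)=\dim E^u$, and let $\langle\cdot,\cdot\rangle'$ be the inner product on $T_{x_0}M$ with $E^s\perp E^u$, $\langle\xi,\eta\rangle'=2\sum_{m\ge0}\langle d\hat f^m\xi,d\hat f^m\eta\rangle$ on $E^s$ and $\langle\xi,\eta\rangle'=2\sum_{m\ge0}\langle d\hat f^{-m}\xi,d\hat f^{-m}\eta\rangle$ on $E^u$. Choose a linear isometry $C_0(\tilde x):(\mathbb R^d,\langle\cdot,\cdot\rangle)\to(T_{x_0}M,\langle\cdot,\cdot\rangle')$ that maps $\mathbb R^{d_s}\times 0$ onto $E^s$ and $0\times\mathbb R^{d_u}$ onto $E^u$, and put $\psi_{\tilde x}=\exp_{x_0}\circ C_0(\tilde x)$. *Double charts.* Let $I(t)=te^{\Gamma t^{1/\gamma}}$,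 let $I^{1/4}$ be a strictly increasing $C^1$ function on $(0,\infty)$ with $I^{1/4}(t)>t$ whose fourth iterate is $I$, and let $\mathcal I=\{I^{-\ell/4}(1):\ell\in\mathbb N\}$; $s=I^{\pm1}(t)$ means $I^{-1}(t)\le s\le I(t)$. For $\epsilon>0$ let $Q(\tilde x)$ be the largest $q\in\mathcal I$ with $q\le\epsilon^{20/\beta}\rho(\tilde x)^{8a/\beta}\|C_0(\tilde x)^{-1}\|^{-2\gamma}$, where $\rho(\tilde x)=d(\{x_{-1},x_0,x_1\},\Gamma_\infty)$ and the norm is taken with respect to the Riemannian and Euclidean norms. Charts $\psi_{\tilde x}^{\eta},\psi_{\tilde x'}^{\eta'}$ *$I$-overlap* if $\eta=I^{\pm1}(\eta')$ and for some $D\in\mathcal D$ containing $x_0,x_0'$ we have $d(x_0,x'_0)+\|\Theta_DC_0(\tilde x)-\Theta_DC_0(\tilde x')\|<\eta^4\eta'^4$. A *double chart* $w=\psi_{\tilde x}^{p^s,p^u}$ consists of a summable $\tilde x$ and $p^s,p^u\in\mathcal I$ with $p^s,p^u\le Q(\tilde x)$. Write $\psi_{\tilde x}^{p^s,p^u}\to\psi_{\tilde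 y}^{q^s,q^u}$ if $\psi_{\tilde x}^{p^s\wedge p^u}$ $I$-overlaps $\psi_{\hat f^{-1}\tilde y}^{p^s\wedge p^u}$, $\psi_{\hat f\tilde x}^{q^s\wedge q^u}$ $I$-overlaps $\psi_{\tilde y}^{q^s\wedge q^u}$, $p^s=\min\{I(q^s),Q(\tilde x)\}$ and $q^u=\min\{I(p^u),Q(\tilde y)\}$. *Admissible manifolds.* An *$s$-admissible manifold* at $\psi_{\tilde x}^{p^s,p^u}$ is a set $\psi_{\tilde x}\{(v,G(v)):v\in\mathbb R^{d_s},|v|<p^s\}$ where $G$ is a $C^{1+\beta/2}$ map from that ball to $\mathbb R^{d_u}$ (its representing function) with $|G(0)|\le10^{-3}(p^s\wedge p^u)^2$, $\|d_0G\|\le\frac12(p^s\wedge p^u)^{\beta/2}$ and $\|dG\|_{C^0}+\mathrm{Höl}_{\beta/2}(dG)<\frac12$. A *$u$-admissible manifold* is a set $\psi_{\tilde x}\{(G(v),v):v\in\mathbb R^{d_u},|v|<p^u\}$ with $G$ mapping to $\mathbb R^{d_s}$ and satisfying the same conditions. **Theorem.** There is $\epsilon_0>0$, independent of the choice of the $C_0(\tilde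 x)$, such that for all $0<\epsilon<\epsilon_0$ and all double charts $w_1=\psi_{\tilde x}^{p^s,p^u}\to w_2=\psi_{\tilde y}^{q^s,q^u}$ the following holds. *$s$-case.* Let $V^s$ be $s$-admissible at $w_2$ with representing function $G$. Write $f_{\tilde x}^{-1}=f_{x_0}^{-1}$. Then $V^s\subset\mathfrak E_{x_0}$, so that $f_{\tilde x}^{-1}V^s$ is defined, and 1. $f_{\tilde x}^{-1}V^s$ contains a unique $s$-admissible manifold at $w_1$, denoted $\mathcal F^s_{w_1,w_2}(V^s)$; 2. for every $u$-admissible $V^u$ at $w_1$, $f_{\tilde x}^{-1}V^s\cap V^u$ is exactly one point; 3. $f_{\tilde x}^{-1}(\psi_{\tilde y}(0,G(0)))\in\mathcal F^s_{w_1,w_2}(V^s)$. *$u$-case.* Let $V^u$ be $u$-admissible at $w_1$ with representing function $G$. Then 1. $f(V^u)$ contains a unique $u$-admissible manifold at $w_2$, denoted $\mathcal F^u_{w_1,w_2}(V^u)$; 2. for every $s$-admissible $V^s$ at $w_2$, $f(V^u)\cap V^s$ is exactly one point; 3. $f(\psi_{\tilde x}(G(0),0))\in\mathcal F^u_{w_1,w_2}(V^u)$.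 -/

import Mathlib

open Set Metric Function Topology Manifold Bundle
open scoped ContDiff

attribute [local instance 2000] chartedSpaceSelf

noncomputable section

/-- The Euclidean space `ℝᵐ`. -/
abbrev Euc (m : ℕ) : Type := EuclideanSpace ℝ (Fin m)

/-- The point `(v₁, v₂)` of `ℝᵈ = ℝᵏ × ℝᵈ⁻ᵏ` (used with `k ≤ d`). -/
def joinVec {d k : ℕ} (v₁ : Euc k) (v₂ : Euc (d - k)) : Euc d :=
  WithLp.toLp 2 fun i : Fin d =>
    if h : (i : ℕ) < k then v₁ ⟨i, h⟩ else v₂ ⟨(i : ℕ) - k, by omega⟩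

/-! ### Ladder function -/

/-- The numerical parameters of the setting: the Hölder exponent `β`, the constants `a`, `K` of the
singular map, the constants `Γ` (called `G`) and `γ` of the ladder function `I`, and a quarter
iterate `J = I^{1/4}` of the ladder function. -/
structure Constants where
  β : ℝ
  a : ℝ
  K : ℝ
  G : ℝ
  γ : ℝ
  J : ℝ → ℝ

namespace Constants

/-- The ladder function `I(t) = t exp(Γ t^{1/γ})`. -/
def ladder (c : Constants) (t : ℝ) : ℝ := t * Real.exp (c.G * t ^ (1 / c.γ))

/-- The standing conditions on the parameters; `J` is a strictly increasing `C¹` function on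
`(0, ∞)` with `J t > t`, whose fourth iterate is the ladder function. -/
structure Valid (c : Constants) : Prop where
  β_pos : 0 < c.β
  β_le_one : c.β ≤ 1
  one_lt_a : 1 < c.a
  one_lt_K : 1 < c.K
  G_pos : 0 < c.G
  γ_gt : 20 / c.β < c.γ
  J_gt : ∀ t, 0 < t → t < c.J t
  J_strictMono : StrictMonoOn c.J (Ioi 0)
  J_contDiff : ContDiffOn ℝ 1 c.J (Ioi 0)
  J_iterate : ∀ t, 0 < t → c.J^[4] t = c.ladder t

/-- The set `{I^{-ℓ/4}(1) : ℓ ∈ ℕ}`. -/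
def ladderSet (c : Constants) : Set ℝ := {t | 0 < t ∧ ∃ l : ℕ, c.J^[l] t = 1}

/-- `s = I^{±1}(t)`, that is `I⁻¹(t) ≤ s ≤ I(t)`. -/
def LadderClose (c : Constants) (s t : ℝ) : Prop := s ≤ c.ladder t ∧ t ≤ c.ladder s

end Constants

/-! ### Geodesics and the exponential map -/

section Geometry

variable (d : ℕ) {M : Type*} [MetricSpace M] [ChartedSpace (Euc d) M] [IsManifold (𝓡 d) ∞ M]
  [RiemannianBundle (fun x : M => TangentSpace (𝓡 d) x)]

/-- The Riemannian metric read in the preferred chart at `x₀`: `g_u(v, w)`. -/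
def chartMetric (x₀ : M) (u v w : Euc d) : ℝ :=
  inner ℝ (mfderiv 𝓘(ℝ, Euc d) (𝓡 d) (extChartAt (𝓡 d) x₀).symm u v)
    (mfderiv 𝓘(ℝ, Euc d) (𝓡 d) (extChartAt (𝓡 d) x₀).symm u w)

/-- A smooth curve is a geodesic if, in every preferred chart, its coordinate expression `c` solves
the geodesic equation, written as the Euler–Lagrange equation of the energy:
`d/dt g_c(c', w) = ½ ∂_w g_c(c', c')` for every constant vector `w`. -/
def IsGeodesic (σ : ℝ → M) : Prop :=
  ContMDiff 𝓘(ℝ, ℝ) (𝓡 d) ∞ σ ∧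
  ∀ (x₀ : M) (t₀ : ℝ), σ t₀ ∈ (extChartAt (𝓡 d) x₀).source →
    let c : ℝ → Euc d := fun t => extChartAt (𝓡 d) x₀ (σ t)
    ∀ w : Euc d,
      HasDerivAt (fun t => chartMetric d x₀ (c t) (deriv c t) w)
        (1 / 2 * fderiv ℝ (fun u => chartMetric d x₀ u (deriv c t₀) (deriv c t₀)) (c t₀) w) t₀

/-- `σ` is a geodesic with initial point `x` and initial velocity `ξ`. -/
def IsGeodesicFrom (x : M) (ξ : TangentSpace (𝓡 d) x) (σ : ℝ → M) : Prop :=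
  IsGeodesic d σ ∧
    (⟨σ 0, mfderiv 𝓘(ℝ, ℝ) (𝓡 d) σ 0 (1 : ℝ)⟩ : TangentBundle (𝓡 d) M) = ⟨x, ξ⟩

open Classical in
/-- The Riemannian exponential map `exp_x : T_xM → M`. -/
def expMap (x : M) (ξ : TangentSpace (𝓡 d) x) : M :=
  if h : ∃ σ : ℝ → M, IsGeodesicFrom d x ξ σ then h.choose 1 else x

/-- The inverse of `exp_x` restricted to the ball of radius `r`. -/
def expInv (r : ℝ) (x z : M) : TangentSpace (𝓡 d) x :=
  Function.invFunOn (expMap d x) (ball (0 : TangentSpace (𝓡 d) x) r) z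

variable (M) in
/-- The choice of a radius `r` and of a countable family of coordinate balls `D n` with orthonormal
frames `Θ n y : T_yM → ℝᵈ` (`y ∈ D n`; the values for `y ∉ D n` are irrelevant), with uniform
Lipschitz constant `L` and with a Lebesgue number `δ`, covering the complement of `S`. -/
structure FrameCover (S : Set M) where
  r : ℝ
  L : ℝ
  center : ℕ → M
  radius : ℕ → ℝ
  Θ : ∀ (_ : ℕ) (y : M), TangentSpace (𝓡 d) y ≃ₗᵢ[ℝ] Euc d
  r_pos : 0 < r
  r_lt_one : r < 1
  one_le_L : 1 ≤ L
  -- the scale `r` at which exponential maps are diffeomorphisms with distortion at most two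
  exp_bijOn : ∀ x : M, BijOn (expMap d x) (ball (0 : TangentSpace (𝓡 d) x) r) (ball x r)
  exp_smooth : ∀ x : M, ContMDiffOn 𝓘(ℝ, TangentSpace (𝓡 d) x) (𝓡 d) ∞ (expMap d x) (ball 0 r)
  expInv_smooth : ∀ x : M,
    ContMDiffOn (𝓡 d) 𝓘(ℝ, TangentSpace (𝓡 d) x) ∞ (expInv d r x) (ball x r)
  exp_lip : ∀ (x : M), ∀ ξ ∈ ball (0 : TangentSpace (𝓡 d) x) r,
    ∀ ζ ∈ ball (0 : TangentSpace (𝓡 d) x) r, dist (expMap d x ξ) (expMap d x ζ) ≤ 2 * ‖ξ - ζ‖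
  expInv_lip : ∀ (x : M), ∀ y ∈ ball x r, ∀ z ∈ ball x r,
    ‖expInv d r x y - expInv d r x z‖ ≤ 2 * dist y z
  -- the covering sets
  radius_pos : ∀ n, 0 < radius n
  radius_lt : ∀ n, radius n < r
  lebesgue : ∃ δ > 0, ∀ y ∉ S, ∃ n, ball y δ ⊆ ball (center n) (radius n)
  -- the frames
  Θ_smooth : ∀ n, ContMDiffOn (𝓡 d).tangent 𝓘(ℝ, Euc d) ∞
    (fun p : TangentBundle (𝓡 d) M => Θ n p.proj p.snd)
    (TotalSpace.proj ⁻¹' ball (center n) (radius n))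
  exp_frame_smooth : ∀ n, ContMDiffOn ((𝓡 d).prod 𝓘(ℝ, Euc d)) (𝓡 d) ∞
    (fun q : M × Euc d => expMap d q.1 ((Θ n q.1).symm q.2))
    (ball (center n) (radius n) ×ˢ ball 0 r)
  exp_frame_lip : ∀ n, ∀ y ∈ ball (center n) (radius n), ∀ y' ∈ ball (center n) (radius n),
    ∀ u ∈ ball (0 : Euc d) r, ∀ u' ∈ ball (0 : Euc d) r,
    dist (expMap d y ((Θ n y).symm u)) (expMap d y' ((Θ n y').symm u')) ≤
      L * (dist y y' + ‖u - u'‖)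
  expInv_frame_lip : ∀ n, ∀ y ∈ ball (center n) (radius n), ∀ y' ∈ ball (center n) (radius n),
    ∀ z ∈ ball y r ∩ ball y' r,
    ‖Θ n y (expInv d r y z) - Θ n y' (expInv d r y' z)‖ ≤ L * dist y y'
  -- Lipschitz dependence of the differentials of `exp_y` and `exp_y⁻¹`, read in the frames
  dexp_frame_lip : ∀ n, ∀ y ∈ ball (center n) (radius n), ∀ y' ∈ ball (center n) (radius n),
    ∀ u ∈ ball (0 : Euc d) r, ∀ u' ∈ ball (0 : Euc d) r,
    expMap d y ((Θ n y).symm u) ∈ ball (center n) (radius n) →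
    expMap d y' ((Θ n y').symm u') ∈ ball (center n) (radius n) →
    ∀ w : Euc d,
    ‖Θ n _ (mfderiv 𝓘(ℝ, Euc d) (𝓡 d) (fun v => expMap d y ((Θ n y).symm v)) u w) -
      Θ n _ (mfderiv 𝓘(ℝ, Euc d) (𝓡 d) (fun v => expMap d y' ((Θ n y').symm v)) u' w)‖ ≤
      L * (‖u - u'‖ + dist y y') * ‖w‖
  dexpInv_frame_lip : ∀ n, ∀ y ∈ ball (center n) (radius n), ∀ y' ∈ ball (center n) (radius n),
    ∀ z ∈ ball (center n) (radius n) ∩ ball y r, ∀ z' ∈ ball (center n) (radius n) ∩ ball y' r,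
    ∀ w : Euc d,
    ‖Θ n y (mfderiv (𝓡 d) 𝓘(ℝ, TangentSpace (𝓡 d) y) (expInv d r y) z ((Θ n z).symm w)) -
      Θ n y' (mfderiv (𝓡 d) 𝓘(ℝ, TangentSpace (𝓡 d) y') (expInv d r y') z' ((Θ n z').symm w))‖ ≤
      L * (dist y y' + dist z z') * ‖w‖

/-- The `n`-th covering set. -/
def FrameCover.D {d : ℕ} {M : Type*} [MetricSpace M] [ChartedSpace (Euc d) M]
    [IsManifold (𝓡 d) ∞ M] [RiemannianBundle (fun x : M => TangentSpace (𝓡 d) x)]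
    {S : Set M} (A : FrameCover d M S) (n : ℕ) : Set M :=
  ball (A.center n) (A.radius n)


/-- The identification of the tangent spaces at equal points. -/
def tangentCast {p q : M} (h : p = q) : TangentSpace (𝓡 d) p →L[ℝ] TangentSpace (𝓡 d) q :=
  h ▸ ContinuousLinearMap.id ℝ (TangentSpace (𝓡 d) p)

/-! ### The singular map -/

/-- The set `Γ_∞` of points at which the differential of `f` is degenerate. -/
def singSet (f : M → M) : Set M :=
  {x | ¬ Bijective (mfderiv (𝓡 d) (𝓡 d) f x)}

/-- `g` restricted to the open set `U` is a `C¹` diffeomorphism onto its (open) image. -/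
def IsDiffeoOn (g : M → M) (U : Set M) : Prop :=
  ContMDiffOn (𝓡 d) (𝓡 d) 1 g U ∧ InjOn g U ∧
    ∀ y ∈ U, Bijective (mfderiv (𝓡 d) (𝓡 d) g y)

/-- The assumptions on the singular map `f`. The balls are `D_x = B(x, 2τ(x))` and
`𝔈_x = B(f x, 2τ(x))`, and `inv x` is the inverse branch `f_x⁻¹` of `f` on `𝔈_x`, the one that
sends `f x` to `x`. -/
structure SingularSystem (c : Constants) (f : M → M) (A : FrameCover d M (singSet d f)) where
  τ : M → ℝ
  inv : M → M → M
  smooth : ContMDiff (𝓡 d) (𝓡 d) 1 f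
  singular : (singSet d f).Nonempty
  τ_gt : ∀ x ∉ singSet d f, f x ∉ singSet d f →
    min (infDist x (singSet d f) ^ c.a) (infDist (f x) (singSet d f) ^ c.a) < τ x
  τ_lt : ∀ x ∉ singSet d f, f x ∉ singSet d f → τ x < 1
  -- (A1)
  f_diffeo : ∀ x ∉ singSet d f, f x ∉ singSet d f → IsDiffeoOn d f (ball x (2 * τ x))
  inv_apply : ∀ x ∉ singSet d f, f x ∉ singSet d f → inv x (f x) = x
  f_inv : ∀ x ∉ singSet d f, f x ∉ singSet d f → ∀ z ∈ ball (f x) (2 * τ x), f (inv x z) = z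
  inv_diffeo : ∀ x ∉ singSet d f, f x ∉ singSet d f →
    IsDiffeoOn d (inv x) (ball (f x) (2 * τ x))
  -- (A2)
  df_bound : ∀ x ∉ singSet d f, f x ∉ singSet d f → ∀ y ∈ ball x (2 * τ x),
    infDist x (singSet d f) ^ c.a ≤ ‖mfderiv (𝓡 d) (𝓡 d) f y‖ ∧
      ‖mfderiv (𝓡 d) (𝓡 d) f y‖ ≤ infDist x (singSet d f) ^ (-c.a)
  dinv_bound : ∀ x ∉ singSet d f, f x ∉ singSet d f → ∀ z ∈ ball (f x) (2 * τ x),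
    infDist x (singSet d f) ^ c.a ≤ ‖mfderiv (𝓡 d) (𝓡 d) (inv x) z‖ ∧
      ‖mfderiv (𝓡 d) (𝓡 d) (inv x) z‖ ≤ infDist x (singSet d f) ^ (-c.a)
  -- (A3): the differentials, read in the frames, are `β`-Hölder
  df_holder : ∀ x ∉ singSet d f, f x ∉ singSet d f → ∀ n m : ℕ,
    ∀ y ∈ ball x (2 * τ x) ∩ A.D n, ∀ z ∈ ball x (2 * τ x) ∩ A.D n,
    f y ∈ A.D m → f z ∈ A.D m → ∀ w : Euc d,
    ‖A.Θ m (f y) (mfderiv (𝓡 d) (𝓡 d) f y ((A.Θ n y).symm w)) -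
      A.Θ m (f z) (mfderiv (𝓡 d) (𝓡 d) f z ((A.Θ n z).symm w))‖ ≤
      c.K * dist y z ^ c.β * ‖w‖
  dinv_holder : ∀ x ∉ singSet d f, f x ∉ singSet d f → ∀ n m : ℕ,
    ∀ y ∈ ball (f x) (2 * τ x) ∩ A.D n, ∀ z ∈ ball (f x) (2 * τ x) ∩ A.D n,
    inv x y ∈ A.D m → inv x z ∈ A.D m → ∀ w : Euc d,
    ‖A.Θ m (inv x y) (mfderiv (𝓡 d) (𝓡 d) (inv x) y ((A.Θ n y).symm w)) -
      A.Θ m (inv x z) (mfderiv (𝓡 d) (𝓡 d) (inv x) z ((A.Θ n z).symm w))‖ ≤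
      c.K * dist y z ^ c.β * ‖w‖

/-! ### Natural extension and summable points -/

/-- The natural extension `M^f`: full orbits of `f`. -/
structure Orbit {M : Type*} (f : M → M) where
  pt : ℤ → M
  map_pt : ∀ i, f (pt i) = pt (i + 1)

namespace Orbit

/-- The shift `f̂`. -/
def shift {M : Type*} {f : M → M} (x : Orbit f) : Orbit f :=
  ⟨fun i => x.pt (i + 1), fun i => x.map_pt (i + 1)⟩

/-- The inverse shift `f̂⁻¹`. -/
def shiftInv {M : Type*} {f : M → M} (x : Orbit f) : Orbit f :=
  ⟨fun i => x.pt (i - 1), fun i => by rw [x.map_pt (i - 1)]; congr 1; ring⟩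

theorem iterate_apply {M : Type*} {f : M → M} (x : Orbit f) (m : ℕ) (i : ℤ) :
    f^[m] (x.pt i) = x.pt (i + m) := by
  induction m with
  | zero => simp
  | succ k ih =>
    rw [Function.iterate_succ_apply', ih, x.map_pt]
    rw [Nat.cast_succ, add_assoc]

theorem iterate_neg {M : Type*} {f : M → M} (x : Orbit f) (m : ℕ) :
    x.pt 0 = f^[m] (x.pt (-m)) := by
  rw [iterate_apply]; simp

/-- `d_x f̂ᵐ ξ` for `m ≥ 0`. -/
def fwd {f : M → M} (x : Orbit f) (m : ℕ) (ξ : TangentSpace (𝓡 d) (x.pt 0)) :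
    TangentSpace (𝓡 d) (f^[m] (x.pt 0)) :=
  mfderiv (𝓡 d) (𝓡 d) (f^[m]) (x.pt 0) ξ

/-- `d_x f̂⁻ᵐ ξ` for `m ≥ 0`: the inverse of the differential of `fᵐ` at `x₋ₘ`, applied to `ξ`. -/
def bwd {f : M → M} (x : Orbit f) (m : ℕ) (ξ : TangentSpace (𝓡 d) (x.pt 0)) :
    TangentSpace (𝓡 d) (x.pt (-m)) :=
  (mfderiv (𝓡 d) (𝓡 d) (f^[m]) (x.pt (-m))).inverse (tangentCast d (x.iterate_neg m) ξ)

/-- The decomposition `T = Es ⊕ Eu` at `x` has the summability properties: the sums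
`∑ |d f̂ᵐ ξ|²` (resp. `∑ |d f̂⁻ᵐ ξ|²`) are bounded over the unit vectors of `Es` (resp. `Eu`). -/
def IsSummableSplitting {f : M → M} (x : Orbit f)
    (Es Eu : Submodule ℝ (TangentSpace (𝓡 d) (x.pt 0))) : Prop :=
  IsCompl Es Eu ∧
  (∃ B : ℝ, ∀ ξ ∈ Es, ‖ξ‖ = 1 →
    Summable (fun m : ℕ => ‖fwd d x m ξ‖ ^ 2) ∧ ∑' m : ℕ, ‖fwd d x m ξ‖ ^ 2 ≤ B) ∧
  (∃ B : ℝ, ∀ ξ ∈ Eu, ‖ξ‖ = 1 →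
    Summable (fun m : ℕ => ‖bwd d x m ξ‖ ^ 2) ∧ ∑' m : ℕ, ‖bwd d x m ξ‖ ^ 2 ≤ B)

/-- The set `0-summ` of summable points. -/
def IsSummable {f : M → M} (x : Orbit f) : Prop :=
  (∀ n : ℤ, x.pt n ∉ singSet d f) ∧
  ∃! P : Submodule ℝ (TangentSpace (𝓡 d) (x.pt 0)) × Submodule ℝ (TangentSpace (𝓡 d) (x.pt 0)),
    IsSummableSplitting d x P.1 P.2

open Classical in
/-- The pair `(Eˢ, Eᵘ)` at a summable point (and a dummy value at other points). -/
def splitting {f : M → M} (x : Orbit f) :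
    Submodule ℝ (TangentSpace (𝓡 d) (x.pt 0)) × Submodule ℝ (TangentSpace (𝓡 d) (x.pt 0)) :=
  if h : IsSummable d x then h.2.choose else (⊥, ⊤)

theorem splitting_isCompl {f : M → M} (x : Orbit f) :
    IsCompl (splitting d x).1 (splitting d x).2 := by
  unfold splitting
  split_ifs with h
  · exact h.2.choose_spec.1.1
  · exact isCompl_bot_top

/-- The dimension `d_s` of `Eˢ`; the dimension of `Eᵘ` is `d - d_s`. -/
def ds {f : M → M} (x : Orbit f) : ℕ := Module.finrank ℝ (splitting d x).1

/-- The projection onto `Eˢ` along `Eᵘ`. -/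
def stableProj {f : M → M} (x : Orbit f) :
    TangentSpace (𝓡 d) (x.pt 0) →ₗ[ℝ] TangentSpace (𝓡 d) (x.pt 0) :=
  Submodule.projection _ _ (splitting_isCompl d x)

/-- The projection onto `Eᵘ` along `Eˢ`. -/
def unstableProj {f : M → M} (x : Orbit f) :
    TangentSpace (𝓡 d) (x.pt 0) →ₗ[ℝ] TangentSpace (𝓡 d) (x.pt 0) :=
  Submodule.projection _ _ (splitting_isCompl d x).symm

/-- The Lyapunov inner product `⟨ξ, η⟩'`. -/
def lyapInner {f : M → M} (x : Orbit f) (ξ η : TangentSpace (𝓡 d) (x.pt 0)) : ℝ :=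
  2 * ∑' m : ℕ, inner ℝ (fwd d x m (stableProj d x ξ))
      (fwd d x m (stableProj d x η)) +
  2 * ∑' m : ℕ, inner ℝ (bwd d x m (unstableProj d x ξ))
      (bwd d x m (unstableProj d x η))

/-- The defining properties of `C₀(x)`: it maps `ℝ^{d_s} × {0}` onto `Eˢ` and `{0} × ℝ^{d_u}` onto
`Eᵘ`, and it is an isometry from the Euclidean to the Lyapunov inner product. -/
structure IsLyapunovFrame {f : M → M} (x : Orbit f)
    (C : Euc d ≃L[ℝ] TangentSpace (𝓡 d) (x.pt 0)) : Prop where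
  stable : C '' {v | ∀ i : Fin d, ds d x ≤ i → v i = 0} = (splitting d x).1
  unstable : C '' {v | ∀ i : Fin d, (i : ℕ) < ds d x → v i = 0} = (splitting d x).2
  inner_eq : ∀ v w : Euc d, lyapInner d x (C v) (C w) = inner ℝ v w

/-- `ρ(x) = d({x₋₁, x₀, x₁}, Γ_∞)`. -/
def rho {f : M → M} (x : Orbit f) : ℝ :=
  min (infDist (x.pt (-1)) (singSet d f))
    (min (infDist (x.pt 0) (singSet d f)) (infDist (x.pt 1) (singSet d f)))

end Orbit

/-! ### Pesin charts, double charts -/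

/-- A choice, for every orbit `x`, of a linear isomorphism `C₀(x) : ℝᵈ → T_{x₀}M`. -/
abbrev ChartChoice (f : M → M) : Type _ :=
  ∀ x : Orbit f, Euc d ≃L[ℝ] TangentSpace (𝓡 d) (x.pt 0)

namespace ChartChoice

variable {d} {f : M → M} (C : ChartChoice d f) (c : Constants) (ε : ℝ)

/-- `C` satisfies the defining properties of `C₀` at all summable points. -/
def Valid : Prop := ∀ x : Orbit f, Orbit.IsSummable d x → Orbit.IsLyapunovFrame d x (C x)

/-- `Q̃_ε(x) = ε^{20/β} ρ(x)^{8a/β} ‖C₀(x)⁻¹‖^{-2γ}`. -/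
def Qtilde (x : Orbit f) : ℝ :=
  ε ^ (20 / c.β) * Orbit.rho d x ^ (8 * c.a / c.β) *
    ‖((C x).symm : TangentSpace (𝓡 d) (x.pt 0) →L[ℝ] Euc d)‖ ^ (-(2 * c.γ))

/-- `Q_ε(x)`, the largest element of `{I^{-ℓ/4}(1)}` that is at most `Q̃_ε(x)`. -/
def Q (x : Orbit f) : ℝ := sSup {q ∈ c.ladderSet | q ≤ Qtilde C c ε x}

/-- The Pesin chart `ψ_x = exp_{x₀} ∘ C₀(x)`. -/
def psi (x : Orbit f) (v : Euc d) : M := expMap d (x.pt 0) (C x v)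

/-- The linear map `Θ_n ∘ C₀(x)` of `ℝᵈ`. -/
def frameMatrix (A : FrameCover d M (singSet d f)) (n : ℕ) (x : Orbit f) : Euc d →L[ℝ] Euc d :=
  ((A.Θ n (x.pt 0)).toContinuousLinearEquiv : TangentSpace (𝓡 d) (x.pt 0) →L[ℝ] Euc d) ∘L
    (C x : Euc d →L[ℝ] TangentSpace (𝓡 d) (x.pt 0))

/-- The Pesin charts `ψ_{x}^{η}` and `ψ_{x'}^{η'}` are `I`-overlapping. -/
def Overlap (A : FrameCover d M (singSet d f)) (x : Orbit f) (η : ℝ) (x' : Orbit f) (η' : ℝ) :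
    Prop :=
  c.LadderClose η η' ∧
  ∃ n : ℕ, x.pt 0 ∈ A.D n ∧ x'.pt 0 ∈ A.D n ∧
    dist (x.pt 0) (x'.pt 0) + ‖frameMatrix C A n x - frameMatrix C A n x'‖ < η ^ 4 * η' ^ 4

end ChartChoice

/-- The data of a double chart `ψ_x^{p^s, p^u}`. -/
structure DoubleChart {M : Type*} (f : M → M) where
  x : Orbit f
  ps : ℝ
  pu : ℝ

namespace DoubleChart

variable {d} {f : M → M} (C : ChartChoice d f) (c : Constants) (ε : ℝ)

/-- `p^s ∧ p^u`. -/
def size {M : Type*} {f : M → M} (w : DoubleChart f) : ℝ := min w.ps w.pu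

/-- The defining conditions of a double chart. -/
structure Valid (w : DoubleChart f) : Prop where
  summable : Orbit.IsSummable d w.x
  ps_mem : w.ps ∈ c.ladderSet
  pu_mem : w.pu ∈ c.ladderSet
  ps_le : w.ps ≤ C.Q c ε w.x
  pu_le : w.pu ≤ C.Q c ε w.x

/-- The relation `w₁ → w₂` between double charts. -/
structure Arrow (A : FrameCover d M (singSet d f)) (w₁ w₂ : DoubleChart f) : Prop where
  overlap_left : C.Overlap c A w₁.x w₁.size w₂.x.shiftInv w₁.size
  overlap_right : C.Overlap c A w₁.x.shift w₂.size w₂.x w₂.size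
  ps_eq : w₁.ps = min (c.ladder w₂.ps) (C.Q c ε w₁.x)
  qu_eq : w₂.pu = min (c.ladder w₁.pu) (C.Q c ε w₂.x)

/-! ### Admissible manifolds -/

/-- The conditions on a representing function `G`, defined on the ball of radius `p` in `ℝᵐ`, for a
double chart of size `η`: it is `C^{1+β/2}`, with `|G(0)| ≤ 10⁻³ η²`, `‖d₀G‖ ≤ ½ η^{β/2}` and
`‖dG‖_{C⁰} + Höl_{β/2}(dG) < ½`. -/
structure IsRepresenting (β η p : ℝ) {m n : ℕ} (G : Euc m → Euc n) : Prop where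
  contDiffOn : ContDiffOn ℝ 1 G (ball 0 p)
  at_zero : ‖G 0‖ ≤ 1 / 10 ^ 3 * η ^ 2
  deriv_zero : ‖fderiv ℝ G 0‖ ≤ 1 / 2 * η ^ (β / 2)
  deriv_holder : ∃ B H : ℝ, 0 ≤ B ∧ 0 ≤ H ∧ B + H < 1 / 2 ∧
    (∀ v ∈ ball (0 : Euc m) p, ‖fderiv ℝ G v‖ ≤ B) ∧
    (∀ v ∈ ball (0 : Euc m) p, ∀ v' ∈ ball (0 : Euc m) p,
      ‖fderiv ℝ G v - fderiv ℝ G v'‖ ≤ H * ‖v - v'‖ ^ (β / 2))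

/-- The set `ψ_x {(v, G v) : |v| < p^s}`. -/
def sGraph (w : DoubleChart f) (G : Euc (w.x.ds d) → Euc (d - w.x.ds d)) : Set M :=
  (fun v => C.psi w.x (joinVec v (G v))) '' ball 0 w.ps

/-- The set `ψ_x {(G v, v) : |v| < p^u}`. -/
def uGraph (w : DoubleChart f) (G : Euc (d - w.x.ds d) → Euc (w.x.ds d)) : Set M :=
  (fun v => C.psi w.x (joinVec (G v) v)) '' ball 0 w.pu

/-- `V` is an `s`-admissible manifold at `w`. -/
def IsSAdmissible (w : DoubleChart f) (V : Set M) : Prop :=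
  ∃ G : Euc (w.x.ds d) → Euc (d - w.x.ds d),
    IsRepresenting c.β w.size w.ps G ∧ V = sGraph C w G

/-- `V` is a `u`-admissible manifold at `w`. -/
def IsUAdmissible (w : DoubleChart f) (V : Set M) : Prop :=
  ∃ G : Euc (d - w.x.ds d) → Euc (w.x.ds d),
    IsRepresenting c.β w.size w.pu G ∧ V = uGraph C w G

end DoubleChart

end Geometry

end

/-! Read in the charts at `x` and at `y`, the map `f` is a small perturbation of the linear map `D =
C₀(f̂x)⁻¹ ∘ df ∘ C₀(x)`. The theorem is a graph transform for such perturbations, made uniform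
although neither the hyperbolicity of `D` nor the size of `df` is uniform.

Hyperbolicity. The Lyapunov product makes `D` block diagonal. Shifting the orbit removes the term `m
= 0` from the stable sum and adds one to the unstable sum, so `|v|² = |Dv|² + 2|C₀(x)v|²` on the
stable factor and the mirror identity holds on the unstable one (`Orbit.lyapunovPair`). With `N =
‖C₀⁻¹‖` this is a contraction by `1 - N⁻²`, and dually an expansion. The margin `N⁻²` may be tiny,
and the bounds on the derivatives of `f` and of its inverse branch blow up like `ρ^{-a}`.

Sizes. The choice of `Q` compensates for both. If `p ≤ Q`, then `p^{β/2} ρ^{-4a} N^{20} ≤ ε^{10}`,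
so on a window of size `p` the nonlinear error and the error caused by the overlap condition are
small multiples of the margin. Also `p^{1/γ} ≤ ε^{20/(βγ)} N⁻²`, so the factor `exp(Γ p^{1/γ})` by
which window sizes may change along an arrow is `1 + ` a small multiple of the margin
(`ScaleBounds`). All smallness conditions involve only the constants, `L`, `r` and the Lebesgue
number; hence `ε₀` does not depend on the frames.

Graph transform. Along an admissible graph the expanded coordinate of the image is an expanding
function of the parameter. A contraction argument inverts it over the whole target ball
(`HypMap.exists_preimage`), and the resulting graph has derivative and Hölder constant multiplied by
about `1 - κ`, which leaves room for the errors (`HypMap.exists_transform`). Expansion of the same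
coordinate yields uniqueness of the new graph, and comparison of the two Lipschitz constants yields
a single intersection with a transversal graph. The u-case uses `g = f`; the s-case uses the inverse
branch `f_x⁻¹` with the two factors exchanged, so one abstract statement serves both.

Three facts have to be extracted from the hypotheses. The exponential map has the identity as
differential at the origin: every geodesic is second-order close to its tangent in a chart
(`exists_geodesic_bound`), and no uniqueness of geodesics is needed. The points `x` and `f̂⁻¹y` have
the same stable dimension (`ChartLink.ds_eq`), since a vector cannot be expanded by one matrix and
contracted by a nearby one. The branch `f_x⁻¹` sends `y_0` to `y_{-1}` (`ChartLink.inv_map`), since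
`f` is injective on a ball that contains both candidates. -/

noncomputable section

set_option synthInstance.maxHeartbeats 400000
set_option maxSynthPendingDepth 3
set_option linter.unusedSectionVars false

/-! ### Geodesics: conservation of energy and second-order closeness to the tangent -/

section Geometry

variable {d : ℕ} {M : Type*} [MetricSpace M] [ChartedSpace (Euc d) M] [IsManifold (𝓡 d) ∞ M]
  [RiemannianBundle (fun x : M => TangentSpace (𝓡 d) x)]

/-- The chart metric as a bilinear form. -/
def chartForm (x₀ : M) (u : Euc d) : Euc d →L[ℝ] Euc d →L[ℝ] ℝ :=
  (innerSL ℝ (E := TangentSpace (𝓡 d) ((extChartAt (𝓡 d) x₀).symm u))).bilinearComp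
    (mfderiv 𝓘(ℝ, Euc d) (𝓡 d) (extChartAt (𝓡 d) x₀).symm u)
    (mfderiv 𝓘(ℝ, Euc d) (𝓡 d) (extChartAt (𝓡 d) x₀).symm u)

/-- The Riemannian norm of a vector of the model space, seen as a tangent vector at `p`. -/
def tnorm (p : M) (ξ : Euc d) : ℝ := norm (E := TangentSpace (𝓡 d) p) ξ

/-- A tangent vector, seen as a vector of the model space. -/
def toModel {p : M} (ξ : TangentSpace (𝓡 d) p) : Euc d := ξ

theorem tnorm_nonneg (p : M) (ξ : Euc d) : 0 ≤ tnorm p ξ :=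
  norm_nonneg (E := TangentSpace (𝓡 d) p) ξ

theorem chartForm_self (x₀ : M) (u v : Euc d) : chartForm x₀ u v v =
    tnorm ((extChartAt (𝓡 d) x₀).symm u)
      (mfderiv 𝓘(ℝ, Euc d) (𝓡 d) (extChartAt (𝓡 d) x₀).symm u v) ^ 2 :=
  real_inner_self_eq_norm_sq (F := TangentSpace (𝓡 d) ((extChartAt (𝓡 d) x₀).symm u)) _

theorem chartForm_symm (x₀ : M) (u v w : Euc d) : chartForm x₀ u v w = chartForm x₀ u w v :=
  real_inner_comm (F := TangentSpace (𝓡 d) ((extChartAt (𝓡 d) x₀).symm u)) _ _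

theorem mdifferentiableAt_symm_extChartAt (x₀ : M) {u : Euc d}
    (hu : u ∈ (extChartAt (𝓡 d) x₀).target) :
    MDifferentiableAt 𝓘(ℝ, Euc d) (𝓡 d) (extChartAt (𝓡 d) x₀).symm u :=
  ((contMDiffOn_extChartAt_symm (I := 𝓡 d) (n := ∞) x₀).contMDiffAt
    ((isOpen_extChartAt_target x₀).mem_nhds hu)).mdifferentiableAt (by simp)

/-- The coordinate expression of a smooth curve. -/
theorem contDiffAt_coord {σ : ℝ → M} (hσ : ContMDiff 𝓘(ℝ, ℝ) (𝓡 d) ∞ σ) (x₀ : M) {t : ℝ}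
    (ht : σ t ∈ (extChartAt (𝓡 d) x₀).source) :
    ContDiffAt ℝ ∞ (fun s => extChartAt (𝓡 d) x₀ (σ s)) t := by
  rw [← contMDiffAt_iff_contDiffAt]
  exact (contMDiffAt_extChartAt' (by simpa using ht)).comp t hσ.contMDiffAt

/-- The chain rule for `φ⁻¹ ∘ (φ ∘ σ) = σ`. The equality is stated in the model space because the
two velocities live over points that are equal only propositionally. -/
theorem mfderiv_symm_coord {σ : ℝ → M} (hσ : ContMDiff 𝓘(ℝ, ℝ) (𝓡 d) ∞ σ) (x₀ : M) {t : ℝ}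
    (ht : σ t ∈ (extChartAt (𝓡 d) x₀).source) :
    (mfderiv 𝓘(ℝ, Euc d) (𝓡 d) (extChartAt (𝓡 d) x₀).symm (extChartAt (𝓡 d) x₀ (σ t))
      (deriv (fun s => extChartAt (𝓡 d) x₀ (σ s)) t) : Euc d) =
    (mfderiv 𝓘(ℝ, ℝ) (𝓡 d) σ t (1 : ℝ) : Euc d) := by
  set c : ℝ → Euc d := fun s => extChartAt (𝓡 d) x₀ (σ s) with hc
  have hcd : DifferentiableAt ℝ c t := (contDiffAt_coord hσ x₀ ht).differentiableAt (by simp)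
  have hmem : c t ∈ (extChartAt (𝓡 d) x₀).target := (extChartAt (𝓡 d) x₀).map_source ht
  have h1 : HasMFDerivAt 𝓘(ℝ, ℝ) (𝓡 d) ((extChartAt (𝓡 d) x₀).symm ∘ c) t _ :=
    (mdifferentiableAt_symm_extChartAt x₀ hmem).hasMFDerivAt.comp t
      hcd.hasFDerivAt.hasMFDerivAt
  have h2 : (extChartAt (𝓡 d) x₀).symm ∘ c =ᶠ[𝓝 t] σ := by
    have : ∀ᶠ s in 𝓝 t, σ s ∈ (extChartAt (𝓡 d) x₀).source :=
      hσ.continuous.continuousAt.eventually_mem ((isOpen_extChartAt_source x₀).mem_nhds ht)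
    filter_upwards [this] with s hs using (extChartAt (𝓡 d) x₀).left_inv hs
  have h3 : HasMFDerivAt 𝓘(ℝ, ℝ) (𝓡 d) σ t _ := h1.congr_of_eventuallyEq h2.symm
  have h4 := h3.mfderiv
  rw [h4]
  show _ = (mfderiv 𝓘(ℝ, Euc d) (𝓡 d) (extChartAt (𝓡 d) x₀).symm (c t)) (fderiv ℝ c t 1)
  rw [fderiv_eq_smul_deriv, one_smul]
  rfl

theorem tnorm_congr {p q : M} (h : p = q) {ξ ζ : Euc d} (h' : ξ = ζ) : tnorm p ξ = tnorm q ζ := by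
  rw [h, h']

theorem tnorm_velocity_sq {σ : ℝ → M} (hσ : ContMDiff 𝓘(ℝ, ℝ) (𝓡 d) ∞ σ) (x₀ : M) {t : ℝ}
    (ht : σ t ∈ (extChartAt (𝓡 d) x₀).source) :
    tnorm (σ t) (mfderiv 𝓘(ℝ, ℝ) (𝓡 d) σ t (1 : ℝ)) ^ 2 =
    chartForm x₀ (extChartAt (𝓡 d) x₀ (σ t)) (deriv (fun s => extChartAt (𝓡 d) x₀ (σ s)) t)
      (deriv (fun s => extChartAt (𝓡 d) x₀ (σ s)) t) := by
  rw [chartForm_self]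
  exact congrArg (· ^ 2) (tnorm_congr ((extChartAt (𝓡 d) x₀).left_inv ht).symm
    (mfderiv_symm_coord hσ x₀ ht).symm)

/-- Constant vectors pushed forward by the inverse chart are smooth sections; this is what transfers
the smoothness of the bundle metric to its coordinate expression `chartForm`. -/
theorem contMDiffOn_symm_section (x₀ : M) (v : Euc d) :
    ContMDiffOn 𝓘(ℝ, Euc d) (𝓡 d).tangent ∞ (fun u : Euc d =>
      (⟨(extChartAt (𝓡 d) x₀).symm u,
        mfderiv 𝓘(ℝ, Euc d) (𝓡 d) (extChartAt (𝓡 d) x₀).symm u v⟩ : TangentBundle (𝓡 d) M))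
      (extChartAt (𝓡 d) x₀).target := by
  have hopen : IsOpen (extChartAt (𝓡 d) x₀).target := isOpen_extChartAt_target x₀
  have h1 := (contMDiffOn_extChartAt_symm (I := 𝓡 d) (n := ∞) x₀).contMDiffOn_tangentMapWithin
    (m := ∞) (by simp) hopen.uniqueMDiffOn
  have h2 : ContMDiff 𝓘(ℝ, Euc d) 𝓘(ℝ, Euc d).tangent ∞
      (fun u : Euc d => (⟨u, v⟩ : TangentBundle 𝓘(ℝ, Euc d) (Euc d))) := by
    intro u
    rw [contMDiffAt_totalSpace]
    refine ⟨contMDiffAt_id, ?_⟩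
    simpa using contMDiffAt_const
  have h3 := h1.comp (s := (extChartAt (𝓡 d) x₀).target) h2.contMDiffOn (fun u hu => hu)
  refine h3.congr fun u hu => ?_
  simp only [Function.comp, tangentMapWithin]
  rw [mfderivWithin_of_isOpen hopen hu]

section Smooth

variable [IsContMDiffRiemannianBundle (𝓡 d) ∞ (Euc d) (fun x : M => TangentSpace (𝓡 d) x)]

theorem contDiffOn_chartForm (x₀ : M) :
    ContDiffOn ℝ ∞ (chartForm (d := d) x₀) (extChartAt (𝓡 d) x₀).target := by
  refine contDiffOn_clm_apply.2 fun v => contDiffOn_clm_apply.2 fun w => ?_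
  rw [← contMDiffOn_iff_contDiffOn]
  exact ContMDiffOn.inner_bundle (contMDiffOn_symm_section x₀ v) (contMDiffOn_symm_section x₀ w)

theorem contDiffAt_chartForm (x₀ : M) {u : Euc d} (hu : u ∈ (extChartAt (𝓡 d) x₀).target) :
    ContDiffAt ℝ ∞ (chartForm (d := d) x₀) u :=
  (contDiffOn_chartForm x₀).contDiffAt ((isOpen_extChartAt_target x₀).mem_nhds hu)

/-- The geodesic equation in terms of the derivative of the chart form. -/
theorem IsGeodesic.hasDerivAt_momentum {σ : ℝ → M} (hσ : IsGeodesic d σ) (x₀ : M) {t : ℝ}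
    (ht : σ t ∈ (extChartAt (𝓡 d) x₀).source) (w : Euc d) :
    HasDerivAt (fun s => chartForm x₀ (extChartAt (𝓡 d) x₀ (σ s))
        (deriv (fun s => extChartAt (𝓡 d) x₀ (σ s)) s) w)
      (1 / 2 * fderiv ℝ (chartForm x₀) (extChartAt (𝓡 d) x₀ (σ t)) w
        (deriv (fun s => extChartAt (𝓡 d) x₀ (σ s)) t)
        (deriv (fun s => extChartAt (𝓡 d) x₀ (σ s)) t)) t := by
  have h := hσ.2 x₀ t ht w
  have hB : DifferentiableAt ℝ (chartForm (d := d) x₀) (extChartAt (𝓡 d) x₀ (σ t)) :=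
    (contDiffAt_chartForm x₀ ((extChartAt (𝓡 d) x₀).map_source ht)).differentiableAt (by simp)
  set v := deriv (fun s => extChartAt (𝓡 d) x₀ (σ s)) t with hv
  have h2 : HasFDerivAt (fun u => chartMetric d x₀ u v v) _ (extChartAt (𝓡 d) x₀ (σ t)) :=
    (hB.hasFDerivAt.clm_apply (hasFDerivAt_const v _)).clm_apply (hasFDerivAt_const v _)
  have h3 : fderiv ℝ (fun u => chartMetric d x₀ u v v) (extChartAt (𝓡 d) x₀ (σ t)) w =
      fderiv ℝ (chartForm x₀) (extChartAt (𝓡 d) x₀ (σ t)) w v v := by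
    rw [h2.fderiv]
    simp
  exact h3 ▸ h

/-- The energy of a curve that satisfies the Euler-Lagrange equation in its own direction is
constant. -/
theorem hasDerivAt_form_self {E : Type*} [NormedAddCommGroup E] [NormedSpace ℝ E]
    {B : E → E →L[ℝ] E →L[ℝ] ℝ} {c : ℝ → E} {t : ℝ} {a : E} (hB : DifferentiableAt ℝ B (c t))
    (hs : ∀ v w, B (c t) v w = B (c t) w v) (hc1 : HasDerivAt c (deriv c t) t)
    (hc2 : HasDerivAt (deriv c) a t)
    (hmom : HasDerivAt (fun s => B (c s) (deriv c s) (deriv c t))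
      (1 / 2 * fderiv ℝ B (c t) (deriv c t) (deriv c t) (deriv c t)) t) :
    HasDerivAt (fun s => B (c s) (deriv c s) (deriv c s)) 0 t := by
  have hBc : HasDerivAt (fun s => B (c s)) (fderiv ℝ B (c t) (deriv c t)) t :=
    HasFDerivAt.comp_hasDerivAt (E := E →L[ℝ] E →L[ℝ] ℝ) t hB.hasFDerivAt hc1
  have h1 := hBc.clm_apply hc2
  have hmom' := (h1.clm_apply (hasDerivAt_const t (deriv c t))).unique hmom
  refine (h1.clm_apply hc2).congr_deriv ?_
  simp only [map_zero, add_zero, add_apply] at hmom' ⊢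
  -- With `v = c'` and `a = c''`: the momentum equation reads `B'(v)(v,v) + B(a,v) = ½ B'(v)(v,v)`,
  -- and by symmetry the derivative of the energy is `B'(v)(v,v) + 2 B(a,v) = 0`.
  rw [hs (deriv c t) a]
  linarith

theorem IsGeodesic.hasDerivAt_energy {σ : ℝ → M} (hσ : IsGeodesic d σ) (t : ℝ) :
    HasDerivAt (fun s => tnorm (σ s) (mfderiv 𝓘(ℝ, ℝ) (𝓡 d) σ s (1 : ℝ)) ^ 2) 0 t := by
  set x₀ := σ t with hx₀
  have ht : σ t ∈ (extChartAt (𝓡 d) x₀).source := mem_extChartAt_source _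
  set c : ℝ → Euc d := fun s => extChartAt (𝓡 d) x₀ (σ s) with hc
  have hev : ∀ᶠ s in 𝓝 t, σ s ∈ (extChartAt (𝓡 d) x₀).source :=
    hσ.1.continuous.continuousAt.eventually_mem ((isOpen_extChartAt_source x₀).mem_nhds ht)
  have hcd : ContDiffAt ℝ ∞ c t := contDiffAt_coord hσ.1 x₀ ht
  have hc1 : HasDerivAt c (deriv c t) t := (hcd.differentiableAt (by simp)).hasDerivAt
  have hc2 : HasDerivAt (deriv c) (deriv (deriv c) t) t := by
    have : ContDiffAt ℝ 1 (deriv c) t := by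
      have := (contDiffAt_succ_iff_hasFDerivAt (n := 1)).1 (hcd.of_le (m := ((2 : ℕ) : WithTop ℕ∞)) ENat.LEInfty.out)
      obtain ⟨f', ⟨u, hu, hf'⟩, hf2⟩ := this
      refine (hf2.clm_apply (contDiffAt_const (c := (1 : ℝ)))).congr_of_eventuallyEq ?_
      filter_upwards [hu] with s hs
      exact (hf' s hs).hasDerivAt.deriv
    exact (this.differentiableAt (by simp)).hasDerivAt
  have hB : DifferentiableAt ℝ (chartForm (d := d) x₀) (c t) :=
    (contDiffAt_chartForm x₀ ((extChartAt (𝓡 d) x₀).map_source ht)).differentiableAt (by simp)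
  refine (hasDerivAt_form_self hB (chartForm_symm x₀ (c t)) hc1 hc2
    (hσ.hasDerivAt_momentum x₀ ht _)).congr_of_eventuallyEq ?_
  filter_upwards [hev] with s hs using tnorm_velocity_sq hσ.1 x₀ hs

theorem IsGeodesic.speed_eq {σ : ℝ → M} (hσ : IsGeodesic d σ) (s t : ℝ) :
    tnorm (σ s) (mfderiv 𝓘(ℝ, ℝ) (𝓡 d) σ s (1 : ℝ)) =
    tnorm (σ t) (mfderiv 𝓘(ℝ, ℝ) (𝓡 d) σ t (1 : ℝ)) := by
  have h := is_const_of_deriv_eq_zero (fun s => (hσ.hasDerivAt_energy s).differentiableAt)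
    (fun s => (hσ.hasDerivAt_energy s).deriv) s t
  exact (sq_eq_sq₀ (tnorm_nonneg _ _) (tnorm_nonneg _ _)).1 h

end Smooth

/-- The distance of the end points of a curve of bounded speed. -/
theorem dist_le_of_speed_le [IsRiemannianManifold (𝓡 d) M] {σ : ℝ → M} {a b V : ℝ} (hab : a ≤ b)
    (hσ : ContMDiffOn 𝓘(ℝ, ℝ) (𝓡 d) 1 σ (Icc a b)) (hV0 : 0 ≤ V)
    (hV : ∀ t ∈ Ioo a b, tnorm (σ t) (mfderiv 𝓘(ℝ, ℝ) (𝓡 d) σ t (1 : ℝ)) ≤ V) :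
    dist (σ a) (σ b) ≤ V * (b - a) := by
  have h1 : edist (σ a) (σ b) ≤ ENNReal.ofReal (V * (b - a)) := by
    rw [IsRiemannianManifold.out (I := 𝓡 d) (σ a) (σ b)]
    refine (riemannianEDist_le_pathELength hσ rfl rfl hab).trans ?_
    rw [pathELength_eq_lintegral_mfderiv_Ioo]
    calc _ ≤ ∫⁻ _ in Ioo a b, ENNReal.ofReal V := by
          refine MeasureTheory.setLIntegral_mono measurable_const fun t ht => ?_
          rw [← ofReal_norm]
          exact ENNReal.ofReal_le_ofReal (hV t ht)
      _ = _ := by simp [ENNReal.ofReal_mul hV0]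
  rw [edist_dist] at h1
  exact (ENNReal.ofReal_le_ofReal_iff (mul_nonneg hV0 (sub_nonneg.2 hab))).1 h1

/-- Compactness of the unit sphere turns positivity at `u₀` into a uniform constant; continuity of
`B` and of its derivative preserves half of it, and a bound on the derivative, nearby. -/
theorem exists_form_bounds {E : Type*} [NormedAddCommGroup E] [NormedSpace ℝ E]
    [FiniteDimensional ℝ E] {B : E → E →L[ℝ] E →L[ℝ] ℝ} {u₀ : E} (hB : ContDiffAt ℝ 1 B u₀)
    (hpos : ∀ v, v ≠ 0 → 0 < B u₀ v v) :
    ∃ m > 0, ∃ K > 0, ∀ᶠ u in 𝓝 u₀, (∀ v, m * ‖v‖ ^ 2 ≤ B u v v) ∧ ‖fderiv ℝ B u‖ ≤ K ∧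
      DifferentiableAt ℝ B u := by
  obtain ⟨m, hm, hmB⟩ : ∃ m > 0, ∀ v, m * ‖v‖ ^ 2 ≤ B u₀ v v := by
    rcases (sphere (0 : E) 1).eq_empty_or_nonempty with h | h
    · refine ⟨1, one_pos, fun v => ?_⟩
      rcases eq_or_ne v 0 with rfl | hv
      · simp
      · have : ‖v‖⁻¹ • v ∈ sphere (0 : E) 1 := by simp [norm_smul, hv]
        simp [h] at this
    · obtain ⟨v₀, hv₀, hmin⟩ := (isCompact_sphere (0 : E) 1).exists_isMinOn h
        (f := fun v => B u₀ v v) (by fun_prop)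
      refine ⟨B u₀ v₀ v₀, hpos _ (by rintro rfl; simp at hv₀), fun v => ?_⟩
      rcases eq_or_ne v 0 with rfl | hv
      · simp
      · have h1 : ‖v‖⁻¹ • v ∈ sphere (0 : E) 1 := by simp [norm_smul, hv]
        have h2 := isMinOn_iff.1 hmin _ h1
        have h3 : v = ‖v‖ • (‖v‖⁻¹ • v) := by simp [hv]
        have h4 : B u₀ v v = ‖v‖ ^ 2 * B u₀ (‖v‖⁻¹ • v) (‖v‖⁻¹ • v) := by
          conv_lhs => rw [h3]
          simp only [map_smul, smul_apply, smul_eq_mul]; ring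
        rw [h4, mul_comm]; gcongr
  refine ⟨m / 2, by positivity, ‖fderiv ℝ B u₀‖ + 1, by positivity, ?_⟩
  have h1 : ∀ᶠ u in 𝓝 u₀, ‖B u - B u₀‖ < m / 2 := by
    have := Metric.continuousAt_iff'.1 hB.continuousAt (m / 2) (by positivity)
    simpa only [dist_eq_norm] using this
  have h2 : ∀ᶠ u in 𝓝 u₀, ‖fderiv ℝ B u‖ < ‖fderiv ℝ B u₀‖ + 1 :=
    (hB.continuousAt_fderiv (by simp)).norm.eventually_lt continuousAt_const (by simp)
  have h3 : ∀ᶠ u in 𝓝 u₀, ContDiffAt ℝ 1 B u := hB.eventually (by simp)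
  filter_upwards [h1, h2, h3] with u hu1 hu2 hu3
  refine ⟨fun v => ?_, hu2.le, hu3.differentiableAt (by simp)⟩
  have h4 : |(B u - B u₀) v v| ≤ m / 2 * ‖v‖ ^ 2 := by
    rw [← Real.norm_eq_abs]
    refine ((B u - B u₀).le_opNorm₂ v v).trans ?_
    rw [mul_assoc, ← sq]; gcongr
  have h5 := (abs_le.1 h4).1
  simp only [sub_apply] at h5
  linarith [hmB v]

/-- A curve of small energy that satisfies the Euler-Lagrange equation is nearly straight. -/
theorem norm_displacement_le {E : Type*} [NormedAddCommGroup E] [NormedSpace ℝ E]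
    {B : E → E →L[ℝ] E →L[ℝ] ℝ} {s : Set E} (hs : Convex ℝ s) {m K V : ℝ} (hm : 0 < m)
    (hK : 0 ≤ K) (hBm : ∀ u ∈ s, ∀ v, m * ‖v‖ ^ 2 ≤ B u v v)
    (hBK : ∀ u ∈ s, ‖fderiv ℝ B u‖ ≤ K) (hBd : ∀ u ∈ s, DifferentiableAt ℝ B u)
    {c : ℝ → E} (hc : ∀ t ∈ Icc (0 : ℝ) 1, c t ∈ s)
    (hc1 : ∀ t ∈ Icc (0 : ℝ) 1, DifferentiableAt ℝ c t)
    (hmom : ∀ t ∈ Icc (0 : ℝ) 1, ∀ w, HasDerivAt (fun s => B (c s) (deriv c s) w)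
      (1 / 2 * fderiv ℝ B (c t) w (deriv c t) (deriv c t)) t)
    (hV : ∀ t ∈ Icc (0 : ℝ) 1, B (c t) (deriv c t) (deriv c t) = V ^ 2) :
    ‖c 1 - c 0 - deriv c 0‖ ≤ 3 / 2 * K / m ^ 2 * V ^ 2 := by
  have h0 : (0 : ℝ) ∈ Icc (0 : ℝ) 1 := by simp
  -- Constant energy `V²` and the lower bound `m` on the form give the speed bound `σ`.
  set σ := Real.sqrt (V ^ 2 / m) with hσ
  have hσ2 : σ ^ 2 = V ^ 2 / m := Real.sq_sqrt (by positivity)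
  have hσ0 : 0 ≤ σ := Real.sqrt_nonneg _
  have hv : ∀ t ∈ Icc (0 : ℝ) 1, ‖deriv c t‖ ≤ σ := fun t ht => by
    refine Real.le_sqrt_of_sq_le ?_
    rw [le_div_iff₀ hm, mul_comm, ← hV t ht]
    exact hBm _ (hc t ht) _
  have hdist : ∀ t ∈ Icc (0 : ℝ) 1, ‖c t - c 0‖ ≤ σ := fun t ht => by
    have := norm_image_sub_le_of_norm_deriv_le_segment' (f := c) (f' := deriv c) (C := σ)
      (a := 0) (b := 1) (fun t ht => (hc1 t ht).hasDerivAt.hasDerivWithinAt)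
      (fun t ht => hv t ⟨ht.1, ht.2.le⟩) t ht
    refine this.trans ?_
    nlinarith [ht.1, ht.2]
  have hkey : ∀ t ∈ Icc (0 : ℝ) 1, ‖deriv c t - deriv c 0‖ ≤ 3 / 2 * K / m ^ 2 * V ^ 2 := by
    intro t ht
    -- The momentum is tested against the change of velocity itself. Its drift contributes `½ K σ²`
    -- and freezing the form at `c 0` contributes `K σ²`; positivity of the form then bounds `m
    -- |w|²` by `3/2 K σ² |w|`.
    set w := deriv c t - deriv c 0 with hw
    have e1 : |B (c t) (deriv c t) w - B (c 0) (deriv c 0) w| ≤ 1 / 2 * K * σ ^ 2 * ‖w‖ := by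
      have := norm_image_sub_le_of_norm_deriv_le_segment' (f := fun s => B (c s) (deriv c s) w)
        (f' := fun t => 1 / 2 * fderiv ℝ B (c t) w (deriv c t) (deriv c t))
        (C := 1 / 2 * K * σ ^ 2 * ‖w‖)
        (a := 0) (b := 1) (fun t ht => (hmom t ht w).hasDerivWithinAt)
        (fun t ht => ?_) t ht
      · refine this.trans ?_
        have : 0 ≤ 1 / 2 * K * σ ^ 2 * ‖w‖ := by positivity
        nlinarith [ht.1, ht.2]
      · have ht' : t ∈ Icc (0 : ℝ) 1 := ⟨ht.1, ht.2.le⟩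
        rw [norm_mul, Real.norm_of_nonneg (by norm_num : (0 : ℝ) ≤ 1 / 2)]
        have a1 : ‖fderiv ℝ B (c t) w (deriv c t) (deriv c t)‖ ≤ K * ‖w‖ * σ * σ := by
          refine ((fderiv ℝ B (c t) w).le_opNorm₂ _ _).trans ?_
          have a2 : ‖fderiv ℝ B (c t) w‖ ≤ K * ‖w‖ :=
            ((fderiv ℝ B (c t)).le_opNorm w).trans (by gcongr; exact hBK _ (hc t ht'))
          have a3 := hv t ht'
          gcongr
        nlinarith
    have e2 : |B (c t) (deriv c t) w - B (c 0) (deriv c t) w| ≤ K * σ ^ 2 * ‖w‖ := by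
      have a1 : ‖B (c t) - B (c 0)‖ ≤ K * σ :=
        (hs.norm_image_sub_le_of_norm_fderiv_le (fun u hu => hBd u hu) hBK (hc 0 h0)
          (hc t ht)).trans (by gcongr; exact hdist t ht)
      have a2 : B (c t) (deriv c t) w - B (c 0) (deriv c t) w =
        (B (c t) - B (c 0)) (deriv c t) w := by simp
      rw [a2, ← Real.norm_eq_abs]
      refine ((B (c t) - B (c 0)).le_opNorm₂ _ _).trans ?_
      have a3 := hv t ht
      calc _ ≤ (K * σ) * σ * ‖w‖ := by gcongr
        _ = _ := by ring
    have e3 : m * ‖w‖ ^ 2 ≤ 3 / 2 * K * σ ^ 2 * ‖w‖ := by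
      refine (hBm _ (hc 0 h0) w).trans ?_
      have : B (c 0) w w = B (c 0) (deriv c t) w - B (c 0) (deriv c 0) w := by
        have h := (B (c 0)).map_sub (deriv c t) (deriv c 0)
        rw [← hw] at h
        rw [h]; rfl
      rw [this]
      have := abs_le.1 e1; have := abs_le.1 e2
      linarith
    rcases (norm_nonneg w).eq_or_lt with h | h
    · rw [← h]; positivity
    · have e4 : m * ‖w‖ ≤ 3 / 2 * K * σ ^ 2 := by
        refine le_of_mul_le_mul_right ?_ h
        linarith
      rw [hσ2] at e4
      have : ‖w‖ ≤ (3 / 2 * K * (V ^ 2 / m)) / m := by rw [le_div_iff₀ hm]; linarith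
      refine this.trans_eq ?_
      field_simp
  -- Integration of the velocity estimate over unit time, after subtraction of the uniform motion.
  have := norm_image_sub_le_of_norm_deriv_le_segment_01' (f := fun t => c t - t • deriv c 0)
      (f' := fun t => deriv c t - (1 : ℝ) • deriv c 0) (C := 3 / 2 * K / m ^ 2 * V ^ 2)
      (fun t ht => ((hc1 t ht).hasDerivAt.sub
        ((hasDerivAt_id t).smul_const (deriv c 0))).hasDerivWithinAt)
      (fun t ht => by simpa using hkey t ⟨ht.1, ht.2.le⟩)
  convert this using 2
  simp
  abel

section Smooth

variable [IsContMDiffRiemannianBundle (𝓡 d) ∞ (Euc d) (fun x : M => TangentSpace (𝓡 d) x)]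
  [IsRiemannianManifold (𝓡 d) M]

theorem tnorm_pos (p : M) {ξ : Euc d} (hξ : ξ ≠ 0) : 0 < tnorm p ξ := by
  have h : (show TangentSpace (𝓡 d) p from ξ) ≠ 0 := hξ
  exact norm_pos_iff.2 h

theorem chartForm_pos (x₀ : M) {v : Euc d} (hv : v ≠ 0) :
    0 < chartForm x₀ (extChartAt (𝓡 d) x₀ x₀) v v := by
  rw [chartForm_self]
  have h := mfderivWithin_range_extChartAt_symm (I := 𝓡 d) (x := x₀)
  rw [ModelWithCorners.Boundaryless.range_eq_univ, mfderivWithin_univ] at h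
  have h2 : toModel (mfderiv 𝓘(ℝ, Euc d) (𝓡 d) (extChartAt (𝓡 d) x₀).symm
      (extChartAt (𝓡 d) x₀ x₀) v) = v :=
    congrArg (fun L : Euc d →L[ℝ] Euc d => L v) h
  have h4 := tnorm_pos ((extChartAt (𝓡 d) x₀).symm (extChartAt (𝓡 d) x₀ x₀)) hv
  exact pow_pos (h4.trans_eq (tnorm_congr rfl h2.symm)) 2

theorem IsGeodesicFrom.start {x : M} {ξ : TangentSpace (𝓡 d) x} {σ : ℝ → M}
    (h : IsGeodesicFrom d x ξ σ) : σ 0 = x := congrArg TotalSpace.proj h.2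

theorem IsGeodesicFrom.velocity {x : M} {ξ : TangentSpace (𝓡 d) x} {σ : ℝ → M}
    (h : IsGeodesicFrom d x ξ σ) : (mfderiv 𝓘(ℝ, ℝ) (𝓡 d) σ 0 (1 : ℝ) : Euc d) = ξ := by
  obtain ⟨_, h2⟩ := h
  have : ∀ p q : TangentBundle (𝓡 d) M, p = q → (p.2 : Euc d) = (q.2 : Euc d) := by
    rintro p _ rfl; rfl
  exact this _ _ h2

theorem IsGeodesicFrom.speed {x : M} {ξ : TangentSpace (𝓡 d) x} {σ : ℝ → M}
    (h : IsGeodesicFrom d x ξ σ) (t : ℝ) :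
    tnorm (σ t) (mfderiv 𝓘(ℝ, ℝ) (𝓡 d) σ t (1 : ℝ)) = ‖ξ‖ :=
  (h.1.speed_eq t 0).trans (tnorm_congr h.start h.velocity)

theorem IsGeodesicFrom.dist_le {x : M} {ξ : TangentSpace (𝓡 d) x} {σ : ℝ → M}
    (h : IsGeodesicFrom d x ξ σ) {t : ℝ} (ht : 0 ≤ t) : dist (σ t) x ≤ ‖ξ‖ * t := by
  have := dist_le_of_speed_le (d := d) ht (h.1.1.of_le ENat.LEInfty.out).contMDiffOn
    (norm_nonneg ξ) (fun t _ => (h.speed t).le)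
  rwa [h.start, sub_zero, dist_comm] at this

/-- Geodesics agree with their initial tangent in a chart, up to second order. -/
theorem exists_geodesic_bound (x : M) : ∃ K > 0, ∃ κ > 0, ∀ (ξ : TangentSpace (𝓡 d) x), ‖ξ‖ < κ →
    ∀ σ, IsGeodesicFrom d x ξ σ →
    ‖extChartAt (𝓡 d) x (σ 1) - extChartAt (𝓡 d) x x - toModel ξ‖ ≤ K * ‖ξ‖ ^ 2 := by
  set φ := extChartAt (𝓡 d) x with hφ
  obtain ⟨m, hm, K, hK, hB⟩ := exists_form_bounds (E := Euc d)
    ((contDiffAt_chartForm x (mem_extChartAt_target x)).of_le ENat.LEInfty.out)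
    (fun v hv => chartForm_pos x hv)
  obtain ⟨ρ, hρ, hρB⟩ := Metric.eventually_nhds_iff_ball.1 hB
  have hev : ∀ᶠ y in 𝓝 x, y ∈ φ.source ∧ φ y ∈ ball (φ x) ρ :=
    ((isOpen_extChartAt_source x).eventually_mem (mem_extChartAt_source x)).and
      ((continuousAt_extChartAt x).eventually_mem (ball_mem_nhds _ hρ))
  obtain ⟨κ, hκ, hκB⟩ := Metric.eventually_nhds_iff_ball.1 hev
  refine ⟨3 / 2 * K / m ^ 2, by positivity, κ, hκ, fun ξ hξ σ hσ => ?_⟩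
  -- Constant speed confines the geodesic, up to time one, to the region where the bounds on the
  -- form hold.
  have hin : ∀ t ∈ Icc (0 : ℝ) 1, σ t ∈ φ.source ∧ φ (σ t) ∈ ball (φ x) ρ := fun t ht => by
    refine hκB _ (mem_ball.2 ((hσ.dist_le ht.1).trans_lt ?_))
    nlinarith [ht.1, ht.2, norm_nonneg ξ]
  have h0 : (0 : ℝ) ∈ Icc (0 : ℝ) 1 := by simp
  have main := norm_displacement_le (E := Euc d) (convex_ball (φ x) ρ) hm hK.le
    (B := chartForm x) (V := ‖ξ‖)
    (fun u hu => (hρB u hu).1) (fun u hu => (hρB u hu).2.1) (fun u hu => (hρB u hu).2.2)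
    (c := fun t => φ (σ t)) (fun t ht => (hin t ht).2)
    (fun t ht => (contDiffAt_coord hσ.1.1 x (hin t ht).1).differentiableAt (by simp))
    (fun t ht w => hσ.1.hasDerivAt_momentum x (hin t ht).1 w)
    (fun t ht => by rw [← hσ.speed t]; exact (tnorm_velocity_sq hσ.1.1 x (hin t ht).1).symm)
  have hder : deriv (fun t => φ (σ t)) 0 = toModel ξ := by
    have hs : σ 0 ∈ φ.source := (hin 0 h0).1
    let L : ℝ →L[ℝ] Euc d :=
      (mfderiv (𝓡 d) 𝓘(ℝ, Euc d) φ (σ 0)).comp (mfderiv 𝓘(ℝ, ℝ) (𝓡 d) σ 0)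
    have h1 : HasMFDerivAt 𝓘(ℝ, ℝ) 𝓘(ℝ, Euc d) (φ ∘ σ) 0 L :=
      (mdifferentiableAt_extChartAt (I := 𝓡 d) (x := x) (y := σ 0)
        (by simpa [hφ] using hs)).hasMFDerivAt.comp (0 : ℝ)
        (hσ.1.1.mdifferentiableAt (by simp)).hasMFDerivAt
    have h2 : deriv (φ ∘ σ) 0 = L 1 := by
      have h1' : HasFDerivAt (φ ∘ σ) L 0 := h1.hasFDerivAt
      exact h1'.hasDerivAt.deriv
    -- A chart has the identity as derivative at its own base point. The point is generalised so
    -- that the equality `σ 0 = x` can be substituted.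
    have h3 : ∀ p : M, p = x → ∀ ζ : Euc d, (mfderiv (𝓡 d) 𝓘(ℝ, Euc d) φ p ζ : Euc d) = ζ := by
      rintro p rfl ζ
      rw [hφ, mfderiv_extChartAt_self]; rfl
    exact h2.trans ((h3 _ hσ.start _).trans hσ.velocity)
  rw [hder] at main
  simpa only [hσ.start] using main

/-! ### The exponential map and its inverse to first order at the base point -/

theorem expMap_zero (x : M) : expMap d x 0 = x := by
  unfold expMap
  split_ifs with h
  · have := h.choose_spec.dist_le (zero_le_one)
    rw [norm_zero, zero_mul] at this
    exact dist_le_zero.1 this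
  · rfl

namespace FrameCover

variable {S : Set M}

/-- The default value of `expMap` never occurs for small nonzero vectors: it would equal the value
at `0` and contradict injectivity on the ball of radius `r`. Existence of geodesics thus comes from
the bijectivity hypothesis. -/
theorem expMap_spec (A : FrameCover d M S) (x : M) {ξ : TangentSpace (𝓡 d) x} (hξ : ‖ξ‖ < A.r) (h0 : ξ ≠ 0) :
    ∃ σ, IsGeodesicFrom d x ξ σ ∧ expMap d x ξ = σ 1 := by
  by_cases h : ∃ σ : ℝ → M, IsGeodesicFrom d x ξ σ
  · refine ⟨h.choose, h.choose_spec, ?_⟩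
    unfold expMap
    rw [dif_pos h]
  · exfalso
    have h1 : expMap d x ξ = x := by unfold expMap; rw [dif_neg h]
    exact h0 ((A.exp_bijOn x).injOn (by simpa using hξ) (by simpa using A.r_pos)
      (h1.trans (expMap_zero x).symm))

theorem exp_bound (A : FrameCover d M S) (x : M) : ∃ K > 0, ∃ κ > 0, ∀ (ξ : TangentSpace (𝓡 d) x), ‖ξ‖ < κ →
    ‖extChartAt (𝓡 d) x (expMap d x ξ) - extChartAt (𝓡 d) x x - toModel ξ‖ ≤ K * ‖ξ‖ ^ 2 := by
  obtain ⟨K, hK, κ, hκ, h⟩ := exists_geodesic_bound (d := d) x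
  refine ⟨K, hK, min κ A.r, lt_min hκ A.r_pos, fun ξ hξ => ?_⟩
  rcases eq_or_ne ξ 0 with rfl | h0
  · have h1 : extChartAt (𝓡 d) x (expMap d x 0) - extChartAt (𝓡 d) x x - (0 : Euc d) = 0 := by
      rw [expMap_zero]; simp
    have h2 : ‖extChartAt (𝓡 d) x (expMap d x 0) - extChartAt (𝓡 d) x x - (0 : Euc d)‖ ≤
        K * ‖(0 : TangentSpace (𝓡 d) x)‖ ^ 2 := by rw [h1]; simp
    exact h2
  · obtain ⟨σ, hσ, he⟩ := A.expMap_spec x (hξ.trans_le (min_le_right _ _)) h0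
    rw [he]
    exact h ξ (hξ.trans_le (min_le_left _ _)) σ hσ

/-- `exp_y` read in the `n`-th frame at `y`. -/
def expFrame (A : FrameCover d M S) (n : ℕ) (y : M) (v : Euc d) : M :=
  expMap d y ((A.Θ n y).symm v)

theorem expFrame_zero (A : FrameCover d M S) (n : ℕ) (y : M) : A.expFrame n y 0 = y := by
  unfold expFrame
  rw [map_zero, expMap_zero]

theorem mdifferentiableAt_expFrame (A : FrameCover d M S) (n : ℕ) (y : M) {v : Euc d}
    (hv : ‖v‖ < A.r) : MDifferentiableAt 𝓘(ℝ, Euc d) (𝓡 d) (A.expFrame n y) v := by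
  have h1 : MDifferentiableAt 𝓘(ℝ, TangentSpace (𝓡 d) y) (𝓡 d) (expMap d y)
      ((A.Θ n y).symm v) :=
    ((A.exp_smooth y).contMDiffAt (isOpen_ball.mem_nhds (by simpa using hv))).mdifferentiableAt
      (by simp)
  have h2 : MDifferentiableAt 𝓘(ℝ, Euc d) 𝓘(ℝ, TangentSpace (𝓡 d) y) (A.Θ n y).symm v :=
    (A.Θ n y).symm.toContinuousLinearEquiv.differentiableAt.mdifferentiableAt
  exact h1.comp v h2

/-- The geodesic bound leaves an error quadratic in `v`. It holds for every geodesic with the given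
velocity, hence for the one selected in `expMap`. -/
theorem hasFDerivAt_chart_expFrame (A : FrameCover d M S) (n : ℕ) (y : M) :
    HasFDerivAt (fun v => extChartAt (𝓡 d) y (A.expFrame n y v))
      (show Euc d →L[ℝ] Euc d from (A.Θ n y).symm.toContinuousLinearEquiv.toContinuousLinearMap)
      0 := by
  obtain ⟨K, hK, κ, hκ, h⟩ := A.exp_bound y
  rw [hasFDerivAt_iff_isLittleO_nhds_zero]
  refine Asymptotics.IsBigO.trans_isLittleO (g := fun v : Euc d => ‖v‖ ^ 2) ?_ ?_
  · refine Asymptotics.IsBigO.of_bound K ?_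
    filter_upwards [ball_mem_nhds (0 : Euc d) hκ] with v hv
    have hv' : ‖(A.Θ n y).symm v‖ < κ := by simpa using hv
    have := h _ hv'
    rw [LinearIsometryEquiv.norm_map] at this
    simp only [zero_add, expFrame_zero]
    rw [norm_pow, norm_norm]
    exact this
  · have := Asymptotics.isLittleO_norm_pow_id (E' := Euc d) one_lt_two
    simpa using this

theorem mfderiv_expFrame_zero (A : FrameCover d M S) (n : ℕ) (y : M) (w : Euc d) :
    toModel (mfderiv 𝓘(ℝ, Euc d) (𝓡 d) (A.expFrame n y) 0 w) = toModel ((A.Θ n y).symm w) := by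
  have h0 := A.expFrame_zero n y
  let L : Euc d →L[ℝ] Euc d :=
      (mfderiv (𝓡 d) 𝓘(ℝ, Euc d) (extChartAt (𝓡 d) y) (A.expFrame n y 0)).comp
        (mfderiv 𝓘(ℝ, Euc d) (𝓡 d) (A.expFrame n y) 0)
  have h1 : HasMFDerivAt 𝓘(ℝ, Euc d) 𝓘(ℝ, Euc d) (extChartAt (𝓡 d) y ∘ A.expFrame n y) 0 L :=
      (mdifferentiableAt_extChartAt (I := 𝓡 d) (x := y) (y := A.expFrame n y 0)
        (by rw [h0]; exact mem_chart_source _ _)).hasMFDerivAt.comp (0 : Euc d)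
        (A.mdifferentiableAt_expFrame n y (by simpa using A.r_pos)).hasMFDerivAt
  have h2 : HasFDerivAt (extChartAt (𝓡 d) y ∘ A.expFrame n y) L 0 := h1.hasFDerivAt
  have h3 : L = _ := h2.unique (A.hasFDerivAt_chart_expFrame n y)
  have h4 : ∀ p : M, p = y → ∀ ζ : Euc d,
      toModel (mfderiv (𝓡 d) 𝓘(ℝ, Euc d) (extChartAt (𝓡 d) y) p ζ) = ζ := by
    rintro p rfl ζ
    exact congrArg (fun L : Euc d →L[ℝ] Euc d => L ζ) (mfderiv_extChartAt_self (I := 𝓡 d))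
  exact (h4 _ h0 _).symm.trans (congrArg (fun L : Euc d →L[ℝ] Euc d => L w) h3)

theorem expInv_expMap (A : FrameCover d M S) (y : M) {ξ : TangentSpace (𝓡 d) y} (hξ : ‖ξ‖ < A.r) :
    expInv d A.r y (expMap d y ξ) = ξ :=
  (A.exp_bijOn y).injOn.leftInvOn_invFunOn (by simpa using hξ)

theorem expMap_expInv (A : FrameCover d M S) {y z : M} (hz : dist z y < A.r) :
    expMap d y (expInv d A.r y z) = z :=
  (A.exp_bijOn y).surjOn.rightInvOn_invFunOn hz

theorem mdifferentiableAt_expInv (A : FrameCover d M S) {y z : M} (hz : dist z y < A.r) :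
    MDifferentiableAt (𝓡 d) 𝓘(ℝ, TangentSpace (𝓡 d) y) (expInv d A.r y) z :=
  ((A.expInv_smooth y).contMDiffAt (isOpen_ball.mem_nhds hz)).mdifferentiableAt (by simp)

/-- Differentiation at the origin of the identity `exp_y⁻¹ ∘ exp_y = id`, whose inner differential
is already known. -/
theorem mfderiv_expInv_self (A : FrameCover d M S) (n : ℕ) (y : M) (w : Euc d) :
    A.Θ n y (mfderiv (𝓡 d) 𝓘(ℝ, TangentSpace (𝓡 d) y) (expInv d A.r y) y ((A.Θ n y).symm w)) =
      w := by
  have h0 := A.expFrame_zero n y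
  have hfun : (fun v => A.Θ n y (expInv d A.r y (A.expFrame n y v))) =ᶠ[𝓝 0] id := by
    filter_upwards [ball_mem_nhds (0 : Euc d) A.r_pos] with v hv
    rw [expFrame, A.expInv_expMap y (by simpa using hv)]
    simp
  have h1 : ∀ p : M, p = y → ∀ ζ : Euc d,
      (show TangentSpace (𝓡 d) y from
        mfderiv (𝓡 d) 𝓘(ℝ, TangentSpace (𝓡 d) y) (expInv d A.r y) p ζ) =
      (show TangentSpace (𝓡 d) y from
        mfderiv (𝓡 d) 𝓘(ℝ, TangentSpace (𝓡 d) y) (expInv d A.r y) y ζ) := by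
    rintro p rfl ζ; rfl
  have h2 : HasMFDerivAt 𝓘(ℝ, Euc d) 𝓘(ℝ, TangentSpace (𝓡 d) y)
      (expInv d A.r y ∘ A.expFrame n y) 0 _ :=
    (A.mdifferentiableAt_expInv (by rw [h0, dist_self]; exact A.r_pos)).hasMFDerivAt.comp
      (0 : Euc d) (A.mdifferentiableAt_expFrame n y (by simpa using A.r_pos)).hasMFDerivAt
  have h3 := (A.Θ n y).toContinuousLinearEquiv.hasFDerivAt.comp (0 : Euc d) h2.hasFDerivAt
  have h4 := h3.unique ((hasFDerivAt_id (0 : Euc d)).congr_of_eventuallyEq hfun)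
  have h5 := congrArg (fun L : Euc d →L[ℝ] Euc d => L w) h4
  refine Eq.trans ?_ h5
  refine congrArg (A.Θ n y) ?_
  refine (h1 _ h0 _).symm.trans ?_
  exact congrArg _ (A.mfderiv_expFrame_zero n y w).symm

end FrameCover
end Smooth

/-! ### Differentials as matrices in the frames, and comparison of frames -/

theorem enorm_comp_sub_comp_le {E : Type*} [NormedAddCommGroup E] [NormedSpace ℝ E]
    (A A' B B' : E →L[ℝ] E) :
    ‖A ∘L B - A' ∘L B'‖ ≤ ‖A - A'‖ * ‖B‖ + ‖A'‖ * ‖B - B'‖ := by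
  have : A ∘L B - A' ∘L B' = (A - A') ∘L B + A' ∘L (B - B') := by
    ext v; simp
  rw [this]
  exact (norm_add_le _ _).trans (add_le_add (ContinuousLinearMap.opNorm_comp_le _ _)
    (ContinuousLinearMap.opNorm_comp_le _ _))

/-- The matrix of a linear map into `T_pM` in the `n`-th frame. -/
def FrameCover.mat {S : Set M} (A : FrameCover d M S) (n : ℕ) (p : M)
    (C : Euc d ≃L[ℝ] TangentSpace (𝓡 d) p) : Euc d →L[ℝ] Euc d :=
  ((A.Θ n p).toContinuousLinearEquiv : TangentSpace (𝓡 d) p →L[ℝ] Euc d) ∘L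
    (C : Euc d →L[ℝ] TangentSpace (𝓡 d) p)

/-- The inverse of `mat`. -/
def FrameCover.matInv {S : Set M} (A : FrameCover d M S) (n : ℕ) (p : M)
    (C : Euc d ≃L[ℝ] TangentSpace (𝓡 d) p) : Euc d →L[ℝ] Euc d :=
  (C.symm : TangentSpace (𝓡 d) p →L[ℝ] Euc d) ∘L
  ((A.Θ n p).symm.toContinuousLinearEquiv : Euc d →L[ℝ] TangentSpace (𝓡 d) p)

/-- The norm of the inverse of a linear isomorphism onto `T_pM`. -/
def invNorm {p : M} (C : Euc d ≃L[ℝ] TangentSpace (𝓡 d) p) : ℝ :=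
  ‖(C.symm : TangentSpace (𝓡 d) p →L[ℝ] Euc d)‖

theorem invNorm_nonneg {p : M} (C : Euc d ≃L[ℝ] TangentSpace (𝓡 d) p) : 0 ≤ invNorm C :=
  norm_nonneg _

theorem norm_symm_le {p : M} (C : Euc d ≃L[ℝ] TangentSpace (𝓡 d) p)
    (ξ : TangentSpace (𝓡 d) p) : ‖C.symm ξ‖ ≤ invNorm C * ‖ξ‖ :=
  (C.symm : TangentSpace (𝓡 d) p →L[ℝ] Euc d).le_opNorm ξ

theorem norm_le_invNorm_mul {p : M} (C : Euc d ≃L[ℝ] TangentSpace (𝓡 d) p) (v : Euc d) :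
    ‖v‖ ≤ invNorm C * ‖C v‖ := by
  simpa using norm_symm_le C (C v)

namespace FrameCover

variable {S : Set M}

theorem norm_mat_apply (A : FrameCover d M S) (n : ℕ) {p : M}
    (C : Euc d ≃L[ℝ] TangentSpace (𝓡 d) p) (v : Euc d) : ‖A.mat n p C v‖ = ‖C v‖ :=
  (A.Θ n p).norm_map _

theorem norm_mat_le (A : FrameCover d M S) (n : ℕ) {p : M}
    {C : Euc d ≃L[ℝ] TangentSpace (𝓡 d) p} (hC : ∀ v, ‖C v‖ ≤ ‖v‖) : ‖A.mat n p C‖ ≤ 1 :=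
  ContinuousLinearMap.opNorm_le_bound _ zero_le_one fun v => by
    rw [norm_mat_apply, one_mul]; exact hC v

theorem norm_matInv_le (A : FrameCover d M S) (n : ℕ) {p : M}
    (C : Euc d ≃L[ℝ] TangentSpace (𝓡 d) p) : ‖A.matInv n p C‖ ≤ invNorm C :=
  ContinuousLinearMap.opNorm_le_bound _ (invNorm_nonneg C) fun v => by
    refine (norm_symm_le C _).trans_eq ?_
    congr 1
    exact (A.Θ n p).symm.norm_map v

theorem matInv_mat (A : FrameCover d M S) (n : ℕ) {p : M}
    (C : Euc d ≃L[ℝ] TangentSpace (𝓡 d) p) : A.matInv n p C ∘L A.mat n p C =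
      ContinuousLinearMap.id ℝ _ := by
  ext v
  simp [matInv, mat]

theorem mat_matInv (A : FrameCover d M S) (n : ℕ) {p : M}
    (C : Euc d ≃L[ℝ] TangentSpace (𝓡 d) p) : A.mat n p C ∘L A.matInv n p C =
      ContinuousLinearMap.id ℝ _ := by
  ext v
  simp [matInv, mat]

/-- The differential of `exp_y` at `u`, read in the `n`-th frame. -/
def dexp (A : FrameCover d M S) (n : ℕ) (y : M) (u : Euc d) : Euc d →L[ℝ] Euc d :=
  ((A.Θ n (A.expFrame n y u)).toContinuousLinearEquiv :
    TangentSpace (𝓡 d) (A.expFrame n y u) →L[ℝ] Euc d) ∘L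
    (mfderiv 𝓘(ℝ, Euc d) (𝓡 d) (A.expFrame n y) u)

/-- The differential of `exp_y⁻¹` at `z`, read in the `n`-th frame. -/
def dinv (A : FrameCover d M S) (n : ℕ) (y z : M) : Euc d →L[ℝ] Euc d :=
  ((A.Θ n y).toContinuousLinearEquiv : TangentSpace (𝓡 d) y →L[ℝ] Euc d) ∘L
    ((mfderiv (𝓡 d) 𝓘(ℝ, TangentSpace (𝓡 d) y) (expInv d A.r y) z :
      TangentSpace (𝓡 d) z →L[ℝ] TangentSpace (𝓡 d) y) ∘L
    ((A.Θ n z).symm.toContinuousLinearEquiv : Euc d →L[ℝ] TangentSpace (𝓡 d) z))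

/-- The differential of a map `g`, read in the `n`-th frame at the source and in the `m`-th one at
the target. -/
def dmap (A : FrameCover d M S) (g : M → M) (n m : ℕ) (z : M) : Euc d →L[ℝ] Euc d :=
  ((A.Θ m (g z)).toContinuousLinearEquiv : TangentSpace (𝓡 d) (g z) →L[ℝ] Euc d) ∘L
    ((mfderiv (𝓡 d) (𝓡 d) g z) ∘L
    ((A.Θ n z).symm.toContinuousLinearEquiv : Euc d →L[ℝ] TangentSpace (𝓡 d) z))

theorem norm_dexp_sub_le (A : FrameCover d M S) {n : ℕ} {y : M} (hy : y ∈ A.D n) {u u' : Euc d}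
    (hu : ‖u‖ < A.r) (hu' : ‖u'‖ < A.r) (h : A.expFrame n y u ∈ A.D n)
    (h' : A.expFrame n y u' ∈ A.D n) : ‖A.dexp n y u - A.dexp n y u'‖ ≤ A.L * ‖u - u'‖ := by
  have hL := A.one_le_L
  refine ContinuousLinearMap.opNorm_le_bound _ (by positivity) fun w => ?_
  have := A.dexp_frame_lip n y hy y hy u (by simpa using hu) u' (by simpa using hu') h h' w
  rw [dist_self, add_zero] at this
  exact this

theorem norm_dinv_sub_le (A : FrameCover d M S) {n : ℕ} {y : M} (hy : y ∈ A.D n) {z z' : M}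
    (hz : dist z y < A.r) (hz' : dist z' y < A.r) (h : z ∈ A.D n)
    (h' : z' ∈ A.D n) : ‖A.dinv n y z - A.dinv n y z'‖ ≤ A.L * dist z z' := by
  have hL := A.one_le_L
  refine ContinuousLinearMap.opNorm_le_bound _ (by positivity) fun w => ?_
  have := A.dexpInv_frame_lip n y hy y hy z ⟨h, hz⟩ z' ⟨h', hz'⟩ w
  rw [dist_self, zero_add] at this
  exact this

section Smooth

variable [IsContMDiffRiemannianBundle (𝓡 d) ∞ (Euc d) (fun x : M => TangentSpace (𝓡 d) x)]
  [IsRiemannianManifold (𝓡 d) M]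

theorem dexp_zero (A : FrameCover d M S) (n : ℕ) (y : M) :
    A.dexp n y 0 = ContinuousLinearMap.id ℝ _ := by
  ext1 w
  have h : ∀ p : M, p = y → ∀ ζ : Euc d, (A.Θ n p) (show TangentSpace (𝓡 d) p from ζ) =
      (A.Θ n y) (show TangentSpace (𝓡 d) y from ζ) := by
    rintro p rfl ζ; rfl
  refine (h _ (A.expFrame_zero n y) _).trans ?_
  refine (congrArg (A.Θ n y) (A.mfderiv_expFrame_zero n y w)).trans ?_
  exact (A.Θ n y).apply_symm_apply w

theorem dinv_self (A : FrameCover d M S) (n : ℕ) (y : M) :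
    A.dinv n y y = ContinuousLinearMap.id ℝ _ := by
  ext1 w
  exact A.mfderiv_expInv_self n y w

theorem norm_dexp_le (A : FrameCover d M S) {n : ℕ} {y : M} (hy : y ∈ A.D n) {u : Euc d}
    (hu : ‖u‖ < A.r) (h : A.expFrame n y u ∈ A.D n) (hL : A.L * ‖u‖ ≤ 1) :
    ‖A.dexp n y u‖ ≤ 2 := by
  have h1 := A.norm_dexp_sub_le hy hu (u' := 0) (by simpa using A.r_pos) h
    (by rwa [A.expFrame_zero])
  rw [A.dexp_zero, sub_zero] at h1
  calc _ = ‖(A.dexp n y u - ContinuousLinearMap.id ℝ _) + ContinuousLinearMap.id ℝ _‖ := by simp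
    _ ≤ 1 + 1 := (norm_add_le _ _).trans
      (add_le_add (h1.trans hL) ContinuousLinearMap.norm_id_le)
    _ = 2 := by norm_num

theorem norm_dinv_sub_id_le (A : FrameCover d M S) {n : ℕ} {y z : M} (hy : y ∈ A.D n)
    (hz : dist z y < A.r) (h : z ∈ A.D n) :
    ‖A.dinv n y z - ContinuousLinearMap.id ℝ _‖ ≤ A.L * dist z y := by
  have h1 := A.norm_dinv_sub_le hy hz (z' := y) (by simpa using A.r_pos) h hy
  rwa [A.dinv_self] at h1

theorem norm_dinv_le (A : FrameCover d M S) {n : ℕ} {y z : M} (hy : y ∈ A.D n)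
    (hz : dist z y < A.r) (h : z ∈ A.D n) (hL : A.L * dist z y ≤ 1) :
    ‖A.dinv n y z‖ ≤ 2 := by
  have h1 := A.norm_dinv_sub_id_le hy hz h
  calc _ = ‖(A.dinv n y z - ContinuousLinearMap.id ℝ _) + ContinuousLinearMap.id ℝ _‖ := by simp
    _ ≤ 1 + 1 := (norm_add_le _ _).trans
      (add_le_add (h1.trans hL) ContinuousLinearMap.norm_id_le)
    _ = 2 := by norm_num

/-- The transition from the `n`-th to the `m`-th frame at `y`. -/
def transition (A : FrameCover d M S) (n m : ℕ) (y : M) : Euc d →L[ℝ] Euc d :=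
  ((A.Θ m y).toContinuousLinearEquiv : TangentSpace (𝓡 d) y →L[ℝ] Euc d) ∘L
    ((A.Θ n y).symm.toContinuousLinearEquiv : Euc d →L[ℝ] TangentSpace (𝓡 d) y)

theorem norm_transition_le (A : FrameCover d M S) (n m : ℕ) (y : M) :
    ‖A.transition n m y‖ ≤ 1 :=
  ContinuousLinearMap.opNorm_le_bound _ zero_le_one fun v => by
    rw [one_mul]
    refine ((A.Θ m y).norm_map _).le.trans ?_
    exact ((A.Θ n y).symm.norm_map v).le

/-- Both sides represent the same differential of `exp_y⁻¹` at `z`, with the frame changed at the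
target or at the source. -/
theorem transition_dinv (A : FrameCover d M S) (n m : ℕ) (y z : M) :
    A.transition n m y ∘L A.dinv n y z = A.dinv m y z ∘L A.transition n m z := by
  ext1 w
  let E : TangentSpace (𝓡 d) z →L[ℝ] TangentSpace (𝓡 d) y :=
    mfderiv (𝓡 d) 𝓘(ℝ, TangentSpace (𝓡 d) y) (expInv d A.r y) z
  have h1 : A.Θ m y ((A.Θ n y).symm (A.Θ n y (E ((A.Θ n z).symm w)))) =
      A.Θ m y (E ((A.Θ n z).symm w)) := congrArg (A.Θ m y) ((A.Θ n y).symm_apply_apply _)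
  have h2 : A.Θ m y (E ((A.Θ m z).symm (A.Θ m z ((A.Θ n z).symm w)))) =
      A.Θ m y (E ((A.Θ n z).symm w)) :=
    congrArg (fun ξ => A.Θ m y (E ξ)) ((A.Θ m z).symm_apply_apply _)
  exact h1.trans h2.symm

/-- No Lipschitz bound on the frames themselves is assumed. By `transition_dinv` the difference of
the transitions is expressed through `dinv - id` in the two frames, and each of these is at most `L`
times the distance. -/
theorem norm_transition_sub_le (A : FrameCover d M S) {n m : ℕ} {y z : M} (hyn : y ∈ A.D n)
    (hym : y ∈ A.D m) (hzn : z ∈ A.D n) (hzm : z ∈ A.D m) (hz : dist z y < A.r) :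
    ‖A.transition n m y - A.transition n m z‖ ≤ 2 * A.L * dist z y := by
  have h1 := A.norm_dinv_sub_id_le hyn hz hzn
  have h2 := A.norm_dinv_sub_id_le hym hz hzm
  have h3 : A.transition n m y - A.transition n m z =
      (A.dinv m y z - ContinuousLinearMap.id ℝ _) ∘L A.transition n m z -
      A.transition n m y ∘L (A.dinv n y z - ContinuousLinearMap.id ℝ _) := by
    rw [ContinuousLinearMap.comp_sub, ContinuousLinearMap.sub_comp, A.transition_dinv]
    simp
  rw [h3]
  refine (norm_sub_le _ _).trans ?_
  have h4 := ContinuousLinearMap.opNorm_comp_le (A.dinv m y z - ContinuousLinearMap.id ℝ _)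
    (A.transition n m z)
  have h5 := ContinuousLinearMap.opNorm_comp_le (A.transition n m y)
    (A.dinv n y z - ContinuousLinearMap.id ℝ _)
  have h6 := A.norm_transition_le n m z
  have hL := A.one_le_L
  have h7 := A.norm_transition_le n m y
  have h8 : ‖A.dinv m y z - ContinuousLinearMap.id ℝ _‖ * ‖A.transition n m z‖ ≤
    A.L * dist z y * 1 := by gcongr
  have h9 : ‖A.transition n m y‖ * ‖A.dinv n y z - ContinuousLinearMap.id ℝ _‖ ≤
    1 * (A.L * dist z y) := by gcongr
  linarith

/-- Closeness in one frame gives closeness in another one. -/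
theorem norm_mat_sub_le (A : FrameCover d M S) {n m : ℕ} {p q : M} (hpn : p ∈ A.D n)
    (hpm : p ∈ A.D m) (hqn : q ∈ A.D n) (hqm : q ∈ A.D m) (hpq : dist p q < A.r)
    (C : Euc d ≃L[ℝ] TangentSpace (𝓡 d) p) {C' : Euc d ≃L[ℝ] TangentSpace (𝓡 d) q}
    (hC' : ∀ v, ‖C' v‖ ≤ ‖v‖) :
    ‖A.mat m p C - A.mat m q C'‖ ≤ ‖A.mat n p C - A.mat n q C'‖ + 2 * A.L * dist p q := by
  have h1 : ∀ (p : M) (C : Euc d ≃L[ℝ] TangentSpace (𝓡 d) p),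
      A.mat m p C = A.transition n m p ∘L A.mat n p C := by
    intro p C; ext1 w; simp [transition, mat]
  have h2 : A.mat m p C - A.mat m q C' = A.transition n m p ∘L (A.mat n p C - A.mat n q C') +
      (A.transition n m p - A.transition n m q) ∘L A.mat n q C' := by
    rw [h1 p, h1 q, ContinuousLinearMap.comp_sub, ContinuousLinearMap.sub_comp]
    abel
  rw [h2]
  refine (norm_add_le _ _).trans (add_le_add ?_ ?_)
  · refine (ContinuousLinearMap.opNorm_comp_le _ _).trans ?_
    exact mul_le_of_le_one_left (norm_nonneg _) (A.norm_transition_le n m p)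
  · refine (ContinuousLinearMap.opNorm_comp_le _ _).trans ?_
    have h3 := A.norm_transition_sub_le hpn hpm hqn hqm (by rwa [dist_comm])
    have h4 := A.norm_mat_le n hC'
    rw [dist_comm] at h3
    have hL := A.one_le_L
    calc _ ≤ 2 * A.L * dist p q * 1 := by gcongr
      _ = _ := mul_one _

end Smooth
end FrameCover

/-! ### Coordinate expression of a map between two exponential charts -/

section Smooth

variable [IsContMDiffRiemannianBundle (𝓡 d) ∞ (Euc d) (fun x : M => TangentSpace (𝓡 d) x)]
  [IsRiemannianManifold (𝓡 d) M] {S : Set M}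

/-- A map `g` near `p`, with `g p` close to `q`: the data needed to control the coordinate
expression of `g` in the exponential charts at `p` and `q`, on the ball of radius `R`. -/
structure ChartData (A : FrameCover d M S) (g : M → M) (p q : M) (R θ Λ K β : ℝ) (n m : ℕ) :
    Prop where
  R_pos : 0 < R
  R_le : R ≤ 1 / 2
  LR : A.L * R ≤ 1
  β_pos : 0 < β
  β_le : β ≤ 1
  one_le_Λ : 1 ≤ Λ
  one_le_K : 1 ≤ K
  Rr : 2 * R < A.r
  θ_lt : 2 * Λ * R + θ < A.r
  Lθ : A.L * (2 * Λ * R + θ) ≤ 1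
  p_mem : ball p (2 * R) ⊆ A.D n
  q_mem : ball q (2 * Λ * R + θ) ⊆ A.D m
  dist_lt : dist (g p) q < θ
  smooth : ContMDiffOn (𝓡 d) (𝓡 d) 1 g (ball p (2 * R))
  bound : ∀ z ∈ ball p (2 * R), ‖mfderiv (𝓡 d) (𝓡 d) g z‖ ≤ Λ
  holder : ∀ z ∈ ball p (2 * R), ∀ z' ∈ ball p (2 * R), g z ∈ A.D m → g z' ∈ A.D m →
    ∀ w : Euc d, ‖A.Θ m (g z) (mfderiv (𝓡 d) (𝓡 d) g z ((A.Θ n z).symm w)) -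
      A.Θ m (g z') (mfderiv (𝓡 d) (𝓡 d) g z' ((A.Θ n z').symm w))‖ ≤ K * dist z z' ^ β * ‖w‖

/-- The coordinate expression of `g` in exponential charts. -/
def chartMap (A : FrameCover d M S) (g : M → M) {p q : M} (Cp : Euc d ≃L[ℝ] TangentSpace (𝓡 d) p)
    (Cq : Euc d ≃L[ℝ] TangentSpace (𝓡 d) q) (v : Euc d) : Euc d :=
  Cq.symm (expInv d A.r q (g (expMap d p (Cp v))))

/-- The derivative of `chartMap`, read in frames. -/
def chartDeriv (A : FrameCover d M S) (g : M → M) (n m : ℕ) {p q : M}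
    (Cp : Euc d ≃L[ℝ] TangentSpace (𝓡 d) p) (Cq : Euc d ≃L[ℝ] TangentSpace (𝓡 d) q) (v : Euc d) :
    Euc d →L[ℝ] Euc d :=
  A.matInv m q Cq ∘L ((A.dinv m q (g (A.expFrame n p (A.mat n p Cp v))) ∘L
    (A.dmap g n m (A.expFrame n p (A.mat n p Cp v)) ∘L A.dexp n p (A.mat n p Cp v))) ∘L
      A.mat n p Cp)

namespace ChartData

variable {A : FrameCover d M S} {g : M → M} {p q : M} {R θ Λ K β : ℝ} {n m : ℕ}

theorem θ_pos (h : ChartData A g p q R θ Λ K β n m) : 0 < θ := dist_nonneg.trans_lt h.dist_lt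

theorem p_mem_D (h : ChartData A g p q R θ Λ K β n m) : p ∈ A.D n :=
  h.p_mem (mem_ball_self (by linarith [h.R_pos]))

theorem q_mem_D (h : ChartData A g p q R θ Λ K β n m) : q ∈ A.D m :=
  h.q_mem (mem_ball_self (by
    have := h.R_pos; have := h.one_le_Λ; have := h.θ_pos; positivity))

theorem dist_expFrame_le (h : ChartData A g p q R θ Λ K β n m) {u u' : Euc d} (hu : ‖u‖ < R)
    (hu' : ‖u'‖ < R) : dist (A.expFrame n p u) (A.expFrame n p u') ≤ 2 * ‖u - u'‖ := by
  have h1 := h.Rr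
  have h2 := h.R_pos
  have := A.exp_lip p ((A.Θ n p).symm u) (by simpa using by linarith)
    ((A.Θ n p).symm u') (by simpa using by linarith)
  rwa [← map_sub, LinearIsometryEquiv.norm_map] at this

theorem expFrame_mem (h : ChartData A g p q R θ Λ K β n m) {u : Euc d} (hu : ‖u‖ < R) :
    A.expFrame n p u ∈ ball p (2 * R) := by
  have := h.dist_expFrame_le hu (u' := 0) (by simpa using h.R_pos)
  rw [A.expFrame_zero, sub_zero] at this
  exact mem_ball.2 (by linarith)

theorem norm_dexp_le (h : ChartData A g p q R θ Λ K β n m) {u : Euc d} (hu : ‖u‖ < R) :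
    ‖A.dexp n p u‖ ≤ 2 := by
  have h1 := h.Rr
  have h2 := h.R_pos
  have h3 := A.one_le_L
  refine A.norm_dexp_le h.p_mem_D (by linarith) (h.p_mem (h.expFrame_mem hu)) ?_
  exact le_trans (by gcongr) h.LR

theorem contMDiffOn_expFrame (A : FrameCover d M S) (n : ℕ) (p : M) :
    ContMDiffOn 𝓘(ℝ, Euc d) (𝓡 d) ∞ (A.expFrame n p) (ball 0 A.r) := by
  have h2 : ContMDiff 𝓘(ℝ, Euc d) 𝓘(ℝ, TangentSpace (𝓡 d) p) ∞ (A.Θ n p).symm :=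
    (A.Θ n p).symm.toContinuousLinearEquiv.contDiff.contMDiff
  exact (A.exp_smooth p).comp h2.contMDiffOn (fun v hv => by simpa using hv)

/-- The distance of the images is at most the length of the image of the segment from `u` to `u'` in
the exponential chart. Its speed is at most `Λ · 2 · |u - u'|`, the `2` being the bound on the
differential of the exponential map. -/
theorem dist_map_le (h : ChartData A g p q R θ Λ K β n m) {u u' : Euc d} (hu : ‖u‖ < R)
    (hu' : ‖u'‖ < R) :
    dist (g (A.expFrame n p u)) (g (A.expFrame n p u')) ≤ 2 * Λ * ‖u - u'‖ := by
  have hr : R < A.r := by linarith [h.R_pos, h.Rr]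
  set c : ℝ → Euc d := fun t => u + t • (u' - u) with hc
  have hcm : ∀ t ∈ Icc (0 : ℝ) 1, ‖c t‖ < R := fun t ht => by
    have h1 : c t ∈ ball (0 : Euc d) R :=
      (convex_ball (0 : Euc d) R).add_smul_sub_mem (by simpa using hu) (by simpa using hu') ht
    simpa using h1
  have hcd : ∀ t, HasDerivAt c (u' - u) t := fun t =>
    (((hasDerivAt_id t).smul_const (u' - u)).const_add u).congr_deriv (by simp)
  have hcs : ContMDiff 𝓘(ℝ, ℝ) 𝓘(ℝ, Euc d) 1 c := by
    apply ContDiff.contMDiff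
    fun_prop
  have h0 : c 0 = u := by simp [hc]
  have h1 : c 1 = u' := by simp [hc]
  have main := dist_le_of_speed_le (d := d) (σ := fun t => g (A.expFrame n p (c t)))
    (a := 0) (b := 1) (V := 2 * Λ * ‖u - u'‖) zero_le_one ?_
    (by have := h.one_le_Λ; positivity) ?_
  · simpa only [h0, h1, sub_zero, mul_one] using main
  · refine h.smooth.comp (t := ball p (2 * R)) ?_ (fun t ht => h.expFrame_mem (hcm t ht))
    refine ((contMDiffOn_expFrame A n p).of_le ENat.LEInfty.out).comp hcs.contMDiffOn ?_
    intro t ht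
    have := hcm t ht
    simp only [mem_preimage, mem_ball_zero_iff]
    linarith
  · intro t ht
    have ht' : t ∈ Icc (0 : ℝ) 1 := ⟨ht.1.le, ht.2.le⟩
    have hz := h.expFrame_mem (hcm t ht')
    have hg : MDifferentiableAt (𝓡 d) (𝓡 d) g (A.expFrame n p (c t)) :=
      (h.smooth.contMDiffAt (isOpen_ball.mem_nhds hz)).mdifferentiableAt (by simp)
    have he := A.mdifferentiableAt_expFrame n p (v := c t) ((hcm t ht').trans hr)
    have hcomp : HasMFDerivAt 𝓘(ℝ, ℝ) (𝓡 d) (g ∘ (A.expFrame n p ∘ c)) t _ :=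
      hg.hasMFDerivAt.comp t (he.hasMFDerivAt.comp t (hcd t).hasFDerivAt.hasMFDerivAt)
    have e1 : toModel (mfderiv 𝓘(ℝ, ℝ) (𝓡 d) (fun t => g (A.expFrame n p (c t))) t (1 : ℝ)) =
        toModel (mfderiv (𝓡 d) (𝓡 d) g (A.expFrame n p (c t))
          (mfderiv 𝓘(ℝ, Euc d) (𝓡 d) (A.expFrame n p) (c t) (u' - u))) := by
      have e2 := hcomp.mfderiv
      have e3 := congrArg (fun L : ℝ →L[ℝ] Euc d => L 1) e2
      refine e3.trans ?_
      have e4 : (ContinuousLinearMap.toSpanSingleton ℝ (u' - u)) (1 : ℝ) = u' - u := by simp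
      exact congrArg (fun w : Euc d => toModel (mfderiv (𝓡 d) (𝓡 d) g (A.expFrame n p (c t))
          (mfderiv 𝓘(ℝ, Euc d) (𝓡 d) (A.expFrame n p) (c t) w))) e4
    refine (tnorm_congr rfl e1).le.trans ?_
    refine ((mfderiv (𝓡 d) (𝓡 d) g (A.expFrame n p (c t))).le_opNorm _).trans ?_
    have e5 : ‖mfderiv 𝓘(ℝ, Euc d) (𝓡 d) (A.expFrame n p) (c t) (u' - u)‖ ≤ 2 * ‖u - u'‖ := by
      rw [norm_sub_rev u u']
      refine ((A.Θ n _).norm_map _).symm.le.trans ?_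
      exact ((A.dexp n p (c t)).le_opNorm (u' - u)).trans
        (by gcongr; exact h.norm_dexp_le (hcm t ht'))
    calc _ ≤ Λ * (2 * ‖u - u'‖) := by
          have := h.bound _ hz
          have := h.one_le_Λ
          gcongr
      _ = _ := by ring

theorem map_mem (h : ChartData A g p q R θ Λ K β n m) {u : Euc d} (hu : ‖u‖ < R) :
    dist (g (A.expFrame n p u)) q < 2 * Λ * R + θ := by
  have h1 := h.dist_map_le hu (u' := 0) (by simpa using h.R_pos)
  rw [A.expFrame_zero, sub_zero] at h1
  have h2 := h.one_le_Λ
  calc _ ≤ dist (g (A.expFrame n p u)) (g p) + dist (g p) q := dist_triangle _ _ _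
    _ < 2 * Λ * R + θ := by
      refine add_lt_add_of_le_of_lt (h1.trans ?_) h.dist_lt
      gcongr

theorem norm_dinv_le (h : ChartData A g p q R θ Λ K β n m) {u : Euc d} (hu : ‖u‖ < R) :
    ‖A.dinv m q (g (A.expFrame n p u))‖ ≤ 2 := by
  have h1 := h.map_mem hu
  have h3 := A.one_le_L
  refine A.norm_dinv_le h.q_mem_D (h1.trans h.θ_lt) (h.q_mem h1) ?_
  exact le_trans (by gcongr) h.Lθ

theorem norm_dmap_le (h : ChartData A g p q R θ Λ K β n m) {z : M} (hz : z ∈ ball p (2 * R)) :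
    ‖A.dmap g n m z‖ ≤ Λ := by
  have h0 := h.one_le_Λ
  refine ContinuousLinearMap.opNorm_le_bound _ (by linarith) fun w => ?_
  refine ((A.Θ m _).norm_map _).le.trans ?_
  refine ((mfderiv (𝓡 d) (𝓡 d) g z).le_opNorm _).trans ?_
  have h1 := h.bound z hz
  have h2 : ‖(A.Θ n z).symm w‖ = ‖w‖ := LinearIsometryEquiv.norm_map _ _
  calc _ ≤ Λ * ‖(A.Θ n z).symm w‖ := by gcongr; exact le_rfl
    _ = _ := by rw [h2]

/-- The derivative of the chart map. -/
theorem hasFDerivAt_chartMap (h : ChartData A g p q R θ Λ K β n m)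
    {Cp : Euc d ≃L[ℝ] TangentSpace (𝓡 d) p} (hCp : ∀ v, ‖Cp v‖ ≤ ‖v‖)
    (Cq : Euc d ≃L[ℝ] TangentSpace (𝓡 d) q) {v : Euc d} (hv : ‖v‖ < R) :
    HasFDerivAt (chartMap A g Cp Cq)
      (chartDeriv A g n m Cp Cq v) v := by
  unfold chartDeriv
  set u := A.mat n p Cp v with hu
  have huR : ‖u‖ < R := by rw [hu, A.norm_mat_apply]; exact (hCp v).trans_lt hv
  have hr : R < A.r := by linarith [h.R_pos, h.Rr]
  have hz := h.expFrame_mem huR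
  have hg : MDifferentiableAt (𝓡 d) (𝓡 d) g (A.expFrame n p u) :=
    (h.smooth.contMDiffAt (isOpen_ball.mem_nhds hz)).mdifferentiableAt (by simp)
  have he := A.mdifferentiableAt_expFrame n p (v := u) (huR.trans hr)
  have hi := A.mdifferentiableAt_expInv (y := q) (z := g (A.expFrame n p u))
    ((h.map_mem huR).trans h.θ_lt)
  have hcomp : HasMFDerivAt 𝓘(ℝ, Euc d) 𝓘(ℝ, TangentSpace (𝓡 d) q)
      (expInv d A.r q ∘ (g ∘ A.expFrame n p)) u _ :=
    hi.hasMFDerivAt.comp u (hg.hasMFDerivAt.comp u he.hasMFDerivAt)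
  have h1 := (A.matInv m q Cq).hasFDerivAt.comp v
    (((A.Θ m q).toContinuousLinearEquiv.hasFDerivAt.comp u hcomp.hasFDerivAt).comp v
      ((A.mat n p Cp).hasFDerivAt))
  have hfun : chartMap A g Cp Cq = fun v => A.matInv m q Cq (A.Θ m q (expInv d A.r q
      (g (A.expFrame n p (A.mat n p Cp v))))) := by
    funext w
    have a1 : A.expFrame n p (A.mat n p Cp w) = expMap d p (Cp w) :=
      congrArg (expMap d p) ((A.Θ n p).symm_apply_apply (Cp w))
    rw [a1]
    exact congrArg Cq.symm ((A.Θ m q).symm_apply_apply _).symm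
  rw [hfun]
  refine h1.congr_fderiv ?_
  ext1 w
  let E : Euc d →L[ℝ] TangentSpace (𝓡 d) (A.expFrame n p u) :=
    mfderiv 𝓘(ℝ, Euc d) (𝓡 d) (A.expFrame n p) u
  let G : TangentSpace (𝓡 d) (A.expFrame n p u) →L[ℝ] TangentSpace (𝓡 d) (g (A.expFrame n p u)) :=
    mfderiv (𝓡 d) (𝓡 d) g (A.expFrame n p u)
  let N : TangentSpace (𝓡 d) (g (A.expFrame n p u)) →L[ℝ] TangentSpace (𝓡 d) q :=
    mfderiv (𝓡 d) 𝓘(ℝ, TangentSpace (𝓡 d) q) (expInv d A.r q) (g (A.expFrame n p u))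
  set X := A.mat n p Cp w with hX
  -- The frames inserted between consecutive differentials in `chartDeriv` cancel in pairs.
  have b1 : A.matInv m q Cq (A.Θ m q (N ((A.Θ m _).symm (A.Θ m _ (G ((A.Θ n _).symm
      (A.Θ n _ (E X)))))))) = A.matInv m q Cq (A.Θ m q (N (G ((A.Θ n _).symm
      (A.Θ n _ (E X)))))) :=
    congrArg (fun ξ => A.matInv m q Cq (A.Θ m q (N ξ))) ((A.Θ m _).symm_apply_apply _)
  have b2 : A.matInv m q Cq (A.Θ m q (N (G ((A.Θ n _).symm (A.Θ n _ (E X)))))) =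
      A.matInv m q Cq (A.Θ m q (N (G (E X)))) :=
    congrArg (fun ξ => A.matInv m q Cq (A.Θ m q (N (G ξ)))) ((A.Θ n _).symm_apply_apply _)
  exact (b1.trans b2).symm

end ChartData
end Smooth

theorem FrameCover.invNorm_le_of_mat {S : Set M} (A : FrameCover d M S) (n : ℕ) {p : M}
    {C : Euc d ≃L[ℝ] TangentSpace (𝓡 d) p} {N : ℝ} (hN : 0 ≤ N)
    (h : ∀ v, ‖v‖ ≤ N * ‖A.mat n p C v‖) : invNorm C ≤ N := by
  refine ContinuousLinearMap.opNorm_le_bound _ hN fun ξ => ?_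
  have := h (C.symm ξ)
  rw [A.norm_mat_apply, C.apply_symm_apply] at this
  exact this

theorem FrameCover.norm_le_mat {S : Set M} (A : FrameCover d M S) (n : ℕ) {p : M}
    (C : Euc d ≃L[ℝ] TangentSpace (𝓡 d) p) (v : Euc d) : ‖v‖ ≤ invNorm C * ‖A.mat n p C v‖ := by
  rw [A.norm_mat_apply]; exact norm_le_invNorm_mul C v

/-- Nearby linear isomorphisms have comparable inverses. -/
theorem FrameCover.invNorm_le_two_mul {S : Set M} (A : FrameCover d M S) (n : ℕ) {p q : M}
    {C : Euc d ≃L[ℝ] TangentSpace (𝓡 d) p} {C' : Euc d ≃L[ℝ] TangentSpace (𝓡 d) q}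
    (h : 2 * invNorm C * ‖A.mat n p C - A.mat n q C'‖ ≤ 1) :
    invNorm C' ≤ 2 * invNorm C ∧ invNorm C ≤ 2 * invNorm C' := by
  set e := ‖A.mat n p C - A.mat n q C'‖ with he
  have hN := invNorm_nonneg C
  have hN' := invNorm_nonneg C'
  have key : ∀ v, ‖A.mat n p C v - A.mat n q C' v‖ ≤ e * ‖v‖ := fun v =>
    (A.mat n p C - A.mat n q C').le_opNorm v
  constructor
  · refine A.invNorm_le_of_mat n (by positivity) fun v => ?_
    have h1 := A.norm_le_mat n C v
    have h2 : ‖A.mat n p C v‖ ≤ ‖A.mat n q C' v‖ + e * ‖v‖ := by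
      have := norm_sub_norm_le (A.mat n p C v) (A.mat n q C' v)
      linarith [key v]
    have h3 : invNorm C * ‖A.mat n p C v‖ ≤ invNorm C * (‖A.mat n q C' v‖ + e * ‖v‖) := by gcongr
    nlinarith [mul_le_mul_of_nonneg_right h (norm_nonneg v)]
  · refine A.invNorm_le_of_mat n (by positivity) fun v => ?_
    have h1 := A.norm_le_mat n C' v
    have h2 : ‖A.mat n q C' v‖ ≤ ‖A.mat n p C v‖ + e * ‖v‖ := by
      have := norm_sub_norm_le (A.mat n q C' v) (A.mat n p C v)
      rw [norm_sub_rev] at this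
      linarith [key v]
    have h4 := A.norm_le_mat n C v
    have h5 : 2 * (e * ‖v‖) ≤ 2 * ‖A.mat n p C v‖ := by
      have h6 : e * ‖v‖ ≤ e * (invNorm C * ‖A.mat n p C v‖) := by gcongr
      have h7 : 2 * (e * (invNorm C * ‖A.mat n p C v‖)) = 2 * invNorm C * e * ‖A.mat n p C v‖ := by
        ring
      have h8 := mul_le_mul_of_nonneg_right h (norm_nonneg (A.mat n p C v))
      linarith [norm_nonneg (A.mat n p C v)]
    have h9 : invNorm C' * ‖A.mat n q C' v‖ ≤ invNorm C' * (2 * ‖A.mat n p C v‖) := by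
      gcongr; 
      have h6 : e * ‖v‖ ≤ e * (invNorm C * ‖A.mat n p C v‖) := by gcongr
      have h8 := mul_le_mul_of_nonneg_right h (norm_nonneg (A.mat n p C v))
      have h7 : 2 * (e * (invNorm C * ‖A.mat n p C v‖)) = 2 * invNorm C * e * ‖A.mat n p C v‖ := by
        ring
      linarith
    linarith

section Smooth

variable [IsContMDiffRiemannianBundle (𝓡 d) ∞ (Euc d) (fun x : M => TangentSpace (𝓡 d) x)]
  [IsRiemannianManifold (𝓡 d) M] {S : Set M}

namespace ChartData

variable {A : FrameCover d M S} {g : M → M} {p q : M} {R θ Λ K β : ℝ} {n m : ℕ}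

theorem norm_dmap_sub_le (h : ChartData A g p q R θ Λ K β n m) {u u' : Euc d} (hu : ‖u‖ < R)
    (hu' : ‖u'‖ < R) : ‖A.dmap g n m (A.expFrame n p u) - A.dmap g n m (A.expFrame n p u')‖ ≤
      K * (2 * ‖u - u'‖) ^ β := by
  have hK := h.one_le_K
  refine ContinuousLinearMap.opNorm_le_bound _ (by positivity) fun w => ?_
  refine (h.holder _ (h.expFrame_mem hu) _ (h.expFrame_mem hu') (h.q_mem (h.map_mem hu))
    (h.q_mem (h.map_mem hu')) w).trans ?_
  have := h.dist_expFrame_le hu hu'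
  have := h.β_pos
  gcongr

/-- Hölder continuity of the derivative of the chart map. -/
theorem norm_chartDeriv_sub_le (h : ChartData A g p q R θ Λ K β n m)
    {Cp : Euc d ≃L[ℝ] TangentSpace (𝓡 d) p} (hCp : ∀ v, ‖Cp v‖ ≤ ‖v‖)
    (Cq : Euc d ≃L[ℝ] TangentSpace (𝓡 d) q) {v v' : Euc d} (hv : ‖v‖ < R) (hv' : ‖v'‖ < R) :
    ‖chartDeriv A g n m Cp Cq v - chartDeriv A g n m Cp Cq v'‖ ≤
      invNorm Cq * (14 * A.L * K * Λ ^ 2) * ‖v - v'‖ ^ β := by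
  unfold chartDeriv
  set u := A.mat n p Cp v with hu
  set u' := A.mat n p Cp v' with hu'
  have huR : ‖u‖ < R := by rw [hu, A.norm_mat_apply]; exact (hCp v).trans_lt hv
  have huR' : ‖u'‖ < R := by rw [hu', A.norm_mat_apply]; exact (hCp v').trans_lt hv'
  have hr : R < A.r := by linarith [h.R_pos, h.Rr]
  have hL := A.one_le_L
  have hK := h.one_le_K
  have hΛ := h.one_le_Λ
  have hβ := h.β_pos
  set t := ‖v - v'‖ with ht
  have ht1 : t ≤ 1 := (norm_sub_le _ _).trans (by linarith [h.R_le])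
  have ht0 : 0 ≤ t := norm_nonneg _
  have htβ : t ≤ t ^ β := by
    simpa using Real.rpow_le_rpow_of_exponent_ge' ht0 ht1 hβ.le h.β_le
  have hut : ‖u - u'‖ ≤ t := by
    rw [hu, hu', ← map_sub, A.norm_mat_apply]; exact hCp _
  have e1 : ‖A.dinv m q (g (A.expFrame n p u)) - A.dinv m q (g (A.expFrame n p u'))‖ ≤
      A.L * (2 * Λ * t) := by
    refine (A.norm_dinv_sub_le h.q_mem_D ((h.map_mem huR).trans h.θ_lt)
      ((h.map_mem huR').trans h.θ_lt) (h.q_mem (h.map_mem huR)) (h.q_mem (h.map_mem huR'))).trans ?_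
    have := h.dist_map_le huR huR'
    calc _ ≤ A.L * (2 * Λ * ‖u - u'‖) := by gcongr
      _ ≤ _ := by gcongr
  have e2 : ‖A.dmap g n m (A.expFrame n p u) - A.dmap g n m (A.expFrame n p u')‖ ≤
      2 * K * t ^ β := by
    refine (h.norm_dmap_sub_le huR huR').trans ?_
    have a1 : (2 * ‖u - u'‖) ^ β ≤ (2 * t) ^ β := by gcongr
    have a2 : (2 * t) ^ β = 2 ^ β * t ^ β := Real.mul_rpow (by norm_num) ht0
    have a3 : (2 : ℝ) ^ β ≤ 2 := by
      simpa using Real.rpow_le_rpow_of_exponent_le (by norm_num : (1 : ℝ) ≤ 2) h.β_le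
    rw [a2] at a1
    calc _ ≤ K * (2 * t ^ β) := by
          gcongr
          exact a1.trans (by gcongr)
      _ = _ := by ring
  have e3 : ‖A.dexp n p u - A.dexp n p u'‖ ≤ A.L * t :=
    (A.norm_dexp_sub_le h.p_mem_D (huR.trans hr) (huR'.trans hr) (h.p_mem (h.expFrame_mem huR))
      (h.p_mem (h.expFrame_mem huR'))).trans (by gcongr)
  have n1 := h.norm_dinv_le huR'
  have n2 := h.norm_dmap_le (h.expFrame_mem huR)
  have n2' := h.norm_dmap_le (h.expFrame_mem huR')
  have n3 := h.norm_dexp_le huR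
  have f1 : ‖A.dmap g n m (A.expFrame n p u) ∘L A.dexp n p u -
      A.dmap g n m (A.expFrame n p u') ∘L A.dexp n p u'‖ ≤ 4 * K * t ^ β + Λ * A.L * t := by
    refine (enorm_comp_sub_comp_le _ _ _ _).trans ?_
    calc _ ≤ 2 * K * t ^ β * 2 + Λ * (A.L * t) := by gcongr
      _ = _ := by ring
  have f2 : ‖A.dmap g n m (A.expFrame n p u) ∘L A.dexp n p u‖ ≤ Λ * 2 :=
    (ContinuousLinearMap.opNorm_comp_le _ _).trans (by gcongr)
  set GE := A.dmap g n m (A.expFrame n p u) ∘L A.dexp n p u with hGE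
  set GE' := A.dmap g n m (A.expFrame n p u') ∘L A.dexp n p u' with hGE'
  -- The three factors have norms at most `2`, `Λ`, `2` and vary by `2LΛt`, `2Kt^β`, `Lt`. Since `t
  -- ≤ 1`, every `t` is replaced by `t^β`, and `4LΛ² + 8K + 2LΛ ≤ 14LKΛ²`.
  have f3 : ‖A.dinv m q (g (A.expFrame n p u)) ∘L GE -
      A.dinv m q (g (A.expFrame n p u')) ∘L GE'‖ ≤ 14 * A.L * K * Λ ^ 2 * t ^ β := by
    refine (enorm_comp_sub_comp_le _ _ _ _).trans ?_
    calc _ ≤ A.L * (2 * Λ * t) * (Λ * 2) + 2 * (4 * K * t ^ β + Λ * A.L * t) := by gcongr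
      _ ≤ A.L * (2 * Λ * t ^ β) * (Λ * 2) + 2 * (4 * K * t ^ β + Λ * A.L * t ^ β) := by gcongr
      _ = (4 * (A.L * Λ ^ 2) + 8 * K + 2 * (A.L * Λ)) * t ^ β := by ring
      _ ≤ (14 * A.L * K * Λ ^ 2) * t ^ β := by
        gcongr
        have g1 : A.L * Λ ^ 2 ≤ A.L * K * Λ ^ 2 := by
          have : A.L * Λ ^ 2 * 1 ≤ A.L * Λ ^ 2 * K := by gcongr
          linarith
        have g2 : K ≤ A.L * K * Λ ^ 2 := by
          have : K * (1 * 1 ^ 2) ≤ K * (A.L * Λ ^ 2) := by gcongr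
          linarith
        have g3 : A.L * Λ ≤ A.L * K * Λ ^ 2 := by
          have : A.L * Λ * (1 * 1) ≤ A.L * Λ * (K * Λ) := by gcongr
          linarith
        linarith
  have f4 : A.matInv m q Cq ∘L ((A.dinv m q (g (A.expFrame n p u)) ∘L GE) ∘L A.mat n p Cp) -
      A.matInv m q Cq ∘L ((A.dinv m q (g (A.expFrame n p u')) ∘L GE') ∘L A.mat n p Cp) =
      A.matInv m q Cq ∘L ((A.dinv m q (g (A.expFrame n p u)) ∘L GE -
        A.dinv m q (g (A.expFrame n p u')) ∘L GE') ∘L A.mat n p Cp) := by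
    ext1 w; simp
  rw [f4]
  refine (ContinuousLinearMap.opNorm_comp_le _ _).trans ?_
  have f5 := (ContinuousLinearMap.opNorm_comp_le (A.dinv m q (g (A.expFrame n p u)) ∘L GE -
        A.dinv m q (g (A.expFrame n p u')) ∘L GE') (A.mat n p Cp))
  have f6 := A.norm_mat_le n hCp
  have f7 := A.norm_matInv_le m Cq
  rw [mul_assoc]
  refine mul_le_mul f7 (f5.trans ?_) (norm_nonneg _) (invNorm_nonneg _)
  exact (mul_le_of_le_one_right (norm_nonneg _) f6).trans f3

theorem norm_chartMap_zero_le (h : ChartData A g p q R θ Λ K β n m)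
    (Cp : Euc d ≃L[ℝ] TangentSpace (𝓡 d) p) (Cq : Euc d ≃L[ℝ] TangentSpace (𝓡 d) q) :
    ‖chartMap A g Cp Cq 0‖ ≤ 2 * invNorm Cq * θ := by
  unfold chartMap
  rw [map_zero, expMap_zero]
  refine (norm_symm_le Cq _).trans ?_
  have h0 : expInv d A.r q q = 0 := by
    have := A.expInv_expMap q (ξ := 0) (by simpa using A.r_pos)
    rwa [expMap_zero] at this
  have h1 : 0 ≤ 2 * Λ * R := by
    have := h.one_le_Λ; have := h.R_pos; positivity
  have h2 := A.expInv_lip q (g p) (by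
    have := h.dist_lt; have := h.θ_lt; simp only [mem_ball]; linarith)
    q (mem_ball_self A.r_pos)
  rw [h0, sub_zero] at h2
  have h3 := invNorm_nonneg Cq
  calc _ ≤ invNorm Cq * (2 * θ) := by
        gcongr
        linarith [h.dist_lt]
    _ = _ := by ring

/-- The derivative at the origin is close to the linear model. -/
theorem norm_chartDeriv_zero_sub_le (h : ChartData A g p q R θ Λ K β n m)
    {Cp : Euc d ≃L[ℝ] TangentSpace (𝓡 d) p} (hCp : ∀ v, ‖Cp v‖ ≤ ‖v‖)
    (Cq : Euc d ≃L[ℝ] TangentSpace (𝓡 d) q) (C' : Euc d ≃L[ℝ] TangentSpace (𝓡 d) (g p))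
    {D : Euc d →L[ℝ] Euc d} (hD : ∀ v, C' (D v) = mfderiv (𝓡 d) (𝓡 d) g p (Cp v))
    (hm : ‖A.mat m (g p) C' - A.mat m q Cq‖ ≤ 3 * A.L * θ) :
    ‖chartDeriv A g n m Cp Cq 0 - D‖ ≤ 4 * A.L * Λ * invNorm Cq * (1 + invNorm C') * θ := by
  have hz : p ∈ ball p (2 * R) := mem_ball_self (by linarith [h.R_pos])
  have hθ := h.θ_pos
  have hL := A.one_le_L
  have hΛ := h.one_le_Λ
  have hN := invNorm_nonneg Cq
  have hN' := invNorm_nonneg C'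
  have hRΛ : 0 ≤ 2 * Λ * R := by have := h.R_pos; positivity
  set G := A.dmap g n m p ∘L A.mat n p Cp with hG
  have e0 : chartDeriv A g n m Cp Cq 0 = A.matInv m q Cq ∘L (A.dinv m q (g p) ∘L G) := by
    unfold chartDeriv
    rw [map_zero, A.dexp_zero, A.expFrame_zero]
    ext1 w; simp [hG]
  have e1 : D = A.matInv m (g p) C' ∘L G := by
    ext1 w
    have a1 : G w = A.Θ m (g p) (mfderiv (𝓡 d) (𝓡 d) g p (Cp w)) :=
      congrArg (fun ξ => A.Θ m (g p) (mfderiv (𝓡 d) (𝓡 d) g p ξ))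
        ((A.Θ n p).symm_apply_apply (Cp w))
    rw [← hD w] at a1
    have a2 : A.matInv m (g p) C' (G w) = D w := by
      rw [a1]
      have := congrArg (fun L : Euc d →L[ℝ] Euc d => L (D w)) (A.matInv_mat m C')
      exact this
    exact a2.symm
  -- The resolvent identity: closeness of the two frames becomes closeness of their inverses, at the
  -- price of both inverse norms.
  have e2 : A.matInv m q Cq - A.matInv m (g p) C' =
      A.matInv m q Cq ∘L ((A.mat m (g p) C' - A.mat m q Cq) ∘L A.matInv m (g p) C') := by
    have a1 := A.mat_matInv m C'
    have a2 := A.matInv_mat m Cq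
    rw [ContinuousLinearMap.sub_comp, a1, ContinuousLinearMap.comp_sub,
      ← ContinuousLinearMap.comp_assoc, a2]
    simp
  have nG : ‖G‖ ≤ Λ := by
    refine (ContinuousLinearMap.opNorm_comp_le _ _).trans ?_
    exact (mul_le_of_le_one_right (norm_nonneg _) (A.norm_mat_le n hCp)).trans (h.norm_dmap_le hz)
  have n1 : ‖A.dinv m q (g p) - ContinuousLinearMap.id ℝ _‖ ≤ A.L * θ := by
    refine (A.norm_dinv_sub_id_le h.q_mem_D ?_ ?_).trans ?_
    · linarith [h.dist_lt, h.θ_lt]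
    · exact h.q_mem (mem_ball.2 (by linarith [h.dist_lt]))
    · have := h.dist_lt; gcongr
  have n2 : ‖A.matInv m q Cq - A.matInv m (g p) C'‖ ≤
      invNorm Cq * (3 * A.L * θ * invNorm C') := by
    rw [e2]
    refine (ContinuousLinearMap.opNorm_comp_le _ _).trans ?_
    refine mul_le_mul (A.norm_matInv_le m Cq) ?_ (norm_nonneg _) hN
    refine (ContinuousLinearMap.opNorm_comp_le _ _).trans ?_
    exact mul_le_mul hm (A.norm_matInv_le m C') (norm_nonneg _) (by positivity)
  -- Two sources of error: `g p` is not the centre `q` of the target chart, and the frame at `q` is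
  -- not the frame `C'` at `g p`.
  have e3 : chartDeriv A g n m Cp Cq 0 - D =
      A.matInv m q Cq ∘L ((A.dinv m q (g p) - ContinuousLinearMap.id ℝ _) ∘L G) +
      (A.matInv m q Cq - A.matInv m (g p) C') ∘L G := by
    rw [e0, e1]
    ext1 w
    simp
  rw [e3]
  have n3 : ‖A.matInv m q Cq ∘L ((A.dinv m q (g p) - ContinuousLinearMap.id ℝ _) ∘L G)‖ ≤
      invNorm Cq * (A.L * θ * Λ) := by
    refine (ContinuousLinearMap.opNorm_comp_le _ _).trans ?_
    refine mul_le_mul (A.norm_matInv_le m Cq) ?_ (norm_nonneg _) hN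
    refine (ContinuousLinearMap.opNorm_comp_le _ _).trans ?_
    exact mul_le_mul n1 nG (norm_nonneg _) (by positivity)
  have n4 : ‖(A.matInv m q Cq - A.matInv m (g p) C') ∘L G‖ ≤
      invNorm Cq * (3 * A.L * θ * invNorm C') * Λ := by
    refine (ContinuousLinearMap.opNorm_comp_le _ _).trans ?_
    exact mul_le_mul n2 nG (norm_nonneg _) (by positivity)
  refine (norm_add_le _ _).trans ((add_le_add n3 n4).trans ?_)
  have hh : 0 ≤ A.L * θ * Λ * invNorm Cq := by positivity
  nlinarith [mul_nonneg hh hN']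

/-- The chart map conjugates: `exp_q (Cq (F v)) = g (exp_p (Cp v))`. -/
theorem expMap_chartMap (h : ChartData A g p q R θ Λ K β n m)
    {Cp : Euc d ≃L[ℝ] TangentSpace (𝓡 d) p} (hCp : ∀ v, ‖Cp v‖ ≤ ‖v‖)
    (Cq : Euc d ≃L[ℝ] TangentSpace (𝓡 d) q) {v : Euc d} (hv : ‖v‖ < R) :
    expMap d q (Cq (chartMap A g Cp Cq v)) = g (expMap d p (Cp v)) := by
  have huR : ‖A.mat n p Cp v‖ < R := by rw [A.norm_mat_apply]; exact (hCp v).trans_lt hv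
  have a1 : A.expFrame n p (A.mat n p Cp v) = expMap d p (Cp v) :=
    congrArg (expMap d p) ((A.Θ n p).symm_apply_apply (Cp v))
  have h1 := h.map_mem huR
  rw [a1] at h1
  unfold chartMap
  rw [Cq.apply_symm_apply]
  exact A.expMap_expInv (h1.trans h.θ_lt)

end ChartData

/-- A chart map is determined by the conjugation relation. -/
theorem eq_chartMap {A : FrameCover d M S} {g : M → M} {p q : M}
    (Cp : Euc d ≃L[ℝ] TangentSpace (𝓡 d) p) {Cq : Euc d ≃L[ℝ] TangentSpace (𝓡 d) q}
    (hCq : ∀ v, ‖Cq v‖ ≤ ‖v‖) {v w : Euc d} (hw : ‖w‖ < A.r)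
    (h : expMap d q (Cq w) = g (expMap d p (Cp v))) : w = chartMap A g Cp Cq v := by
  unfold chartMap
  rw [← h, A.expInv_expMap q ((hCq w).trans_lt hw), Cq.symm_apply_apply]

end Smooth

/-! ### The graph transform for a perturbation of a hyperbolic linear map -/

theorem exists_fixedPoint_closedBall {E : Type*} [NormedAddCommGroup E] [CompleteSpace E]
    {f : E → E} {r K : ℝ} (hr : 0 ≤ r) (hK : K < 1)
    (hmaps : ∀ x, ‖x‖ ≤ r → ‖f x‖ ≤ r)
    (hlip : ∀ x y, ‖x‖ ≤ r → ‖y‖ ≤ r → ‖f x - f y‖ ≤ K * ‖x - y‖) :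
    ∃ x, ‖x‖ ≤ r ∧ f x = x := by
  have hm : MapsTo f (closedBall (0 : E) r) (closedBall 0 r) := fun x hx => by
    simpa using hmaps x (by simpa using hx)
  have hc : ContractingWith K.toNNReal (hm.restrict f _ _) := by
    refine ⟨by simpa using hK, LipschitzWith.of_dist_le_mul fun x y => ?_⟩
    have h1 := hlip x y (mem_closedBall_zero_iff.1 x.2) (mem_closedBall_zero_iff.1 y.2)
    rw [Subtype.dist_eq, Subtype.dist_eq, dist_eq_norm, dist_eq_norm]
    exact h1.trans (mul_le_mul_of_nonneg_right (Real.le_coe_toNNReal K) (norm_nonneg _))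
  obtain ⟨x, hx, hfx, -⟩ := hc.exists_fixedPoint' isClosed_closedBall.isComplete hm
    (x := 0) (by simpa using hr) (edist_ne_top _ _)
  exact ⟨x, by simpa using hx, hfx⟩

/-- A splitting of `ℝᵈ` into two orthogonal coordinate spaces. -/
structure CoordSplit (d k l : ℕ) where
  iE : Euc k →L[ℝ] Euc d
  iU : Euc l →L[ℝ] Euc d
  pE : Euc d →L[ℝ] Euc k
  pU : Euc d →L[ℝ] Euc l
  pE_iE : ∀ a, pE (iE a) = a
  pE_iU : ∀ b, pE (iU b) = 0
  pU_iE : ∀ a, pU (iE a) = 0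
  pU_iU : ∀ b, pU (iU b) = b
  add_eq : ∀ v, iE (pE v) + iU (pU v) = v
  norm_iE : ∀ a, ‖iE a‖ ≤ ‖a‖
  norm_iU : ∀ b, ‖iU b‖ ≤ ‖b‖
  norm_pE : ∀ v, ‖pE v‖ ≤ ‖v‖
  norm_pU : ∀ v, ‖pU v‖ ≤ ‖v‖

/-- The point with given coordinates. -/
def CoordSplit.join {d k l : ℕ} (J : CoordSplit d k l) (a : Euc k) (b : Euc l) : Euc d :=
  J.iE a + J.iU b

/-- A map of `ℝᵈ` that is close to a linear hyperbolic one, with the inequalities that make the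
graph transform work: `E` is contracted, `U` is expanded. -/
structure HypMap {d k l : ℕ} (J : CoordSplit d k l) (F : Euc d → Euc d)
    (F' : Euc d → Euc d →L[ℝ] Euc d) (D : Euc d →L[ℝ] Euc d) (Du : Euc l ≃L[ℝ] Euc l)
    (P Q κ κ' lam H β e₀ t₀ lam₀ η₁ η₂ : ℝ) : Prop where
  deriv : ∀ v, ‖v‖ < 2 * P → HasFDerivAt F (F' v) v
  close : ∀ v, ‖v‖ < 2 * P → ‖F' v - D‖ ≤ lam
  -- In the application `lam` is governed by the window `P`, which may be far larger than `η₁` and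
  -- `η₂`. The slope at the new centre must be compared with `η₂ ^ (β / 2)`, so a sharper bound is
  -- kept for the small ball that contains the relevant source point.
  close₀ : ∀ v, ‖v‖ ≤ η₁ ^ 2 / 1000 + 3 / 2 * t₀ → ‖F' v - D‖ ≤ lam₀
  holder : ∀ v v', ‖v‖ < 2 * P → ‖v'‖ < 2 * P → ‖F' v - F' v'‖ ≤ H * ‖v - v'‖ ^ (β / 2)
  at_zero : ‖F 0‖ ≤ e₀
  pU_D_iE : ∀ a, J.pU (D (J.iE a)) = 0
  pU_D_iU : ∀ b, J.pU (D (J.iU b)) = Du b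
  pE_D_iU : ∀ b, J.pE (D (J.iU b)) = 0
  contract : ∀ a, ‖J.pE (D (J.iE a))‖ ≤ (1 - κ) * ‖a‖
  expand : ∀ b, ‖b‖ ≤ (1 - κ') * ‖Du b‖
  β_pos : 0 < β
  β_le : β ≤ 1
  κ_pos : 0 < κ
  κ_le : κ ≤ 1
  κ'_pos : 0 < κ'
  κ'_le : κ' ≤ 1
  H_nonneg : 0 ≤ H
  lam_nonneg : 0 ≤ lam
  η₁_pos : 0 < η₁
  η₁_le : η₁ ≤ P
  P_le : P ≤ 1
  η₂_pos : 0 < η₂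
  η₂_le : η₂ ≤ Q
  Q_le : Q ≤ 1
  lam_le : lam ≤ κ / 100
  lam_le' : lam ≤ κ' / 100
  H_le : H ≤ κ / 100
  t₀_eq : t₀ = e₀ + lam * (η₁ ^ 2 / 1000)
  t₀_lt : t₀ < Q
  cover : (1 - κ') * (Q + t₀ + 2 * lam * P) < P
  zero_le : e₀ + (1 - κ) * (η₁ ^ 2 / 1000 + t₀ / 2) + lam * (η₁ ^ 2 / 1000 + 3 / 2 * t₀) ≤
    η₂ ^ 2 / 1000
  deriv_le : (1 - κ) * (1 / 2 * η₁ ^ (β / 2) + 1 / 2 * t₀ ^ (β / 2)) + 3 / 2 * lam₀ ≤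
    1 / 2 * η₂ ^ (β / 2)

theorem DoubleChart.IsRepresenting.norm_sub_le {β η p : ℝ} {m n : ℕ} {G : Euc m → Euc n}
    (hG : DoubleChart.IsRepresenting β η p G) {v v' : Euc m} (hv : ‖v‖ < p) (hv' : ‖v'‖ < p) :
    ‖G v - G v'‖ ≤ 1 / 2 * ‖v - v'‖ := by
  obtain ⟨B, H, hB, hH, hBH, h1, -⟩ := hG.deriv_holder
  refine (convex_ball (0 : Euc m) p).norm_image_sub_le_of_norm_fderiv_le (f := G) (𝕜 := ℝ)
    (fun u hu => ?_) (fun u hu => (h1 u hu).trans (by linarith)) (by simpa using hv')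
    (by simpa using hv)
  exact (hG.contDiffOn.contDiffAt (isOpen_ball.mem_nhds hu)).differentiableAt (by simp)

theorem DoubleChart.IsRepresenting.norm_le {β η p : ℝ} {m n : ℕ} {G : Euc m → Euc n}
    (hG : DoubleChart.IsRepresenting β η p G) {v : Euc m} (hv : ‖v‖ < p) :
    ‖G v‖ ≤ η ^ 2 / 1000 + 1 / 2 * ‖v‖ := by
  have hp : 0 < p := (norm_nonneg v).trans_lt hv
  have h1 := hG.norm_sub_le hv (v' := 0) (by simpa using hp)
  rw [sub_zero] at h1
  have h2 := hG.at_zero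
  have h3 := norm_sub_norm_le (G v) (G 0)
  linarith

namespace HypMap

variable {k l : ℕ} {J : CoordSplit d k l} {F : Euc d → Euc d}
    {F' : Euc d → Euc d →L[ℝ] Euc d} {D : Euc d →L[ℝ] Euc d} {Du : Euc l ≃L[ℝ] Euc l}
    {P Q κ κ' lam H β e₀ t₀ lam₀ η₁ η₂ : ℝ} {G : Euc l → Euc k}

section

variable (h : HypMap J F F' D Du P Q κ κ' lam H β e₀ t₀ lam₀ η₁ η₂)
  (hG : DoubleChart.IsRepresenting β η₁ P G)

theorem P_pos (h : HypMap J F F' D Du P Q κ κ' lam H β e₀ t₀ lam₀ η₁ η₂) : 0 < P :=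
  h.η₁_pos.trans_le h.η₁_le

theorem Q_pos (h : HypMap J F F' D Du P Q κ κ' lam H β e₀ t₀ lam₀ η₁ η₂) : 0 < Q :=
  h.η₂_pos.trans_le h.η₂_le

theorem e₀_nonneg (h : HypMap J F F' D Du P Q κ κ' lam H β e₀ t₀ lam₀ η₁ η₂) : 0 ≤ e₀ :=
  (norm_nonneg _).trans h.at_zero

theorem t₀_nonneg (h : HypMap J F F' D Du P Q κ κ' lam H β e₀ t₀ lam₀ η₁ η₂) : 0 ≤ t₀ := by
  rw [h.t₀_eq]
  have := h.e₀_nonneg; have := h.lam_nonneg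
  positivity

include h hG

theorem norm_curve_le {v : Euc l} (hv : ‖v‖ < P) :
    ‖J.join (G v) v‖ ≤ η₁ ^ 2 / 1000 + 3 / 2 * ‖v‖ := by
  have h1 := hG.norm_le hv
  calc _ ≤ ‖J.iE (G v)‖ + ‖J.iU v‖ := norm_add_le _ _
    _ ≤ _ := by linarith [J.norm_iE (G v), J.norm_iU v]

theorem norm_curve_lt {v : Euc l} (hv : ‖v‖ < P) : ‖J.join (G v) v‖ < 2 * P := by
  have h1 := norm_curve_le h hG hv
  have h2 := h.η₁_le
  have h3 := h.P_le
  have h4 := h.η₁_pos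
  nlinarith

theorem hasFDerivAt_curve {v : Euc l} (hv : ‖v‖ < P) :
    HasFDerivAt (fun v => J.join (G v) v) (J.iE ∘L fderiv ℝ G v + J.iU) v := by
  have h1 : DifferentiableAt ℝ G v := (hG.contDiffOn.contDiffAt
    (isOpen_ball.mem_nhds (by simpa using hv))).differentiableAt (by simp)
  exact (J.iE.hasFDerivAt.comp v h1.hasFDerivAt).add J.iU.hasFDerivAt

end

end HypMap

namespace HypMap

variable {k l : ℕ} {J : CoordSplit d k l} {F : Euc d → Euc d}
    {F' : Euc d → Euc d →L[ℝ] Euc d} {D : Euc d →L[ℝ] Euc d} {Du : Euc l ≃L[ℝ] Euc l}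
    {P Q κ κ' lam H β e₀ t₀ lam₀ η₁ η₂ : ℝ} {G : Euc l → Euc k}
  (h : HypMap J F F' D Du P Q κ κ' lam H β e₀ t₀ lam₀ η₁ η₂)
  (hG : DoubleChart.IsRepresenting β η₁ P G)

/-- The derivative of the expanded coordinate along the graph of `G`. -/
def dU (J : CoordSplit d k l) (F' : Euc d → Euc d →L[ℝ] Euc d) (G : Euc l → Euc k) (v : Euc l) :
    Euc l →L[ℝ] Euc l :=
  J.pU ∘L (F' (J.join (G v) v) ∘L (J.iE ∘L fderiv ℝ G v + J.iU))

/-- The derivative of the contracted coordinate along the graph of `G`. -/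
def dE (J : CoordSplit d k l) (F' : Euc d → Euc d →L[ℝ] Euc d) (G : Euc l → Euc k) (v : Euc l) :
    Euc l →L[ℝ] Euc k :=
  J.pE ∘L (F' (J.join (G v) v) ∘L (J.iE ∘L fderiv ℝ G v + J.iU))

theorem norm_pE_comp_le {m : ℕ} (J : CoordSplit d k l) (T : Euc m →L[ℝ] Euc d) :
    ‖J.pE ∘L T‖ ≤ ‖T‖ :=
  ContinuousLinearMap.opNorm_le_bound _ (norm_nonneg _) fun v =>
    (J.norm_pE _).trans (T.le_opNorm v)

theorem norm_pU_comp_le {m : ℕ} (J : CoordSplit d k l) (T : Euc m →L[ℝ] Euc d) :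
    ‖J.pU ∘L T‖ ≤ ‖T‖ :=
  ContinuousLinearMap.opNorm_le_bound _ (norm_nonneg _) fun v =>
    (J.norm_pU _).trans (T.le_opNorm v)

theorem norm_iE_comp_le {m : ℕ} (J : CoordSplit d k l) (T : Euc m →L[ℝ] Euc k) :
    ‖J.iE ∘L T‖ ≤ ‖T‖ :=
  ContinuousLinearMap.opNorm_le_bound _ (norm_nonneg _) fun v =>
    (J.norm_iE _).trans (T.le_opNorm v)

theorem norm_iU_le (J : CoordSplit d k l) : ‖J.iU‖ ≤ 1 :=
  ContinuousLinearMap.opNorm_le_bound _ zero_le_one fun v => by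
    rw [one_mul]; exact J.norm_iU v

include h hG

theorem norm_tangent_le {v : Euc l} (hv : ‖v‖ < P) :
    ‖J.iE ∘L fderiv ℝ G v + J.iU‖ ≤ 3 / 2 := by
  obtain ⟨B, K, hB, hK, hBK, h1, -⟩ := hG.deriv_holder
  refine (norm_add_le _ _).trans ?_
  have h2 := (norm_iE_comp_le J (fderiv ℝ G v)).trans (h1 v (by simpa using hv))
  linarith [norm_iU_le J]

theorem hasFDerivAt_U {v : Euc l} (hv : ‖v‖ < P) :
    HasFDerivAt (fun v => J.pU (F (J.join (G v) v))) (dU J F' G v) v :=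
  J.pU.hasFDerivAt.comp v (HasFDerivAt.comp (g := F) (f := fun v => J.join (G v) v) v
    (h.deriv _ (norm_curve_lt h hG hv)) (hasFDerivAt_curve h hG hv))

theorem hasFDerivAt_E {v : Euc l} (hv : ‖v‖ < P) :
    HasFDerivAt (fun v => J.pE (F (J.join (G v) v))) (dE J F' G v) v :=
  J.pE.hasFDerivAt.comp v (HasFDerivAt.comp (g := F) (f := fun v => J.join (G v) v) v
    (h.deriv _ (norm_curve_lt h hG hv)) (hasFDerivAt_curve h hG hv))

/-- `D` maps the contracted factor to itself, so it contributes exactly `Du` to the expanded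
coordinate of a tangent vector; the rest is `F' - D` applied to a tangent of norm at most `3/2`. -/
theorem norm_dU_sub_le' {v : Euc l} (hv : ‖v‖ < P) {e : ℝ}
    (he : ‖F' (J.join (G v) v) - D‖ ≤ e) : ‖dU J F' G v - Du‖ ≤ 3 / 2 * e := by
  have h1 : dU J F' G v - Du = J.pU ∘L ((F' (J.join (G v) v) - D) ∘L
      (J.iE ∘L fderiv ℝ G v + J.iU)) := by
    ext1 b
    simp [dU, h.pU_D_iE, h.pU_D_iU]
    abel
  rw [h1]
  refine (norm_pU_comp_le J _).trans ((ContinuousLinearMap.opNorm_comp_le _ _).trans ?_)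
  have h3 := norm_tangent_le h hG hv
  have h5 : 0 ≤ e := (norm_nonneg _).trans he
  calc _ ≤ e * (3 / 2) := by gcongr
    _ = _ := by ring

theorem norm_dU_sub_le {v : Euc l} (hv : ‖v‖ < P) : ‖dU J F' G v - Du‖ ≤ 3 / 2 * lam :=
  norm_dU_sub_le' h hG hv (h.close _ (norm_curve_lt h hG hv))

/-- Here `D` acts on the slope of the graph only, and contracts it. -/
theorem norm_dE_le' {v : Euc l} (hv : ‖v‖ < P) {e : ℝ}
    (he : ‖F' (J.join (G v) v) - D‖ ≤ e) :
    ‖dE J F' G v‖ ≤ (1 - κ) * ‖fderiv ℝ G v‖ + 3 / 2 * e := by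
  have h1 : dE J F' G v = J.pE ∘L ((F' (J.join (G v) v) - D) ∘L
      (J.iE ∘L fderiv ℝ G v + J.iU)) + (J.pE ∘L (D ∘L J.iE)) ∘L fderiv ℝ G v := by
    ext1 b
    simp [dE, h.pE_D_iU]
    abel
  have h2 : ‖J.pE ∘L (D ∘L J.iE)‖ ≤ 1 - κ :=
    ContinuousLinearMap.opNorm_le_bound _ (by linarith [h.κ_le]) h.contract
  have h3 := norm_tangent_le h hG hv
  have h5 : 0 ≤ e := (norm_nonneg _).trans he
  rw [h1]
  refine (norm_add_le _ _).trans ?_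
  have h6 : ‖J.pE ∘L ((F' (J.join (G v) v) - D) ∘L (J.iE ∘L fderiv ℝ G v + J.iU))‖ ≤
      3 / 2 * e := by
    refine (norm_pE_comp_le J _).trans ((ContinuousLinearMap.opNorm_comp_le _ _).trans ?_)
    calc _ ≤ e * (3 / 2) := by gcongr
      _ = _ := by ring
  have h7 : ‖(J.pE ∘L (D ∘L J.iE)) ∘L fderiv ℝ G v‖ ≤ (1 - κ) * ‖fderiv ℝ G v‖ :=
    (ContinuousLinearMap.opNorm_comp_le _ _).trans (by gcongr)
  linarith

theorem norm_dE_le {v : Euc l} (hv : ‖v‖ < P) :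
    ‖dE J F' G v‖ ≤ (1 - κ) * ‖fderiv ℝ G v‖ + 3 / 2 * lam :=
  norm_dE_le' h hG hv (h.close _ (norm_curve_lt h hG hv))

theorem norm_dE_le_half {v : Euc l} (hv : ‖v‖ < P) : ‖dE J F' G v‖ ≤ 1 / 2 := by
  obtain ⟨B, K, hB, hK, hBK, h1, -⟩ := hG.deriv_holder
  have h2 := h1 v (by simpa using hv)
  have h3 := h.lam_le
  have h4 := h.κ_le
  have h5 := h.κ_pos
  have h6 := norm_dE_le h hG hv
  have h7 : (1 - κ) * ‖fderiv ℝ G v‖ ≤ (1 - κ) * (1 / 2) :=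
    mul_le_mul_of_nonneg_left (by linarith) (by linarith)
  linarith

/-- The expanded coordinate along the graph is expanding. -/
theorem norm_sub_le_U {v v' : Euc l} (hv : ‖v‖ < P) (hv' : ‖v'‖ < P) :
    ‖v - v'‖ ≤ ‖J.pU (F (J.join (G v) v)) - J.pU (F (J.join (G v') v'))‖ := by
  set t : Euc l → Euc l := fun v => J.pU (F (J.join (G v) v)) with ht
  have h1 : ‖(t v - Du v) - (t v' - Du v')‖ ≤ 3 / 2 * lam * ‖v - v'‖ := by
    refine (convex_ball (0 : Euc l) P).norm_image_sub_le_of_norm_hasFDerivWithin_le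
      (f := fun v => t v - Du v) (f' := fun v => dU J F' G v - Du) (𝕜 := ℝ)
      (fun u hu => ?_) (fun u hu => ?_) (by simpa using hv') (by simpa using hv)
    · exact ((hasFDerivAt_U h hG (by simpa using hu)).sub Du.hasFDerivAt).hasFDerivWithinAt
    · exact norm_dU_sub_le h hG (by simpa using hu)
  have h2 := h.expand (v - v')
  have h3 : ‖Du (v - v')‖ ≤ ‖t v - t v'‖ + 3 / 2 * lam * ‖v - v'‖ := by
    have e : Du (v - v') = (t v - t v') - ((t v - Du v) - (t v' - Du v')) := by
      rw [map_sub]; abel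
    rw [e]
    exact (norm_sub_le _ _).trans (by linarith)
  show ‖v - v'‖ ≤ ‖t v - t v'‖
  have h4 := h.lam_le'
  have h5 := h.κ'_pos
  have h6 := h.κ'_le
  have h7 := h.lam_nonneg
  have n1 := norm_nonneg (v - v')
  have n2 := norm_nonneg (t v - t v')
  have h8 : (1 - κ') * ‖Du (v - v')‖ ≤ (1 - κ') * (‖t v - t v'‖ + 3 / 2 * lam * ‖v - v'‖) :=
    mul_le_mul_of_nonneg_left h3 (by linarith)
  have h9 : (1 - κ') * (3 / 2 * lam * ‖v - v'‖) ≤ 3 / 2 * lam * ‖v - v'‖ :=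
    mul_le_of_le_one_left (by positivity) (by linarith)
  -- The expansion rate beats the perturbation because `3/2 · lam` is smaller than `κ'`.
  have h10 : (1 - 3 / 2 * lam) * ‖v - v'‖ ≤ (1 - κ') * ‖t v - t v'‖ := by linarith
  have h11 : (1 - κ') * ‖t v - t v'‖ ≤ (1 - 3 / 2 * lam) * ‖t v - t v'‖ :=
    mul_le_mul_of_nonneg_right (by linarith) n2
  exact le_of_mul_le_mul_left (h10.trans h11) (by linarith)

/-- The infinitesimal form of `norm_sub_le_U`; it makes `dU` invertible with inverse of norm at most
one. -/
theorem norm_le_dU {v : Euc l} (hv : ‖v‖ < P) (b : Euc l) : ‖b‖ ≤ ‖dU J F' G v b‖ := by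
  have h1 := norm_dU_sub_le h hG hv
  have h2 := h.expand b
  have h3 : ‖Du b‖ ≤ ‖dU J F' G v b‖ + 3 / 2 * lam * ‖b‖ := by
    have e : Du b = dU J F' G v b - (dU J F' G v - Du) b := by simp
    rw [e]
    refine (norm_sub_le _ _).trans (add_le_add le_rfl ?_)
    exact ((dU J F' G v - Du).le_opNorm b).trans (by gcongr)
  have h4 := h.lam_le'
  have h5 := h.κ'_pos
  have h6 := h.κ'_le
  have h7 := h.lam_nonneg
  have n1 := norm_nonneg b
  have n2 := norm_nonneg (dU J F' G v b)
  have h8 : (1 - κ') * ‖Du b‖ ≤ (1 - κ') * (‖dU J F' G v b‖ + 3 / 2 * lam * ‖b‖) :=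
    mul_le_mul_of_nonneg_left h3 (by linarith)
  have h9 : (1 - κ') * (3 / 2 * lam * ‖b‖) ≤ 3 / 2 * lam * ‖b‖ :=
    mul_le_of_le_one_left (by positivity) (by linarith)
  have h10 : (1 - 3 / 2 * lam) * ‖b‖ ≤ (1 - κ') * ‖dU J F' G v b‖ := by linarith
  have h11 : (1 - κ') * ‖dU J F' G v b‖ ≤ (1 - 3 / 2 * lam) * ‖dU J F' G v b‖ :=
    mul_le_mul_of_nonneg_right (by linarith) n2
  exact le_of_mul_le_mul_left (h10.trans h11) (by linarith)

/-- The centre `(G 0, 0)` lies in the contracted factor, which `D` preserves. So its image has an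
expanded coordinate coming only from `F 0` and from `F - D`, which is `lam`-Lipschitz. -/
theorem norm_U_zero_le : ‖J.pU (F (J.join (G 0) 0))‖ ≤ t₀ := by
  have hP := P_pos h
  have h0 : ‖(0 : Euc l)‖ < P := by simpa using hP
  have h1 := norm_curve_lt h hG h0
  have h2 : ‖(F (J.join (G 0) 0) - D (J.join (G 0) 0)) - (F 0 - D 0)‖ ≤
      lam * ‖J.join (G 0) 0 - 0‖ := by
    refine (convex_ball (0 : Euc d) (2 * P)).norm_image_sub_le_of_norm_hasFDerivWithin_le
      (f := fun v => F v - D v) (f' := fun v => F' v - D) (𝕜 := ℝ)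
      (fun u hu => ?_) (fun u hu => ?_) (by simpa using hP) (by simpa using h1)
    · exact ((h.deriv u (by simpa using hu)).sub D.hasFDerivAt).hasFDerivWithinAt
    · exact h.close u (by simpa using hu)
  have h3 : J.join (G 0) 0 = J.iE (G 0) := by simp [CoordSplit.join]
  have h4 : J.pU (F (J.join (G 0) 0)) = J.pU ((F (J.join (G 0) 0) - D (J.join (G 0) 0)) -
      (F 0 - D 0)) + J.pU (F 0) := by
    have := h.pU_D_iE (G 0)
    rw [h3]
    simp only [map_sub, map_zero]
    rw [this]
    abel
  rw [h4, h.t₀_eq]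
  refine (norm_add_le _ _).trans ?_
  have h5 := (J.norm_pU (F 0)).trans h.at_zero
  have h6 := (J.norm_pU ((F (J.join (G 0) 0) - D (J.join (G 0) 0)) - (F 0 - D 0))).trans h2
  have h7 : lam * ‖J.join (G 0) 0 - 0‖ ≤ lam * (η₁ ^ 2 / 1000) := by
    have := h.lam_nonneg
    gcongr
    rw [sub_zero, h3]
    refine (J.norm_iE _).trans (hG.at_zero.trans_eq ?_)
    ring
  linarith

/-- With `t` the expanded coordinate along the graph, `t v = w` says that `v` is fixed by `v ↦
Du⁻¹(w - (t v - Du v))`. This map is a contraction, and it preserves the ball of radius `(1 - κ')(Q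
+ t₀ + 2 lam P)`, which is smaller than `P` by the hypothesis `cover`. -/
theorem exists_preimage {w : Euc l} (hw : ‖w‖ < Q) :
    ∃ v, ‖v‖ < P ∧ J.pU (F (J.join (G v) v)) = w := by
  set t : Euc l → Euc l := fun v => J.pU (F (J.join (G v) v)) with ht
  have hP := P_pos h
  have hQ := Q_pos h
  have ht0 := t₀_nonneg h
  have hl := h.lam_nonneg
  have hκ := h.κ'_le
  have hκ' := h.κ'_pos
  set R₁ := (1 - κ') * (Q + t₀ + 2 * lam * P) with hR₁
  have hR0 : 0 ≤ R₁ := mul_nonneg (by linarith) (by positivity)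
  have hRP : R₁ < P := h.cover
  have hLip : ∀ v v' : Euc l, ‖v‖ ≤ R₁ → ‖v'‖ ≤ R₁ →
      ‖(t v - Du v) - (t v' - Du v')‖ ≤ 3 / 2 * lam * ‖v - v'‖ := by
    intro v v' hv hv'
    refine (convex_ball (0 : Euc l) P).norm_image_sub_le_of_norm_hasFDerivWithin_le
      (f := fun v => t v - Du v) (f' := fun v => dU J F' G v - Du) (𝕜 := ℝ)
      (fun u hu => ?_) (fun u hu => ?_) (by simpa using hv'.trans_lt hRP)
      (by simpa using hv.trans_lt hRP)
    · exact ((hasFDerivAt_U h hG (by simpa using hu)).sub Du.hasFDerivAt).hasFDerivWithinAt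
    · exact norm_dU_sub_le h hG (by simpa using hu)
  have hsymm : ∀ b, ‖Du.symm b‖ ≤ (1 - κ') * ‖b‖ := fun b => by
    simpa using h.expand (Du.symm b)
  have hmaps : ∀ v, ‖v‖ ≤ R₁ → ‖Du.symm (w - (t v - Du v))‖ ≤ R₁ := by
    intro v hv
    refine (hsymm _).trans ?_
    have h1 := hLip v 0 hv (by simpa using hR0)
    have h2 : ‖t 0‖ ≤ t₀ := norm_U_zero_le h hG
    have h3 : ‖t v - Du v‖ ≤ t₀ + 3 / 2 * lam * P := by
      have e : t v - Du v = ((t v - Du v) - (t 0 - Du 0)) + t 0 := by simp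
      rw [e]
      refine (norm_add_le _ _).trans ?_
      have : 3 / 2 * lam * ‖v - 0‖ ≤ 3 / 2 * lam * P := by
        rw [sub_zero]; gcongr; linarith
      linarith
    have h4 : ‖w - (t v - Du v)‖ ≤ Q + t₀ + 2 * lam * P := by
      refine (norm_sub_le _ _).trans ?_
      have : 3 / 2 * lam * P ≤ 2 * lam * P := by gcongr; norm_num
      linarith
    exact mul_le_mul_of_nonneg_left h4 (by linarith)
  have hlip : ∀ v v', ‖v‖ ≤ R₁ → ‖v'‖ ≤ R₁ →
      ‖Du.symm (w - (t v - Du v)) - Du.symm (w - (t v' - Du v'))‖ ≤ 1 / 2 * ‖v - v'‖ := by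
    intro v v' hv hv'
    rw [← map_sub]
    refine (hsymm _).trans ?_
    have h1 := hLip v v' hv hv'
    have e : w - (t v - Du v) - (w - (t v' - Du v')) = -((t v - Du v) - (t v' - Du v')) := by abel
    rw [e, norm_neg]
    have h2 := h.lam_le'
    have h3 : (1 - κ') * ‖(t v - Du v) - (t v' - Du v')‖ ≤ ‖(t v - Du v) - (t v' - Du v')‖ :=
      mul_le_of_le_one_left (norm_nonneg _) (by linarith)
    refine h3.trans (h1.trans ?_)
    gcongr
    linarith
  obtain ⟨v, hv, hvf⟩ := exists_fixedPoint_closedBall (f := fun v => Du.symm (w - (t v - Du v)))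
    hR0 (by norm_num) hmaps hlip
  refine ⟨v, hv.trans_lt hRP, ?_⟩
  have := congrArg Du hvf
  simp only [ContinuousLinearEquiv.apply_symm_apply] at this
  have h2 : w - t v = 0 := by
    have : w - (t v - Du v) - Du v = 0 := sub_eq_zero.2 this
    rw [← this]; abel
  exact (sub_eq_zero.1 h2).symm

end HypMap

namespace HypMap

variable {k l : ℕ} {J : CoordSplit d k l} {F : Euc d → Euc d}
    {F' : Euc d → Euc d →L[ℝ] Euc d} {D : Euc d →L[ℝ] Euc d} {Du : Euc l ≃L[ℝ] Euc l}
    {P Q κ κ' lam H β e₀ t₀ lam₀ η₁ η₂ : ℝ} {G : Euc l → Euc k}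
  (h : HypMap J F F' D Du P Q κ κ' lam H β e₀ t₀ lam₀ η₁ η₂)
  (hG : DoubleChart.IsRepresenting β η₁ P G)

include h in
theorem norm_F'_sub_le (hG : DoubleChart.IsRepresenting β η₁ P G) {v v' : Euc l}
    (hv : ‖v‖ < P) (hv' : ‖v'‖ < P) :
    ‖F' (J.join (G v) v) - F' (J.join (G v') v')‖ ≤ 3 / 2 * H * ‖v - v'‖ ^ (β / 2) := by
  have hβ := h.β_pos
  have hβ1 := h.β_le
  have hH := h.H_nonneg
  refine (h.holder _ _ (norm_curve_lt h hG hv) (norm_curve_lt h hG hv')).trans ?_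
  have h1 : ‖J.join (G v) v - J.join (G v') v'‖ ≤ 3 / 2 * ‖v - v'‖ := by
    have e : J.join (G v) v - J.join (G v') v' = J.iE (G v - G v') + J.iU (v - v') := by
      simp only [CoordSplit.join, map_sub]; abel
    rw [e]
    refine (norm_add_le _ _).trans ?_
    have := hG.norm_sub_le hv hv'
    linarith [J.norm_iE (G v - G v'), J.norm_iU (v - v')]
  have h2 : ‖J.join (G v) v - J.join (G v') v'‖ ^ (β / 2) ≤
      (3 / 2) ^ (β / 2) * ‖v - v'‖ ^ (β / 2) := by
    rw [← Real.mul_rpow (by norm_num) (norm_nonneg _)]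
    exact Real.rpow_le_rpow (norm_nonneg _) h1 (by linarith)
  have h3 : (3 / 2 : ℝ) ^ (β / 2) ≤ 3 / 2 := by
    conv_rhs => rw [← Real.rpow_one (3 / 2 : ℝ)]
    exact Real.rpow_le_rpow_of_exponent_le (by norm_num) (by linarith)
  have h4 : 0 ≤ ‖v - v'‖ ^ (β / 2) := by positivity
  calc _ ≤ H * (3 / 2 * ‖v - v'‖ ^ (β / 2)) :=
        mul_le_mul_of_nonneg_left (h2.trans (mul_le_mul_of_nonneg_right h3 h4)) hH
    _ = _ := by ring

/-- A product rule that separates two effects: a change of the derivative `N` acts on the whole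
tangent, while a change of the slope `X` passes only through the block `p ∘ N' ∘ iE`. That block is
small for the expanded coordinate and contracting for the other one. -/
theorem norm_mid_le {m : ℕ} (p : Euc d →L[ℝ] Euc m)
    (hp : ∀ u, ‖p u‖ ≤ ‖u‖) {N N' : Euc d →L[ℝ] Euc d} {X X' : Euc l →L[ℝ] Euc k}
    {a b c : ℝ} (hN : ‖N - N'‖ ≤ a) (hX : ‖J.iE ∘L X + J.iU‖ ≤ 3 / 2)
    (hX' : ‖X - X'‖ ≤ b) (hpN : ‖p ∘L (N' ∘L J.iE)‖ ≤ c) :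
    ‖p ∘L (N ∘L (J.iE ∘L X + J.iU)) - p ∘L (N' ∘L (J.iE ∘L X' + J.iU))‖ ≤
      3 / 2 * a + c * b := by
  have e : p ∘L (N ∘L (J.iE ∘L X + J.iU)) - p ∘L (N' ∘L (J.iE ∘L X' + J.iU)) =
      p ∘L ((N - N') ∘L (J.iE ∘L X + J.iU)) + (p ∘L (N' ∘L J.iE)) ∘L (X - X') := by
    ext1 u
    simp only [sub_apply, ContinuousLinearMap.comp_apply,
      add_apply, map_add, map_sub]
    abel
  have ha : 0 ≤ a := (norm_nonneg _).trans hN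
  have hc : 0 ≤ c := (norm_nonneg _).trans hpN
  rw [e]
  refine (norm_add_le _ _).trans (add_le_add ?_ ?_)
  · refine (ContinuousLinearMap.opNorm_le_bound (M := a * (3 / 2)) _ (by positivity)
      fun u => ?_).trans_eq (by ring)
    refine (hp _).trans ?_
    refine (((N - N') ∘L (J.iE ∘L X + J.iU)).le_opNorm u).trans ?_
    have := (ContinuousLinearMap.opNorm_comp_le (N - N') (J.iE ∘L X + J.iU))
    have h2 : ‖N - N'‖ * ‖J.iE ∘L X + J.iU‖ ≤ a * (3 / 2) := by gcongr
    exact mul_le_mul_of_nonneg_right (this.trans h2) (norm_nonneg _)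
  · exact (ContinuousLinearMap.opNorm_comp_le _ _).trans (by gcongr)

include h in
theorem norm_dU_sub_dU_le (hG : DoubleChart.IsRepresenting β η₁ P G) {v v' : Euc l}
    (hv : ‖v‖ < P) (hv' : ‖v'‖ < P) {b : ℝ} (hb : ‖fderiv ℝ G v - fderiv ℝ G v'‖ ≤ b) :
    ‖dU J F' G v - dU J F' G v'‖ ≤ 3 / 2 * (3 / 2 * H * ‖v - v'‖ ^ (β / 2)) + lam * b := by
  refine norm_mid_le J.pU J.norm_pU (norm_F'_sub_le h hG hv hv')
    (norm_tangent_le h hG hv) hb ?_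
  have hl := h.lam_nonneg
  refine ContinuousLinearMap.opNorm_le_bound _ hl fun u => ?_
  have e : (J.pU ∘L (F' (J.join (G v') v') ∘L J.iE)) u =
      J.pU ((F' (J.join (G v') v') - D) (J.iE u)) := by
    simp [h.pU_D_iE]
  rw [e]
  refine (J.norm_pU _).trans (((F' (J.join (G v') v') - D).le_opNorm _).trans ?_)
  have h1 := h.close _ (norm_curve_lt h hG hv')
  have h2 := J.norm_iE u
  gcongr

include h in
theorem norm_dE_sub_dE_le (hG : DoubleChart.IsRepresenting β η₁ P G) {v v' : Euc l}
    (hv : ‖v‖ < P) (hv' : ‖v'‖ < P) {b : ℝ} (hb : ‖fderiv ℝ G v - fderiv ℝ G v'‖ ≤ b) :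
    ‖dE J F' G v - dE J F' G v'‖ ≤
      3 / 2 * (3 / 2 * H * ‖v - v'‖ ^ (β / 2)) + (lam + (1 - κ)) * b := by
  refine norm_mid_le J.pE J.norm_pE (norm_F'_sub_le h hG hv hv')
    (norm_tangent_le h hG hv) hb ?_
  have hl := h.lam_nonneg
  have hκ := h.κ_le
  refine ContinuousLinearMap.opNorm_le_bound _ (by linarith) fun u => ?_
  have e : (J.pE ∘L (F' (J.join (G v') v') ∘L J.iE)) u =
      J.pE ((F' (J.join (G v') v') - D) (J.iE u)) + J.pE (D (J.iE u)) := by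
    simp
  rw [e, add_mul]
  refine (norm_add_le _ _).trans (add_le_add ?_ (h.contract u))
  refine (J.norm_pE _).trans (((F' (J.join (G v') v') - D).le_opNorm _).trans ?_)
  have h1 := h.close _ (norm_curve_lt h hG hv')
  have h2 := J.norm_iE u
  gcongr

/-- The image of the graph of `G` contains a graph of the same kind over the ball of radius `Q`. -/
theorem exists_transform (h : HypMap J F F' D Du P Q κ κ' lam H β e₀ t₀ lam₀ η₁ η₂)
    (hG : DoubleChart.IsRepresenting β η₁ P G) :
    ∃ G' : Euc l → Euc k, DoubleChart.IsRepresenting β η₂ Q G' ∧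
      ∀ w, ‖w‖ < Q → ∃ v, ‖v‖ < P ∧ F (J.join (G v) v) = J.join (G' w) w := by
  have hκ := h.κ_le
  have hκ0 := h.κ_pos
  have hβ := h.β_pos
  have hl := h.lam_nonneg
  have hlκ := h.lam_le
  have hH := h.H_nonneg
  have hHκ := h.H_le
  have hQ := Q_pos h
  have ht0 := t₀_nonneg h
  have hP := P_pos h
  -- `τ` inverts the expanded coordinate along the graph, and the new graph is `Φ ∘ τ`. By expansion
  -- `τ` is 1-Lipschitz.
  choose! τ hτ1 hτ2 using fun w : Euc l => exists_preimage h hG (w := w)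
  set Φ : Euc l → Euc k := fun v => J.pE (F (J.join (G v) v)) with hΦ
  have hτlip : ∀ w w', ‖w‖ < Q → ‖w'‖ < Q → ‖τ w - τ w'‖ ≤ ‖w - w'‖ := by
    intro w w' hw hw'
    have := norm_sub_le_U h hG (hτ1 w hw) (hτ1 w' hw')
    rwa [hτ2 w hw, hτ2 w' hw'] at this
  have hτcont : ∀ w, ‖w‖ < Q → ContinuousAt τ w := by
    intro w hw
    rw [ContinuousAt, tendsto_iff_norm_sub_tendsto_zero]
    have hev : ∀ᶠ w' in 𝓝 w, ‖τ w' - τ w‖ ≤ ‖w' - w‖ := by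
      filter_upwards [isOpen_ball.mem_nhds (mem_ball_zero_iff.2 hw)] with w' hw'
      exact hτlip _ _ (mem_ball_zero_iff.1 hw') hw
    refine squeeze_zero' (Filter.Eventually.of_forall fun _ => norm_nonneg _) hev ?_
    exact tendsto_iff_norm_sub_tendsto_zero.1 Filter.tendsto_id
  -- In finite dimension injectivity of `dU` suffices for it to be an isomorphism.
  have hT : ∀ w, ‖w‖ < Q → ∃ T : Euc l ≃L[ℝ] Euc l, (T : Euc l →L[ℝ] Euc l) = dU J F' G (τ w) := by
    intro w hw
    have hinj : Injective (dU J F' G (τ w)) := by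
      refine (injective_iff_map_eq_zero _).2 fun b hb => ?_
      have := norm_le_dU h hG (hτ1 w hw) b
      rw [hb, norm_zero] at this
      exact norm_le_zero_iff.1 this
    refine ⟨(LinearEquiv.ofInjectiveEndo (dU J F' G (τ w) : Euc l →ₗ[ℝ] Euc l)
      hinj).toContinuousLinearEquiv, ?_⟩
    ext1 u
    rfl
  choose! T hTe using hT
  have hTs : ∀ w, ‖w‖ < Q → ‖((T w).symm : Euc l →L[ℝ] Euc l)‖ ≤ 1 := by
    intro w hw
    refine ContinuousLinearMap.opNorm_le_bound _ zero_le_one fun b => ?_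
    have h1 := norm_le_dU h hG (hτ1 w hw) ((T w).symm b)
    rw [← hTe w hw] at h1
    simpa using h1
  have hτd : ∀ w, ‖w‖ < Q → HasFDerivAt τ ((T w).symm : Euc l →L[ℝ] Euc l) w := by
    intro w hw
    refine HasFDerivAt.of_local_left_inverse (f := fun v => J.pU (F (J.join (G v) v)))
      (hτcont w hw) ?_ ?_
    · rw [hTe w hw]
      exact hasFDerivAt_U h hG (hτ1 w hw)
    · filter_upwards [isOpen_ball.mem_nhds (mem_ball_zero_iff.2 hw)] with w' hw'
      exact hτ2 w' (mem_ball_zero_iff.1 hw')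
  have hG'd : ∀ w, ‖w‖ < Q → HasFDerivAt (fun w => Φ (τ w))
      (dE J F' G (τ w) ∘L ((T w).symm : Euc l →L[ℝ] Euc l)) w := fun w hw =>
    HasFDerivAt.comp (g := Φ) (f := τ) w (hasFDerivAt_E h hG (hτ1 w hw)) (hτd w hw)
  have hfd : ∀ w, ‖w‖ < Q → fderiv ℝ (fun w => Φ (τ w)) w =
      dE J F' G (τ w) ∘L ((T w).symm : Euc l →L[ℝ] Euc l) := fun w hw => (hG'd w hw).fderiv
  have hfdle : ∀ w, ‖w‖ < Q → ‖fderiv ℝ (fun w => Φ (τ w)) w‖ ≤ ‖dE J F' G (τ w)‖ := by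
    intro w hw
    rw [hfd w hw]
    refine (ContinuousLinearMap.opNorm_comp_le _ _).trans ?_
    exact mul_le_of_le_one_right (norm_nonneg _) (hTs w hw)
  obtain ⟨B, K, hB, hK, hBK, hB1, hK1⟩ := hG.deriv_holder
  -- From the derivative of `dE`: `(1 - κ + lam) K + 9/4 H`. From that of the inverse of `dU`,
  -- weighted by `‖dE‖ ≤ 1/2`: `½ lam K + 9/8 H`.
  set H' := (1 - κ + 3 / 2 * lam) * K + 27 / 8 * H with hH'
  have hholder : ∀ w w', ‖w‖ < Q → ‖w'‖ < Q →
      ‖fderiv ℝ (fun w => Φ (τ w)) w - fderiv ℝ (fun w => Φ (τ w)) w'‖ ≤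
        H' * ‖w - w'‖ ^ (β / 2) := by
    intro w w' hw hw'
    set δ := ‖τ w - τ w'‖ ^ (β / 2) with hδ
    have hδ0 : 0 ≤ δ := by positivity
    have hδw : δ ≤ ‖w - w'‖ ^ (β / 2) :=
      Real.rpow_le_rpow (norm_nonneg _) (hτlip w w' hw hw') (by linarith)
    have hb := hK1 (τ w) (by simpa using hτ1 w hw) (τ w') (by simpa using hτ1 w' hw')
    have h1 := norm_dU_sub_dU_le h hG (hτ1 w hw) (hτ1 w' hw') hb
    have h2 := norm_dE_sub_dE_le h hG (hτ1 w hw) (hτ1 w' hw') hb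
    have h3 := norm_dE_le_half h hG (hτ1 w' hw')
    -- The difference `E T⁻¹ - E' T'⁻¹` written as `(E - E') T⁻¹ - E' T'⁻¹ (T - T') T⁻¹`.
    have e : fderiv ℝ (fun w => Φ (τ w)) w - fderiv ℝ (fun w => Φ (τ w)) w' =
        (dE J F' G (τ w) - dE J F' G (τ w')) ∘L ((T w).symm : Euc l →L[ℝ] Euc l) -
        ((dE J F' G (τ w') ∘L ((T w').symm : Euc l →L[ℝ] Euc l)) ∘L
          (dU J F' G (τ w) - dU J F' G (τ w'))) ∘L ((T w).symm : Euc l →L[ℝ] Euc l) := by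
      rw [hfd w hw, hfd w' hw', ← hTe w hw, ← hTe w' hw']
      ext1 u
      simp
    have h4 : ‖(dE J F' G (τ w) - dE J F' G (τ w')) ∘L ((T w).symm : Euc l →L[ℝ] Euc l)‖ ≤
        ‖dE J F' G (τ w) - dE J F' G (τ w')‖ :=
      (ContinuousLinearMap.opNorm_comp_le _ _).trans
        (mul_le_of_le_one_right (norm_nonneg _) (hTs w hw))
    have h5 : ‖((dE J F' G (τ w') ∘L ((T w').symm : Euc l →L[ℝ] Euc l)) ∘L
          (dU J F' G (τ w) - dU J F' G (τ w'))) ∘L ((T w).symm : Euc l →L[ℝ] Euc l)‖ ≤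
        1 / 2 * ‖dU J F' G (τ w) - dU J F' G (τ w')‖ := by
      refine (ContinuousLinearMap.opNorm_comp_le _ _).trans ?_
      refine (mul_le_of_le_one_right (norm_nonneg _) (hTs w hw)).trans ?_
      refine (ContinuousLinearMap.opNorm_comp_le _ _).trans ?_
      refine mul_le_mul_of_nonneg_right ?_ (norm_nonneg _)
      refine (ContinuousLinearMap.opNorm_comp_le _ _).trans ?_
      exact (mul_le_of_le_one_right (norm_nonneg _) (hTs w' hw')).trans h3
    rw [e]
    refine (norm_sub_le _ _).trans ((add_le_add h4 h5).trans ?_)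
    have h6 : ‖dE J F' G (τ w) - dE J F' G (τ w')‖ +
        1 / 2 * ‖dU J F' G (τ w) - dU J F' G (τ w')‖ ≤ H' * δ := by
      rw [hH']
      linarith
    refine h6.trans (mul_le_mul_of_nonneg_left hδw ?_)
    rw [hH']
    have : 0 ≤ 1 - κ + 3 / 2 * lam := by linarith
    positivity
  have hH'0 : 0 ≤ H' := by
    have : 0 ≤ 1 - κ + 3 / 2 * lam := by linarith
    positivity
  -- The new centre comes from the source point `τ 0`, which expansion keeps within `t₀` of the old
  -- centre.
  have hv0 : ‖τ 0‖ ≤ t₀ := by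
    have h0 : ‖(0 : Euc l)‖ < Q := by simpa using hQ
    have h1 := norm_sub_le_U h hG (hτ1 0 h0) (v' := 0) (by simpa using hP)
    rw [hτ2 0 h0, sub_zero, zero_sub, norm_neg] at h1
    exact h1.trans (norm_U_zero_le h hG)
  have h0 : ‖(0 : Euc l)‖ < Q := by simpa using hQ
  have hcurve0 : ‖J.join (G (τ 0)) (τ 0)‖ ≤ η₁ ^ 2 / 1000 + 3 / 2 * t₀ :=
    (norm_curve_le h hG (hτ1 0 h0)).trans (by linarith)
  refine ⟨fun w => Φ (τ w), ⟨?_, ?_, ?_, ?_⟩, fun w hw => ⟨τ w, hτ1 w hw, ?_⟩⟩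
  · have hd : DifferentiableOn ℝ (fun w => Φ (τ w)) (ball 0 Q) := fun w hw =>
      (hG'd w (mem_ball_zero_iff.1 hw)).differentiableAt.differentiableWithinAt
    have : ContDiffOn ℝ (0 + 1) (fun w => Φ (τ w)) (ball 0 Q) := by
      rw [contDiffOn_succ_iff_fderiv_of_isOpen isOpen_ball]
      refine ⟨hd, by simp, contDiffOn_zero.2 fun w hw => ?_⟩
      -- Continuity of the derivative is read off from its Hölder estimate.
      refine ContinuousAt.continuousWithinAt ?_
      rw [ContinuousAt, tendsto_iff_norm_sub_tendsto_zero]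
      have hev : ∀ᶠ w' in 𝓝 w, ‖fderiv ℝ (fun w => Φ (τ w)) w' -
          fderiv ℝ (fun w => Φ (τ w)) w‖ ≤ H' * ‖w' - w‖ ^ (β / 2) := by
        filter_upwards [isOpen_ball.mem_nhds hw] with w' hw'
        exact hholder _ _ (mem_ball_zero_iff.1 hw') (mem_ball_zero_iff.1 hw)
      refine squeeze_zero' (Filter.Eventually.of_forall fun _ => norm_nonneg _) hev ?_
      have hc : ContinuousAt (fun w' : Euc l => H' * ‖w' - w‖ ^ (β / 2)) w := by
        refine ContinuousAt.mul continuousAt_const (ContinuousAt.rpow_const (by fun_prop) ?_)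
        right; positivity
      have := hc.tendsto
      simpa [Real.zero_rpow (by positivity : β / 2 ≠ 0)] using this
    simpa using this
  · have h1 : Φ (τ 0) = J.pE ((F (J.join (G (τ 0)) (τ 0)) - D (J.join (G (τ 0)) (τ 0))) -
        (F 0 - D 0)) + J.pE (F 0) + J.pE (D (J.iE (G (τ 0)))) := by
      have := h.pE_D_iU (τ 0)
      rw [hΦ]
      simp only [CoordSplit.join, map_sub, map_zero, map_add]
      rw [this]
      abel
    have h2 : ‖(F (J.join (G (τ 0)) (τ 0)) - D (J.join (G (τ 0)) (τ 0))) - (F 0 - D 0)‖ ≤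
        lam * ‖J.join (G (τ 0)) (τ 0) - 0‖ := by
      have hc := norm_curve_lt h hG (hτ1 0 h0)
      refine (convex_ball (0 : Euc d) (2 * P)).norm_image_sub_le_of_norm_hasFDerivWithin_le
        (f := fun v => F v - D v) (f' := fun v => F' v - D) (𝕜 := ℝ)
        (fun u hu => ?_) (fun u hu => ?_) (by simpa using hP) (by simpa using hc)
      · exact ((h.deriv u (by simpa using hu)).sub D.hasFDerivAt).hasFDerivWithinAt
      · exact h.close u (by simpa using hu)
    rw [sub_zero] at h2
    have h3 := (J.norm_pE _).trans h2
    have h4 := (J.norm_pE (F 0)).trans h.at_zero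
    have h5 := h.contract (G (τ 0))
    have h6 : (1 - κ) * ‖G (τ 0)‖ ≤ (1 - κ) * (η₁ ^ 2 / 1000 + t₀ / 2) :=
      mul_le_mul_of_nonneg_left ((hG.norm_le (hτ1 0 h0)).trans (by linarith)) (by linarith)
    have h7 : lam * ‖J.join (G (τ 0)) (τ 0)‖ ≤ lam * (η₁ ^ 2 / 1000 + 3 / 2 * t₀) :=
      mul_le_mul_of_nonneg_left hcurve0 hl
    have h8 := h.zero_le
    show ‖Φ (τ 0)‖ ≤ _
    rw [h1]
    refine (norm_add_le _ _).trans ?_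
    have := norm_add_le (J.pE ((F (J.join (G (τ 0)) (τ 0)) - D (J.join (G (τ 0)) (τ 0))) -
        (F 0 - D 0))) (J.pE (F 0))
    linarith
  · refine (hfdle 0 h0).trans ?_
    have h1 := norm_dE_le' h hG (hτ1 0 h0) (h.close₀ _ hcurve0)
    have h2 := hK1 (τ 0) (by simpa using hτ1 0 h0) 0 (by simpa using hP)
    rw [sub_zero] at h2
    have h3 : ‖τ 0‖ ^ (β / 2) ≤ t₀ ^ (β / 2) :=
      Real.rpow_le_rpow (norm_nonneg _) hv0 (by linarith)
    have h4 : K * ‖τ 0‖ ^ (β / 2) ≤ 1 / 2 * t₀ ^ (β / 2) :=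
      mul_le_mul (by linarith) h3 (by positivity) (by norm_num)
    have h5 : ‖fderiv ℝ G (τ 0)‖ ≤ 1 / 2 * η₁ ^ (β / 2) + 1 / 2 * t₀ ^ (β / 2) := by
      have := norm_sub_norm_le (fderiv ℝ G (τ 0)) (fderiv ℝ G 0)
      linarith [hG.deriv_zero]
    have h6 := mul_le_mul_of_nonneg_left h5 (by linarith : (0 : ℝ) ≤ 1 - κ)
    linarith [h.deriv_le]
  · refine ⟨(1 - κ) * B + 3 / 2 * lam, H', by
      have : 0 ≤ 1 - κ := by linarith
      positivity, hH'0, ?_, fun w hw => ?_, fun w hw w' hw' => ?_⟩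
    -- The sum of the two constants is contracted as a whole, from `1/2` to `(1 - κ)/2`. The
    -- perturbations add at most `9/4 lam + 27/8 H`, which is less than `κ/2`.
    · have h1 : (1 - κ) * (B + K) ≤ (1 - κ) * (1 / 2) :=
        mul_le_mul_of_nonneg_left hBK.le (by linarith)
      have h2 : 3 / 2 * lam * K ≤ 3 / 2 * lam * (1 / 2) :=
        mul_le_mul_of_nonneg_left (by linarith) (by positivity)
      rw [hH']
      linarith
    · have hw := mem_ball_zero_iff.1 hw
      refine (hfdle w hw).trans ((norm_dE_le h hG (hτ1 w hw)).trans ?_)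
      have := hB1 (τ w) (by simpa using hτ1 w hw)
      have h2 : 0 ≤ 1 - κ := by linarith
      gcongr
    · exact hholder w w' (mem_ball_zero_iff.1 hw) (mem_ball_zero_iff.1 hw')
  · have h1 := J.add_eq (F (J.join (G (τ w)) (τ w)))
    rw [hτ2 w hw] at h1
    exact h1.symm

end HypMap

namespace HypMap

variable {k l : ℕ} {J : CoordSplit d k l} {F : Euc d → Euc d}
    {F' : Euc d → Euc d →L[ℝ] Euc d} {D : Euc d →L[ℝ] Euc d} {Du : Euc l ≃L[ℝ] Euc l}
    {P Q κ κ' lam H β e₀ t₀ lam₀ η₁ η₂ : ℝ} {G : Euc l → Euc k}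

theorem _root_.CoordSplit.pE_join (J : CoordSplit d k l) (a : Euc k) (b : Euc l) :
    J.pE (J.join a b) = a := by
  simp [CoordSplit.join, J.pE_iE, J.pE_iU]

theorem _root_.CoordSplit.pU_join (J : CoordSplit d k l) (a : Euc k) (b : Euc l) :
    J.pU (J.join a b) = b := by
  simp [CoordSplit.join, J.pU_iE, J.pU_iU]

/-- Expansion of the second coordinate makes the source point unique, and the first coordinate
follows. Uniqueness of admissible manifolds inside the image rests on this. -/
theorem transform_unique (h : HypMap J F F' D Du P Q κ κ' lam H β e₀ t₀ lam₀ η₁ η₂)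
    (hG : DoubleChart.IsRepresenting β η₁ P G) {v v' : Euc l} (hv : ‖v‖ < P) (hv' : ‖v'‖ < P)
    {a a' : Euc k} {w : Euc l} (e : F (J.join (G v) v) = J.join a w)
    (e' : F (J.join (G v') v') = J.join a' w) : v = v' ∧ a = a' := by
  have h1 := norm_sub_le_U h hG hv hv'
  rw [e, e', J.pU_join, J.pU_join, sub_self, norm_zero] at h1
  have h2 : v = v' := sub_eq_zero.1 (norm_le_zero_iff.1 h1)
  subst h2
  refine ⟨rfl, ?_⟩
  rw [← J.pE_join a w, ← e, e', J.pE_join]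

/-- Since `t₀ < Q`, the image of the old centre lies over the ball of radius `Q`; by
`transform_unique` it is then on the new graph. -/
theorem center_mem (h : HypMap J F F' D Du P Q κ κ' lam H β e₀ t₀ lam₀ η₁ η₂)
    (hG : DoubleChart.IsRepresenting β η₁ P G) {G' : Euc l → Euc k}
    (hG' : ∀ w, ‖w‖ < Q → ∃ v, ‖v‖ < P ∧ F (J.join (G v) v) = J.join (G' w) w) :
    ∃ w, ‖w‖ < Q ∧ F (J.join (G 0) 0) = J.join (G' w) w := by
  have h1 := (norm_U_zero_le h hG).trans_lt h.t₀_lt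
  obtain ⟨v, hv, hvw⟩ := hG' _ h1
  have hP : ‖(0 : Euc l)‖ < P := by simpa using P_pos h
  have h2 : F (J.join (G 0) 0) = J.join (J.pE (F (J.join (G 0) 0))) (J.pU (F (J.join (G 0) 0))) :=
    (J.add_eq _).symm
  obtain ⟨-, h3⟩ := transform_unique h hG hP hv h2 hvw
  exact ⟨_, h1, by rw [← h3]; exact h2⟩

theorem norm_sub_le_E (h : HypMap J F F' D Du P Q κ κ' lam H β e₀ t₀ lam₀ η₁ η₂)
    (hG : DoubleChart.IsRepresenting β η₁ P G) {v v' : Euc l} (hv : ‖v‖ < P) (hv' : ‖v'‖ < P) :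
    ‖J.pE (F (J.join (G v) v)) - J.pE (F (J.join (G v') v'))‖ ≤ 1 / 2 * ‖v - v'‖ := by
  refine (convex_ball (0 : Euc l) P).norm_image_sub_le_of_norm_hasFDerivWithin_le
    (f := fun v => J.pE (F (J.join (G v) v))) (f' := dE J F' G) (𝕜 := ℝ)
    (fun u hu => ?_) (fun u hu => ?_) (by simpa using hv') (by simpa using hv)
  · exact (hasFDerivAt_E h hG (by simpa using hu)).hasFDerivWithinAt
  · exact norm_dE_le_half h hG (by simpa using hu)

/-- The image of the graph of `G` meets a transversal graph in exactly one point. -/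
theorem existsUnique_inter (h : HypMap J F F' D Du P Q κ κ' lam H β e₀ t₀ lam₀ η₁ η₂)
    (hG : DoubleChart.IsRepresenting β η₁ P G) {p : ℝ} (hp : η₂ ≤ p) {N : Euc k → Euc l}
    (hN : DoubleChart.IsRepresenting β η₂ p N) :
    ∃! v, ‖v‖ < P ∧ ∃ s, ‖s‖ < p ∧ F (J.join (G v) v) = J.join s (N s) := by
  obtain ⟨G', hG'1, hG'2⟩ := exists_transform h hG
  have hη := h.η₂_pos
  have hηQ := h.η₂_le
  have hQ := h.Q_le
  have hη2 : η₂ ^ 2 / 50 < η₂ := by nlinarith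
  have hη3 : 0 < η₂ ^ 2 := by positivity
  have hE : ∀ w : Euc l, ‖w‖ ≤ η₂ ^ 2 / 100 → ‖G' w‖ ≤ η₂ ^ 2 / 100 := fun w hw =>
    (hG'1.norm_le (by linarith)).trans (by linarith)
  -- Where the new graph and the graph of `N` meet, `s = G' w` and `w = N s`. The composition `N ∘
  -- G'` contracts a ball of radius `η₂²/100`, small enough to lie in both domains.
  obtain ⟨w, hw, hwf⟩ := exists_fixedPoint_closedBall (f := fun w => N (G' w))
    (r := η₂ ^ 2 / 100) (K := 1 / 2) (by positivity) (by norm_num)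
    (fun w hw => (hN.norm_le ((hE w hw).trans_lt (by linarith))).trans
      (by linarith [hE w hw]))
    (fun w w' hw hw' => by
      have h1 := hN.norm_sub_le (v := G' w) (v' := G' w') ((hE w hw).trans_lt (by linarith))
        ((hE w' hw').trans_lt (by linarith))
      have h2 := hG'1.norm_sub_le (v := w) (v' := w') (by linarith) (by linarith)
      linarith [norm_nonneg (w - w')])
  obtain ⟨v, hv, hvw⟩ := hG'2 w (by linarith)
  refine ⟨v, ⟨hv, G' w, (hE w hw).trans_lt (by linarith), ?_⟩, ?_⟩
  · rw [hvw]
    exact congrArg _ hwf.symm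
  · rintro v' ⟨hv', s, hs, e⟩
    have e0 : F (J.join (G v) v) = J.join (G' w) (N (G' w)) := by
      rw [hvw]
      exact congrArg _ hwf.symm
    -- Uniqueness is checked among all source points, not only those over the ball of radius `Q`.
    -- Along the image the first coordinate is ½-Lipschitz in the parameter while the second is
    -- expanding, and `N` is ½-Lipschitz; hence `|v' - v| ≤ ¼ |v' - v|`.
    have h1 := norm_sub_le_U h hG hv' hv
    have h2 := norm_sub_le_E h hG hv' hv
    rw [e, e0, J.pU_join, J.pU_join] at h1
    rw [e, e0, J.pE_join, J.pE_join] at h2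
    have h3 := hN.norm_sub_le (v := s) (v' := G' w) hs ((hE w hw).trans_lt (by linarith))
    have h4 : ‖v' - v‖ ≤ 0 := by linarith [norm_nonneg (v' - v)]
    exact sub_eq_zero.1 (norm_le_zero_iff.1 h4)

end HypMap

/-! ### The differential along an orbit and the invariance of the splitting -/

theorem inverse_apply_of_bijective {E F : Type*} [NormedAddCommGroup E] [NormedSpace ℝ E]
    [NormedAddCommGroup F] [NormedSpace ℝ F] [FiniteDimensional ℝ E]
    (T : E →L[ℝ] F) (hT : Bijective T) (ζ : E) : T.inverse (T ζ) = ζ := by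
  let e : E ≃L[ℝ] F := (LinearEquiv.ofBijective (T : E →ₗ[ℝ] F) hT).toContinuousLinearEquiv
  have h : T = (e : E →L[ℝ] F) := by ext1 u; rfl
  rw [h, ContinuousLinearMap.inverse_equiv]
  exact e.symm_apply_apply ζ

instance (p : M) : FiniteDimensional ℝ (TangentSpace (𝓡 d) p) :=
  inferInstanceAs (FiniteDimensional ℝ (Euc d))

theorem tangentCast_rfl (p : M) (ξ : TangentSpace (𝓡 d) p) : tangentCast d rfl ξ = ξ := rfl

theorem norm_tangentCast {p q : M} (h : p = q) (ξ : TangentSpace (𝓡 d) p) :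
    ‖tangentCast d h ξ‖ = ‖ξ‖ := by subst h; rfl

theorem bijective_tangentCast {p q : M} (h : p = q) :
    Bijective (tangentCast d h : TangentSpace (𝓡 d) p →L[ℝ] TangentSpace (𝓡 d) q) := by
  subst h; exact bijective_id

/-- The chain rule for points that are equal only propositionally, with the value transported
between the two tangent spaces. -/
theorem mfderiv_comp_cast {f g h : M → M} {p : M} (e : g = f ∘ h) (hp : f (h p) = g p)
    (hf : MDifferentiableAt (𝓡 d) (𝓡 d) f (h p)) (hh : MDifferentiableAt (𝓡 d) (𝓡 d) h p)
    (ξ : TangentSpace (𝓡 d) p) :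
    mfderiv (𝓡 d) (𝓡 d) g p ξ =
      tangentCast d hp (mfderiv (𝓡 d) (𝓡 d) f (h p) (mfderiv (𝓡 d) (𝓡 d) h p ξ)) := by
  subst e
  rw [mfderiv_comp p hf hh]
  rfl

namespace Orbit

variable {f : M → M}

theorem ext_pt {x y : Orbit f} (h : ∀ i, x.pt i = y.pt i) : x = y := by
  cases x; cases y
  simp only [mk.injEq]
  exact funext h

theorem shiftInv_shift (x : Orbit f) : x.shift.shiftInv = x :=
  ext_pt fun i => by simp [shift, shiftInv]

theorem shift_shiftInv (x : Orbit f) : x.shiftInv.shift = x :=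
  ext_pt fun i => by simp [shift, shiftInv]

/-- The differential of `f` as a map between the tangent spaces along the orbit. -/
def step (x : Orbit f) : TangentSpace (𝓡 d) (x.pt 0) →L[ℝ] TangentSpace (𝓡 d) (x.shift.pt 0) :=
  tangentCast d (x.map_pt 0) ∘L mfderiv (𝓡 d) (𝓡 d) f (x.pt 0)

theorem step_bijective {x : Orbit f} (hx : x.pt 0 ∉ singSet d f) : Bijective (x.step (d := d)) :=
  (bijective_tangentCast _).comp (not_not.1 hx)

theorem mdifferentiable_iterate (hf : MDifferentiable (𝓡 d) (𝓡 d) f) (m : ℕ) :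
    MDifferentiable (𝓡 d) (𝓡 d) f^[m] := by
  induction m with
  | zero => exact mdifferentiable_id
  | succ m ih => exact ih.comp hf

/-- Norms rather than vectors are compared, because the two vectors belong to tangent spaces at
different expressions of the same point. -/
theorem norm_fwd_shift (hf : MDifferentiable (𝓡 d) (𝓡 d) f) (x : Orbit f) (m : ℕ)
    (ξ : TangentSpace (𝓡 d) (x.pt 0)) : ‖fwd d x.shift m (x.step ξ)‖ = ‖fwd d x (m + 1) ξ‖ := by
  have key : ∀ (p q : M) (h : f p = q) (ξ : TangentSpace (𝓡 d) p),
      ‖mfderiv (𝓡 d) (𝓡 d) f^[m] q (tangentCast d h (mfderiv (𝓡 d) (𝓡 d) f p ξ))‖ =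
        ‖mfderiv (𝓡 d) (𝓡 d) f^[m + 1] p ξ‖ := by
    rintro p q rfl ξ
    rw [mfderiv_comp_cast (f := f^[m]) (h := f) (g := f^[m + 1]) rfl rfl
      (mdifferentiable_iterate hf m _) (hf _)]
    rfl
  exact key _ _ (x.map_pt 0) ξ

theorem norm_fwd_zero (x : Orbit f) (ξ : TangentSpace (𝓡 d) (x.pt 0)) : ‖fwd d x 0 ξ‖ = ‖ξ‖ := by
  have : mfderiv (𝓡 d) (𝓡 d) (f^[0]) (x.pt 0) = ContinuousLinearMap.id ℝ _ := mfderiv_id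
  unfold fwd
  rw [this]
  rfl

theorem bijective_iterate (hf : MDifferentiable (𝓡 d) (𝓡 d) f) (m : ℕ) (p : M)
    (hp : ∀ j < m, f^[j] p ∉ singSet d f) : Bijective (mfderiv (𝓡 d) (𝓡 d) f^[m] p) := by
  induction m with
  | zero =>
    have : mfderiv (𝓡 d) (𝓡 d) (f^[0]) p = ContinuousLinearMap.id ℝ _ := mfderiv_id
    rw [this]
    exact bijective_id
  | succ m ih =>
    have h1 := ih fun j hj => hp j (by omega)
    have h2 : Bijective (mfderiv (𝓡 d) (𝓡 d) f (f^[m] p)) := not_not.1 (hp m (by omega))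
    have h3 : (mfderiv (𝓡 d) (𝓡 d) f^[m + 1] p : _ → _) = fun ξ =>
        tangentCast d (iterate_succ_apply' f m p).symm
          (mfderiv (𝓡 d) (𝓡 d) f (f^[m] p) (mfderiv (𝓡 d) (𝓡 d) f^[m] p ξ)) := by
      funext ξ
      exact mfderiv_comp_cast (iterate_succ' f m) _ (hf _) (mdifferentiable_iterate hf m _) ξ
    rw [h3]
    exact (bijective_tangentCast _).comp (h2.comp h1)

theorem norm_bwd_shift (hf : MDifferentiable (𝓡 d) (𝓡 d) f) {x : Orbit f}
    (hx : ∀ n, x.pt n ∉ singSet d f) (m : ℕ) (ξ : TangentSpace (𝓡 d) (x.pt 0)) :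
    ‖bwd d x.shift (m + 1) (x.step ξ)‖ = ‖bwd d x m ξ‖ := by
  have key : ∀ (p q r p' : M) (hq : q = f^[m] p) (hr : f q = r) (hp : p' = p)
      (hr' : r = f^[m + 1] p') (ξ : TangentSpace (𝓡 d) q), (∀ j < m + 1, f^[j] p ∉ singSet d f) →
      ‖(mfderiv (𝓡 d) (𝓡 d) f^[m + 1] p').inverse
        (tangentCast d hr' (tangentCast d hr (mfderiv (𝓡 d) (𝓡 d) f q ξ)))‖ =
      ‖(mfderiv (𝓡 d) (𝓡 d) f^[m] p).inverse (tangentCast d hq ξ)‖ := by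
    rintro p q r p' rfl rfl rfl hr' ξ hns
    have h1 := bijective_iterate hf m p' fun j hj => hns j (by omega)
    -- Written as the image of `ζ` under the differential of `f^m`, both backward vectors become
    -- `ζ`. Nonsingularity along the orbit ensures that `inverse` is a genuine inverse.
    obtain ⟨ζ, rfl⟩ := h1.2 ξ
    have h2 := mfderiv_comp_cast (iterate_succ' f m) hr' (hf _) (mdifferentiable_iterate hf m _) ζ
    rw [tangentCast_rfl, tangentCast_rfl, ← h2, inverse_apply_of_bijective _ h1,
      inverse_apply_of_bijective _ (bijective_iterate hf (m + 1) p' hns)]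
  refine key (x.pt (-m)) _ _ _ (x.iterate_neg m) (x.map_pt 0) ?_ _ ξ ?_
  · show x.pt (-((m + 1 : ℕ) : ℤ) + 1) = _
    congr 1; push_cast; ring
  · intro j _
    rw [iterate_apply]
    exact hx _

theorem norm_bwd_zero (x : Orbit f) (ξ : TangentSpace (𝓡 d) (x.pt 0)) : ‖bwd d x 0 ξ‖ = ‖ξ‖ := by
  have key : ∀ (p q : M) (h : q = f^[0] p) (ξ : TangentSpace (𝓡 d) q),
      ‖(mfderiv (𝓡 d) (𝓡 d) f^[0] p).inverse (tangentCast d h ξ)‖ = ‖ξ‖ := by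
    intro p q h ξ
    have h' : q = p := h
    subst h'
    have h1 : mfderiv (𝓡 d) (𝓡 d) (f^[0]) q = ContinuousLinearMap.id ℝ _ := mfderiv_id
    have h2 : mfderiv (𝓡 d) (𝓡 d) (f^[0]) q ξ = tangentCast d h ξ := by rw [h1]; rfl
    have h3 : Bijective (mfderiv (𝓡 d) (𝓡 d) (f^[0]) q) := by rw [h1]; exact bijective_id
    rw [← h2, inverse_apply_of_bijective _ h3]
  exact key _ _ (x.iterate_neg 0) ξ

theorem fwd_smul (x : Orbit f) (m : ℕ) (a : ℝ) (ξ : TangentSpace (𝓡 d) (x.pt 0)) :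
    fwd d x m (a • ξ) = a • fwd d x m ξ := map_smul _ _ _

theorem bwd_smul (x : Orbit f) (m : ℕ) (a : ℝ) (ξ : TangentSpace (𝓡 d) (x.pt 0)) :
    bwd d x m (a • ξ) = a • bwd d x m ξ := by
  unfold bwd
  rw [map_smul, map_smul]

end Orbit

/-- Scaling to the unit sphere. The absolute value of `B` is used because `B` may be negative when
`S` is trivial. -/
theorem exists_homogeneous_bound {E : Type*} [NormedAddCommGroup E] [NormedSpace ℝ E]
    {N : ℕ → E → ℝ} (hN : ∀ m (a : ℝ) ξ, N m (a • ξ) = |a| * N m ξ) {S : Submodule ℝ E} {B : ℝ}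
    (hB : ∀ ξ ∈ S, ‖ξ‖ = 1 → Summable (fun m => N m ξ ^ 2) ∧ ∑' m, N m ξ ^ 2 ≤ B) :
    ∃ B' ≥ 0, ∀ ξ ∈ S, Summable (fun m => N m ξ ^ 2) ∧ ∑' m, N m ξ ^ 2 ≤ B' * ‖ξ‖ ^ 2 := by
  refine ⟨|B|, abs_nonneg B, fun ξ hξ => ?_⟩
  rcases eq_or_ne ξ 0 with rfl | h0
  · have : ∀ m, N m (0 : E) = 0 := fun m => by simpa using hN m 0 0
    simp [this]
  · have hn : ‖ξ‖ ≠ 0 := norm_ne_zero_iff.2 h0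
    obtain ⟨h1, h2⟩ := hB (‖ξ‖⁻¹ • ξ) (S.smul_mem _ hξ) (by
      rw [norm_smul, norm_inv, norm_norm, inv_mul_cancel₀ hn])
    have h3 : ∀ m, N m ξ ^ 2 = ‖ξ‖ ^ 2 * N m (‖ξ‖⁻¹ • ξ) ^ 2 := fun m => by
      rw [hN, abs_inv, abs_norm]
      field_simp
    simp only [h3]
    refine ⟨h1.mul_left _, ?_⟩
    rw [tsum_mul_left, mul_comm]
    exact mul_le_mul_of_nonneg_right (h2.trans (le_abs_self B)) (by positivity)

namespace Orbit

variable {f : M → M}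

theorem norm_fwd_smul (x : Orbit f) (m : ℕ) (a : ℝ) (ξ : TangentSpace (𝓡 d) (x.pt 0)) :
    ‖fwd d x m (a • ξ)‖ = |a| * ‖fwd d x m ξ‖ := by
  rw [fwd_smul, norm_smul, Real.norm_eq_abs]

theorem norm_bwd_smul (x : Orbit f) (m : ℕ) (a : ℝ) (ξ : TangentSpace (𝓡 d) (x.pt 0)) :
    ‖bwd d x m (a • ξ)‖ = |a| * ‖bwd d x m ξ‖ := by
  rw [bwd_smul, norm_smul, Real.norm_eq_abs]

/-- The differential of `f` as a linear isomorphism between tangent spaces along the orbit. -/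
def stepEquiv {x : Orbit f} (hx : x.pt 0 ∉ singSet d f) :
    TangentSpace (𝓡 d) (x.pt 0) ≃L[ℝ] TangentSpace (𝓡 d) (x.shift.pt 0) :=
  (LinearEquiv.ofBijective (x.step (d := d)).toLinearMap (step_bijective hx)).toContinuousLinearEquiv

/-- The shift drops the term `m = 0`, which is `‖ξ‖²`; this loss is the source of strict contraction
in the Lyapunov norm. -/
theorem tsum_fwd_shift (hf : MDifferentiable (𝓡 d) (𝓡 d) f) (x : Orbit f)
    (ξ : TangentSpace (𝓡 d) (x.pt 0)) (h : Summable fun m => ‖fwd d x m ξ‖ ^ 2) :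
    ∑' m, ‖fwd d x m ξ‖ ^ 2 = ‖ξ‖ ^ 2 + ∑' m, ‖fwd d x.shift m (x.step ξ)‖ ^ 2 := by
  rw [h.tsum_eq_zero_add, norm_fwd_zero]
  simp only [norm_fwd_shift hf]

theorem summable_fwd_shift (hf : MDifferentiable (𝓡 d) (𝓡 d) f) (x : Orbit f)
    (ξ : TangentSpace (𝓡 d) (x.pt 0)) : (Summable fun m => ‖fwd d x.shift m (x.step ξ)‖ ^ 2) ↔
      Summable fun m => ‖fwd d x m ξ‖ ^ 2 := by
  simp only [norm_fwd_shift hf]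
  exact summable_nat_add_iff (f := fun m => ‖fwd d x m ξ‖ ^ 2) 1

/-- The shift adds a new term `m = 0`; this gain is the source of strict expansion. -/
theorem tsum_bwd_shift (hf : MDifferentiable (𝓡 d) (𝓡 d) f) {x : Orbit f}
    (hx : ∀ n, x.pt n ∉ singSet d f)
    (ξ : TangentSpace (𝓡 d) (x.pt 0)) (h : Summable fun m => ‖bwd d x m ξ‖ ^ 2) :
    ∑' m, ‖bwd d x.shift m (x.step ξ)‖ ^ 2 = ‖x.step ξ‖ ^ 2 + ∑' m, ‖bwd d x m ξ‖ ^ 2 := by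
  have h1 : Summable fun m => ‖bwd d x.shift m (x.step ξ)‖ ^ 2 := by
    refine (summable_nat_add_iff 1).1 ?_
    simpa only [norm_bwd_shift hf hx] using h
  rw [h1.tsum_eq_zero_add, norm_bwd_zero]
  simp only [norm_bwd_shift hf hx]

theorem summable_bwd_shift (hf : MDifferentiable (𝓡 d) (𝓡 d) f) {x : Orbit f}
    (hx : ∀ n, x.pt n ∉ singSet d f)
    (ξ : TangentSpace (𝓡 d) (x.pt 0)) : (Summable fun m => ‖bwd d x.shift m (x.step ξ)‖ ^ 2) ↔
      Summable fun m => ‖bwd d x m ξ‖ ^ 2 := by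
  rw [← summable_nat_add_iff (f := fun m => ‖bwd d x.shift m (x.step ξ)‖ ^ 2) 1]
  simp only [norm_bwd_shift hf hx]

/-- The sums for a vector and for its image differ by one term, and `df` is an isomorphism, so
bounds over unit vectors transfer by homogeneity. The equivalence in both directions is what carries
uniqueness along the shift. -/
theorem isSummableSplitting_shift (hf : MDifferentiable (𝓡 d) (𝓡 d) f) {x : Orbit f}
    (hx : ∀ n, x.pt n ∉ singSet d f) (Es Eu : Submodule ℝ (TangentSpace (𝓡 d) (x.pt 0))) :
    IsSummableSplitting d x.shift
      (Es.map (stepEquiv (hx 0) : TangentSpace (𝓡 d) (x.pt 0) ≃ₗ[ℝ] _).toLinearMap)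
      (Eu.map (stepEquiv (hx 0) : TangentSpace (𝓡 d) (x.pt 0) ≃ₗ[ℝ] _).toLinearMap) ↔
    IsSummableSplitting d x Es Eu := by
  set T := stepEquiv (hx 0) with hT
  have hTs : ∀ ξ, x.step ξ = T ξ := fun ξ => rfl
  set a := ‖(T.symm : TangentSpace (𝓡 d) (x.shift.pt 0) →L[ℝ] TangentSpace (𝓡 d) (x.pt 0))‖
  set b := ‖(T : TangentSpace (𝓡 d) (x.pt 0) →L[ℝ] TangentSpace (𝓡 d) (x.shift.pt 0))‖
  have hn : ∀ ξ : TangentSpace (𝓡 d) (x.pt 0), ‖ξ‖ ≤ a * ‖T ξ‖ := fun ξ => by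
    simpa using (T.symm : TangentSpace (𝓡 d) (x.shift.pt 0) →L[ℝ]
      TangentSpace (𝓡 d) (x.pt 0)).le_opNorm (T ξ)
  have hn' : ∀ ξ : TangentSpace (𝓡 d) (x.pt 0), ‖T ξ‖ ≤ b * ‖ξ‖ := fun ξ =>
    (T : TangentSpace (𝓡 d) (x.pt 0) →L[ℝ] TangentSpace (𝓡 d) (x.shift.pt 0)).le_opNorm ξ
  have ha2 : ∀ ξ, ‖ξ‖ ^ 2 ≤ a ^ 2 * ‖T ξ‖ ^ 2 := fun ξ => by
    rw [← mul_pow]; gcongr; exact hn ξ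
  have hb2 : ∀ ξ, ‖T ξ‖ ^ 2 ≤ b ^ 2 * ‖ξ‖ ^ 2 := fun ξ => by
    rw [← mul_pow]; gcongr; exact hn' ξ
  refine and_congr ?_ (and_congr ?_ ?_)
  · exact ((Submodule.orderIsoMapComap
      (T : TangentSpace (𝓡 d) (x.pt 0) ≃ₗ[ℝ] TangentSpace (𝓡 d) (x.shift.pt 0))).isCompl_iff
      (x := Es) (y := Eu)).symm
  · constructor
    · rintro ⟨B, hB⟩
      obtain ⟨B', hB'0, hB'⟩ := exists_homogeneous_bound
        (N := fun m ξ => ‖fwd d x.shift m ξ‖) (norm_fwd_smul x.shift) hB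
      refine ⟨1 + B' * b ^ 2, fun ξ hξ h1 => ?_⟩
      obtain ⟨h2, h3⟩ := hB' (T ξ) (Submodule.mem_map_of_mem hξ)
      have h4 := (summable_fwd_shift hf x ξ).1 h2
      refine ⟨h4, ?_⟩
      rw [tsum_fwd_shift hf x ξ h4, h1]
      have h5 := hb2 ξ
      rw [h1] at h5
      have h6 : B' * ‖T ξ‖ ^ 2 ≤ B' * b ^ 2 := mul_le_mul_of_nonneg_left (by linarith) hB'0
      have h7 := h3.trans h6
      simp only [one_pow]
      exact add_le_add le_rfl h7
    · rintro ⟨B, hB⟩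
      obtain ⟨B', hB'0, hB'⟩ := exists_homogeneous_bound
        (N := fun m ξ => ‖fwd d x m ξ‖) (norm_fwd_smul x) hB
      refine ⟨B' * a ^ 2, fun η hη h1 => ?_⟩
      obtain ⟨ξ, hξ, rfl⟩ := hη
      have h1 : ‖T ξ‖ = 1 := h1
      obtain ⟨h2, h3⟩ := hB' ξ hξ
      refine ⟨(summable_fwd_shift hf x ξ).2 h2, ?_⟩
      have h4 := tsum_fwd_shift hf x ξ h2
      have h5 := ha2 ξ
      rw [h1] at h5
      have h6 : B' * ‖ξ‖ ^ 2 ≤ B' * a ^ 2 := mul_le_mul_of_nonneg_left (by linarith) hB'0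
      have h7 : ∑' m, ‖fwd d x.shift m (x.step ξ)‖ ^ 2 ≤ B' * a ^ 2 := by
        linarith [sq_nonneg ‖ξ‖]
      exact h7
  · constructor
    · rintro ⟨B, hB⟩
      obtain ⟨B', hB'0, hB'⟩ := exists_homogeneous_bound
        (N := fun m ξ => ‖bwd d x.shift m ξ‖) (norm_bwd_smul x.shift) hB
      refine ⟨B' * b ^ 2, fun ξ hξ h1 => ?_⟩
      obtain ⟨h2, h3⟩ := hB' (T ξ) (Submodule.mem_map_of_mem hξ)
      have h4 := (summable_bwd_shift hf hx ξ).1 h2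
      refine ⟨h4, ?_⟩
      have h8 : ∑' m, ‖bwd d x.shift m (x.step ξ)‖ ^ 2 ≤ B' * ‖T ξ‖ ^ 2 := h3
      rw [tsum_bwd_shift hf hx ξ h4] at h8
      have h5 := hb2 ξ
      rw [h1] at h5
      have h6 : B' * ‖T ξ‖ ^ 2 ≤ B' * b ^ 2 := mul_le_mul_of_nonneg_left (by linarith) hB'0
      linarith [sq_nonneg ‖x.step ξ‖]
    · rintro ⟨B, hB⟩
      obtain ⟨B', hB'0, hB'⟩ := exists_homogeneous_bound
        (N := fun m ξ => ‖bwd d x m ξ‖) (norm_bwd_smul x) hB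
      refine ⟨1 + B' * a ^ 2, fun η hη h1 => ?_⟩
      obtain ⟨ξ, hξ, rfl⟩ := hη
      have h1 : ‖T ξ‖ = 1 := h1
      obtain ⟨h2, h3⟩ := hB' ξ hξ
      refine ⟨(summable_bwd_shift hf hx ξ).2 h2, ?_⟩
      have h4 := tsum_bwd_shift hf hx ξ h2
      rw [hTs, h1] at h4
      have h5 := ha2 ξ
      rw [h1] at h5
      have h6 : B' * ‖ξ‖ ^ 2 ≤ B' * a ^ 2 := mul_le_mul_of_nonneg_left (by linarith) hB'0
      refine (h4.trans_le ?_)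
      linarith

theorem isSummable_shift (hf : MDifferentiable (𝓡 d) (𝓡 d) f) {x : Orbit f}
    (hx : IsSummable d x) : IsSummable d x.shift := by
  obtain ⟨h1, P, hP, hu⟩ := hx
  set T : TangentSpace (𝓡 d) (x.pt 0) ≃ₗ[ℝ] TangentSpace (𝓡 d) (x.shift.pt 0) :=
    (stepEquiv (h1 0)).toLinearEquiv
  refine ⟨fun n => h1 (n + 1), ⟨P.1.map T.toLinearMap, P.2.map T.toLinearMap⟩,
    (isSummableSplitting_shift hf h1 _ _).2 hP, fun P' hP' => ?_⟩
  have h2 : ∀ W : Submodule ℝ (TangentSpace (𝓡 d) (x.shift.pt 0)),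
      (W.map T.symm.toLinearMap).map T.toLinearMap = W := fun W =>
    (Submodule.orderIsoMapComap T).apply_symm_apply W |>.symm ▸ by
      rw [← Submodule.map_comp]; simp
  have h3 := hu ⟨P'.1.map T.symm.toLinearMap, P'.2.map T.symm.toLinearMap⟩
    ((isSummableSplitting_shift hf h1 _ _).1 (by
      show IsSummableSplitting d x.shift ((P'.1.map T.symm.toLinearMap).map T.toLinearMap)
        ((P'.2.map T.symm.toLinearMap).map T.toLinearMap)
      rw [h2, h2]
      exact hP'))
  rw [← h3]
  exact Prod.ext (h2 P'.1).symm (h2 P'.2).symm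

theorem splitting_spec {x : Orbit f} (hx : IsSummable d x) :
    IsSummableSplitting d x (splitting d x).1 (splitting d x).2 := by
  unfold splitting
  rw [dif_pos hx]
  exact hx.2.choose_spec.1

/-- The image of the splitting is again summable, so uniqueness identifies it. -/
theorem splitting_shift (hf : MDifferentiable (𝓡 d) (𝓡 d) f) {x : Orbit f}
    (hx : IsSummable d x) :
    (splitting d x.shift).1 =
      (splitting d x).1.map (stepEquiv (hx.1 0)).toLinearEquiv.toLinearMap ∧
    (splitting d x.shift).2 =
      (splitting d x).2.map (stepEquiv (hx.1 0)).toLinearEquiv.toLinearMap := by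
  have h1 := (isSummable_shift hf hx).2.unique (y₂ := (_, _))
    (splitting_spec (isSummable_shift hf hx))
    ((isSummableSplitting_shift hf hx.1 _ _).2 (splitting_spec hx))
  exact ⟨congrArg Prod.fst h1, congrArg Prod.snd h1⟩

theorem ds_shift (hf : MDifferentiable (𝓡 d) (𝓡 d) f) {x : Orbit f}
    (hx : IsSummable d x) : ds d x.shift = ds d x := by
  unfold ds
  rw [(splitting_shift hf hx).1]
  exact LinearEquiv.finrank_map_eq (stepEquiv (hx.1 0)).toLinearEquiv _

end Orbit

/-! ### Hyperbolicity in Lyapunov coordinates -/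

/-- Only the first `k` coordinates are non-zero. -/
def IsLow (k : ℕ) (v : Euc d) : Prop := ∀ i : Fin d, k ≤ i → v i = 0

/-- The first `k` coordinates are zero. -/
def IsHigh (k : ℕ) (v : Euc d) : Prop := ∀ i : Fin d, (i : ℕ) < k → v i = 0

/-- The part of `v` in the first `k` coordinates. -/
def lowPart (k : ℕ) (v : Euc d) : Euc d := WithLp.toLp 2 fun i => if (i : ℕ) < k then v i else 0

theorem isLow_lowPart (k : ℕ) (v : Euc d) : IsLow k (lowPart k v) := fun i hi => by
  simp [lowPart, not_lt.2 hi]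

theorem isHigh_sub_lowPart (k : ℕ) (v : Euc d) : IsHigh k (v - lowPart k v) := fun i hi => by
  simp [lowPart, hi]

theorem IsLow.add_isHigh_norm {k : ℕ} {a b : Euc d} (ha : IsLow k a) (hb : IsHigh k b) :
    ‖a + b‖ ^ 2 = ‖a‖ ^ 2 + ‖b‖ ^ 2 := by
  rw [EuclideanSpace.norm_sq_eq, EuclideanSpace.norm_sq_eq, EuclideanSpace.norm_sq_eq,
    ← Finset.sum_add_distrib]
  refine Finset.sum_congr rfl fun i _ => ?_
  rcases lt_or_ge (i : ℕ) k with h | h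
  · simp [hb i h]
  · simp [ha i h]

theorem IsLow.eq_zero {k : ℕ} {a : Euc d} (ha : IsLow k a) (hb : IsHigh k a) : a = 0 := by
  ext i
  rcases lt_or_ge (i : ℕ) k with h | h
  · exact hb i h
  · exact ha i h

theorem IsLow.sub {k : ℕ} {a b : Euc d} (ha : IsLow k a) (hb : IsLow k b) : IsLow k (a - b) :=
  fun i hi => by simp [ha i hi, hb i hi]

theorem IsHigh.sub {k : ℕ} {a b : Euc d} (ha : IsHigh k a) (hb : IsHigh k b) : IsHigh k (a - b) :=
  fun i hi => by simp [ha i hi, hb i hi]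

/-- The matrix `D` of a hyperbolic linear map in Lyapunov coordinates. -/
structure LyapunovPair (k : ℕ) {p p' : M} (C : Euc d ≃L[ℝ] TangentSpace (𝓡 d) p)
    (C' : Euc d ≃L[ℝ] TangentSpace (𝓡 d) p') (D : Euc d ≃L[ℝ] Euc d) : Prop where
  low : ∀ v, IsLow k v → IsLow k (D v)
  high : ∀ v, IsHigh k v → IsHigh k (D v)
  low_norm : ∀ v, IsLow k v → ‖v‖ ^ 2 = ‖D v‖ ^ 2 + 2 * ‖C v‖ ^ 2
  high_norm : ∀ v, IsHigh k v → ‖D v‖ ^ 2 = ‖v‖ ^ 2 + 2 * ‖C' (D v)‖ ^ 2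
  norm_le : ∀ v, ‖C v‖ ≤ ‖v‖
  norm_le' : ∀ v, ‖C' v‖ ≤ ‖v‖

/-- If `c ≥ a / N`, then `b² ≤ (1 - 2N⁻²) a² ≤ (1 - N⁻²)² a²`. -/
theorem le_one_sub_inv_sq_mul {a b c N : ℝ} (ha : 0 ≤ a) (h : a ^ 2 = b ^ 2 + 2 * c ^ 2)
    (hN : 1 ≤ N) (hc : a ≤ N * c) : b ≤ (1 - (N ^ 2)⁻¹) * a := by
  have hN2 : 1 ≤ N ^ 2 := one_le_pow₀ hN
  have h1 : (N ^ 2)⁻¹ ≤ 1 := inv_le_one_of_one_le₀ hN2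
  have h2 : (N ^ 2)⁻¹ * a ^ 2 ≤ c ^ 2 := by
    rw [inv_mul_le_iff₀ (by positivity), ← mul_pow]
    exact pow_le_pow_left₀ ha hc 2
  refine le_of_sq_le_sq ?_ (mul_nonneg (by linarith) ha)
  have h3 : 0 ≤ ((N ^ 2)⁻¹ * a) ^ 2 := sq_nonneg _
  calc b ^ 2 ≤ a ^ 2 - 2 * ((N ^ 2)⁻¹ * a ^ 2) := by linarith
    _ ≤ a ^ 2 - 2 * ((N ^ 2)⁻¹ * a ^ 2) + ((N ^ 2)⁻¹ * a) ^ 2 := by linarith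
    _ = _ := by ring

namespace LyapunovPair

variable {k : ℕ} {p p' : M} {C : Euc d ≃L[ℝ] TangentSpace (𝓡 d) p}
    {C' : Euc d ≃L[ℝ] TangentSpace (𝓡 d) p'} {D : Euc d ≃L[ℝ] Euc d}

theorem one_le_invNorm (hd : 0 < d) {p : M} {C : Euc d ≃L[ℝ] TangentSpace (𝓡 d) p}
    (hC : ∀ v, ‖C v‖ ≤ ‖v‖) : 1 ≤ invNorm C := by
  have : Nonempty (Fin d) := ⟨⟨0, hd⟩⟩
  obtain ⟨v, hv⟩ := exists_norm_eq (Euc d) (zero_le_one' ℝ)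
  have h1 := norm_le_invNorm_mul C v
  have h2 := hC v
  rw [hv] at h1 h2
  exact h1.trans (mul_le_of_le_one_right (invNorm_nonneg C) h2)

theorem low_contract (h : LyapunovPair k C C' D) (hd : 0 < d) {v : Euc d} (hv : IsLow k v) :
    ‖D v‖ ≤ (1 - (invNorm C ^ 2)⁻¹) * ‖v‖ :=
  le_one_sub_inv_sq_mul (norm_nonneg _) (h.low_norm v hv)
    (one_le_invNorm hd h.norm_le) (norm_le_invNorm_mul C v)

theorem high_expand (h : LyapunovPair k C C' D) (hd : 0 < d) {v : Euc d} (hv : IsHigh k v) :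
    ‖v‖ ≤ (1 - (invNorm C' ^ 2)⁻¹) * ‖D v‖ :=
  le_one_sub_inv_sq_mul (norm_nonneg _) (h.high_norm v hv)
    (one_le_invNorm hd h.norm_le') (norm_le_invNorm_mul C' (D v))

theorem map_parts (D : Euc d ≃L[ℝ] Euc d) (k : ℕ) (v : Euc d) :
    D v = D (lowPart k v) + D (v - lowPart k v) := by
  rw [map_sub]; abel

/-- The high part of the preimage is mapped to a vector that is both high and low, hence zero, and
`D` is injective. -/
theorem low_symm (h : LyapunovPair k C C' D) {w : Euc d} (hw : IsLow k w) :
    IsLow k (D.symm w) := by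
  obtain ⟨v, rfl⟩ := D.surjective w
  rw [D.symm_apply_apply]
  have h1 := h.high _ (isHigh_sub_lowPart k v)
  have h2 := hw.sub (h.low _ (isLow_lowPart k v))
  rw [map_parts D k v, add_sub_cancel_left] at h2
  have h3 : v - lowPart k v = 0 := D.injective (by rw [h2.eq_zero h1, map_zero])
  rw [sub_eq_zero.1 h3]
  exact isLow_lowPart k v

theorem high_symm (h : LyapunovPair k C C' D) {w : Euc d} (hw : IsHigh k w) :
    IsHigh k (D.symm w) := by
  obtain ⟨v, rfl⟩ := D.surjective w
  rw [D.symm_apply_apply]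
  have h1 := h.low _ (isLow_lowPart k v)
  have h2 := hw.sub (h.high _ (isHigh_sub_lowPart k v))
  rw [map_parts D k v, add_sub_cancel_right] at h2
  have h3 : lowPart k v = 0 := D.injective (by rw [h1.eq_zero h2, map_zero])
  have := isHigh_sub_lowPart k v
  rwa [h3, sub_zero] at this

theorem norm_sq_eq (k : ℕ) (v : Euc d) :
    ‖v‖ ^ 2 = ‖lowPart k v‖ ^ 2 + ‖v - lowPart k v‖ ^ 2 := by
  rw [← (isLow_lowPart k v).add_isHigh_norm (isHigh_sub_lowPart k v), add_sub_cancel]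

theorem norm_sq_map (h : LyapunovPair k C C' D) (v : Euc d) :
    ‖D v‖ ^ 2 = ‖D (lowPart k v)‖ ^ 2 + ‖D (v - lowPart k v)‖ ^ 2 := by
  rw [map_parts D k v]
  exact (h.low _ (isLow_lowPart k v)).add_isHigh_norm (h.high _ (isHigh_sub_lowPart k v))

/-- The stable part does not grow. The unstable part gains only the term `2‖C' D b‖²`, which the
Riemannian bound `Λ` controls by `2Λ²‖b‖²`. -/
theorem norm_map_le (h : LyapunovPair k C C' D) {Λ : ℝ} (hΛ : 1 ≤ Λ)
    (hΛ' : ∀ v, ‖C' (D v)‖ ≤ Λ * ‖C v‖) (v : Euc d) : ‖D v‖ ≤ 2 * Λ * ‖v‖ := by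
  have h1 := h.norm_sq_map v
  have h2 := norm_sq_eq k v
  have h3 := h.low_norm _ (isLow_lowPart k v)
  have h4 := h.high_norm _ (isHigh_sub_lowPart k v)
  set a := lowPart k v
  set b := v - lowPart k v
  have h5 : ‖C' (D b)‖ ^ 2 ≤ Λ ^ 2 * ‖b‖ ^ 2 := by
    rw [← mul_pow]
    exact pow_le_pow_left₀ (norm_nonneg _) ((hΛ' b).trans (by gcongr; exact h.norm_le b)) 2
  have hΛ2 : 1 ≤ Λ ^ 2 := one_le_pow₀ hΛ
  refine le_of_sq_le_sq ?_ (by positivity)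
  nlinarith [sq_nonneg ‖C a‖, sq_nonneg ‖a‖, sq_nonneg ‖b‖,
    mul_nonneg (by linarith : (0 : ℝ) ≤ Λ ^ 2 - 1) (sq_nonneg ‖b‖),
    mul_nonneg (by linarith : (0 : ℝ) ≤ Λ ^ 2 - 1) (sq_nonneg ‖a‖)]

theorem norm_le_map (h : LyapunovPair k C C' D) {Λ : ℝ} (hΛ : 1 ≤ Λ)
    (hΛ' : ∀ v, ‖C v‖ ≤ Λ * ‖C' (D v)‖) (v : Euc d) : ‖v‖ ≤ 2 * Λ * ‖D v‖ := by
  have h1 := h.norm_sq_map v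
  have h2 := norm_sq_eq k v
  have h3 := h.low_norm _ (isLow_lowPart k v)
  have h4 := h.high_norm _ (isHigh_sub_lowPart k v)
  set a := lowPart k v
  set b := v - lowPart k v
  have h5 : ‖C a‖ ^ 2 ≤ Λ ^ 2 * ‖D a‖ ^ 2 := by
    rw [← mul_pow]
    exact pow_le_pow_left₀ (norm_nonneg _) ((hΛ' a).trans (by gcongr; exact h.norm_le' _)) 2
  have hΛ2 : 1 ≤ Λ ^ 2 := one_le_pow₀ hΛ
  refine le_of_sq_le_sq ?_ (by positivity)
  nlinarith [sq_nonneg ‖C' (D b)‖, sq_nonneg ‖D a‖, sq_nonneg ‖D b‖,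
    mul_nonneg (by linarith : (0 : ℝ) ≤ Λ ^ 2 - 1) (sq_nonneg ‖D b‖),
    mul_nonneg (by linarith : (0 : ℝ) ≤ Λ ^ 2 - 1) (sq_nonneg ‖D a‖)]

/-- A detour through Lyapunov coordinates: one factor `2Λ` for `D`, and one factor `Λ` for the
return to the Riemannian norm at the image point. -/
theorem invNorm_le (h : LyapunovPair k C C' D) {Λ : ℝ} (hΛ : 1 ≤ Λ)
    (hΛ1 : ∀ v, ‖C' (D v)‖ ≤ Λ * ‖C v‖) (hΛ2 : ∀ v, ‖C v‖ ≤ Λ * ‖C' (D v)‖) :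
    invNorm C' ≤ 2 * Λ ^ 2 * invNorm C := by
  have h0 := invNorm_nonneg C
  refine ContinuousLinearMap.opNorm_le_bound _ (by positivity) fun η => ?_
  obtain ⟨w, rfl⟩ := C'.surjective η
  obtain ⟨v, rfl⟩ := D.surjective w
  show ‖C'.symm (C' (D v))‖ ≤ _
  rw [C'.symm_apply_apply]
  calc ‖D v‖ ≤ 2 * Λ * (invNorm C * ‖C v‖) :=
        (h.norm_map_le hΛ hΛ1 v).trans (by gcongr; exact norm_le_invNorm_mul C v)
    _ ≤ 2 * Λ * (invNorm C * (Λ * ‖C' (D v)‖)) := by gcongr; exact hΛ2 v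
    _ = _ := by ring

theorem invNorm_le' (h : LyapunovPair k C C' D) {Λ : ℝ} (hΛ : 1 ≤ Λ)
    (hΛ1 : ∀ v, ‖C' (D v)‖ ≤ Λ * ‖C v‖) (hΛ2 : ∀ v, ‖C v‖ ≤ Λ * ‖C' (D v)‖) :
    invNorm C ≤ 2 * Λ ^ 2 * invNorm C' := by
  have h0 := invNorm_nonneg C'
  refine ContinuousLinearMap.opNorm_le_bound _ (by positivity) fun η => ?_
  obtain ⟨v, rfl⟩ := C.surjective η
  show ‖C.symm (C v)‖ ≤ _
  rw [C.symm_apply_apply]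
  calc ‖v‖ ≤ 2 * Λ * (invNorm C' * ‖C' (D v)‖) :=
        (h.norm_le_map hΛ hΛ2 v).trans (by gcongr; exact norm_le_invNorm_mul C' (D v))
    _ ≤ 2 * Λ * (invNorm C' * (Λ * ‖C v‖)) := by gcongr; exact hΛ1 v
    _ = _ := by ring

end LyapunovPair

namespace Orbit

variable {f : M → M}

theorem lyapInner_self_stable {x : Orbit f} {ξ : TangentSpace (𝓡 d) (x.pt 0)}
    (h : ξ ∈ (splitting d x).1) : lyapInner d x ξ ξ = 2 * ∑' m : ℕ, ‖fwd d x m ξ‖ ^ 2 := by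
  have h1 : stableProj d x ξ = ξ := Submodule.projection_apply_left (splitting_isCompl d x) ⟨ξ, h⟩
  have h2 : unstableProj d x ξ = 0 :=
    Submodule.projection_apply_right (splitting_isCompl d x).symm ⟨ξ, h⟩
  have h3 : ∀ m, bwd d x m 0 = 0 := fun m => by simp [bwd]
  unfold lyapInner
  rw [h1, h2]
  simp only [h3, inner_zero_left, tsum_zero, mul_zero, add_zero, real_inner_self_eq_norm_sq]

theorem lyapInner_self_unstable {x : Orbit f} {ξ : TangentSpace (𝓡 d) (x.pt 0)}
    (h : ξ ∈ (splitting d x).2) : lyapInner d x ξ ξ = 2 * ∑' m : ℕ, ‖bwd d x m ξ‖ ^ 2 := by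
  have h1 : unstableProj d x ξ = ξ :=
    Submodule.projection_apply_left (splitting_isCompl d x).symm ⟨ξ, h⟩
  have h2 : stableProj d x ξ = 0 :=
    Submodule.projection_apply_right (splitting_isCompl d x) ⟨ξ, h⟩
  have h3 : ∀ m, fwd d x m 0 = 0 := fun m => by simp [fwd]
  unfold lyapInner
  rw [h1, h2]
  simp only [h3, inner_zero_left, tsum_zero, mul_zero, zero_add, real_inner_self_eq_norm_sq]

theorem summable_stable {x : Orbit f} (hx : IsSummable d x) {ξ : TangentSpace (𝓡 d) (x.pt 0)}
    (h : ξ ∈ (splitting d x).1) : Summable fun m : ℕ => ‖fwd d x m ξ‖ ^ 2 := by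
  obtain ⟨-, ⟨B, hB⟩, -⟩ := splitting_spec hx
  obtain ⟨B', -, hB'⟩ := exists_homogeneous_bound
    (N := fun m ξ => ‖fwd d x m ξ‖) (norm_fwd_smul x) hB
  exact (hB' ξ h).1

theorem summable_unstable {x : Orbit f} (hx : IsSummable d x) {ξ : TangentSpace (𝓡 d) (x.pt 0)}
    (h : ξ ∈ (splitting d x).2) : Summable fun m : ℕ => ‖bwd d x m ξ‖ ^ 2 := by
  obtain ⟨-, -, ⟨B, hB⟩⟩ := splitting_spec hx
  obtain ⟨B', -, hB'⟩ := exists_homogeneous_bound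
    (N := fun m ξ => ‖bwd d x m ξ‖) (norm_bwd_smul x) hB
  exact (hB' ξ h).1

variable {x : Orbit f} {C : Euc d ≃L[ℝ] TangentSpace (𝓡 d) (x.pt 0)}

theorem IsLyapunovFrame.mem_stable_iff (hC : IsLyapunovFrame d x C) {v : Euc d} :
    C v ∈ (splitting d x).1 ↔ IsLow (ds d x) v := by
  rw [← SetLike.mem_coe, ← hC.stable, C.injective.mem_set_image]
  exact Iff.rfl

theorem IsLyapunovFrame.mem_unstable_iff (hC : IsLyapunovFrame d x C) {v : Euc d} :
    C v ∈ (splitting d x).2 ↔ IsHigh (ds d x) v := by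
  rw [← SetLike.mem_coe, ← hC.unstable, C.injective.mem_set_image]
  exact Iff.rfl

theorem IsLyapunovFrame.norm_sq_low (hC : IsLyapunovFrame d x C) {v : Euc d}
    (hv : IsLow (ds d x) v) : ‖v‖ ^ 2 = 2 * ∑' m : ℕ, ‖fwd d x m (C v)‖ ^ 2 := by
  rw [← lyapInner_self_stable (hC.mem_stable_iff.2 hv), hC.inner_eq, real_inner_self_eq_norm_sq]

theorem IsLyapunovFrame.norm_sq_high (hC : IsLyapunovFrame d x C) {v : Euc d}
    (hv : IsHigh (ds d x) v) : ‖v‖ ^ 2 = 2 * ∑' m : ℕ, ‖bwd d x m (C v)‖ ^ 2 := by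
  rw [← lyapInner_self_unstable (hC.mem_unstable_iff.2 hv), hC.inner_eq,
    real_inner_self_eq_norm_sq]

/-- The factor `2` in the Lyapunov product pays for the missing orthogonality of the splitting. The
terms `m = 0` give `2‖Ca‖² ≤ ‖a‖²` and `2‖Cb‖² ≤ ‖b‖²`, and `(‖Ca‖ + ‖Cb‖)² ≤ 2‖Ca‖² + 2‖Cb‖²`. -/
theorem IsLyapunovFrame.norm_le (hC : IsLyapunovFrame d x C) (hx : IsSummable d x) (v : Euc d) :
    ‖C v‖ ≤ ‖v‖ := by
  set a := lowPart (ds d x) v with ha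
  set b := v - a with hb
  have la : IsLow (ds d x) a := isLow_lowPart _ v
  have lb : IsHigh (ds d x) b := isHigh_sub_lowPart _ v
  have h1 : 2 * ‖C a‖ ^ 2 ≤ ‖a‖ ^ 2 := by
    rw [hC.norm_sq_low la]
    have := (summable_stable hx (hC.mem_stable_iff.2 la)).le_tsum 0 fun _ _ => sq_nonneg _
    rw [norm_fwd_zero] at this
    linarith
  have h2 : 2 * ‖C b‖ ^ 2 ≤ ‖b‖ ^ 2 := by
    rw [hC.norm_sq_high lb]
    have := (summable_unstable hx (hC.mem_unstable_iff.2 lb)).le_tsum 0 fun _ _ => sq_nonneg _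
    rw [norm_bwd_zero] at this
    linarith
  have h3 := LyapunovPair.norm_sq_eq (ds d x) v
  have h4 : ‖C v‖ ≤ ‖C a‖ + ‖C b‖ := by
    have : C v = C a + C b := by rw [← map_add, hb, add_sub_cancel]
    rw [this]
    exact norm_add_le _ _
  refine le_of_sq_le_sq ?_ (norm_nonneg _)
  have h5 : ‖C v‖ ^ 2 ≤ (‖C a‖ + ‖C b‖) ^ 2 := pow_le_pow_left₀ (norm_nonneg _) h4 2
  rw [h3]
  nlinarith [sq_nonneg (‖C a‖ - ‖C b‖)]

theorem lyapunovPair (hf : MDifferentiable (𝓡 d) (𝓡 d) f) (hx : IsSummable d x)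
    (hC : IsLyapunovFrame d x C) {C' : Euc d ≃L[ℝ] TangentSpace (𝓡 d) (x.shift.pt 0)}
    (hC' : IsLyapunovFrame d x.shift C') :
    LyapunovPair (ds d x) C C' ((C.trans (stepEquiv (hx.1 0))).trans C'.symm) := by
  set D := (C.trans (stepEquiv (hx.1 0))).trans C'.symm with hD
  have hCD : ∀ v, C' (D v) = x.step (C v) := fun v => C'.apply_symm_apply _
  have hds := ds_shift hf hx
  have hlow : ∀ v, IsLow (ds d x) v → IsLow (ds d x) (D v) := by
    intro v hv
    have h1 := hC'.mem_stable_iff (v := D v)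
    rw [hds] at h1
    rw [← h1, hCD, (splitting_shift hf hx).1]
    exact Submodule.mem_map_of_mem (hC.mem_stable_iff.2 hv)
  have hhigh : ∀ v, IsHigh (ds d x) v → IsHigh (ds d x) (D v) := by
    intro v hv
    have h1 := hC'.mem_unstable_iff (v := D v)
    rw [hds] at h1
    rw [← h1, hCD, (splitting_shift hf hx).2]
    exact Submodule.mem_map_of_mem (hC.mem_unstable_iff.2 hv)
  refine ⟨hlow, hhigh, fun v hv => ?_, fun v hv => ?_, hC.norm_le hx,
    hC'.norm_le (isSummable_shift hf hx)⟩
  · have h1 := hC'.norm_sq_low (v := D v) (by rw [hds]; exact hlow v hv)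
    rw [h1, hC.norm_sq_low hv, tsum_fwd_shift hf x _ (summable_stable hx (hC.mem_stable_iff.2 hv)),
      hCD]
    ring
  · have h1 := hC'.norm_sq_high (v := D v) (by rw [hds]; exact hhigh v hv)
    rw [h1, hC.norm_sq_high hv, hCD,
      tsum_bwd_shift hf hx.1 _ (summable_unstable hx (hC.mem_unstable_iff.2 hv))]
    ring

end Orbit

/-! ### Inequalities between window sizes, hyperbolicity margins and errors -/

/-- The inequalities between the numerical data of two consecutive charts. -/
structure ScaleBounds (β γ Γ L K Λ₀ N N' Nq P Q η₁ η₂ μ s : ℝ) : Prop where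
  β_pos : 0 < β
  β_le : β ≤ 1
  γ_ge : 1 ≤ γ
  Γ_pos : 0 < Γ
  one_le_L : 1 ≤ L
  one_le_K : 1 ≤ K
  one_le_Λ₀ : 1 ≤ Λ₀
  one_le_N : 1 ≤ N
  one_le_N' : 1 ≤ N'
  Nq_nonneg : 0 ≤ Nq
  N'_le : N' ≤ 8 * Λ₀ ^ 2 * N
  Nq_le : Nq ≤ 2 * N'
  N'_le_Nq : N' ≤ 2 * Nq
  η₁_pos : 0 < η₁
  η₂_pos : 0 < η₂
  η₁_le : η₁ ≤ P
  η₂_le : η₂ ≤ Q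
  P_le : P ≤ 1
  Q_le : Q ≤ 1
  P_rpow : P ^ (β / 2) * (Λ₀ ^ 4 * N ^ 20) ≤ μ
  μ_nonneg : 0 ≤ μ
  μ_le : 10 ^ 12 * (L * K) * μ ≤ 1
  s_le : 1000 * (Γ * s) ≤ 1
  P_root : P ^ (1 / γ) ≤ s * (N ^ 2)⁻¹
  Q_root : Q ^ (1 / γ) ≤ s * (Nq ^ 2)⁻¹
  Q_le_P : Q ≤ P * Real.exp (Γ * P ^ (1 / γ))
  η₁_le_η₂ : η₁ ≤ η₂ * Real.exp (Γ * η₂ ^ (1 / γ))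
  η₂_le_η₁ : η₂ ≤ η₁ * Real.exp (Γ * η₁ ^ (1 / γ))

namespace ScaleBounds

theorem rpow_two_mul {x e : ℝ} (hx : 0 ≤ x) : x ^ (2 * e) = (x ^ e) ^ 2 := by
  rw [mul_comm, Real.rpow_mul hx]
  exact Real.rpow_natCast _ 2

theorem mul_rpow_le {c x e : ℝ} (hc : 1 ≤ c) (hx : 0 ≤ x) (he : e ≤ 1) :
    (c * x) ^ e ≤ c * x ^ e := by
  rw [Real.mul_rpow (by linarith) hx]
  refine mul_le_mul_of_nonneg_right ?_ (by positivity)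
  conv_rhs => rw [← Real.rpow_one c]
  exact Real.rpow_le_rpow_of_exponent_le hc he

theorem exp_le_one_add {x : ℝ} (h0 : 0 ≤ x) (h1 : x ≤ 1 / 2) : Real.exp x ≤ 1 + 2 * x := by
  have h2 := Real.exp_bound' h0 (h1.trans (by norm_num)) (n := 2) (by norm_num)
  simp [Finset.sum_range_succ, Nat.factorial] at h2
  nlinarith

variable {β γ Γ L K Λ₀ N N' Nq P Q η₁ η₂ μ s : ℝ}

theorem P_pos (h : ScaleBounds β γ Γ L K Λ₀ N N' Nq P Q η₁ η₂ μ s) : 0 < P :=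
  h.η₁_pos.trans_le h.η₁_le

theorem s_nonneg (h : ScaleBounds β γ Γ L K Λ₀ N N' Nq P Q η₁ η₂ μ s) : 0 ≤ s := by
  have h1 : 0 ≤ s * (N ^ 2)⁻¹ := le_trans (Real.rpow_nonneg h.P_pos.le _) h.P_root
  have h2 : 0 < N := by linarith [h.one_le_N]
  by_contra hs
  have : s * (N ^ 2)⁻¹ < 0 := mul_neg_of_neg_of_pos (not_le.1 hs) (by positivity)
  linarith

theorem κ_pos (h : ScaleBounds β γ Γ L K Λ₀ N N' Nq P Q η₁ η₂ μ s) : 0 < (N ^ 2)⁻¹ := by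
  have h2 : 0 < N := by linarith [h.one_le_N]
  positivity

theorem κ_le (h : ScaleBounds β γ Γ L K Λ₀ N N' Nq P Q η₁ η₂ μ s) : (N ^ 2)⁻¹ ≤ 1 :=
  inv_le_one_of_one_le₀ (one_le_pow₀ h.one_le_N)

theorem κ'_pos (h : ScaleBounds β γ Γ L K Λ₀ N N' Nq P Q η₁ η₂ μ s) : 0 < (N' ^ 2)⁻¹ := by
  have h2 : 0 < N' := by linarith [h.one_le_N']
  positivity

theorem κ'_le (h : ScaleBounds β γ Γ L K Λ₀ N N' Nq P Q η₁ η₂ μ s) : (N' ^ 2)⁻¹ ≤ 1 :=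
  inv_le_one_of_one_le₀ (one_le_pow₀ h.one_le_N')

theorem η₂_le_two_mul (h : ScaleBounds β γ Γ L K Λ₀ N N' Nq P Q η₁ η₂ μ s) : η₂ ≤ 2 * η₁ := by
  have h1 : η₁ ^ (1 / γ) ≤ P ^ (1 / γ) :=
    Real.rpow_le_rpow h.η₁_pos.le h.η₁_le (by have := h.γ_ge; positivity)
  have h2 : s * (N ^ 2)⁻¹ ≤ s := mul_le_of_le_one_right h.s_nonneg h.κ_le
  have h3 : Γ * η₁ ^ (1 / γ) ≤ Γ * s :=
    mul_le_mul_of_nonneg_left (h1.trans (h.P_root.trans h2)) h.Γ_pos.le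
  have h4 : 0 ≤ Γ * η₁ ^ (1 / γ) := mul_nonneg h.Γ_pos.le (Real.rpow_nonneg h.η₁_pos.le _)
  have h5 := exp_le_one_add h4 (by linarith [h.s_le])
  have h6 := h.s_le
  refine h.η₂_le_η₁.trans ?_
  rw [mul_comm]
  exact mul_le_mul_of_nonneg_right (by linarith) h.η₁_pos.le

/-- The exponent `2γ` in the definition of `Q` matches the exponent `1/γ` in the ladder: `P ^ (1 /
γ) ≤ s N⁻²`. So one step of the ladder costs only a small fraction of the margin `κ = N⁻²`. -/
theorem exp_η₂_le (h : ScaleBounds β γ Γ L K Λ₀ N N' Nq P Q η₁ η₂ μ s) :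
    Real.exp (Γ * η₂ ^ (1 / γ)) ≤ 1 + (N ^ 2)⁻¹ / 200 := by
  have hγ := h.γ_ge
  have h1 : η₂ ^ (1 / γ) ≤ (2 * P) ^ (1 / γ) :=
    Real.rpow_le_rpow h.η₂_pos.le (h.η₂_le_two_mul.trans (by linarith [h.η₁_le])) (by positivity)
  have h2 : (2 * P) ^ (1 / γ) ≤ 2 * P ^ (1 / γ) :=
    mul_rpow_le one_le_two h.P_pos.le ((div_le_one (by linarith)).2 hγ)
  have h3 : Γ * η₂ ^ (1 / γ) ≤ Γ * (2 * (s * (N ^ 2)⁻¹)) :=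
    mul_le_mul_of_nonneg_left (by linarith [h.P_root]) h.Γ_pos.le
  have h4 : 0 ≤ Γ * η₂ ^ (1 / γ) := mul_nonneg h.Γ_pos.le (Real.rpow_nonneg h.η₂_pos.le _)
  have h5 : 1000 * (Γ * s) * (N ^ 2)⁻¹ ≤ 1 * (N ^ 2)⁻¹ :=
    mul_le_mul_of_nonneg_right h.s_le h.κ_pos.le
  have h7 := h.κ_le
  have h8 : Γ * η₂ ^ (1 / γ) ≤ (N ^ 2)⁻¹ / 500 := by
    refine h3.trans ?_
    linarith
  have h6 := exp_le_one_add h4 (by linarith)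
  linarith [h.κ_pos]

theorem η₁_le_mul (h : ScaleBounds β γ Γ L K Λ₀ N N' Nq P Q η₁ η₂ μ s) :
    η₁ ≤ η₂ * (1 + (N ^ 2)⁻¹ / 200) :=
  h.η₁_le_η₂.trans (mul_le_mul_of_nonneg_left h.exp_η₂_le h.η₂_pos.le)

/-- The relevant margin is `N'⁻²`. Only the case `P < Q` needs an argument, and there `P ^ (1 / γ) ≤
Q ^ (1 / γ) ≤ s Nq⁻²`, with `Nq` comparable to `N'`. -/
theorem Q_le_mul (h : ScaleBounds β γ Γ L K Λ₀ N N' Nq P Q η₁ η₂ μ s) :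
    Q ≤ P * (1 + (N' ^ 2)⁻¹ / 10) := by
  have hP := h.P_pos
  have hκ := h.κ'_pos
  have hκ1 := h.κ'_le
  rcases le_or_gt Q P with hQ | hQ
  · exact hQ.trans (le_mul_of_one_le_right hP.le (by linarith))
  have hγ := h.γ_ge
  have hN' := h.one_le_N'
  have hq : 0 < Nq := by linarith [h.N'_le_Nq]
  have h1 : P ^ (1 / γ) ≤ Q ^ (1 / γ) := Real.rpow_le_rpow hP.le hQ.le (by positivity)
  have h2 : (Nq ^ 2)⁻¹ ≤ 4 * (N' ^ 2)⁻¹ := by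
    have h3 : N' ^ 2 ≤ (2 * Nq) ^ 2 := pow_le_pow_left₀ (by linarith) h.N'_le_Nq 2
    rw [← div_eq_mul_inv, le_div_iff₀ (by positivity), inv_mul_le_iff₀ (by positivity)]
    linarith
  have h3 : s * (Nq ^ 2)⁻¹ ≤ s * (4 * (N' ^ 2)⁻¹) := mul_le_mul_of_nonneg_left h2 h.s_nonneg
  have h4 : Γ * P ^ (1 / γ) ≤ Γ * (s * (4 * (N' ^ 2)⁻¹)) :=
    mul_le_mul_of_nonneg_left (h1.trans (h.Q_root.trans h3)) h.Γ_pos.le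
  have h5 : 1000 * (Γ * s) * (N' ^ 2)⁻¹ ≤ 1 * (N' ^ 2)⁻¹ :=
    mul_le_mul_of_nonneg_right h.s_le hκ.le
  have h6 : Γ * P ^ (1 / γ) ≤ (N' ^ 2)⁻¹ / 250 := by linarith
  have h7 : 0 ≤ Γ * P ^ (1 / γ) := mul_nonneg h.Γ_pos.le (Real.rpow_nonneg hP.le _)
  have h8 := exp_le_one_add h7 (by linarith)
  exact h.Q_le_P.trans (mul_le_mul_of_nonneg_left (by linarith) hP.le)

/-- The smallness of `P ^ (β / 2)` in all the forms that are used. -/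
theorem rpow_bounds (h : ScaleBounds β γ Γ L K Λ₀ N N' Nq P Q η₁ η₂ μ s) :
    ∃ X : ℝ, P ^ (β / 2) = X ∧ P ^ β = X ^ 2 ∧ 0 < X ∧ P ≤ X ^ 2 ∧
      X * (Λ₀ ^ 4 * N ^ 3) ≤ μ ∧ X * (Λ₀ ^ 4 * N ^ 3) ≤ 1 ∧ μ ≤ 1 := by
  have hP := h.P_pos
  have hβ := h.β_le
  have hΛ := h.one_le_Λ₀
  have hN := h.one_le_N
  have hLK : 1 ≤ L * K := one_le_mul_of_one_le_of_one_le h.one_le_L h.one_le_K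
  have hμ1 : μ ≤ 1 := by nlinarith [h.μ_le, h.μ_nonneg]
  have h1 : P ^ β = (P ^ (β / 2)) ^ 2 := by
    rw [← rpow_two_mul hP.le]; congr 1; ring
  have h2 : P ≤ P ^ β := by
    conv_lhs => rw [← Real.rpow_one P]
    exact Real.rpow_le_rpow_of_exponent_ge hP h.P_le hβ
  have hX : 0 < P ^ (β / 2) := by positivity
  have h3 : P ^ (β / 2) * (Λ₀ ^ 4 * N ^ 3) ≤ μ := by
    refine le_trans ?_ h.P_rpow
    gcongr
    norm_num
  exact ⟨_, rfl, h1, hX, h2.trans_eq h1, h3, h3.trans hμ1, hμ1⟩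

end ScaleBounds

namespace ScaleBounds

variable {β γ Γ L K Λ₀ N N' Nq P Q η₁ η₂ μ s : ℝ}

/-- All additions to the target radius amount to a factor of at most `1 + κ'/2`, and `(1 - κ')(1 +
κ'/2) < 1`. -/
theorem cover_aux {κ' w P Q t lam η : ℝ} (hκ : 0 < κ') (hκ1 : κ' ≤ 1) (hP : 0 < P) (hw : 0 < w)
    (hQ : Q ≤ P * (1 + κ' / 10)) (hη : 0 < η) (hη1 : η ≤ 1) (hηP : η ≤ 2 * P)
    (ht : t ≤ 1 / 10 ^ 6 * (w * η ^ 2))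
    (hl : lam ≤ 1 / 10 ^ 6 * w) (hwκ : w ≤ 64 * κ') : (1 - κ') * (Q + t + 2 * lam * P) < P := by
  have h0 : w * η ^ 2 ≤ w * η := by
    refine mul_le_mul_of_nonneg_left ?_ hw.le
    rw [pow_two]
    exact mul_le_of_le_one_left hη.le hη1
  have h1 : w * η ≤ 64 * κ' * (2 * P) := by gcongr
  have h2 : lam * P ≤ 1 / 10 ^ 6 * (64 * κ') * P :=
    mul_le_mul_of_nonneg_right (by linarith) hP.le
  have h5 : 0 < P * κ' := mul_pos hP hκ
  have h3 : Q + t + 2 * lam * P ≤ P * (1 + κ' / 2) := by linarith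
  have h4 : (1 - κ') * (Q + t + 2 * lam * P) ≤ (1 - κ') * (P * (1 + κ' / 2)) :=
    mul_le_mul_of_nonneg_left h3 (by linarith)
  have h6 : 0 ≤ P * κ' * κ' := by positivity
  linarith

/-- Passing from `η₁²` to `η₂²` costs a factor `1 + κ/10`, which `1 - κ` absorbs; all other terms
are small multiples of `κ η₂²`. -/
theorem zero_aux {κ w e t lam η₁ η₂ : ℝ} (hκ : 0 < κ) (hκ1 : κ ≤ 1) (hw : 0 < w) (hwκ : w ≤ κ)
    (hη₁ : 0 < η₁) (hη₂ : 0 < η₂) (hη : η₁ ≤ η₂ * (1 + κ / 200)) (ht0 : 0 ≤ t)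
    (ht : t ≤ 1 / 10 ^ 6 * (w * η₂ ^ 2)) (hl : lam ≤ 1 / 10 ^ 6 * w)
    (he : e ≤ 4 / 10 ^ 7 * (w * η₂ ^ 2)) (hz : η₁ ^ 2 / 1000 + 3 / 2 * t ≤ η₂ ^ 2) :
    e + (1 - κ) * (η₁ ^ 2 / 1000 + t / 2) + lam * (η₁ ^ 2 / 1000 + 3 / 2 * t) ≤
      η₂ ^ 2 / 1000 := by
  have h60 : 0 < η₂ ^ 2 := by positivity
  have h1 : η₁ ^ 2 ≤ η₂ ^ 2 * (1 + κ / 10) := by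
    calc η₁ ^ 2 ≤ (η₂ * (1 + κ / 200)) ^ 2 := pow_le_pow_left₀ hη₁.le hη 2
      _ = η₂ ^ 2 * (1 + κ / 200) ^ 2 := by ring
      _ ≤ _ := mul_le_mul_of_nonneg_left (by nlinarith) h60.le
  have h2 : (1 - κ) * η₁ ^ 2 ≤ (1 - κ) * (η₂ ^ 2 * (1 + κ / 10)) :=
    mul_le_mul_of_nonneg_left h1 (by linarith)
  have h3 : (1 - κ) * t ≤ t := mul_le_of_le_one_left ht0 (by linarith)
  have h4 : lam * (η₁ ^ 2 / 1000 + 3 / 2 * t) ≤ 1 / 10 ^ 6 * w * η₂ ^ 2 :=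
    mul_le_mul hl hz (by positivity) (by positivity)
  have h5 : w * η₂ ^ 2 ≤ κ * η₂ ^ 2 := mul_le_mul_of_nonneg_right hwκ h60.le
  have h6 : 0 ≤ κ * κ * η₂ ^ 2 := by positivity
  linarith

theorem deriv_aux {κ Y y₁ y t : ℝ} (hκ : 0 < κ) (hκ1 : κ ≤ 1) (hY : 0 < Y)
    (h1 : y₁ ≤ (1 + κ / 200) * Y) (h2 : t ≤ 2 / 10 ^ 7 * κ * Y) (h3 : y ≤ 8 / 10 ^ 7 * κ * Y) :
    (1 - κ) * (1 / 2 * y₁ + 1 / 2 * t) + 3 / 2 * y ≤ 1 / 2 * Y := by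
  have h9 : (1 - κ) * (1 / 2 * y₁ + 1 / 2 * t) ≤
      (1 - κ) * (1 / 2 * ((1 + κ / 200) * Y) + 1 / 2 * (2 / 10 ^ 7 * κ * Y)) :=
    mul_le_mul_of_nonneg_left (by linarith) (by linarith)
  have h10 : 0 < κ * Y := mul_pos hκ hY
  have h11 : 0 ≤ κ * κ * Y := by positivity
  linarith

theorem Nq_le_mul (h : ScaleBounds β γ Γ L K Λ₀ N N' Nq P Q η₁ η₂ μ s) :
    Nq ≤ 16 * Λ₀ ^ 2 * N := by
  linarith [h.Nq_le, h.N'_le]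

/-- The weight `(Λ₀⁴N²)⁻¹` is, up to the constant `64`, a common lower bound for the margins `N⁻²`
and `N'⁻²`. Errors are measured against it so that contraction and expansion are served at once. -/
theorem weight_pos (h : ScaleBounds β γ Γ L K Λ₀ N N' Nq P Q η₁ η₂ μ s) :
    0 < (Λ₀ ^ 4 * N ^ 2)⁻¹ := by
  have h1 := h.one_le_Λ₀
  have h2 := h.one_le_N
  positivity

theorem weight_le_κ (h : ScaleBounds β γ Γ L K Λ₀ N N' Nq P Q η₁ η₂ μ s) :
    (Λ₀ ^ 4 * N ^ 2)⁻¹ ≤ (N ^ 2)⁻¹ := by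
  have h1 := h.one_le_Λ₀
  have h2 := h.one_le_N
  refine inv_anti₀ (by positivity) (le_mul_of_one_le_left (by positivity) (one_le_pow₀ h1))

theorem weight_le_κ' (h : ScaleBounds β γ Γ L K Λ₀ N N' Nq P Q η₁ η₂ μ s) :
    (Λ₀ ^ 4 * N ^ 2)⁻¹ ≤ 64 * (N' ^ 2)⁻¹ := by
  have h1 := h.one_le_Λ₀
  have h2 := h.one_le_N
  have h3 := h.one_le_N'
  have h4 : N' ^ 2 ≤ (8 * Λ₀ ^ 2 * N) ^ 2 := pow_le_pow_left₀ (by linarith) h.N'_le 2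
  rw [← div_eq_mul_inv, le_div_iff₀ (by positivity), inv_mul_le_iff₀ (by positivity)]
  refine h4.trans_eq (by ring)

/-- The Hölder constant satisfies `a ≤ 896 LK Λ₀⁴ N`, with `896 = 14 · 4 · 16`. One factor `X Λ₀⁴ N³
≤ μ` pays for it together with the margin, and `10¹² LK μ ≤ 1` absorbs the numerical constants. -/
theorem holder_bounds (h : ScaleBounds β γ Γ L K Λ₀ N N' Nq P Q η₁ η₂ μ s) {a X : ℝ}
    (ha : a ≤ Nq * (14 * L * K * (2 * Λ₀) ^ 2)) (hX : 0 < X)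
    (h1 : X * (Λ₀ ^ 4 * N ^ 3) ≤ μ) (h2 : X * (Λ₀ ^ 4 * N ^ 3) ≤ 1) :
    a * X ≤ 1 / 10 ^ 7 * (N ^ 2)⁻¹ ∧ a * X ^ 2 ≤ 1 / 10 ^ 7 * (Λ₀ ^ 4 * N ^ 2)⁻¹ ∧
      1152 * L * Λ₀ ^ 5 * N ^ 2 * X ^ 4 ≤ 1 / 10 ^ 7 * (Λ₀ ^ 4 * N ^ 2)⁻¹ := by
  have hΛ := h.one_le_Λ₀
  have hN := h.one_le_N
  have hL := h.one_le_L
  have hK := h.one_le_K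
  have hμ := h.μ_nonneg
  have hLK : L ≤ L * K := le_mul_of_one_le_right (by linarith) hK
  have hLKμ := h.μ_le
  have hLμ : L * μ ≤ L * K * μ := mul_le_mul_of_nonneg_right hLK hμ
  have ha1 : a ≤ 896 * (L * K) * (Λ₀ ^ 4 * N) := by
    refine ha.trans ?_
    calc Nq * (14 * L * K * (2 * Λ₀) ^ 2) ≤ 16 * Λ₀ ^ 2 * N * (14 * L * K * (2 * Λ₀) ^ 2) :=
          mul_le_mul_of_nonneg_right h.Nq_le_mul (by positivity)
      _ = _ := by ring
  refine ⟨?_, ?_, ?_⟩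
  · rw [← div_eq_mul_inv, le_div_iff₀ (by positivity)]
    calc a * X * N ^ 2 ≤ 896 * (L * K) * (Λ₀ ^ 4 * N) * X * N ^ 2 := by gcongr
      _ = 896 * (L * K) * (X * (Λ₀ ^ 4 * N ^ 3)) := by ring
      _ ≤ 896 * (L * K) * μ := by gcongr
      _ ≤ _ := by linarith
  · rw [← div_eq_mul_inv, le_div_iff₀ (by positivity)]
    have h3 : X * Λ₀ ^ 4 ≤ 1 := by
      refine le_trans ?_ h2
      refine mul_le_mul_of_nonneg_left ?_ hX.le
      exact le_mul_of_one_le_right (by positivity) (one_le_pow₀ hN)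
    calc a * X ^ 2 * (Λ₀ ^ 4 * N ^ 2) ≤
          896 * (L * K) * (Λ₀ ^ 4 * N) * X ^ 2 * (Λ₀ ^ 4 * N ^ 2) := by gcongr
      _ = 896 * (L * K) * (X * (Λ₀ ^ 4 * N ^ 3)) * (X * Λ₀ ^ 4) := by ring
      _ ≤ 896 * (L * K) * μ * 1 := by gcongr
      _ ≤ _ := by linarith
  · rw [← div_eq_mul_inv, le_div_iff₀ (by positivity)]
    calc 1152 * L * Λ₀ ^ 5 * N ^ 2 * X ^ 4 * (Λ₀ ^ 4 * N ^ 2) =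
          1152 * L * (Λ₀ ^ 9 * N ^ 4) * X ^ 4 := by ring
      _ ≤ 1152 * L * (Λ₀ ^ 16 * N ^ 12) * X ^ 4 := by
          gcongr <;> norm_num
      _ = 1152 * L * (X * (Λ₀ ^ 4 * N ^ 3)) * (X * (Λ₀ ^ 4 * N ^ 3)) ^ 3 := by ring
      _ ≤ 1152 * L * μ * 1 := by
          gcongr
          exact pow_le_one₀ (by positivity) h2
      _ ≤ _ := by linarith

set_option maxHeartbeats 1600000 in
/-- The inequalities required by the graph transform. -/
theorem hyp_bounds (h : ScaleBounds β γ Γ L K Λ₀ N N' Nq P Q η₁ η₂ μ s) {a e₀ e₁ lam H t₀ lam₀ : ℝ}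
    (ha : a = Nq * (14 * L * K * (2 * Λ₀) ^ 2)) (he₀ : e₀ = 2 * Nq * η₂ ^ 8)
    (he₁ : e₁ = 4 * L * (2 * Λ₀) * Nq * (1 + N') * η₂ ^ 8)
    (hlam : lam = e₁ + a * (2 * P) ^ β) (hH : H = a * (4 * P) ^ (β / 2))
    (ht₀ : t₀ = e₀ + lam * (η₁ ^ 2 / 1000))
    (hlam₀ : lam₀ = e₁ + a * (η₁ ^ 2 / 1000 + 3 / 2 * t₀) ^ β) :
    0 ≤ lam ∧ 0 ≤ H ∧ lam ≤ (N ^ 2)⁻¹ / 100 ∧ lam ≤ (N' ^ 2)⁻¹ / 100 ∧ H ≤ (N ^ 2)⁻¹ / 100 ∧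
    t₀ < Q ∧ (1 - (N' ^ 2)⁻¹) * (Q + t₀ + 2 * lam * P) < P ∧
    e₀ + (1 - (N ^ 2)⁻¹) * (η₁ ^ 2 / 1000 + t₀ / 2) +
      lam * (η₁ ^ 2 / 1000 + 3 / 2 * t₀) ≤ η₂ ^ 2 / 1000 ∧
    (1 - (N ^ 2)⁻¹) * (1 / 2 * η₁ ^ (β / 2) + 1 / 2 * t₀ ^ (β / 2)) + 3 / 2 * lam₀ ≤
      1 / 2 * η₂ ^ (β / 2) ∧ η₁ ^ 2 / 1000 + 3 / 2 * t₀ < 2 * P := by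
  have hΛ := h.one_le_Λ₀
  have hN := h.one_le_N
  have hN' := h.one_le_N'
  have hL := h.one_le_L
  have hK := h.one_le_K
  have hβ := h.β_pos
  have hβ1 := h.β_le
  have hNq0 := h.Nq_nonneg
  have hP := h.P_pos
  have hP1 := h.P_le
  have hQ1 := h.Q_le
  have hη₁ := h.η₁_pos
  have hη₂ := h.η₂_pos
  have hη₁P := h.η₁_le
  have hη₂Q := h.η₂_le
  obtain ⟨X, hX1, hX2, hX, hPX, hXμ, hX1', hμ1⟩ := h.rpow_bounds
  obtain ⟨b1, b2, b3⟩ := h.holder_bounds ha.le hX hXμ hX1'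
  set w := (Λ₀ ^ 4 * N ^ 2)⁻¹ with hw
  set κ := (N ^ 2)⁻¹ with hκ
  set κ' := (N' ^ 2)⁻¹ with hκ'
  have w0 : 0 < w := h.weight_pos
  have wκ : w ≤ κ := h.weight_le_κ
  have wκ' : w ≤ 64 * κ' := h.weight_le_κ'
  have κ0 : 0 < κ := h.κ_pos
  have κ1 : κ ≤ 1 := h.κ_le
  have κ'0 : 0 < κ' := h.κ'_pos
  have κ'1 : κ' ≤ 1 := h.κ'_le
  have ha0 : 0 ≤ a := by rw [ha]; positivity
  have hη₂P : η₂ ≤ 2 * P := h.η₂_le_two_mul.trans (by linarith)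
  have hη₂1 : η₂ ≤ 1 := hη₂Q.trans hQ1
  have hη₁2 : η₁ ≤ 2 * η₂ := by
    refine h.η₁_le_mul.trans ?_
    have : η₂ * (1 + κ / 200) ≤ η₂ * 2 := mul_le_mul_of_nonneg_left (by linarith) hη₂.le
    linarith
  have hηsq : η₂ ^ 2 ≤ 4 * X ^ 4 := by
    calc η₂ ^ 2 ≤ (2 * X ^ 2) ^ 2 := by gcongr; linarith
      _ = _ := by ring
  have h6' : 0 < η₂ ^ 6 := by positivity
  have h8 : η₂ ^ 8 = η₂ ^ 2 * η₂ ^ 6 := by ring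
  -- `1152 = 4 · 2 · 16 · 9` collects the constants of `e₁`, by `Nq ≤ 16Λ₀²N` and `1 + N' ≤ 9Λ₀²N`.
  -- In `η₂⁸ = η₂² η₂⁶` the first factor pays for the powers of `Λ₀` and `N`, and the second remains
  -- as the actual smallness.
  have hE : 1152 * L * Λ₀ ^ 5 * N ^ 2 * η₂ ^ 8 ≤ 4 / 10 ^ 7 * w * η₂ ^ 6 := by
    rw [h8, ← mul_assoc]
    refine mul_le_mul_of_nonneg_right ?_ h6'.le
    calc _ ≤ 1152 * L * Λ₀ ^ 5 * N ^ 2 * (4 * X ^ 4) :=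
          mul_le_mul_of_nonneg_left hηsq (by positivity)
      _ = 4 * (1152 * L * Λ₀ ^ 5 * N ^ 2 * X ^ 4) := by ring
      _ ≤ _ := by linarith
  have hΛN : 1 ≤ Λ₀ ^ 2 * N := one_le_mul_of_one_le_of_one_le (one_le_pow₀ hΛ) hN
  have e₁0 : 0 ≤ e₁ := by rw [he₁]; positivity
  have e₀0 : 0 ≤ e₀ := by rw [he₀]; positivity
  have e₁w : e₁ ≤ 4 / 10 ^ 7 * w * η₂ ^ 6 := by
    refine le_trans ?_ hE
    rw [he₁]
    refine mul_le_mul_of_nonneg_right ?_ (by positivity)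
    have h1 : 1 + N' ≤ 9 * (Λ₀ ^ 2 * N) := by linarith [h.N'_le]
    calc 4 * L * (2 * Λ₀) * Nq * (1 + N') ≤
          4 * L * (2 * Λ₀) * (16 * Λ₀ ^ 2 * N) * (9 * (Λ₀ ^ 2 * N)) := by
            gcongr
            exact h.Nq_le_mul
      _ = _ := by ring
  have e₀w : e₀ ≤ 4 / 10 ^ 7 * w * η₂ ^ 6 := by
    refine le_trans ?_ hE
    rw [he₀]
    refine mul_le_mul_of_nonneg_right ?_ (by positivity)
    have h2 : Λ₀ ^ 2 * N ≤ Λ₀ ^ 5 * N ^ 2 := by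
      have : N ≤ N ^ 2 := le_self_pow₀ hN (by norm_num)
      gcongr
      norm_num
    have h3 : Λ₀ ^ 5 * N ^ 2 ≤ L * (Λ₀ ^ 5 * N ^ 2) := le_mul_of_one_le_left (by positivity) hL
    have h4 : 0 ≤ L * (Λ₀ ^ 5 * N ^ 2) := by positivity
    linarith [h.Nq_le_mul]
  have h66 : η₂ ^ 6 ≤ η₂ ^ 2 := pow_le_pow_of_le_one hη₂.le hη₂1 (by norm_num)
  have h26 : η₂ ^ 2 ≤ η₂ := by
    have := pow_le_pow_of_le_one hη₂.le hη₂1 (show 1 ≤ 2 by norm_num)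
    linarith [pow_one η₂]
  have h60 : 0 < η₂ ^ 2 := by positivity
  have hw6 : w * η₂ ^ 6 ≤ w * η₂ ^ 2 := mul_le_mul_of_nonneg_left h66 w0.le
  have hw2 : w * η₂ ^ 2 ≤ w * η₂ := mul_le_mul_of_nonneg_left h26 w0.le
  have hw1 : w * η₂ ≤ w := mul_le_of_le_one_right w0.le hη₂1
  have hPβ : (2 * P) ^ β ≤ 2 * X ^ 2 := by
    rw [← hX2]; exact mul_rpow_le one_le_two hP.le hβ1
  have lamw : lam ≤ 1 / 10 ^ 6 * w := by
    have h1 : a * (2 * P) ^ β ≤ a * (2 * X ^ 2) := mul_le_mul_of_nonneg_left hPβ ha0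
    rw [hlam]
    linarith
  have lam0 : 0 ≤ lam := by rw [hlam]; positivity
  have H0 : 0 ≤ H := by rw [hH]; positivity
  have Hκ : H ≤ 4 / 10 ^ 7 * κ := by
    have h1 : (4 * P) ^ (β / 2) ≤ 4 * X := by
      rw [← hX1]; exact mul_rpow_le (by norm_num) hP.le (by linarith)
    have h2 : a * (4 * P) ^ (β / 2) ≤ a * (4 * X) := mul_le_mul_of_nonneg_left h1 ha0
    rw [hH]
    linarith
  have hη₁sq : η₁ ^ 2 ≤ 4 * η₂ ^ 2 := by
    calc η₁ ^ 2 ≤ (2 * η₂) ^ 2 := by gcongr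
      _ = _ := by ring
  have hlamη : lam * η₁ ^ 2 ≤ 1 / 10 ^ 6 * w * (4 * η₂ ^ 2) := by gcongr
  have t₀0 : 0 ≤ t₀ := by rw [ht₀]; positivity
  have t₀w : t₀ ≤ 1 / 10 ^ 6 * (w * η₂ ^ 2) := by
    rw [ht₀]
    linarith
  have w1 : w ≤ 1 := wκ.trans κ1
  have t₀η : t₀ ≤ 1 / 10 ^ 6 * η₂ ^ 2 := by
    refine t₀w.trans (mul_le_mul_of_nonneg_left ?_ (by norm_num))
    exact mul_le_of_le_one_left h60.le w1
  have hz : η₁ ^ 2 / 1000 + 3 / 2 * t₀ ≤ η₂ ^ 2 := by linarith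
  refine ⟨lam0, H0, by linarith only [lamw, wκ, κ0], by linarith only [lamw, wκ', κ'0],
    by linarith only [Hκ, κ0], by linarith only [t₀η, h26, hη₂Q, hη₂],
    cover_aux κ'0 κ'1 hP w0 h.Q_le_mul hη₂ hη₂1 hη₂P t₀w lamw wκ',
    zero_aux κ0 κ1 w0 wκ hη₁ hη₂ h.η₁_le_mul t₀0 t₀w lamw
      (by linarith only [e₀w, hw6]) hz, ?_, ?_⟩
  · set Y := η₂ ^ (β / 2) with hY
    have Y0 : 0 < Y := by positivity
    have Y1 : Y ≤ 1 := Real.rpow_le_one hη₂.le hη₂1 (by linarith)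
    have hYX : Y ≤ 2 * X := by
      refine (Real.rpow_le_rpow hη₂.le hη₂P (by linarith)).trans ?_
      rw [← hX1]
      exact mul_rpow_le one_le_two hP.le (by linarith)
    have h1 : η₁ ^ (β / 2) ≤ (1 + κ / 200) * Y := by
      refine (Real.rpow_le_rpow hη₁.le h.η₁_le_mul (by linarith)).trans ?_
      rw [mul_comm]
      exact mul_rpow_le (by linarith) hη₂.le (by linarith)
    have h2 : (η₂ ^ 2) ^ (β / 2) = Y ^ 2 := by
      rw [hY, ← Real.rpow_natCast, ← Real.rpow_natCast, ← Real.rpow_mul hη₂.le,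
        ← Real.rpow_mul hη₂.le, mul_comm]
    have h3 : t₀ ^ (β / 2) ≤ Y ^ 2 := by
      rw [← h2]
      exact Real.rpow_le_rpow t₀0 (by linarith) (by linarith)
    -- The relevant source point lies within `η₂²` of the origin, so the error with exponent `β` is
    -- of order `Y⁴`: one factor `Y` is kept and the others beat the constant `a`.
    have h4 : (η₁ ^ 2 / 1000 + 3 / 2 * t₀) ^ β ≤ Y ^ 2 * Y ^ 2 := by
      have e : β = 2 * (β / 2) := by ring
      calc _ ≤ (η₂ ^ 2) ^ β := Real.rpow_le_rpow (by positivity) hz hβ.le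
        _ = Y ^ 2 * Y ^ 2 := by
          rw [e, rpow_two_mul (by positivity), h2]; ring
    have hXκ : X ≤ 1 / 10 ^ 7 * κ := by
      rw [hκ, ← div_eq_mul_inv, le_div_iff₀ (by positivity)]
      have h5 : X * N ^ 2 ≤ X * (Λ₀ ^ 4 * N ^ 3) := by
        refine mul_le_mul_of_nonneg_left ?_ hX.le
        calc N ^ 2 ≤ N ^ 3 := pow_le_pow_right₀ hN (by norm_num)
          _ ≤ _ := le_mul_of_one_le_left (by positivity) (one_le_pow₀ hΛ)
      have hLK : 1 ≤ L * K := one_le_mul_of_one_le_of_one_le hL hK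
      have h6 := h.μ_le
      have h7 : 10 ^ 12 * μ ≤ 10 ^ 12 * (L * K) * μ := by
        have := mul_le_mul_of_nonneg_right hLK h.μ_nonneg
        linarith
      linarith
    have h5 : Y ^ 2 ≤ 2 / 10 ^ 7 * κ * Y := by
      rw [pow_two]; exact mul_le_mul_of_nonneg_right (by linarith) Y0.le
    have h6 : a * (η₁ ^ 2 / 1000 + 3 / 2 * t₀) ^ β ≤ 4 / 10 ^ 7 * κ * Y := by
      have h7 : Y ^ 2 ≤ 4 * X ^ 2 := by
        calc Y ^ 2 ≤ (2 * X) ^ 2 := by gcongr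
          _ = _ := by ring
      have h8 : Y ^ 2 ≤ Y := by
        rw [pow_two]; exact mul_le_of_le_one_left Y0.le Y1
      calc _ ≤ a * (Y ^ 2 * Y ^ 2) := mul_le_mul_of_nonneg_left h4 ha0
        _ ≤ a * (4 * X ^ 2 * Y) := by gcongr
        _ = 4 * (a * X ^ 2) * Y := by ring
        _ ≤ 4 * (1 / 10 ^ 7 * κ) * Y :=
          mul_le_mul_of_nonneg_right (by linarith only [b2, wκ]) Y0.le
        _ = _ := by ring
    have h7 : η₂ ^ 6 ≤ Y := by
      have h8 : η₂ ^ 6 ≤ η₂ := by linarith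
      refine h8.trans ?_
      conv_lhs => rw [← Real.rpow_one η₂]
      exact Real.rpow_le_rpow_of_exponent_ge hη₂ hη₂1 (by linarith)
    have h8 : e₁ ≤ 4 / 10 ^ 7 * κ * Y := by
      exact e₁w.trans (mul_le_mul (by linarith only [wκ]) h7 h6'.le (by linarith only [κ0]))
    refine deriv_aux κ0 κ1 Y0 h1 (h3.trans h5) ?_
    rw [hlam₀]
    linarith only [h6, h8]
  · have : η₂ ^ 2 ≤ η₂ := h26
    have h1 : η₁ ^ 2 ≤ η₁ := by
      have := pow_le_pow_of_le_one hη₁.le (hη₁P.trans hP1) (show 1 ≤ 2 by norm_num)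
      linarith [pow_one η₁]
    linarith

end ScaleBounds

/-! ### From estimates in coordinates to the graph transform on the manifold -/

/-- The linear isomorphism `D` respects the splitting, contracts the first and expands the second
factor. -/
structure SplitHyp {k l : ℕ} (J : CoordSplit d k l) (D : Euc d ≃L[ℝ] Euc d) (κ κ' : ℝ) :
    Prop where
  pU_iE : ∀ a, J.pU (D (J.iE a)) = 0
  pE_iU : ∀ b, J.pE (D (J.iU b)) = 0
  pE_symm_iU : ∀ b, J.pE (D.symm (J.iU b)) = 0
  contract : ∀ a, ‖D (J.iE a)‖ ≤ (1 - κ) * ‖J.iE a‖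
  expand : ∀ b, ‖J.iU b‖ ≤ (1 - κ') * ‖D (J.iU b)‖
  κ_le : κ ≤ 1
  κ'_le : κ' ≤ 1

namespace SplitHyp

variable {k l : ℕ} {J : CoordSplit d k l} {D : Euc d ≃L[ℝ] Euc d} {κ κ' : ℝ}

/-- The expanding block of `D`. -/
def blockU (h : SplitHyp J D κ κ') : Euc l ≃L[ℝ] Euc l :=
  ContinuousLinearEquiv.equivOfInverse
    (J.pU ∘L ((D : Euc d →L[ℝ] Euc d) ∘L J.iU)) (J.pU ∘L ((D.symm : Euc d →L[ℝ] Euc d) ∘L J.iU))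
    (fun b => by
      have h1 : J.iU (J.pU (D (J.iU b))) = D (J.iU b) := by
        have := J.add_eq (D (J.iU b))
        rwa [h.pE_iU, map_zero, zero_add] at this
      show J.pU (D.symm (J.iU (J.pU (D (J.iU b))))) = b
      rw [h1, D.symm_apply_apply, J.pU_iU])
    (fun b => by
      have h1 : J.iU (J.pU (D.symm (J.iU b))) = D.symm (J.iU b) := by
        have := J.add_eq (D.symm (J.iU b))
        rwa [h.pE_symm_iU, map_zero, zero_add] at this
      show J.pU (D (J.iU (J.pU (D.symm (J.iU b))))) = b
      rw [h1, D.apply_symm_apply, J.pU_iU])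

theorem contract_block (h : SplitHyp J D κ κ') (a : Euc k) :
    ‖J.pE (D (J.iE a))‖ ≤ (1 - κ) * ‖a‖ := by
  refine (J.norm_pE _).trans ((h.contract a).trans ?_)
  exact mul_le_mul_of_nonneg_left (J.norm_iE a) (by linarith [h.κ_le])

theorem expand_block (h : SplitHyp J D κ κ') (b : Euc l) :
    ‖b‖ ≤ (1 - κ') * ‖h.blockU b‖ := by
  have h1 : D (J.iU b) = J.iU (h.blockU b) := by
    have := J.add_eq (D (J.iU b))
    rw [h.pE_iU, map_zero, zero_add] at this
    exact this.symm
  have h2 : ‖b‖ ≤ ‖J.iU b‖ := by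
    conv_lhs => rw [← J.pU_iU b]
    exact J.norm_pU _
  refine h2.trans ((h.expand b).trans ?_)
  rw [h1]
  exact mul_le_mul_of_nonneg_left (J.norm_iU _) (by linarith [h.κ'_le])

end SplitHyp

section Smooth

variable [IsContMDiffRiemannianBundle (𝓡 d) ∞ (Euc d) (fun x : M => TangentSpace (𝓡 d) x)]
  [IsRiemannianManifold (𝓡 d) M] {S : Set M}

namespace ChartData

variable {A : FrameCover d M S} {g : M → M} {p q : M} {n m : ℕ}
  {Cp : Euc d ≃L[ℝ] TangentSpace (𝓡 d) p} {Cq : Euc d ≃L[ℝ] TangentSpace (𝓡 d) q}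
  {C' : Euc d ≃L[ℝ] TangentSpace (𝓡 d) (g p)} {D : Euc d ≃L[ℝ] Euc d}
  {β γ Γ K Λ₀ P Q η₁ η₂ μ s : ℝ} {k l : ℕ} {J : CoordSplit d k l}

/-- The coordinate expression of `g` satisfies the hypotheses of the graph transform. -/
theorem exists_hypMap (h : ChartData A g p q (2 * P) (η₂ ^ 8) (2 * Λ₀) K β n m)
    (hs : ScaleBounds β γ Γ A.L K Λ₀ (invNorm Cp) (invNorm C') (invNorm Cq) P Q η₁ η₂ μ s)
    (hJ : SplitHyp J D (invNorm Cp ^ 2)⁻¹ (invNorm C' ^ 2)⁻¹)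
    (hCp : ∀ v, ‖Cp v‖ ≤ ‖v‖)
    (hD : ∀ v, C' (D v) = mfderiv (𝓡 d) (𝓡 d) g p (Cp v))
    (hm : ‖A.mat m (g p) C' - A.mat m q Cq‖ ≤ 3 * A.L * η₂ ^ 8) :
    ∃ lam H e₀ t₀ lam₀ : ℝ, HypMap J (chartMap A g Cp Cq) (chartDeriv A g n m Cp Cq) D hJ.blockU
      P Q (invNorm Cp ^ 2)⁻¹ (invNorm C' ^ 2)⁻¹ lam H β e₀ t₀ lam₀ η₁ η₂ := by
  set a := invNorm Cq * (14 * A.L * K * (2 * Λ₀) ^ 2) with ha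
  set e₀ := 2 * invNorm Cq * η₂ ^ 8 with he₀
  set e₁ := 4 * A.L * (2 * Λ₀) * invNorm Cq * (1 + invNorm C') * η₂ ^ 8 with he₁
  set lam := e₁ + a * (2 * P) ^ β with hlam
  set H := a * (4 * P) ^ (β / 2) with hH
  set t₀ := e₀ + lam * (η₁ ^ 2 / 1000) with ht₀
  set lam₀ := e₁ + a * (η₁ ^ 2 / 1000 + 3 / 2 * t₀) ^ β with hlam₀
  obtain ⟨b1, b2, b3, b4, b5, b6, b7, b8, b9, b10⟩ := hs.hyp_bounds ha he₀ he₁ hlam hH ht₀ hlam₀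
  have hP := hs.P_pos
  have hβ := hs.β_pos
  have ha0 : 0 ≤ a := by
    have h1 := hs.Nq_nonneg
    have h2 := hs.one_le_L
    have h3 := hs.one_le_K
    have h4 := hs.one_le_Λ₀
    rw [ha]; positivity
  have hlip := fun v v' hv hv' => h.norm_chartDeriv_sub_le hCp Cq (v := v) (v' := v') hv hv'
  have h0 := h.norm_chartDeriv_zero_sub_le hCp Cq C' (D := D) hD hm
  have hclose : ∀ v, ∀ z, ‖v‖ < 2 * P → ‖v‖ ≤ z →
      ‖chartDeriv A g n m Cp Cq v - D‖ ≤ e₁ + a * z ^ β := by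
    intro v z hv hz
    have h1 := hlip v 0 hv (by simpa using hP)
    rw [sub_zero] at h1
    have h2 : a * ‖v‖ ^ β ≤ a * z ^ β := by gcongr
    calc _ = ‖(chartDeriv A g n m Cp Cq 0 - D) +
          (chartDeriv A g n m Cp Cq v - chartDeriv A g n m Cp Cq 0)‖ := by congr 1; abel
      _ ≤ _ := (norm_add_le _ _).trans (add_le_add h0 (h1.trans h2))
  refine ⟨lam, H, e₀, t₀, lam₀, ?_⟩
  refine
    { deriv := fun v hv => h.hasFDerivAt_chartMap hCp Cq hv
      close := fun v hv => hclose v _ hv hv.le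
      close₀ := fun v hv => hclose v _ (hv.trans_lt b10) hv
      holder := fun v v' hv hv' => ?_
      at_zero := h.norm_chartMap_zero_le Cp Cq
      pU_D_iE := hJ.pU_iE
      pU_D_iU := fun b => rfl
      pE_D_iU := hJ.pE_iU
      contract := hJ.contract_block
      expand := hJ.expand_block
      β_pos := hβ
      β_le := hs.β_le
      κ_pos := hs.κ_pos
      κ_le := hs.κ_le
      κ'_pos := hs.κ'_pos
      κ'_le := hs.κ'_le
      H_nonneg := b2
      lam_nonneg := b1
      η₁_pos := hs.η₁_pos
      η₁_le := hs.η₁_le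
      P_le := hs.P_le
      η₂_pos := hs.η₂_pos
      η₂_le := hs.η₂_le
      Q_le := hs.Q_le
      lam_le := b3
      lam_le' := b4
      H_le := b5
      t₀_eq := rfl
      t₀_lt := b6
      cover := b7
      zero_le := b8
      deriv_le := b9 }
  have h0 := hlip v v' hv hv'
  have h1 : ‖v - v'‖ ≤ 4 * P := (norm_sub_le _ _).trans (by linarith)
  -- The derivative is `β`-Hölder, but only exponent `β/2` is claimed; the spare half of the
  -- exponent becomes the small factor `(4P) ^ (β / 2)`.
  have h2 : ‖v - v'‖ ^ (β / 2) ≤ (4 * P) ^ (β / 2) := by gcongr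
  have h3 : ‖v - v'‖ ^ β = ‖v - v'‖ ^ (β / 2) * ‖v - v'‖ ^ (β / 2) := by
    rw [← pow_two, ← ScaleBounds.rpow_two_mul (norm_nonneg _)]
    congr 1; ring
  rw [h3] at h0
  have h4 : a * (‖v - v'‖ ^ (β / 2) * ‖v - v'‖ ^ (β / 2)) ≤
      a * ((4 * P) ^ (β / 2) * ‖v - v'‖ ^ (β / 2)) :=
    mul_le_mul_of_nonneg_left (mul_le_mul_of_nonneg_right h2 (by positivity)) ha0
  rw [hH, mul_assoc]
  exact h0.trans h4

end ChartData

/-- The image under the chart `exp_p ∘ C` of the graph of a map from the second to the first factor,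
over a ball. -/
def chartGraph {k l : ℕ} (J : CoordSplit d k l) {p : M} (C : Euc d ≃L[ℝ] TangentSpace (𝓡 d) p)
    (P : ℝ) (G : Euc l → Euc k) : Set M :=
  (fun v => expMap d p (C (J.join (G v) v))) '' ball 0 P

/-- The graph transform on the manifold. -/
structure GraphTransform {k l : ℕ} (J : CoordSplit d k l) (g : M → M) {p q : M}
    (Cp : Euc d ≃L[ℝ] TangentSpace (𝓡 d) p) (Cq : Euc d ≃L[ℝ] TangentSpace (𝓡 d) q)
    (β P Q Q' η₁ η₂ : ℝ) (G : Euc l → Euc k) : Prop where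
  exists_unique : ∃ G' : Euc l → Euc k, DoubleChart.IsRepresenting β η₂ Q G' ∧
    chartGraph J Cq Q G' ⊆ g '' chartGraph J Cp P G ∧
    (∀ G'', DoubleChart.IsRepresenting β η₂ Q G'' →
      chartGraph J Cq Q G'' ⊆ g '' chartGraph J Cp P G →
        chartGraph J Cq Q G'' = chartGraph J Cq Q G') ∧
    g (expMap d p (Cp (J.join (G 0) 0))) ∈ chartGraph J Cq Q G'
  inter : ∀ N : Euc k → Euc l, DoubleChart.IsRepresenting β η₂ Q' N →
    ∃! z, z ∈ (g '' chartGraph J Cp P G) ∩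
      ((fun s => expMap d q (Cq (J.join s (N s)))) '' ball 0 Q')

/-- The conjugation relation moves coordinate statements to the manifold. The way back uses
injectivity of the exponential map on the ball of radius `A.r`, which is why both target windows
must be smaller than `A.r / 2`. -/
theorem HypMap.graphTransform {A : FrameCover d M S} {g : M → M} {p q : M} {n m : ℕ}
    {Cp : Euc d ≃L[ℝ] TangentSpace (𝓡 d) p} {Cq : Euc d ≃L[ℝ] TangentSpace (𝓡 d) q}
    {D : Euc d →L[ℝ] Euc d} {k l : ℕ} {J : CoordSplit d k l} {Du : Euc l ≃L[ℝ] Euc l}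
    {Λ K P Q Q' κ κ' lam H β e₀ t₀ lam₀ η₁ η₂ θ : ℝ} {G : Euc l → Euc k}
    (h : HypMap J (chartMap A g Cp Cq) (chartDeriv A g n m Cp Cq) D Du P Q κ κ' lam H β e₀ t₀
      lam₀ η₁ η₂)
    (hc : ChartData A g p q (2 * P) θ Λ K β n m)
    (hCp : ∀ v, ‖Cp v‖ ≤ ‖v‖) (hCq : ∀ v, ‖Cq v‖ ≤ ‖v‖)
    (hQ : 2 * Q < A.r) (hη : η₂ ≤ Q') (hQ' : 2 * Q' < A.r)
    (hG : DoubleChart.IsRepresenting β η₁ P G) :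
    GraphTransform J g Cp Cq β P Q Q' η₁ η₂ G := by
  have hr1 := A.r_lt_one
  have hη0 := h.η₂_pos
  have hηQ := h.η₂_le
  -- Points of either kind of graph have norm below `2R`, hence lie where the target chart is
  -- injective.
  have hjoin : ∀ {R : ℝ} {a : Euc k} {b : Euc l}, η₂ ≤ R → 2 * R < A.r →
      (‖b‖ < R ∧ ‖a‖ ≤ η₂ ^ 2 / 1000 + 1 / 2 * ‖b‖ ∨ ‖a‖ < R ∧ ‖b‖ ≤ η₂ ^ 2 / 1000 + 1 / 2 * ‖a‖) →
      ‖J.join a b‖ < A.r := by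
    intro R a b hR hRr hab
    have h1 : ‖J.join a b‖ ≤ ‖a‖ + ‖b‖ :=
      (norm_add_le _ _).trans (add_le_add (J.norm_iE a) (J.norm_iU b))
    have h2 : η₂ ^ 2 ≤ η₂ := by nlinarith
    rcases hab with ⟨h3, h4⟩ | ⟨h3, h4⟩ <;> linarith
  obtain ⟨G', hG', hG'2⟩ := h.exists_transform hG
  have himg : ∀ v, ‖v‖ < P → expMap d q (Cq (chartMap A g Cp Cq (J.join (G v) v))) =
      g (expMap d p (Cp (J.join (G v) v))) := fun v hv =>
    hc.expMap_chartMap hCp Cq (HypMap.norm_curve_lt h hG hv)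
  refine ⟨⟨G', hG', ?_, ?_, ?_⟩, ?_⟩
  · rintro _ ⟨w, hw, rfl⟩
    obtain ⟨v, hv, hvw⟩ := hG'2 w (mem_ball_zero_iff.1 hw)
    refine ⟨_, ⟨v, mem_ball_zero_iff.2 hv, rfl⟩, ?_⟩
    show g (expMap d p (Cp (J.join (G v) v))) = expMap d q (Cq (J.join (G' w) w))
    rw [← himg v hv, hvw]
  · intro G'' hG'' hsub
    have key : ∀ w, ‖w‖ < Q → G'' w = G' w := by
      intro w hw
      obtain ⟨_, ⟨v', hv', rfl⟩, he⟩ := hsub ⟨w, mem_ball_zero_iff.2 hw, rfl⟩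
      have h1 := eq_chartMap Cp hCq (w := J.join (G'' w) w)
        (hjoin hηQ hQ (Or.inl ⟨hw, hG''.norm_le hw⟩)) he.symm
      obtain ⟨v, hv, hvw⟩ := hG'2 w hw
      exact (h.transform_unique hG (mem_ball_zero_iff.1 hv') hv h1.symm hvw).2
    refine image_congr fun w hw => ?_
    rw [key w (mem_ball_zero_iff.1 hw)]
  · obtain ⟨w, hw, he⟩ := h.center_mem hG hG'2
    refine ⟨w, mem_ball_zero_iff.2 hw, ?_⟩
    show expMap d q (Cq (J.join (G' w) w)) = _
    rw [← he, himg 0 (by simpa using h.P_pos)]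
  · intro N hN
    obtain ⟨v, ⟨hv, s, hs, he⟩, hu⟩ := h.existsUnique_inter hG hη hN
    refine ⟨g (expMap d p (Cp (J.join (G v) v))),
      ⟨⟨_, ⟨v, mem_ball_zero_iff.2 hv, rfl⟩, rfl⟩, s, mem_ball_zero_iff.2 hs, ?_⟩, ?_⟩
    · show expMap d q (Cq (J.join s (N s))) = _
      rw [← he, himg v hv]
    · rintro _ ⟨⟨_, ⟨v', hv', rfl⟩, rfl⟩, s', hs', he'⟩
      have hs'' := mem_ball_zero_iff.1 hs'
      have h1 := eq_chartMap Cp hCq (w := J.join s' (N s'))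
        (hjoin hη hQ' (Or.inr ⟨hs'', hN.norm_le hs''⟩)) he'
      rw [hu v' ⟨mem_ball_zero_iff.1 hv', s', hs'', h1.symm⟩]

end Smooth

/-! ### The coordinate splitting and its exchange of factors -/

section Split

variable {k : ℕ}

/-- The first `k` coordinates. -/
def projLow (hk : k ≤ d) (v : Euc d) : Euc k := WithLp.toLp 2 fun i => v ⟨i, by omega⟩

/-- The last `d - k` coordinates. -/
def projHigh (k : ℕ) (v : Euc d) : Euc (d - k) := WithLp.toLp 2 fun i => v ⟨i + k, by omega⟩

theorem projLow_joinVec (hk : k ≤ d) (a : Euc k) (b : Euc (d - k)) :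
    projLow hk (joinVec a b) = a := by
  ext i
  simp [projLow, joinVec]

theorem projHigh_joinVec (a : Euc k) (b : Euc (d - k)) : projHigh k (joinVec a b) = b := by
  ext i
  simp [projHigh, joinVec]

theorem joinVec_proj (hk : k ≤ d) (v : Euc d) : joinVec (projLow hk v) (projHigh k v) = v := by
  ext i
  by_cases h : (i : ℕ) < k
  · simp [joinVec, h, projLow]
  · have h' : (i : ℕ) - k + k = i := by omega
    simp [joinVec, h, projHigh, h']

theorem isLow_joinVec (a : Euc k) : IsLow k (joinVec a (0 : Euc (d - k))) := fun i hi => by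
  simp [joinVec, not_lt.2 hi]

theorem isHigh_joinVec (b : Euc (d - k)) : IsHigh k (joinVec (0 : Euc k) b) := fun i hi => by
  simp [joinVec, hi]

theorem projHigh_of_isLow {v : Euc d} (hv : IsLow k v) : projHigh k v = 0 := by
  ext i
  exact hv _ (by simp)

theorem projLow_of_isHigh (hk : k ≤ d) {v : Euc d} (hv : IsHigh k v) : projLow hk v = 0 := by
  ext i
  exact hv _ (by simp)

theorem joinVec_add (a a' : Euc k) (b b' : Euc (d - k)) :
    joinVec (d := d) (a + a') (b + b') = joinVec a b + joinVec a' b' := by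
  ext i
  by_cases h : (i : ℕ) < k <;> simp [joinVec, h]

theorem joinVec_smul (c : ℝ) (a : Euc k) (b : Euc (d - k)) :
    joinVec (d := d) (c • a) (c • b) = c • joinVec a b := by
  ext i
  by_cases h : (i : ℕ) < k <;> simp [joinVec, h]

theorem norm_joinVec_sq (hk : k ≤ d) (a : Euc k) (b : Euc (d - k)) :
    ‖joinVec (d := d) a b‖ ^ 2 = ‖a‖ ^ 2 + ‖b‖ ^ 2 := by
  obtain ⟨l, rfl⟩ := Nat.exists_eq_add_of_le hk
  have hl : k + l - k = l := by omega
  have h1 : ∀ i : Fin k, joinVec (d := k + l) a b (Fin.castAdd l i) = a i := fun i => by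
    simp [joinVec]
  have h2 : ∀ i : Fin l, joinVec (d := k + l) a b (Fin.natAdd k i) = b (Fin.cast hl.symm i) :=
    fun i => by simp [joinVec, Fin.cast]
  rw [EuclideanSpace.norm_sq_eq, EuclideanSpace.norm_sq_eq, EuclideanSpace.norm_sq_eq,
    Fin.sum_univ_add]
  simp only [h1, h2]
  congr 1
  exact Fintype.sum_equiv (finCongr hl.symm) _ _ fun i => rfl

theorem norm_projLow_le (hk : k ≤ d) (v : Euc d) : ‖projLow hk v‖ ≤ ‖v‖ := by
  refine le_of_sq_le_sq ?_ (norm_nonneg _)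
  have := norm_joinVec_sq hk (projLow hk v) (projHigh k v)
  rw [joinVec_proj] at this
  linarith [sq_nonneg ‖projHigh k v‖]

theorem norm_projHigh_le (hk : k ≤ d) (v : Euc d) : ‖projHigh k v‖ ≤ ‖v‖ := by
  refine le_of_sq_le_sq ?_ (norm_nonneg _)
  have := norm_joinVec_sq hk (projLow hk v) (projHigh k v)
  rw [joinVec_proj] at this
  linarith [sq_nonneg ‖projLow hk v‖]

/-- The splitting `ℝᵈ = ℝᵏ × ℝᵈ⁻ᵏ`. -/
def splitLow (hk : k ≤ d) : CoordSplit d k (d - k) where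
  iE := LinearMap.toContinuousLinearMap
    { toFun := fun a => joinVec a 0
      map_add' := fun a b => by rw [← joinVec_add, add_zero]
      map_smul' := fun c a => by rw [RingHom.id_apply, ← joinVec_smul, smul_zero] }
  iU := LinearMap.toContinuousLinearMap
    { toFun := fun b => joinVec 0 b
      map_add' := fun a b => by rw [← joinVec_add, add_zero]
      map_smul' := fun c a => by rw [RingHom.id_apply, ← joinVec_smul, smul_zero] }
  pE := LinearMap.toContinuousLinearMap
    { toFun := projLow hk
      map_add' := fun a b => rfl
      map_smul' := fun c a => rfl }
  pU := LinearMap.toContinuousLinearMap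
    { toFun := projHigh k
      map_add' := fun a b => rfl
      map_smul' := fun c a => rfl }
  pE_iE a := projLow_joinVec hk a 0
  pE_iU b := projLow_joinVec hk 0 b
  pU_iE a := projHigh_joinVec a 0
  pU_iU b := projHigh_joinVec 0 b
  add_eq v := by
    show joinVec (projLow hk v) 0 + joinVec 0 (projHigh k v) = v
    rw [← joinVec_add, add_zero, zero_add, joinVec_proj]
  norm_iE a := by
    refine le_of_sq_le_sq ?_ (norm_nonneg _)
    show ‖joinVec (d := d) a 0‖ ^ 2 ≤ _
    rw [norm_joinVec_sq hk]; simp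
  norm_iU b := by
    refine le_of_sq_le_sq ?_ (norm_nonneg _)
    show ‖joinVec (d := d) (k := k) 0 b‖ ^ 2 ≤ _
    rw [norm_joinVec_sq hk]; simp
  norm_pE v := norm_projLow_le hk v
  norm_pU v := norm_projHigh_le hk v

theorem splitLow_join (hk : k ≤ d) (a : Euc k) (b : Euc (d - k)) :
    (splitLow hk).join a b = joinVec a b := by
  show joinVec a 0 + joinVec 0 b = joinVec a b
  rw [← joinVec_add, add_zero, zero_add]

/-- The same splitting with the factors exchanged. -/
def CoordSplit.swap {k l : ℕ} (J : CoordSplit d k l) : CoordSplit d l k where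
  iE := J.iU
  iU := J.iE
  pE := J.pU
  pU := J.pE
  pE_iE := J.pU_iU
  pE_iU := J.pU_iE
  pU_iE := J.pE_iU
  pU_iU := J.pE_iE
  add_eq v := by rw [add_comm]; exact J.add_eq v
  norm_iE := J.norm_iU
  norm_iU := J.norm_iE
  norm_pE := J.norm_pU
  norm_pU := J.norm_pE

theorem CoordSplit.swap_join {k l : ℕ} (J : CoordSplit d k l) (a : Euc l) (b : Euc k) :
    J.swap.join a b = J.join b a := add_comm _ _

end Split

namespace LyapunovPair

variable {k : ℕ} {p p' : M} {C : Euc d ≃L[ℝ] TangentSpace (𝓡 d) p}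
    {C' : Euc d ≃L[ℝ] TangentSpace (𝓡 d) p'} {D : Euc d ≃L[ℝ] Euc d}

theorem inv_sq_le_one {N : ℝ} (hN : 1 ≤ N) : (N ^ 2)⁻¹ ≤ 1 :=
  inv_le_one_of_one_le₀ (one_le_pow₀ hN)

theorem splitHyp (h : LyapunovPair k C C' D) (hd : 0 < d) (hk : k ≤ d) :
    SplitHyp (splitLow hk) D (invNorm C ^ 2)⁻¹ (invNorm C' ^ 2)⁻¹ where
  pU_iE a := projHigh_of_isLow (h.low _ (isLow_joinVec a))
  pE_iU b := projLow_of_isHigh hk (h.high _ (isHigh_joinVec b))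
  pE_symm_iU b := projLow_of_isHigh hk (h.high_symm (isHigh_joinVec b))
  contract a := h.low_contract hd (isLow_joinVec a)
  expand b := h.high_expand hd (isHigh_joinVec b)
  κ_le := inv_sq_le_one (one_le_invNorm hd h.norm_le)
  κ'_le := inv_sq_le_one (one_le_invNorm hd h.norm_le')

/-- For the inverse the unstable factor is contracted, and the two frames exchange roles along with
the two factors. -/
theorem splitHyp_symm (h : LyapunovPair k C C' D) (hd : 0 < d) (hk : k ≤ d) :
    SplitHyp (splitLow hk).swap D.symm (invNorm C' ^ 2)⁻¹ (invNorm C ^ 2)⁻¹ where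
  pU_iE a := projLow_of_isHigh hk (h.high_symm (isHigh_joinVec a))
  pE_iU b := projHigh_of_isLow (h.low_symm (isLow_joinVec b))
  pE_symm_iU b := projHigh_of_isLow (h.low _ (isLow_joinVec b))
  contract a := by
    have := h.high_expand hd (h.high_symm (isHigh_joinVec a))
    rwa [D.apply_symm_apply] at this
  expand b := by
    have := h.low_contract hd (h.low_symm (isLow_joinVec b))
    rwa [D.apply_symm_apply] at this
  κ_le := inv_sq_le_one (one_le_invNorm hd h.norm_le')
  κ'_le := inv_sq_le_one (one_le_invNorm hd h.norm_le)

end LyapunovPair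

/-! ### Transport between equal points, and the differential of an inverse branch -/

/-- A frame of `T_pM` as a frame of the tangent space at an equal point. -/
def castFrame {p q : M} (h : p = q) (C : Euc d ≃L[ℝ] TangentSpace (𝓡 d) p) :
    Euc d ≃L[ℝ] TangentSpace (𝓡 d) q :=
  h ▸ C

section CastFrame

variable {p q : M} (h : p = q) (C : Euc d ≃L[ℝ] TangentSpace (𝓡 d) p)

theorem castFrame_apply (v : Euc d) : castFrame h C v = tangentCast d h (C v) := by
  subst h; rfl

theorem norm_castFrame (v : Euc d) : ‖castFrame h C v‖ = ‖C v‖ := by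
  subst h; rfl

theorem invNorm_castFrame : invNorm (castFrame h C) = invNorm C := by
  subst h; rfl

theorem mat_castFrame {S : Set M} (A : FrameCover d M S) (n : ℕ) :
    A.mat n q (castFrame h C) = A.mat n p C := by
  subst h; rfl

end CastFrame

/-- Differentiation of `f ∘ g = id` at `y` shows that the differential of `f` sends `dg ξ` to `ξ`;
injectivity identifies `dg ξ` with `ζ`. -/
theorem mfderiv_localInverse_apply {f g : M → M} {z y : M} (hz : f z = y) (hy : g y = z)
    (hfg : ∀ᶠ u in 𝓝 y, f (g u) = u) (hf : MDifferentiableAt (𝓡 d) (𝓡 d) f z)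
    (hg : MDifferentiableAt (𝓡 d) (𝓡 d) g y) (hinj : Injective (mfderiv (𝓡 d) (𝓡 d) f z))
    {ξ : TangentSpace (𝓡 d) y} {ζ : TangentSpace (𝓡 d) z}
    (h : tangentCast d hz (mfderiv (𝓡 d) (𝓡 d) f z ζ) = ξ) :
    tangentCast d hy.symm ζ = mfderiv (𝓡 d) (𝓡 d) g y ξ := by
  have key : ∀ (z' : M) (e : z' = z) (hz' : f z' = y) (η : TangentSpace (𝓡 d) z'),
      tangentCast d hz' (mfderiv (𝓡 d) (𝓡 d) f z' η) = ξ → tangentCast d e.symm ζ = η := by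
    rintro z' rfl hz' η hη
    rw [← h] at hη
    have := (bijective_tangentCast hz').1 hη
    exact (hinj this).symm
  refine key (g y) hy (hfg.self_of_nhds) _ ?_
  have hf' : MDifferentiableAt (𝓡 d) (𝓡 d) f (g y) := by rw [hy]; exact hf
  have h1 : mfderiv (𝓡 d) (𝓡 d) (fun u => f (g u)) y = mfderiv (𝓡 d) (𝓡 d) id y :=
    Filter.EventuallyEq.mfderiv_eq hfg
  have h2 : mfderiv (𝓡 d) (𝓡 d) (fun u => f (g u)) y =
      (mfderiv (𝓡 d) (𝓡 d) f (g y)).comp (mfderiv (𝓡 d) (𝓡 d) g y) :=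
    mfderiv_comp y hf' hg
  have h3 : ∀ (q : M) (e : q = y) (T : TangentSpace (𝓡 d) y →L[ℝ] TangentSpace (𝓡 d) q),
      (∀ v : Euc d, toModel (T v) = v) → tangentCast d e (T ξ) = ξ := by
    rintro q rfl T hT
    exact hT ξ
  refine h3 (f (g y)) _ ((mfderiv (𝓡 d) (𝓡 d) f (g y)).comp (mfderiv (𝓡 d) (𝓡 d) g y)) fun v => ?_
  have h4 := congrArg (fun T : Euc d →L[ℝ] Euc d => T v) (h2.symm.trans (h1.trans mfderiv_id))
  exact h4

/-! ### Consequences of `p ≤ Q` and the choice of `ε₀` -/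

namespace Constants

variable {c : Constants}

theorem Valid.γ_pos (hc : c.Valid) : 0 < c.γ :=
  lt_trans (div_pos (by norm_num) hc.β_pos) hc.γ_gt

theorem Valid.twenty_lt (hc : c.Valid) : 20 < c.γ * c.β := by
  have := hc.γ_gt
  rwa [div_lt_iff₀ hc.β_pos] at this

theorem Valid.one_le_γ (hc : c.Valid) : 1 ≤ c.γ := by
  have h1 := hc.twenty_lt
  have h2 : c.γ * c.β ≤ c.γ * 1 := mul_le_mul_of_nonneg_left hc.β_le_one hc.γ_pos.le
  linarith

theorem Valid.ladder_mono (hc : c.Valid) {s t : ℝ} (hs : 0 ≤ s) (hst : s ≤ t) :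
    c.ladder s ≤ c.ladder t := by
  unfold ladder
  have h1 : s ^ (1 / c.γ) ≤ t ^ (1 / c.γ) :=
    Real.rpow_le_rpow hs hst (by have := hc.γ_pos; positivity)
  have h2 := Real.exp_le_exp.2 (mul_le_mul_of_nonneg_left h1 hc.G_pos.le)
  exact mul_le_mul hst h2 (Real.exp_pos _).le (hs.trans hst)

theorem Valid.le_ladder (hc : c.Valid) {t : ℝ} (ht : 0 ≤ t) : t ≤ c.ladder t := by
  unfold ladder
  refine le_mul_of_one_le_right ht (Real.one_le_exp ?_)
  exact mul_nonneg hc.G_pos.le (Real.rpow_nonneg ht _)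

/-- The bounds that follow from `P ≤ Q̃_ε`. -/
theorem Valid.rpow_bounds (hc : c.Valid) {ε ρ N P : ℝ} (hε : 0 < ε) (hε1 : ε ≤ 1) (hρ : 0 < ρ)
    (hρ1 : ρ ≤ 1) (hN : 1 ≤ N) (hP : 0 < P)
    (h : P ≤ ε ^ (20 / c.β) * ρ ^ (8 * c.a / c.β) * N ^ (-(2 * c.γ))) :
    P ^ (c.β / 2) * ((ρ ^ (-c.a)) ^ 4 * N ^ 20) ≤ ε ^ 10 ∧
    P ^ (1 / c.γ) ≤ ε ^ (20 / (c.β * c.γ)) * (N ^ 2)⁻¹ ∧ P ≤ 1 := by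
  have hβ := hc.β_pos
  have hγ := hc.γ_pos
  have ha := hc.one_lt_a
  have hN0 : 0 < N := by linarith
  have e1 : 0 ≤ ε ^ (20 / c.β) := by positivity
  have e2 : 0 ≤ ρ ^ (8 * c.a / c.β) := by positivity
  have e3 : 0 ≤ N ^ (-(2 * c.γ)) := by positivity
  have hpow : ∀ e : ℝ, 0 ≤ e → P ^ e ≤ ε ^ (20 / c.β * e) * ρ ^ (8 * c.a / c.β * e) *
      N ^ (-(2 * c.γ) * e) := by
    intro e he
    refine (Real.rpow_le_rpow hP.le h he).trans_eq ?_
    rw [Real.mul_rpow (mul_nonneg e1 e2) e3, Real.mul_rpow e1 e2, ← Real.rpow_mul hε.le,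
      ← Real.rpow_mul hρ.le, ← Real.rpow_mul hN0.le]
  refine ⟨?_, ?_, ?_⟩
  -- Under the power `β/2` the exponents `20/β`, `8a/β`, `2γ` become `10`, `4a`, `γβ`, and `γβ >
  -- 20`.
  · have h1 := hpow (c.β / 2) (by positivity)
    have x1 : 20 / c.β * (c.β / 2) = ((10 : ℕ) : ℝ) := by field_simp; norm_num
    have x2 : 8 * c.a / c.β * (c.β / 2) = 4 * c.a := by field_simp; norm_num
    rw [x1, x2, Real.rpow_natCast] at h1
    have x3 : N ^ (-(2 * c.γ) * (c.β / 2)) ≤ (N ^ 20)⁻¹ := by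
      have : (N ^ 20)⁻¹ = N ^ (-(20 : ℝ)) := by
        rw [Real.rpow_neg hN0.le]; congr 1; exact (Real.rpow_natCast N 20).symm
      rw [this]
      refine Real.rpow_le_rpow_of_exponent_le hN ?_
      linarith [hc.twenty_lt]
    have x4 : (ρ ^ (-c.a)) ^ 4 = (ρ ^ (4 * c.a))⁻¹ := by
      rw [← Real.rpow_natCast, ← Real.rpow_mul hρ.le, ← Real.rpow_neg hρ.le]
      congr 1; push_cast; ring
    have x5 : 0 < ρ ^ (4 * c.a) := by positivity
    rw [x4]
    calc _ ≤ ε ^ 10 * ρ ^ (4 * c.a) * (N ^ 20)⁻¹ * ((ρ ^ (4 * c.a))⁻¹ * N ^ 20) := by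
          refine mul_le_mul_of_nonneg_right (h1.trans ?_) (by positivity)
          exact mul_le_mul_of_nonneg_left x3 (by positivity)
      _ = ε ^ 10 := by field_simp
  · have h1 := hpow (1 / c.γ) (by positivity)
    have x1 : 20 / c.β * (1 / c.γ) = 20 / (c.β * c.γ) := by field_simp
    have x2 : -(2 * c.γ) * (1 / c.γ) = -(2 : ℝ) := by field_simp
    have x3 : N ^ (-(2 : ℝ)) = (N ^ 2)⁻¹ := by
      rw [Real.rpow_neg hN0.le]; congr 1; exact Real.rpow_natCast N 2
    rw [x1, x2, x3] at h1
    refine h1.trans (mul_le_mul_of_nonneg_right ?_ (by positivity))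
    exact mul_le_of_le_one_right (by positivity) (Real.rpow_le_one hρ.le hρ1 (by positivity))
  · refine h.trans ?_
    have y1 : ε ^ (20 / c.β) ≤ 1 := Real.rpow_le_one hε.le hε1 (by positivity)
    have y2 : ρ ^ (8 * c.a / c.β) ≤ 1 := Real.rpow_le_one hρ.le hρ1 (by positivity)
    have y3 : N ^ (-(2 * c.γ)) ≤ 1 := Real.rpow_le_one_of_one_le_of_nonpos hN (by linarith)
    exact mul_le_one₀ (mul_le_one₀ y1 e2 y2) e3 y3

end Constants

/-- The requirements on `ε`. -/
structure SmallEps (c : Constants) (L r δ ε : ℝ) : Prop where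
  pos : 0 < ε
  le_one : ε ≤ 1
  holder : 10 ^ 12 * (L * c.K) * ε ^ 10 ≤ 1
  ladder : 1000 * (c.G * ε ^ (20 / (c.β * c.γ))) ≤ 1
  a_le : 1000 * c.a * ε ^ 10 ≤ 1
  L_le : 1000 * L * ε ^ 10 ≤ 1
  r_le : 1000 * ε ^ 10 ≤ r
  δ_le : 1000 * ε ^ 10 ≤ δ

theorem eventually_mul_rpow_le {b e u : ℝ} (he : 0 < e) (hu : 0 < u) :
    ∀ᶠ ε : ℝ in 𝓝[>] 0, b * ε ^ e ≤ u := by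
  have h1 : Filter.Tendsto (fun ε : ℝ => b * ε ^ e) (𝓝[>] 0) (𝓝 (b * 0 ^ e)) := by
    refine Filter.Tendsto.mono_left ?_ nhdsWithin_le_nhds
    exact ((Real.continuousAt_rpow_const 0 e (Or.inr he.le)).tendsto).const_mul b
  rw [Real.zero_rpow he.ne', mul_zero] at h1
  exact (h1.eventually (gt_mem_nhds hu)).mono fun ε h => le_of_lt h

/-- Every requirement is that a fixed multiple of a positive power of `ε` is small, and none refers
to a choice of frames. -/
theorem exists_smallEps {c : Constants} (hc : c.Valid) {L r δ : ℝ} (hr : 0 < r) (hδ : 0 < δ) :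
    ∃ ε₀ > 0, ∀ ε, 0 < ε → ε < ε₀ → SmallEps c L r δ ε := by
  have hp : ∀ {b u : ℝ}, 0 < u → ∀ᶠ ε : ℝ in 𝓝[>] 0, b * ε ^ 10 ≤ u := fun {b u} hu =>
    (eventually_mul_rpow_le (b := b) (e := (10 : ℕ)) (by norm_num) hu).mono fun ε h => by
      rwa [Real.rpow_natCast] at h
  have h2 : ∀ᶠ ε : ℝ in 𝓝[>] 0, (1000 * c.G) * ε ^ (20 / (c.β * c.γ)) ≤ 1 :=
    eventually_mul_rpow_le (by have := hc.β_pos; have := hc.γ_pos; positivity) one_pos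
  have h3 : ∀ᶠ ε : ℝ in 𝓝[>] 0, 1 * ε ^ (1 : ℝ) ≤ 1 := eventually_mul_rpow_le one_pos one_pos
  have hall : ∀ᶠ ε : ℝ in 𝓝[>] 0, SmallEps c L r δ ε := by
    filter_upwards [self_mem_nhdsWithin, h3, hp (b := 10 ^ 12 * (L * c.K)) one_pos, h2,
      hp (b := 1000 * c.a) one_pos, hp (b := 1000 * L) one_pos, hp (b := 1000) hr,
      hp (b := 1000) hδ] with ε a1 a2 a3 a4 a5 a6 a7 a8
    exact ⟨a1, by simpa using a2, a3, by linarith, a5, a6, a7, a8⟩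
  obtain ⟨u, hu, hsub⟩ := mem_nhdsGT_iff_exists_Ioo_subset.1 hall
  exact ⟨u, hu, fun ε h1 h2 => hsub ⟨h1, h2⟩⟩

/-- The numerical data of a chart of scale `η₁ ≤ P` followed by a chart of scale `η₂`. -/
structure PreScale (c : Constants) (L r δ ε ρ N P η₁ η₂ : ℝ) : Prop where
  valid : c.Valid
  small : SmallEps c L r δ ε
  one_le_L : 1 ≤ L
  ρ_pos : 0 < ρ
  ρ_le : ρ ≤ 1
  one_le_N : 1 ≤ N
  P_le : P ≤ ε ^ (20 / c.β) * ρ ^ (8 * c.a / c.β) * N ^ (-(2 * c.γ))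
  η₁_pos : 0 < η₁
  η₂_pos : 0 < η₂
  η₁_le : η₁ ≤ P
  close : c.LadderClose η₁ η₂

namespace PreScale

variable {c : Constants} {L r δ ε ρ N P η₁ η₂ : ℝ}

theorem P_pos (h : PreScale c L r δ ε ρ N P η₁ η₂) : 0 < P := h.η₁_pos.trans_le h.η₁_le

theorem rpow_bounds (h : PreScale c L r δ ε ρ N P η₁ η₂) :
    P ^ (c.β / 2) * ((ρ ^ (-c.a)) ^ 4 * N ^ 20) ≤ ε ^ 10 ∧
    P ^ (1 / c.γ) ≤ ε ^ (20 / (c.β * c.γ)) * (N ^ 2)⁻¹ ∧ P ≤ 1 :=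
  h.valid.rpow_bounds h.small.pos h.small.le_one h.ρ_pos h.ρ_le h.one_le_N h.P_pos h.P_le

theorem one_le_Λ₀ (h : PreScale c L r δ ε ρ N P η₁ η₂) : 1 ≤ ρ ^ (-c.a) :=
  Real.one_le_rpow_of_pos_of_le_one_of_nonpos h.ρ_pos h.ρ_le (by linarith [h.valid.one_lt_a])

theorem P_mul_le (h : PreScale c L r δ ε ρ N P η₁ η₂) :
    P * ((ρ ^ (-c.a)) ^ 4 * N ^ 20) ≤ ε ^ 10 := by
  obtain ⟨h1, -, h3⟩ := h.rpow_bounds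
  have h4 := h.one_le_Λ₀
  have h5 := h.one_le_N
  refine le_trans (mul_le_mul_of_nonneg_right ?_ (by positivity)) h1
  conv_lhs => rw [← Real.rpow_one P]
  exact Real.rpow_le_rpow_of_exponent_ge h.P_pos h3 (by linarith [h.valid.β_le_one])

theorem η₂_le (h : PreScale c L r δ ε ρ N P η₁ η₂) : η₂ ≤ 2 * η₁ := by
  obtain ⟨-, h2, -⟩ := h.rpow_bounds
  have hγ := h.valid.γ_pos
  have hG := h.valid.G_pos
  have hη := h.η₁_pos
  have h1 : η₁ ^ (1 / c.γ) ≤ P ^ (1 / c.γ) :=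
    Real.rpow_le_rpow hη.le h.η₁_le (by positivity)
  have hε := h.small.pos
  have hs : 0 ≤ ε ^ (20 / (c.β * c.γ)) := by positivity
  have h3 : ε ^ (20 / (c.β * c.γ)) * (N ^ 2)⁻¹ ≤ ε ^ (20 / (c.β * c.γ)) :=
    mul_le_of_le_one_right hs (LyapunovPair.inv_sq_le_one h.one_le_N)
  have h4 : c.G * η₁ ^ (1 / c.γ) ≤ c.G * ε ^ (20 / (c.β * c.γ)) :=
    mul_le_mul_of_nonneg_left (h1.trans (h2.trans h3)) hG.le
  have h5 : 0 ≤ c.G * η₁ ^ (1 / c.γ) := by positivity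
  have h6 := h.small.ladder
  have h7 := ScaleBounds.exp_le_one_add h5 (by linarith)
  refine h.close.2.trans ?_
  unfold Constants.ladder
  rw [mul_comm]
  exact mul_le_mul_of_nonneg_right (by linarith) hη.le

theorem scaleBounds (h : PreScale c L r δ ε ρ N P η₁ η₂) {ρ' N' Nq Q : ℝ}
    (hρ' : 0 < ρ') (hρ'1 : ρ' ≤ 1) (hNq : 1 ≤ Nq) (hN' : 1 ≤ N')
    (hQ : Q ≤ ε ^ (20 / c.β) * ρ' ^ (8 * c.a / c.β) * Nq ^ (-(2 * c.γ)))
    (hη : η₂ ≤ Q) (hQP : Q ≤ c.ladder P) (h1 : N' ≤ 8 * (ρ ^ (-c.a)) ^ 2 * N)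
    (h2 : Nq ≤ 2 * N') (h3 : N' ≤ 2 * Nq) :
    ScaleBounds c.β c.γ c.G L c.K (ρ ^ (-c.a)) N N' Nq P Q η₁ η₂ (ε ^ 10)
      (ε ^ (20 / (c.β * c.γ))) := by
  obtain ⟨a1, a2, a3⟩ := h.rpow_bounds
  obtain ⟨b1, b2, b3⟩ := h.valid.rpow_bounds h.small.pos h.small.le_one hρ' hρ'1 hNq
    (h.η₂_pos.trans_le hη) hQ
  have hε := h.small.pos
  exact
    { β_pos := h.valid.β_pos
      β_le := h.valid.β_le_one
      γ_ge := h.valid.one_le_γ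
      Γ_pos := h.valid.G_pos
      one_le_L := h.one_le_L
      one_le_K := h.valid.one_lt_K.le
      one_le_Λ₀ := h.one_le_Λ₀
      one_le_N := h.one_le_N
      one_le_N' := hN'
      Nq_nonneg := by linarith
      N'_le := h1
      Nq_le := h2
      N'_le_Nq := h3
      η₁_pos := h.η₁_pos
      η₂_pos := h.η₂_pos
      η₁_le := h.η₁_le
      η₂_le := hη
      P_le := a3
      Q_le := b3
      P_rpow := a1
      μ_nonneg := by positivity
      μ_le := h.small.holder
      s_le := h.small.ladder
      P_root := a2
      Q_root := b2
      Q_le_P := hQP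
      η₁_le_η₂ := h.close.1
      η₂_le_η₁ := h.close.2 }

end PreScale

/-! ### Sizes of double charts related by an arrow -/

section Scales

variable {f : M → M} {C : ChartChoice d f} {c : Constants} {ε : ℝ}

/-- Positivity excludes the junk value `0` of the supremum of an empty set. -/
theorem ChartChoice.Q_le_Qtilde {x : Orbit f} (h : 0 < C.Q c ε x) : C.Q c ε x ≤ C.Qtilde c ε x := by
  unfold ChartChoice.Q at h ⊢
  rcases eq_empty_or_nonempty {q ∈ c.ladderSet | q ≤ ChartChoice.Qtilde C c ε x} with h0 | h0
  · rw [h0, Real.sSup_empty] at h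
    exact absurd h (lt_irrefl 0)
  · exact csSup_le h0 fun q hq => hq.2

theorem Orbit.rho_nonneg (x : Orbit f) : 0 ≤ Orbit.rho d x :=
  le_min infDist_nonneg (le_min infDist_nonneg infDist_nonneg)

theorem ChartChoice.rho_pos (hc : c.Valid) {x : Orbit f} (h : 0 < C.Q c ε x) :
    0 < Orbit.rho d x := by
  refine (Orbit.rho_nonneg x).lt_of_ne' fun h0 => ?_
  have h1 := h.trans_le (ChartChoice.Q_le_Qtilde h)
  unfold ChartChoice.Qtilde at h1
  have hβ := hc.β_pos
  have ha := hc.one_lt_a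
  rw [h0, Real.zero_rpow (by positivity)] at h1
  simp at h1

theorem infDist_le_one [CompactSpace M] (hdiam : diam (univ : Set M) < 1) {S : Set M}
    (hS : S.Nonempty) (x : M) : infDist x S ≤ 1 := by
  obtain ⟨s, hs⟩ := hS
  refine (infDist_le_dist_of_mem hs).trans (le_trans ?_ hdiam.le)
  exact dist_le_diam_of_mem isCompact_univ.isBounded (mem_univ _) (mem_univ _)

theorem DoubleChart.Valid.size_pos {w : DoubleChart f} (h : w.Valid C c ε) : 0 < w.size :=
  lt_min h.ps_mem.1 h.pu_mem.1

theorem DoubleChart.Valid.Q_pos {w : DoubleChart f} (h : w.Valid C c ε) : 0 < C.Q c ε w.x :=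
  h.ps_mem.1.trans_le h.ps_le

variable {A : FrameCover d M (singSet d f)} {w₁ w₂ : DoubleChart f}

theorem DoubleChart.Arrow.ps_le (h : w₁.Arrow C c ε A w₂) : w₁.ps ≤ c.ladder w₂.ps := by
  rw [h.ps_eq]; exact min_le_left _ _

theorem DoubleChart.Arrow.qu_le (h : w₁.Arrow C c ε A w₂) : w₂.pu ≤ c.ladder w₁.pu := by
  rw [h.qu_eq]; exact min_le_left _ _

/-- The delicate case is a minimum attained at `q^u`. If `q^u = I(p^u)`, it dominates `p^u`. If it
is capped at `Q(y)`, it dominates `q^s`, since `q^s ≤ Q(y)`, and `p^s ≤ I(q^s)` concludes. The other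
inequality is symmetric. -/
theorem DoubleChart.Arrow.ladderClose (hc : c.Valid) (h : w₁.Arrow C c ε A w₂)
    (h₁ : w₁.Valid C c ε) (h₂ : w₂.Valid C c ε) : c.LadderClose w₁.size w₂.size := by
  have p1 := h₁.ps_mem.1
  have p2 := h₁.pu_mem.1
  have q1 := h₂.ps_mem.1
  have q2 := h₂.pu_mem.1
  have m1 := hc.le_ladder q1.le
  have m2 := hc.le_ladder p2.le
  constructor
  · rcases le_total w₂.ps w₂.pu with hle | hle
    · unfold size
      rw [min_eq_left hle]
      exact (min_le_left _ _).trans h.ps_le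
    · unfold size
      rw [min_eq_right hle]
      rcases le_total (c.ladder w₁.pu) (C.Q c ε w₂.x) with h3 | h3
      · have := h.qu_eq
        rw [min_eq_left h3] at this
        rw [this]
        exact (min_le_right _ _).trans (m2.trans (hc.le_ladder (p2.le.trans m2)))
      · have := h.qu_eq
        rw [min_eq_right h3] at this
        refine (min_le_left _ _).trans (h.ps_le.trans (hc.ladder_mono q1.le ?_))
        rw [this]
        exact h₂.ps_le
  · rcases le_total w₁.pu w₁.ps with hle | hle
    · unfold size
      rw [min_eq_right hle]
      exact (min_le_right _ _).trans h.qu_le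
    · unfold size
      rw [min_eq_left hle]
      rcases le_total (c.ladder w₂.ps) (C.Q c ε w₁.x) with h3 | h3
      · have := h.ps_eq
        rw [min_eq_left h3] at this
        rw [this]
        exact (min_le_left _ _).trans (m1.trans (hc.le_ladder (q1.le.trans m1)))
      · have := h.ps_eq
        rw [min_eq_right h3] at this
        refine (min_le_right _ _).trans (h.qu_le.trans (hc.ladder_mono p2.le ?_))
        rw [this]
        exact h₁.pu_le

end Scales

/-- Needed for `f̂⁻¹y`: a double chart assumes summability only at `y` itself. -/
theorem Orbit.isSummable_of_shift {f : M → M} (hf : MDifferentiable (𝓡 d) (𝓡 d) f) {x : Orbit f}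
    (hx : Orbit.IsSummable d x.shift) : Orbit.IsSummable d x := by
  obtain ⟨h0, P, hP, hu⟩ := hx
  have h1 : ∀ n, x.pt n ∉ singSet d f := fun n => by simpa [shift] using h0 (n - 1)
  set T : TangentSpace (𝓡 d) (x.pt 0) ≃ₗ[ℝ] TangentSpace (𝓡 d) (x.shift.pt 0) :=
    (stepEquiv (h1 0)).toLinearEquiv
  have h2 : ∀ W : Submodule ℝ (TangentSpace (𝓡 d) (x.shift.pt 0)),
      (W.map T.symm.toLinearMap).map T.toLinearMap = W := fun W => by
    rw [← Submodule.map_comp]; simp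
  have h3 : ∀ W : Submodule ℝ (TangentSpace (𝓡 d) (x.pt 0)),
      (W.map T.toLinearMap).map T.symm.toLinearMap = W := fun W => by
    rw [← Submodule.map_comp]; simp
  refine ⟨h1, ⟨P.1.map T.symm.toLinearMap, P.2.map T.symm.toLinearMap⟩, ?_, fun P' hP' => ?_⟩
  · refine (isSummableSplitting_shift hf h1 _ _).1 ?_
    show Orbit.IsSummableSplitting d x.shift ((P.1.map T.symm.toLinearMap).map T.toLinearMap)
        ((P.2.map T.symm.toLinearMap).map T.toLinearMap)
    rw [h2, h2]
    exact hP
  · have h4 := hu ⟨P'.1.map T.toLinearMap, P'.2.map T.toLinearMap⟩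
      ((isSummableSplitting_shift hf h1 _ _).2 hP')
    rw [← h4]
    exact Prod.ext (h3 P'.1).symm (h3 P'.2).symm

/-- If the dimensions differed, some coordinate vector would be expanded by one matrix with its
margin and contracted by the other, although the matrices differ by less than that margin. -/
theorem LyapunovPair.dim_eq {k k' : ℕ} {p p' q q' : M} {C : Euc d ≃L[ℝ] TangentSpace (𝓡 d) p}
    {C' : Euc d ≃L[ℝ] TangentSpace (𝓡 d) p'} {B : Euc d ≃L[ℝ] TangentSpace (𝓡 d) q}
    {B' : Euc d ≃L[ℝ] TangentSpace (𝓡 d) q'} {D E : Euc d ≃L[ℝ] Euc d}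
    (h : LyapunovPair k C C' D) (h' : LyapunovPair k' B B' E) (hd : 0 < d) (hk : k ≤ d)
    (hk' : k' ≤ d) {κ η : ℝ} (hη : η < κ) (hκ0 : 0 ≤ η) (hκ : κ ≤ (invNorm C ^ 2)⁻¹)
    (hκ' : κ ≤ (invNorm C' ^ 2)⁻¹) (hclose : ∀ v, ‖D v - E v‖ ≤ η * ‖v‖) : k = k' := by
  have basis : ∀ j : Fin d, ‖EuclideanSpace.single j (1 : ℝ)‖ = 1 := fun j => by simp
  have hlow : ∀ (j : Fin d) (n : ℕ), (j : ℕ) < n → IsLow n (EuclideanSpace.single j (1 : ℝ)) :=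
    fun j n hj i hi => by
      have : i ≠ j := fun e => by subst e; omega
      simp [this]
  have hhigh : ∀ (j : Fin d) (n : ℕ), n ≤ (j : ℕ) → IsHigh n (EuclideanSpace.single j (1 : ℝ)) :=
    fun j n hj i hi => by
      have : i ≠ j := fun e => by subst e; omega
      simp [this]
  have i1 := inv_sq_le_one (one_le_invNorm hd h'.norm_le)
  have i2 := inv_sq_le_one (one_le_invNorm hd h'.norm_le')
  have i3 := inv_sq_le_one (one_le_invNorm hd h.norm_le')
  have j1 : 0 ≤ (invNorm B ^ 2)⁻¹ := by positivity
  have j2 : 0 ≤ (invNorm B' ^ 2)⁻¹ := by positivity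
  rcases lt_trichotomy k k' with hlt | heq | hlt
  · exfalso
    -- Counting from zero, coordinate number `k` is the first unstable one for `D` and still a
    -- stable one for `E`.
    set e : Euc d := EuclideanSpace.single (⟨k, by omega⟩ : Fin d) (1 : ℝ)
    have he : ‖e‖ = 1 := basis _
    have h1 := h.high_expand hd (hhigh ⟨k, by omega⟩ k le_rfl)
    have h2 := h'.low_contract hd (hlow ⟨k, by omega⟩ k' hlt)
    have h3 := hclose e
    have h4 := norm_sub_norm_le (D e) (E e)
    change ‖e‖ ≤ _ * ‖D e‖ at h1
    change ‖E e‖ ≤ _ * ‖e‖ at h2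
    rw [he] at h1 h2 h3
    have h5 : ‖D e‖ ≤ 1 + η := by linarith
    have h6 : (1 - (invNorm C' ^ 2)⁻¹) * ‖D e‖ ≤ (1 - κ) * (1 + η) :=
      mul_le_mul (by linarith) h5 (norm_nonneg _) (by linarith)
    nlinarith
  · exact heq
  · exfalso
    set e : Euc d := EuclideanSpace.single (⟨k', by omega⟩ : Fin d) (1 : ℝ)
    have he : ‖e‖ = 1 := basis _
    have h1 := h.low_contract hd (hlow ⟨k', by omega⟩ k hlt)
    have h2 := h'.high_expand hd (hhigh ⟨k', by omega⟩ k' le_rfl)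
    have h3 := hclose e
    have h4 := norm_sub_norm_le (E e) (D e)
    rw [norm_sub_rev] at h4
    change ‖D e‖ ≤ _ * ‖e‖ at h1
    change ‖e‖ ≤ _ * ‖E e‖ at h2
    rw [he] at h1 h2 h3
    have h5 : (1 - (invNorm B' ^ 2)⁻¹) * ‖E e‖ ≤ ‖E e‖ :=
      mul_le_of_le_one_left (norm_nonneg _) (by linarith)
    linarith

/-- Moving a point by little does not change much the distance to the singular set. -/
theorem half_rpow_le_infDist {S : Set M} {a ρ t : ℝ} (ha : 1 ≤ a) (hρ : 0 < ρ)
    (ht : 2 * a * t ≤ ρ) {x z : M} (hz : ρ ≤ infDist z S) (hxz : dist z x ≤ t) :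
    0 < infDist x S ∧ 1 / 2 * ρ ^ a ≤ infDist x S ^ a ∧ infDist x S ^ (-a) ≤ 2 * ρ ^ (-a) := by
  have h1 : ρ * (1 - t / ρ) ≤ infDist x S := by
    have h2 : ρ * (1 - t / ρ) = ρ - t := by field_simp
    rw [h2]
    have := infDist_le_infDist_add_dist (s := S) (x := z) (y := x)
    linarith
  have h3 : t / ρ ≤ 1 / (2 * a) := by
    rw [div_le_div_iff₀ hρ (by linarith)]; linarith
  have h4 : 1 / (2 * a) ≤ 1 / 2 := by
    rw [div_le_div_iff₀ (by linarith) (by norm_num)]; linarith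
  have h5 : 0 < 1 - t / ρ := by linarith
  have h6 : 1 / 2 ≤ (1 - t / ρ) ^ a := by
    -- Bernoulli's inequality: `(1 - t/ρ)^a ≥ 1 - a t/ρ ≥ 1/2`.
    have h7 := one_add_mul_self_le_rpow_one_add (s := -(t / ρ)) (by linarith) ha
    have h8 : a * (t / ρ) ≤ 1 / 2 := by
      calc a * (t / ρ) ≤ a * (1 / (2 * a)) := by gcongr
        _ = 1 / 2 := by field_simp
    rw [← sub_eq_add_neg] at h7
    linarith
  have h7 : 1 / 2 * ρ ^ a ≤ infDist x S ^ a := by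
    calc 1 / 2 * ρ ^ a ≤ (1 - t / ρ) ^ a * ρ ^ a := by gcongr
      _ = (ρ * (1 - t / ρ)) ^ a := by rw [Real.mul_rpow hρ.le h5.le, mul_comm]
      _ ≤ _ := by gcongr
  have h8 : 0 < infDist x S := (mul_pos hρ h5).trans_le h1
  refine ⟨h8, h7, ?_⟩
  rw [Real.rpow_neg h8.le, Real.rpow_neg hρ.le]
  have h9 : 0 < ρ ^ a := by positivity
  calc (infDist x S ^ a)⁻¹ ≤ (1 / 2 * ρ ^ a)⁻¹ := inv_anti₀ (by positivity) h7
    _ = _ := by field_simp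

namespace PreScale

variable {c : Constants} {L r δ ε ρ N P η₁ η₂ : ℝ}

theorem eps_le (h : PreScale c L r δ ε ρ N P η₁ η₂) : 1000 * ε ^ 10 ≤ 1 := by
  have h1 := h.small.L_le
  have h2 := h.one_le_L
  have h3 : 0 < ε ^ 10 := pow_pos h.small.pos 10
  nlinarith

theorem Λ₀_mul_P_le (h : PreScale c L r δ ε ρ N P η₁ η₂) : ρ ^ (-c.a) * P ≤ ε ^ 10 := by
  refine le_trans ?_ h.P_mul_le
  rw [mul_comm]
  refine mul_le_mul_of_nonneg_left ?_ h.P_pos.le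
  have h1 := h.one_le_Λ₀
  calc ρ ^ (-c.a) ≤ (ρ ^ (-c.a)) ^ 4 := le_self_pow₀ h1 (by norm_num)
    _ ≤ _ := le_mul_of_one_le_right (by positivity) (one_le_pow₀ h.one_le_N)

theorem P_le_eps (h : PreScale c L r δ ε ρ N P η₁ η₂) : P ≤ ε ^ 10 :=
  (le_mul_of_one_le_left h.P_pos.le h.one_le_Λ₀).trans h.Λ₀_mul_P_le

theorem η₂_le_two_P (h : PreScale c L r δ ε ρ N P η₁ η₂) : η₂ ≤ 2 * P :=
  h.η₂_le.trans (by linarith [h.η₁_le])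

theorem η₂_le_one (h : PreScale c L r δ ε ρ N P η₁ η₂) : η₂ ≤ 1 := by
  linarith [h.η₂_le_two_P, h.P_le_eps, h.eps_le]

theorem η₁_le_one (h : PreScale c L r δ ε ρ N P η₁ η₂) : η₁ ≤ 1 := by
  linarith [h.η₁_le, h.P_le_eps, h.eps_le, h.P_pos]

theorem η₂_pow_le (h : PreScale c L r δ ε ρ N P η₁ η₂) : η₂ ^ 8 ≤ 2 * P :=
  (pow_le_of_le_one h.η₂_pos.le h.η₂_le_one (by norm_num)).trans h.η₂_le_two_P

theorem η₁_pow_le (h : PreScale c L r δ ε ρ N P η₁ η₂) : η₁ ^ 8 ≤ P :=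
  (pow_le_of_le_one h.η₁_pos.le h.η₁_le_one (by norm_num)).trans h.η₁_le

theorem radius_le (h : PreScale c L r δ ε ρ N P η₁ η₂) :
    8 * ρ ^ (-c.a) * P + η₂ ^ 8 ≤ 10 * ε ^ 10 := by
  linarith [h.η₂_pow_le, h.P_le_eps, h.Λ₀_mul_P_le]

theorem P_le_mul_ρ (h : PreScale c L r δ ε ρ N P η₁ η₂) :
    P ≤ ε ^ 10 * ρ ^ c.a ∧ ρ ^ c.a ≤ ρ := by
  have h1 := h.ρ_pos
  have h2 : 0 < ρ ^ c.a := by positivity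
  constructor
  · have := h.Λ₀_mul_P_le
    rwa [Real.rpow_neg h1.le, inv_mul_le_iff₀ h2, mul_comm] at this
  · conv_rhs => rw [← Real.rpow_one ρ]
    exact Real.rpow_le_rpow_of_exponent_ge h1 h.ρ_le h.valid.one_lt_a.le

theorem two_mul_a_mul_le (h : PreScale c L r δ ε ρ N P η₁ η₂) : 2 * c.a * (2 * P) ≤ ρ := by
  obtain ⟨h1, h2⟩ := h.P_le_mul_ρ
  have h3 := h.small.a_le
  have h4 := h.valid.one_lt_a
  have h5 := h.ρ_pos
  have h6 : 0 < ε ^ 10 := pow_pos h.small.pos 10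
  calc 2 * c.a * (2 * P) ≤ 2 * c.a * (2 * (ε ^ 10 * ρ)) := by
        gcongr; exact h1.trans (by gcongr)
    _ = 4 * (c.a * ε ^ 10) * ρ := by ring
    _ ≤ 1 * ρ := by gcongr; linarith
    _ = ρ := one_mul ρ

end PreScale

/-! ### Construction of the chart data; admissible manifolds as chart graphs -/

section Builder

variable {f : M → M} {A : FrameCover d M (singSet d f)}

/-- The Lebesgue number supplies one frame around `p` and one around `q`. The image of the window
stays within `2 · (2Λ₀) · (2P) + θ = 8Λ₀P + θ` of `q`. -/
theorem exists_chartData {g : M → M} {p q : M} {U : Set M} {P θ Λ₀ K β δ : ℝ}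
    (hδ : ∀ y ∉ singSet d f, ∃ n, ball y δ ⊆ ball (A.center n) (A.radius n))
    (hp : p ∉ singSet d f) (hq : q ∉ singSet d f) (hP : 0 < P) (hβ : 0 < β) (hβ1 : β ≤ 1)
    (hΛ : 1 ≤ Λ₀) (hK : 1 ≤ K) (hr : 8 * Λ₀ * P + θ < A.r) (hL : A.L * (8 * Λ₀ * P + θ) ≤ 1)
    (hδT : 8 * Λ₀ * P + θ ≤ δ) (hθ : dist (g p) q < θ) (hU : ball p (4 * P) ⊆ U)
    (hg : ContMDiffOn (𝓡 d) (𝓡 d) 1 g U)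
    (hb : ∀ z ∈ U, ‖mfderiv (𝓡 d) (𝓡 d) g z‖ ≤ 2 * Λ₀)
    (hh : ∀ n m : ℕ, ∀ y ∈ U ∩ A.D n, ∀ z ∈ U ∩ A.D n, g y ∈ A.D m → g z ∈ A.D m → ∀ w : Euc d,
      ‖A.Θ m (g y) (mfderiv (𝓡 d) (𝓡 d) g y ((A.Θ n y).symm w)) -
        A.Θ m (g z) (mfderiv (𝓡 d) (𝓡 d) g z ((A.Θ n z).symm w))‖ ≤ K * dist y z ^ β * ‖w‖) :
    ∃ n m, ChartData A g p q (2 * P) θ (2 * Λ₀) K β n m := by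
  obtain ⟨n, hn⟩ := hδ p hp
  obtain ⟨m, hm⟩ := hδ q hq
  have hθ0 : 0 < θ := dist_nonneg.trans_lt hθ
  have hr1 := A.r_lt_one
  have hL1 := A.one_le_L
  have h8 : 8 * P ≤ 8 * Λ₀ * P := by nlinarith
  have e : 2 * (2 * Λ₀) * (2 * P) = 8 * Λ₀ * P := by ring
  have e' : 2 * (2 * P) = 4 * P := by ring
  refine ⟨n, m, ?_⟩
  have hsub : ball p (2 * (2 * P)) ⊆ A.D n := (ball_subset_ball (by linarith)).trans hn
  refine
    { R_pos := by linarith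
      R_le := by linarith
      LR := le_trans (mul_le_mul_of_nonneg_left (by linarith) (by linarith)) hL
      β_pos := hβ
      β_le := hβ1
      one_le_Λ := by linarith
      one_le_K := hK
      Rr := by linarith
      θ_lt := by rw [e]; exact hr
      Lθ := by rw [e]; exact hL
      p_mem := hsub
      q_mem := by rw [e]; exact (ball_subset_ball hδT).trans hm
      dist_lt := hθ
      smooth := by rw [e']; exact hg.mono hU
      bound := fun z hz => hb z (hU (by rwa [e'] at hz))
      holder := fun y hy z hz h1 h2 w => ?_ }
  exact hh n m y ⟨hU (by rwa [e'] at hy), hsub hy⟩ z ⟨hU (by rwa [e'] at hz), hsub hz⟩ h1 h2 w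

end Builder

section Admissible

variable {f : M → M} {C : ChartChoice d f} {c : Constants}

theorem DoubleChart.uGraph_eq {w : DoubleChart f} (hk : w.x.ds d ≤ d)
    (G : Euc (d - w.x.ds d) → Euc (w.x.ds d)) :
    w.uGraph C G = chartGraph (splitLow hk) (C w.x) w.pu G :=
  image_congr fun v _ => by rw [splitLow_join]; rfl

theorem DoubleChart.sGraph_eq {w : DoubleChart f} (hk : w.x.ds d ≤ d)
    (G : Euc (w.x.ds d) → Euc (d - w.x.ds d)) :
    w.sGraph C G = chartGraph (splitLow hk).swap (C w.x) w.ps G :=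
  image_congr fun v _ => by rw [CoordSplit.swap_join, splitLow_join]; rfl

theorem DoubleChart.isUAdmissible_iff {w : DoubleChart f} {k : ℕ} (h : w.x.ds d = k) (hk : k ≤ d)
    (V : Set M) : w.IsUAdmissible C c V ↔ ∃ G : Euc (d - k) → Euc k,
      IsRepresenting c.β w.size w.pu G ∧ V = chartGraph (splitLow hk) (C w.x) w.pu G := by
  subst h
  simp only [IsUAdmissible, uGraph_eq hk]

theorem DoubleChart.isSAdmissible_iff {w : DoubleChart f} {k : ℕ} (h : w.x.ds d = k) (hk : k ≤ d)
    (V : Set M) : w.IsSAdmissible C c V ↔ ∃ G : Euc k → Euc (d - k),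
      IsRepresenting c.β w.size w.ps G ∧ V = chartGraph (splitLow hk).swap (C w.x) w.ps G := by
  subst h
  simp only [IsSAdmissible, sGraph_eq hk]

theorem Orbit.ds_le (C : ChartChoice d f) (x : Orbit f) : Orbit.ds d x ≤ d := by
  have h1 : Module.finrank ℝ (TangentSpace (𝓡 d) (x.pt 0)) = d := by
    rw [((C x).toLinearEquiv).symm.finrank_eq, finrank_euclideanSpace_fin]
  exact (Submodule.finrank_le _).trans h1.le

end Admissible

namespace PreScale

variable {c : Constants} {L r δ ε ρ N P η₁ η₂ : ℝ}

theorem η₂_pow_le_sq (h : PreScale c L r δ ε ρ N P η₁ η₂) :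
    η₂ ^ 8 ≤ 256 * (P ^ (c.β / 2)) ^ 2 ∧ η₁ ^ 8 ≤ (P ^ (c.β / 2)) ^ 2 ∧
      (η₁ ^ 8) ^ c.β ≤ (P ^ (c.β / 2)) ^ 2 := by
  obtain ⟨-, -, h3⟩ := h.rpow_bounds
  have hP := h.P_pos
  have hβ := h.valid.β_pos
  have h1 : P ≤ P ^ (c.β / 2) := by
    conv_lhs => rw [← Real.rpow_one P]
    exact Real.rpow_le_rpow_of_exponent_ge hP h3 (by linarith [h.valid.β_le_one])
  have h2 : P ^ 8 ≤ (P ^ (c.β / 2)) ^ 2 :=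
    (pow_le_pow_of_le_one hP.le h3 (by norm_num)).trans (pow_le_pow_left₀ hP.le h1 2)
  have h4 : η₁ ^ 8 ≤ P ^ 8 := pow_le_pow_left₀ h.η₁_pos.le h.η₁_le 8
  refine ⟨?_, h4.trans h2, ?_⟩
  · calc η₂ ^ 8 ≤ (2 * P) ^ 8 := pow_le_pow_left₀ h.η₂_pos.le h.η₂_le_two_P 8
      _ = 256 * P ^ 8 := by ring
      _ ≤ _ := by gcongr
  · have h5 : η₁ ^ 8 ≤ P := h.η₁_pow_le
    have h6 : 0 ≤ η₁ ^ 8 := by have := h.η₁_pos; positivity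
    refine (Real.rpow_le_rpow h6 h5 hβ.le).trans_eq ?_
    rw [← Real.rpow_natCast, ← Real.rpow_mul hP.le]
    congr 1; push_cast; ring

theorem sq_mul_le (h : PreScale c L r δ ε ρ N P η₁ η₂) :
    10 ^ 6 * c.K * ((P ^ (c.β / 2)) ^ 2 * ((ρ ^ (-c.a)) ^ 7 * N ^ 3)) ≤ 1 := by
  obtain ⟨h1, -, -⟩ := h.rpow_bounds
  have h4 := h.one_le_Λ₀
  have h5 := h.one_le_N
  have hK := h.valid.one_lt_K
  have hP := h.P_pos
  set t := P ^ (c.β / 2) with ht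
  set Λ := ρ ^ (-c.a)
  have ht0 : 0 < t := by positivity
  have h6 : Λ ^ 7 * N ^ 3 ≤ (Λ ^ 4 * N ^ 20) ^ 2 := by
    rw [mul_pow, ← pow_mul, ← pow_mul]
    exact mul_le_mul (pow_le_pow_right₀ h4 (by norm_num)) (pow_le_pow_right₀ h5 (by norm_num))
      (by positivity) (by positivity)
  have h7 : t ^ 2 * (Λ ^ 7 * N ^ 3) ≤ (ε ^ 10) ^ 2 := by
    calc _ ≤ t ^ 2 * (Λ ^ 4 * N ^ 20) ^ 2 := by gcongr
      _ = (t * (Λ ^ 4 * N ^ 20)) ^ 2 := by ring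
      _ ≤ _ := pow_le_pow_left₀ (by positivity) h1 2
  have h8 := h.small.holder
  have h9 := h.eps_le
  have h10 : 0 < ε ^ 10 := pow_pos h.small.pos 10
  have h11 : c.K ≤ L * c.K := le_mul_of_one_le_left (by linarith) h.one_le_L
  calc _ ≤ 10 ^ 6 * c.K * (ε ^ 10) ^ 2 := by gcongr
    _ = 10 ^ 6 * c.K * ε ^ 10 * ε ^ 10 := by ring
    _ ≤ 1 * 1 := by
      refine mul_le_mul ?_ (by linarith) h10.le zero_le_one
      refine le_trans ?_ h8
      gcongr <;> norm_num
    _ = 1 := one_mul 1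

theorem frame_small (h : PreScale c L r δ ε ρ N P η₁ η₂) :
    2 * (8 * (ρ ^ (-c.a)) ^ 2 * N) * η₂ ^ 8 ≤ 1 := by
  obtain ⟨h1, -, -⟩ := h.η₂_pow_le_sq
  have h4 := h.one_le_Λ₀
  have h5 := h.one_le_N
  have hK := h.valid.one_lt_K
  refine le_trans ?_ h.sq_mul_le
  set t := P ^ (c.β / 2)
  set Λ := ρ ^ (-c.a)
  have h6 : Λ ^ 2 * N ≤ Λ ^ 7 * N ^ 3 :=
    mul_le_mul (pow_le_pow_right₀ h4 (by norm_num)) (le_self_pow₀ h5 (by norm_num))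
      (by linarith) (by positivity)
  have h7 : 4096 * (t ^ 2 * (Λ ^ 2 * N)) ≤ 10 ^ 6 * c.K * (t ^ 2 * (Λ ^ 7 * N ^ 3)) := by
    refine mul_le_mul (by linarith) (by gcongr) (by positivity) (by positivity)
  calc _ ≤ 2 * (8 * Λ ^ 2 * N) * (256 * t ^ 2) := by gcongr
    _ = 4096 * (t ^ 2 * (Λ ^ 2 * N)) := by ring
    _ ≤ _ := h7

/-- Input for `LyapunovPair.dim_eq`: the left side bounds the difference of the two step matrices in
`ChartLink.ds_eq`, and the right side is below both margins at `x`. -/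
theorem dim_small (h : PreScale c L r δ ε ρ N P η₁ η₂) :
    4 * (ρ ^ (-c.a)) ^ 2 * N * (2 * ρ ^ (-c.a) * η₂ ^ 8 + ρ ^ (-c.a) * η₁ ^ 8 +
      c.K * (η₁ ^ 8) ^ c.β) < ((8 * (ρ ^ (-c.a)) ^ 2 * N) ^ 2)⁻¹ := by
  obtain ⟨h1, h2, h3⟩ := h.η₂_pow_le_sq
  have h4 := h.one_le_Λ₀
  have h5 := h.one_le_N
  have hK := h.valid.one_lt_K
  have hP := h.P_pos
  have h0 := h.sq_mul_le
  set t := P ^ (c.β / 2) with ht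
  set Λ := ρ ^ (-c.a)
  have ht0 : 0 < t := by positivity
  rw [← one_div, lt_div_iff₀ (by positivity)]
  have h6 : 2 * Λ * η₂ ^ 8 + Λ * η₁ ^ 8 + c.K * (η₁ ^ 8) ^ c.β ≤ 514 * c.K * Λ * t ^ 2 := by
    have a1 : 2 * Λ * η₂ ^ 8 ≤ 2 * Λ * (256 * t ^ 2) := by gcongr
    have a2 : Λ * η₁ ^ 8 ≤ Λ * t ^ 2 := by gcongr
    have a3 : c.K * (η₁ ^ 8) ^ c.β ≤ c.K * t ^ 2 := by gcongr
    have a4 : c.K * t ^ 2 ≤ c.K * Λ * t ^ 2 := by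
      rw [mul_assoc]
      exact mul_le_mul_of_nonneg_left (le_mul_of_one_le_left (by positivity) h4) (by linarith)
    have a5 : Λ * t ^ 2 ≤ c.K * (Λ * t ^ 2) := le_mul_of_one_le_left (by positivity) hK.le
    nlinarith
  calc _ ≤ 4 * Λ ^ 2 * N * (514 * c.K * Λ * t ^ 2) * (8 * Λ ^ 2 * N) ^ 2 := by gcongr
    _ = 131584 * c.K * (t ^ 2 * (Λ ^ 7 * N ^ 3)) := by ring
    _ < 10 ^ 6 * c.K * (t ^ 2 * (Λ ^ 7 * N ^ 3)) := by gcongr; norm_num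
    _ ≤ 1 := h0

theorem radius_le_rpow (h : PreScale c L r δ ε ρ N P η₁ η₂) :
    8 * ρ ^ (-c.a) * P + η₂ ^ 8 ≤ ρ ^ c.a := by
  have h0 := h.P_mul_le
  have h4 := h.one_le_Λ₀
  have h5 := h.one_le_N
  have h6 := h.eps_le
  have h7 := h.η₂_pow_le
  have hP := h.P_pos
  have h1 : P * (ρ ^ (-c.a)) ^ 2 ≤ ε ^ 10 := by
    refine le_trans ?_ h0
    refine mul_le_mul_of_nonneg_left ?_ hP.le
    exact (pow_le_pow_right₀ h4 (by norm_num)).trans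
      (le_mul_of_one_le_right (by positivity) (one_le_pow₀ h5))
  have h2 : ρ ^ c.a = (ρ ^ (-c.a))⁻¹ := by rw [Real.rpow_neg h.ρ_pos.le, inv_inv]
  rw [h2, ← one_div, le_div_iff₀ (by linarith)]
  have h3 : P ≤ ρ ^ (-c.a) * P := le_mul_of_one_le_left hP.le h4
  set Λ := ρ ^ (-c.a)
  calc (8 * Λ * P + η₂ ^ 8) * Λ ≤ (8 * Λ * P + 2 * (Λ * P)) * Λ := by gcongr; linarith
    _ = 10 * (P * Λ ^ 2) := by ring
    _ ≤ 1 := by linarith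

end PreScale

section Smooth

variable [IsContMDiffRiemannianBundle (𝓡 d) ∞ (Euc d) (fun x : M => TangentSpace (𝓡 d) x)]
  [IsRiemannianManifold (𝓡 d) M] {S : Set M}

/-- The overlap condition holds in some ball `A.D m₀`, whereas the chart data use the ball obtained
from the Lebesgue number at `q`; the change of frame reconciles them. -/
theorem ChartData.graphTransform {A : FrameCover d M S} {g : M → M} {p q : M} {n m m₀ : ℕ}
    {Cp : Euc d ≃L[ℝ] TangentSpace (𝓡 d) p} {Cq : Euc d ≃L[ℝ] TangentSpace (𝓡 d) q}
    {C' : Euc d ≃L[ℝ] TangentSpace (𝓡 d) (g p)} {D : Euc d ≃L[ℝ] Euc d}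
    {c : Constants} {δ ε ρ ρ' P Q Q' η₁ η₂ : ℝ} {k l : ℕ} {J : CoordSplit d k l}
    {G : Euc l → Euc k} (hd : 0 < d)
    (h : ChartData A g p q (2 * P) (η₂ ^ 8) (2 * ρ ^ (-c.a)) c.K c.β n m)
    (hs : PreScale c A.L A.r δ ε ρ (invNorm Cp) P η₁ η₂)
    (hJ : SplitHyp J D (invNorm Cp ^ 2)⁻¹ (invNorm C' ^ 2)⁻¹)
    (hCp : ∀ v, ‖Cp v‖ ≤ ‖v‖) (hCq : ∀ v, ‖Cq v‖ ≤ ‖v‖) (hC' : ∀ v, ‖C' v‖ ≤ ‖v‖)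
    (hD : ∀ v, C' (D v) = mfderiv (𝓡 d) (𝓡 d) g p (Cp v))
    (hN' : invNorm C' ≤ 8 * (ρ ^ (-c.a)) ^ 2 * invNorm Cp)
    (hp₀ : g p ∈ A.D m₀) (hq₀ : q ∈ A.D m₀) (hm : ‖A.mat m₀ (g p) C' - A.mat m₀ q Cq‖ ≤ η₂ ^ 8)
    (hρ' : 0 < ρ') (hρ'1 : ρ' ≤ 1)
    (hQ : Q ≤ ε ^ (20 / c.β) * ρ' ^ (8 * c.a / c.β) * invNorm Cq ^ (-(2 * c.γ)))
    (hQ' : Q' ≤ ε ^ (20 / c.β) * ρ' ^ (8 * c.a / c.β) * invNorm Cq ^ (-(2 * c.γ)))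
    (hηQ : η₂ ≤ Q) (hηQ' : η₂ ≤ Q') (hQP : Q ≤ c.ladder P)
    (hG : DoubleChart.IsRepresenting c.β η₁ P G) :
    GraphTransform J g Cp Cq c.β P Q Q' η₁ η₂ G := by
  have hNq := LyapunovPair.one_le_invNorm hd hCq
  have hN1 := LyapunovPair.one_le_invNorm hd hC'
  have hη := h.θ_pos
  have hη2 := hs.η₂_pos
  have hε := hs.small.pos
  -- The scale data read backwards, with the target window in the role of `P`, bound that window by
  -- `ε¹⁰`.
  have small : ∀ {Q : ℝ}, η₂ ≤ Q →
      Q ≤ ε ^ (20 / c.β) * ρ' ^ (8 * c.a / c.β) * invNorm Cq ^ (-(2 * c.γ)) → 2 * Q < A.r := by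
    intro Q h1 h2
    have hs' : PreScale c A.L A.r δ ε ρ' (invNorm Cq) Q η₂ η₁ :=
      ⟨hs.valid, hs.small, hs.one_le_L, hρ', hρ'1, hNq, h2, hη2, hs.η₁_pos, h1,
        hs.close.2, hs.close.1⟩
    have := hs'.P_le_eps
    have := hs.small.r_le
    have : 0 < ε ^ 10 := by positivity
    linarith
  have hfr : 2 * invNorm C' * ‖A.mat m₀ (g p) C' - A.mat m₀ q Cq‖ ≤ 1 := by
    have := invNorm_nonneg Cp
    refine le_trans ?_ hs.frame_small
    gcongr
  obtain ⟨h1, h2⟩ := A.invNorm_le_two_mul m₀ hfr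
  have hmem : g p ∈ A.D m := by
    have h3 := h.map_mem (u := 0) (by simpa using h.R_pos)
    rw [A.expFrame_zero] at h3
    exact h.q_mem h3
  have hr : dist (g p) q < A.r := by
    have h3 := h.dist_lt
    have h4 := h.θ_lt
    have h5 := h.one_le_Λ
    have h6 := h.R_pos
    have h7 : 0 ≤ 2 * (2 * ρ ^ (-c.a)) * (2 * P) := by positivity
    linarith
  -- One `η₂⁸` comes from the overlap, and `2L η₂⁸` from the change of frame between `g p` and `q`.
  have hm' : ‖A.mat m (g p) C' - A.mat m q Cq‖ ≤ 3 * A.L * η₂ ^ 8 := by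
    refine (A.norm_mat_sub_le hp₀ hmem hq₀ h.q_mem_D hr C' hCq).trans ?_
    have h3 : 2 * A.L * dist (g p) q ≤ 2 * A.L * η₂ ^ 8 := by
      have := A.one_le_L
      have := h.dist_lt.le
      gcongr
    have h4 : η₂ ^ 8 ≤ A.L * η₂ ^ 8 := le_mul_of_one_le_left hη.le A.one_le_L
    linarith
  obtain ⟨lam, H, e₀, t₀, lam₀, hH⟩ := h.exists_hypMap
    (hs.scaleBounds hρ' hρ'1 hNq hN1 hQ hηQ hQP hN' h1 h2) hJ hCp hD hm'
  exact hH.graphTransform h hCp hCq (small hηQ hQ) hηQ' (small hηQ' hQ') hG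

end Smooth

/-! ### Linked double charts: the inverse branch and the stable dimension -/

section Smooth

variable [IsContMDiffRiemannianBundle (𝓡 d) ∞ (Euc d) (fun x : M => TangentSpace (𝓡 d) x)]
  [IsRiemannianManifold (𝓡 d) M] {f : M → M} {A : FrameCover d M (singSet d f)} {c : Constants}

/-- The lower bound on `df` is the upper bound on the differential of the inverse branch, which
inverts it. -/
theorem SingularSystem.bounds_mfderiv (S : SingularSystem d c f A) {x y : M} (hx : x ∉ singSet d f)
    (hfx : f x ∉ singSet d f) (hy : y ∈ ball x (2 * S.τ x)) (hfy : f y ∈ ball (f x) (2 * S.τ x))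
    (hinv : S.inv x (f y) = y) (ζ : TangentSpace (𝓡 d) y) :
    tangentCast d hinv.symm ζ =
        mfderiv (𝓡 d) (𝓡 d) (S.inv x) (f y) (mfderiv (𝓡 d) (𝓡 d) f y ζ) ∧
      ‖mfderiv (𝓡 d) (𝓡 d) f y ζ‖ ≤ infDist x (singSet d f) ^ (-c.a) * ‖ζ‖ ∧
      ‖ζ‖ ≤ infDist x (singSet d f) ^ (-c.a) * ‖mfderiv (𝓡 d) (𝓡 d) f y ζ‖ := by
  have h1 : tangentCast d hinv.symm ζ =
      mfderiv (𝓡 d) (𝓡 d) (S.inv x) (f y) (mfderiv (𝓡 d) (𝓡 d) f y ζ) := by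
    refine mfderiv_localInverse_apply (f := f) (g := S.inv x) rfl hinv ?_
      (S.smooth.mdifferentiableAt (by simp)) ?_ ((S.f_diffeo x hx hfx).2.2 y hy).1 rfl
    · filter_upwards [isOpen_ball.mem_nhds hfy] with u hu using S.f_inv x hx hfx u hu
    · exact ((S.inv_diffeo x hx hfx).1.contMDiffAt (isOpen_ball.mem_nhds hfy)).mdifferentiableAt
        (by simp)
  refine ⟨h1, ?_, ?_⟩
  · exact ((mfderiv (𝓡 d) (𝓡 d) f y).le_opNorm ζ).trans
      (mul_le_mul_of_nonneg_right (S.df_bound x hx hfx y hy).2 (norm_nonneg _))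
  · rw [← norm_tangentCast hinv.symm ζ, h1]
    exact ((mfderiv (𝓡 d) (𝓡 d) (S.inv x) (f y)).le_opNorm _).trans
      (mul_le_mul_of_nonneg_right (S.dinv_bound x hx hfx _ hfy).2 (norm_nonneg _))

/-- The data of two double charts at `x` and at `z.shift` that are related by an arrow. -/
structure ChartLink (A : FrameCover d M (singSet d f)) (c : Constants) (C : ChartChoice d f)
    (δ ε : ℝ) (x z : Orbit f) (ps pu qs qu η₁ η₂ : ℝ) (n m : ℕ) : Prop where
  dim_pos : 0 < d
  valid : c.Valid
  small : SmallEps c A.L A.r δ ε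
  lebesgue : ∀ y ∉ singSet d f, ∃ n, ball y δ ⊆ ball (A.center n) (A.radius n)
  infDist_le : ∀ y, infDist y (singSet d f) ≤ 1
  frames : C.Valid
  x_summable : Orbit.IsSummable d x
  z_summable : Orbit.IsSummable d z
  shift_x_summable : Orbit.IsSummable d x.shift
  shift_z_summable : Orbit.IsSummable d z.shift
  rho_x_pos : 0 < Orbit.rho d x
  rho_z_pos : 0 < Orbit.rho d z.shift
  ps_le : ps ≤ C.Qtilde c ε x
  pu_le : pu ≤ C.Qtilde c ε x
  qs_le : qs ≤ C.Qtilde c ε z.shift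
  qu_le : qu ≤ C.Qtilde c ε z.shift
  η₁_pos : 0 < η₁
  η₂_pos : 0 < η₂
  η₁_le_ps : η₁ ≤ ps
  η₁_le_pu : η₁ ≤ pu
  η₂_le_qs : η₂ ≤ qs
  η₂_le_qu : η₂ ≤ qu
  close : c.LadderClose η₁ η₂
  ps_le_ladder : ps ≤ c.ladder qs
  qu_le_ladder : qu ≤ c.ladder pu
  x_mem : x.pt 0 ∈ A.D n
  z_mem : z.pt 0 ∈ A.D n
  left_dist : dist (x.pt 0) (z.pt 0) < η₁ ^ 8
  left_mat : ‖A.mat n _ (C x) - A.mat n _ (C z)‖ ≤ η₁ ^ 8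
  shift_x_mem : x.shift.pt 0 ∈ A.D m
  shift_z_mem : z.shift.pt 0 ∈ A.D m
  right_dist : dist (x.shift.pt 0) (z.shift.pt 0) < η₂ ^ 8
  right_mat : ‖A.mat m _ (C x.shift) - A.mat m _ (C z.shift)‖ ≤ η₂ ^ 8

namespace ChartLink

variable {C : ChartChoice d f} {δ ε ps pu qs qu η₁ η₂ : ℝ} {x z : Orbit f} {n m : ℕ}

theorem rho_le_one (h : ChartLink A c C δ ε x z ps pu qs qu η₁ η₂ n m) (y : Orbit f) :
    Orbit.rho d y ≤ 1 := (min_le_left _ _).trans (h.infDist_le _)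

theorem norm_le (h : ChartLink A c C δ ε x z ps pu qs qu η₁ η₂ n m) {y : Orbit f}
    (hy : Orbit.IsSummable d y) (v : Euc d) : ‖C y v‖ ≤ ‖v‖ := (h.frames y hy).norm_le hy v

theorem preScale (h : ChartLink A c C δ ε x z ps pu qs qu η₁ η₂ n m) :
    PreScale c A.L A.r δ ε (Orbit.rho d x) (invNorm (C x)) pu η₁ η₂ :=
  ⟨h.valid, h.small, A.one_le_L, h.rho_x_pos, h.rho_le_one x,
    LyapunovPair.one_le_invNorm h.dim_pos (h.norm_le h.x_summable), h.pu_le, h.η₁_pos, h.η₂_pos,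
    h.η₁_le_pu, h.close⟩

theorem preScale' (h : ChartLink A c C δ ε x z ps pu qs qu η₁ η₂ n m) :
    PreScale c A.L A.r δ ε (Orbit.rho d z.shift) (invNorm (C z.shift)) qs η₂ η₁ :=
  ⟨h.valid, h.small, A.one_le_L, h.rho_z_pos, h.rho_le_one _,
    LyapunovPair.one_le_invNorm h.dim_pos (h.norm_le h.shift_z_summable), h.qs_le, h.η₂_pos,
    h.η₁_pos, h.η₂_le_qs, h.close.2, h.close.1⟩

theorem x_notMem (h : ChartLink A c C δ ε x z ps pu qs qu η₁ η₂ n m) : x.pt 0 ∉ singSet d f :=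
  h.x_summable.1 0

theorem map_x_notMem (h : ChartLink A c C δ ε x z ps pu qs qu η₁ η₂ n m) :
    f (x.pt 0) ∉ singSet d f := by
  rw [x.map_pt 0]; exact h.x_summable.1 _

theorem dist_map (h : ChartLink A c C δ ε x z ps pu qs qu η₁ η₂ n m) :
    dist (z.shift.pt 0) (f (x.pt 0)) < η₂ ^ 8 := by
  rw [x.map_pt 0, dist_comm]; exact h.right_dist

theorem rho_lt_τ (h : ChartLink A c C δ ε x z ps pu qs qu η₁ η₂ n m)
    (S : SingularSystem d c f A) : Orbit.rho d x ^ c.a < S.τ (x.pt 0) := by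
  refine lt_of_le_of_lt ?_ (S.τ_gt _ h.x_notMem h.map_x_notMem)
  have h1 := h.rho_x_pos
  have h2 := h.valid.one_lt_a
  refine le_min ?_ ?_
  · exact Real.rpow_le_rpow h1.le ((min_le_right _ _).trans (min_le_left _ _)) (by linarith)
  · rw [x.map_pt 0]
    exact Real.rpow_le_rpow h1.le ((min_le_right _ _).trans (min_le_right _ _)) (by linarith)

theorem infDist_rpow_le (h : ChartLink A c C δ ε x z ps pu qs qu η₁ η₂ n m) :
    infDist (x.pt 0) (singSet d f) ^ (-c.a) ≤ Orbit.rho d x ^ (-c.a) :=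
  Real.rpow_le_rpow_of_nonpos h.rho_x_pos ((min_le_right _ _).trans (min_le_left _ _))
    (by linarith [h.valid.one_lt_a])

/-- The s-case has sizes measured by `ρ(y)`, while the hypotheses on the inverse branch speak of
`x_0` and `f(x_0)`. These points are close to `y_{-1}` and `y_0`, both of which enter `ρ(y)`, so
only a factor `2` is lost. -/
theorem rho_shift_bounds (h : ChartLink A c C δ ε x z ps pu qs qu η₁ η₂ n m)
    (S : SingularSystem d c f A) : 1 / 2 * Orbit.rho d z.shift ^ c.a < S.τ (x.pt 0) ∧
      infDist (x.pt 0) (singSet d f) ^ (-c.a) ≤ 2 * Orbit.rho d z.shift ^ (-c.a) := by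
  have hp := h.preScale'
  have ha := h.valid.one_lt_a.le
  have h1 := half_rpow_le_infDist ha h.rho_z_pos hp.two_mul_a_mul_le (x := x.pt 0) (z := z.pt 0)
    (S := singSet d f) (min_le_left _ _) (by
      rw [dist_comm]; exact h.left_dist.le.trans hp.η₂_pow_le)
  have h2 := half_rpow_le_infDist ha h.rho_z_pos hp.two_mul_a_mul_le (x := f (x.pt 0))
    (z := z.shift.pt 0) (S := singSet d f) ((min_le_right _ _).trans (min_le_left _ _))
    (h.dist_map.le.trans (hp.η₁_pow_le.trans (by linarith [hp.P_pos])))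
  exact ⟨lt_of_le_of_lt (le_min h1.2.1 h2.2.1) (S.τ_gt _ h.x_notMem h.map_x_notMem), h1.2.2⟩

theorem z_mem_ball (h : ChartLink A c C δ ε x z ps pu qs qu η₁ η₂ n m)
    (S : SingularSystem d c f A) : z.pt 0 ∈ ball (x.pt 0) (2 * S.τ (x.pt 0)) := by
  have hp := h.preScale
  have h1 := h.rho_lt_τ S
  have h2 := hp.P_le_mul_ρ.1
  have h3 : ε ^ 10 * Orbit.rho d x ^ c.a ≤ 1 * Orbit.rho d x ^ c.a := by
    have := hp.ρ_pos
    gcongr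
    linarith [hp.eps_le, pow_pos hp.small.pos 10]
  have h4 := h.left_dist
  rw [dist_comm] at h4
  have h5 := hp.η₁_pow_le
  have h6 := Real.rpow_pos_of_pos hp.ρ_pos c.a
  exact mem_ball.2 (by linarith)

theorem ball_subset (h : ChartLink A c C δ ε x z ps pu qs qu η₁ η₂ n m)
    (S : SingularSystem d c f A) : 8 * Orbit.rho d z.shift ^ (-c.a) * qs + η₁ ^ 8 <
      2 * S.τ (x.pt 0) ∧ 8 * qs < 2 * S.τ (x.pt 0) := by
  have hp := h.preScale'
  have h1 := (h.rho_shift_bounds S).1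
  have h2 := hp.radius_le_rpow
  have h3 : 8 * qs ≤ 8 * Orbit.rho d z.shift ^ (-c.a) * qs := by
    nlinarith [hp.one_le_Λ₀, hp.P_pos]
  have h4 := pow_pos h.η₁_pos 8
  exact ⟨by linarith, by linarith⟩

theorem map_z_mem_ball (h : ChartLink A c C δ ε x z ps pu qs qu η₁ η₂ n m)
    (S : SingularSystem d c f A) : z.shift.pt 0 ∈ ball (f (x.pt 0)) (2 * S.τ (x.pt 0)) := by
  have hp := h.preScale'
  have := (h.ball_subset S).2
  exact mem_ball.2 (by linarith [h.dist_map, hp.η₁_pow_le, hp.P_pos])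

theorem inv_bound (h : ChartLink A c C δ ε x z ps pu qs qu η₁ η₂ n m)
    (S : SingularSystem d c f A) {y : M} (hy : y ∈ ball (f (x.pt 0)) (2 * S.τ (x.pt 0))) :
    ‖mfderiv (𝓡 d) (𝓡 d) (S.inv (x.pt 0)) y‖ ≤ 2 * Orbit.rho d z.shift ^ (-c.a) :=
  (S.dinv_bound _ h.x_notMem h.map_x_notMem _ hy).2.trans (h.rho_shift_bounds S).2

theorem exists_chartData_inv (h : ChartLink A c C δ ε x z ps pu qs qu η₁ η₂ n m)
    (S : SingularSystem d c f A) {p : M} (hp : p ∉ singSet d f)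
    (hpx : dist p (f (x.pt 0)) < η₂ ^ 8) (hd : dist (S.inv (x.pt 0) p) (x.pt 0) < η₁ ^ 8) :
    ∃ n m, ChartData A (S.inv (x.pt 0)) p (x.pt 0) (2 * qs) (η₁ ^ 8)
      (2 * Orbit.rho d z.shift ^ (-c.a)) c.K c.β n m := by
  have hs := h.preScale'
  have h1 := hs.radius_le
  have h0 := pow_pos hs.small.pos 10
  refine exists_chartData (U := ball (f (x.pt 0)) (2 * S.τ (x.pt 0))) h.lebesgue hp h.x_notMem
    hs.P_pos hs.valid.β_pos hs.valid.β_le_one hs.one_le_Λ₀ hs.valid.one_lt_K.le ?_ ?_ ?_ hd ?_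
    (S.inv_diffeo _ h.x_notMem h.map_x_notMem).1 (fun y hy => h.inv_bound S hy)
    (S.dinv_holder _ h.x_notMem h.map_x_notMem)
  · linarith [hs.small.r_le]
  · have := A.one_le_L
    calc _ ≤ A.L * (10 * ε ^ 10) := by gcongr
      _ ≤ 1 := by
        have := hs.small.L_le
        have : 0 ≤ A.L * ε ^ 10 := by positivity
        linarith
  · linarith [hs.small.δ_le]
  · refine ball_subset_ball' ?_
    have := (h.ball_subset S).2
    linarith [hs.η₁_pow_le, hs.P_pos]

/-- The inverse branch sends `f(x_0)` to `x_0`, and its derivative bound keeps the image of the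
nearby point `y_0` inside `B(x_0, 2τ)`. The point `z_0` lies in the same ball and has the same image
under `f`, which is injective there. -/
theorem inv_map (h : ChartLink A c C δ ε x z ps pu qs qu η₁ η₂ n m)
    (S : SingularSystem d c f A) : S.inv (x.pt 0) (z.shift.pt 0) = z.pt 0 := by
  have hs := h.preScale'
  have hx := h.x_notMem
  have hfx := h.map_x_notMem
  obtain ⟨n', m', hc⟩ := h.exists_chartData_inv S hfx (by
    rw [dist_self]; exact pow_pos h.η₂_pos 8) (by
    rw [S.inv_apply _ hx hfx, dist_self]; exact pow_pos h.η₁_pos 8)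
  have hr : dist (z.shift.pt 0) (f (x.pt 0)) < A.r := by
    have := h.dist_map
    have := hs.η₁_pow_le
    have := hs.P_le_eps
    have := hs.small.r_le
    have := pow_pos hs.small.pos 10
    linarith
  set ξ := expInv d A.r (f (x.pt 0)) (z.shift.pt 0) with hξ
  have h1 : ‖ξ‖ ≤ 2 * dist (z.shift.pt 0) (f (x.pt 0)) := by
    have h0 : expInv d A.r (f (x.pt 0)) (f (x.pt 0)) = 0 := by
      have := A.expInv_expMap (f (x.pt 0)) (ξ := 0) (by simpa using A.r_pos)
      rwa [expMap_zero] at this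
    have := A.expInv_lip (f (x.pt 0)) _ hr (f (x.pt 0)) (mem_ball_self A.r_pos)
    rwa [h0, sub_zero] at this
  have h2 : ‖A.Θ n' (f (x.pt 0)) ξ‖ < 2 * qs := by
    rw [LinearIsometryEquiv.norm_map]
    linarith [h.dist_map, hs.η₁_pow_le]
  have h3 : A.expFrame n' (f (x.pt 0)) (A.Θ n' (f (x.pt 0)) ξ) = z.shift.pt 0 :=
    (congrArg (expMap d _) ((A.Θ n' _).symm_apply_apply ξ)).trans (A.expMap_expInv hr)
  have h4 := hc.map_mem h2
  rw [h3] at h4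
  have h5 : S.inv (x.pt 0) (z.shift.pt 0) ∈ ball (x.pt 0) (2 * S.τ (x.pt 0)) :=
    mem_ball.2 (by linarith [(h.ball_subset S).1])
  refine (S.f_diffeo _ hx hfx).2.1 h5 (h.z_mem_ball S) ?_
  rw [S.f_inv _ hx hfx _ (h.map_z_mem_ball S)]
  exact (z.map_pt 0).symm

end ChartLink

end Smooth

/-! ### Comparison of the step matrices at linked points -/

section Smooth

variable {f : M → M} {A : FrameCover d M (singSet d f)} {c : Constants}

theorem FrameCover.Θ_tangentCast (A : FrameCover d M (singSet d f)) (m : ℕ) {p q : M} (h : p = q)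
    (ξ : TangentSpace (𝓡 d) p) : A.Θ m q (tangentCast d h ξ) = A.Θ m p ξ := by
  subst h; rfl

/-- The matrix of the differential of `f` along an orbit in Lyapunov frames. -/
def ChartChoice.stepMatrix (C : ChartChoice d f) {x : Orbit f} (hx : x.pt 0 ∉ singSet d f) :
    Euc d ≃L[ℝ] Euc d :=
  ((C x).trans (Orbit.stepEquiv hx)).trans (C x.shift).symm

theorem ChartChoice.apply_stepMatrix (C : ChartChoice d f) {x : Orbit f}
    (hx : x.pt 0 ∉ singSet d f) (v : Euc d) :
    C x.shift (C.stepMatrix hx v) = x.step (C x v) :=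
  (C x.shift).apply_symm_apply _

theorem ChartChoice.mat_stepMatrix (C : ChartChoice d f) {x : Orbit f}
    (hx : x.pt 0 ∉ singSet d f) (n m : ℕ) (v : Euc d) :
    A.mat m _ (C x.shift) (C.stepMatrix hx v) =
      A.dmap f n m (x.pt 0) (A.mat n _ (C x) v) := by
  show A.Θ m _ (C x.shift (C.stepMatrix hx v)) = A.Θ m (f (x.pt 0))
    (mfderiv (𝓡 d) (𝓡 d) f (x.pt 0) ((A.Θ n _).symm (A.Θ n _ (C x v))))
  rw [C.apply_stepMatrix hx, (A.Θ n _).symm_apply_apply]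
  exact A.Θ_tangentCast m (x.map_pt 0) _

namespace ChartLink

variable [IsContMDiffRiemannianBundle (𝓡 d) ∞ (Euc d) (fun x : M => TangentSpace (𝓡 d) x)]
  [IsRiemannianManifold (𝓡 d) M]
  {C : ChartChoice d f} {δ ε ps pu qs qu η₁ η₂ : ℝ} {x z : Orbit f} {n m : ℕ}

theorem norm_step_x (h : ChartLink A c C δ ε x z ps pu qs qu η₁ η₂ n m)
    (S : SingularSystem d c f A) (ξ : TangentSpace (𝓡 d) (x.pt 0)) :
    ‖x.step ξ‖ ≤ infDist (x.pt 0) (singSet d f) ^ (-c.a) * ‖ξ‖ ∧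
      ‖ξ‖ ≤ infDist (x.pt 0) (singSet d f) ^ (-c.a) * ‖x.step ξ‖ := by
  have h1 : 0 < 2 * S.τ (x.pt 0) := dist_nonneg.trans_lt (h.z_mem_ball S)
  have h2 := (S.bounds_mfderiv h.x_notMem h.map_x_notMem (mem_ball_self h1) (mem_ball_self h1)
    (S.inv_apply _ h.x_notMem h.map_x_notMem) ξ).2
  have h3 : ‖x.step ξ‖ = ‖mfderiv (𝓡 d) (𝓡 d) f (x.pt 0) ξ‖ := norm_tangentCast _ _
  rwa [h3]

theorem inv_map' (h : ChartLink A c C δ ε x z ps pu qs qu η₁ η₂ n m)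
    (S : SingularSystem d c f A) : S.inv (x.pt 0) (f (z.pt 0)) = z.pt 0 :=
  (congrArg (S.inv (x.pt 0)) (z.map_pt 0)).trans (h.inv_map S)

theorem bounds_z (h : ChartLink A c C δ ε x z ps pu qs qu η₁ η₂ n m)
    (S : SingularSystem d c f A) (ξ : TangentSpace (𝓡 d) (z.pt 0)) :
    tangentCast d (h.inv_map' S).symm ξ = mfderiv (𝓡 d) (𝓡 d) (S.inv (x.pt 0)) (f (z.pt 0))
        (mfderiv (𝓡 d) (𝓡 d) f (z.pt 0) ξ) ∧
      ‖mfderiv (𝓡 d) (𝓡 d) f (z.pt 0) ξ‖ ≤ infDist (x.pt 0) (singSet d f) ^ (-c.a) * ‖ξ‖ ∧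
      ‖ξ‖ ≤ infDist (x.pt 0) (singSet d f) ^ (-c.a) * ‖mfderiv (𝓡 d) (𝓡 d) f (z.pt 0) ξ‖ :=
  S.bounds_mfderiv h.x_notMem h.map_x_notMem (h.z_mem_ball S) (by
    rw [z.map_pt 0]; exact h.map_z_mem_ball S) (h.inv_map' S) ξ

theorem norm_step_z (h : ChartLink A c C δ ε x z ps pu qs qu η₁ η₂ n m)
    (S : SingularSystem d c f A) (ξ : TangentSpace (𝓡 d) (z.pt 0)) :
    ‖z.step ξ‖ ≤ infDist (x.pt 0) (singSet d f) ^ (-c.a) * ‖ξ‖ ∧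
      ‖ξ‖ ≤ infDist (x.pt 0) (singSet d f) ^ (-c.a) * ‖z.step ξ‖ := by
  have h3 : ‖z.step ξ‖ = ‖mfderiv (𝓡 d) (𝓡 d) f (z.pt 0) ξ‖ := norm_tangentCast _ _
  rw [h3]
  exact (h.bounds_z S ξ).2

theorem pair_x (h : ChartLink A c C δ ε x z ps pu qs qu η₁ η₂ n m)
    (S : SingularSystem d c f A) :
    LyapunovPair (Orbit.ds d x) (C x) (C x.shift) (C.stepMatrix h.x_notMem) :=
  Orbit.lyapunovPair (S.smooth.mdifferentiable (by simp)) h.x_summable (h.frames _ h.x_summable)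
    (h.frames _ h.shift_x_summable)

theorem pair_z (h : ChartLink A c C δ ε x z ps pu qs qu η₁ η₂ n m)
    (S : SingularSystem d c f A) :
    LyapunovPair (Orbit.ds d z) (C z) (C z.shift) (C.stepMatrix (h.z_summable.1 0)) :=
  Orbit.lyapunovPair (S.smooth.mdifferentiable (by simp)) h.z_summable (h.frames _ h.z_summable)
    (h.frames _ h.shift_z_summable)

theorem norm_stepMatrix_x (h : ChartLink A c C δ ε x z ps pu qs qu η₁ η₂ n m)
    (S : SingularSystem d c f A) {Λ : ℝ} (hΛ : infDist (x.pt 0) (singSet d f) ^ (-c.a) ≤ Λ)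
    (v : Euc d) : ‖C x.shift (C.stepMatrix h.x_notMem v)‖ ≤ Λ * ‖C x v‖ ∧
      ‖C x v‖ ≤ Λ * ‖C x.shift (C.stepMatrix h.x_notMem v)‖ := by
  rw [C.apply_stepMatrix]
  obtain ⟨h1, h2⟩ := h.norm_step_x S (C x v)
  exact ⟨h1.trans (by gcongr), h2.trans (by gcongr)⟩

theorem norm_stepMatrix_z (h : ChartLink A c C δ ε x z ps pu qs qu η₁ η₂ n m)
    (S : SingularSystem d c f A) {Λ : ℝ} (hΛ : infDist (x.pt 0) (singSet d f) ^ (-c.a) ≤ Λ)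
    (v : Euc d) : ‖C z.shift (C.stepMatrix (h.z_summable.1 0) v)‖ ≤ Λ * ‖C z v‖ ∧
      ‖C z v‖ ≤ Λ * ‖C z.shift (C.stepMatrix (h.z_summable.1 0) v)‖ := by
  rw [C.apply_stepMatrix]
  obtain ⟨h1, h2⟩ := h.norm_step_z S (C z v)
  exact ⟨h1.trans (by gcongr), h2.trans (by gcongr)⟩

theorem invNorm_shift_x (h : ChartLink A c C δ ε x z ps pu qs qu η₁ η₂ n m)
    (S : SingularSystem d c f A) :
    invNorm (C x.shift) ≤ 2 * (Orbit.rho d x ^ (-c.a)) ^ 2 * invNorm (C x) :=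
  (h.pair_x S).invNorm_le h.preScale.one_le_Λ₀
    (fun v => (h.norm_stepMatrix_x S h.infDist_rpow_le v).1)
    (fun v => (h.norm_stepMatrix_x S h.infDist_rpow_le v).2)

theorem invNorm_z (h : ChartLink A c C δ ε x z ps pu qs qu η₁ η₂ n m)
    (S : SingularSystem d c f A) :
    invNorm (C z) ≤ 8 * (Orbit.rho d z.shift ^ (-c.a)) ^ 2 * invNorm (C z.shift) := by
  have hΛ := (h.rho_shift_bounds S).2
  refine ((h.pair_z S).invNorm_le' (by linarith [h.preScale'.one_le_Λ₀])
    (fun v => (h.norm_stepMatrix_z S hΛ v).1) (fun v => (h.norm_stepMatrix_z S hΛ v).2)).trans_eq ?_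
  ring

/-- The two step matrices represent `df` at nearby points in nearby frames, so `LyapunovPair.dim_eq`
applies. -/
theorem ds_eq (h : ChartLink A c C δ ε x z ps pu qs qu η₁ η₂ n m)
    (S : SingularSystem d c f A) : Orbit.ds d x = Orbit.ds d z := by
  have hp := h.preScale
  have hK := h.valid.one_lt_K
  have hβ := h.valid.β_pos
  have hη₁ := h.η₁_pos
  have hη₂ := h.η₂_pos
  have hN := hp.one_le_N
  have hΛ := hp.one_le_Λ₀
  have hN1 := h.invNorm_shift_x S
  have hΛx := h.infDist_rpow_le
  set Λ := Orbit.rho d x ^ (-c.a) with hΛd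
  set N := invNorm (C x) with hNd
  have hN0 : 1 ≤ invNorm (C x.shift) :=
    LyapunovPair.one_le_invNorm h.dim_pos (h.norm_le h.shift_x_summable)
  have hN2 : invNorm (C z.shift) ≤ 4 * Λ ^ 2 * N := by
    have hfr : 2 * invNorm (C x.shift) *
        ‖A.mat m _ (C x.shift) - A.mat m _ (C z.shift)‖ ≤ 1 := by
      refine le_trans ?_ hp.frame_small
      have : invNorm (C x.shift) ≤ 8 * Λ ^ 2 * N := hN1.trans (by gcongr; norm_num)
      have := h.right_mat
      gcongr
    linarith [(A.invNorm_le_two_mul m hfr).1]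
  have hN0' : 1 ≤ invNorm (C z.shift) :=
    LyapunovPair.one_le_invNorm h.dim_pos (h.norm_le h.shift_z_summable)
  have hκ : ((8 * Λ ^ 2 * N) ^ 2)⁻¹ ≤ (invNorm (C x.shift) ^ 2)⁻¹ := by
    have : invNorm (C x.shift) ≤ 8 * Λ ^ 2 * N := hN1.trans (by gcongr; norm_num)
    gcongr
  have hκ' : ((8 * Λ ^ 2 * N) ^ 2)⁻¹ ≤ (N ^ 2)⁻¹ := by
    have : N ≤ 8 * Λ ^ 2 * N := by
      refine le_mul_of_one_le_left (by linarith) ?_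
      nlinarith
    gcongr
  refine (h.pair_x S).dim_eq (h.pair_z S) h.dim_pos (Orbit.ds_le C x) (Orbit.ds_le C z)
    hp.dim_small (by positivity) hκ' hκ fun v => ?_
  set D := C.stepMatrix h.x_notMem
  set E := C.stepMatrix (h.z_summable.1 0)
  have hDv : ‖D v‖ ≤ 2 * Λ * ‖v‖ :=
    (h.pair_x S).norm_map_le hΛ (fun v => (h.norm_stepMatrix_x S hΛx v).1) v
  -- Telescoping over three changes: of the target frame, of the source frame, and of the base point
  -- of `df`. The overlaps control the first two and the Hölder condition (A3) the third.
  have e1 : A.mat m _ (C z.shift) (D v - E v) =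
      -(A.mat m _ (C x.shift) - A.mat m _ (C z.shift)) (D v) +
      (A.dmap f n m (x.pt 0) ((A.mat n _ (C x) - A.mat n _ (C z)) v) +
      (A.dmap f n m (x.pt 0) (A.mat n _ (C z) v) - A.dmap f n m (z.pt 0) (A.mat n _ (C z) v))) := by
    rw [map_sub, ← C.mat_stepMatrix (h.z_summable.1 0) n m v, sub_apply,
      sub_apply, map_sub, ← C.mat_stepMatrix h.x_notMem n m v]
    abel
  have b1 : ‖-(A.mat m _ (C x.shift) - A.mat m _ (C z.shift)) (D v)‖ ≤ η₂ ^ 8 * (2 * Λ * ‖v‖) := by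
    rw [norm_neg]
    refine (ContinuousLinearMap.le_opNorm _ _).trans ?_
    exact mul_le_mul h.right_mat hDv (norm_nonneg _) (by positivity)
  have b2 : ‖A.dmap f n m (x.pt 0) ((A.mat n _ (C x) - A.mat n _ (C z)) v)‖ ≤
      Λ * (η₁ ^ 8 * ‖v‖) := by
    set w := (A.mat n _ (C x) - A.mat n _ (C z)) v
    have hw : ‖w‖ ≤ η₁ ^ 8 * ‖v‖ := (ContinuousLinearMap.le_opNorm _ _).trans
      (mul_le_mul_of_nonneg_right h.left_mat (norm_nonneg _))
    have h0 : ‖A.dmap f n m (x.pt 0) w‖ = ‖x.step ((A.Θ n _).symm w)‖ := by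
      refine ((A.Θ m _).norm_map _).trans ?_
      exact (norm_tangentCast (x.map_pt 0) _).symm
    rw [h0]
    refine (h.norm_step_x S _).1.trans ?_
    rw [LinearIsometryEquiv.norm_map]
    exact mul_le_mul hΛx hw (norm_nonneg _) (by linarith)
  have b3 : ‖A.dmap f n m (x.pt 0) (A.mat n _ (C z) v) - A.dmap f n m (z.pt 0) (A.mat n _ (C z) v)‖ ≤
      c.K * (η₁ ^ 8) ^ c.β * ‖v‖ := by
    have h0 : 0 < 2 * S.τ (x.pt 0) := dist_nonneg.trans_lt (h.z_mem_ball S)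
    refine (S.df_holder _ h.x_notMem h.map_x_notMem n m _ ⟨mem_ball_self h0, h.x_mem⟩ _
      ⟨h.z_mem_ball S, h.z_mem⟩ ?_ ?_ _).trans ?_
    · rw [x.map_pt 0]; exact h.shift_x_mem
    · rw [z.map_pt 0]; exact h.shift_z_mem
    · rw [A.norm_mat_apply]
      have h1 := h.norm_le h.z_summable v
      have h2 := h.left_dist.le
      gcongr
  have b := (A.norm_le_mat m (C z.shift) (D v - E v))
  rw [e1] at b
  have b4 := (norm_add_le _ _).trans (add_le_add b1 ((norm_add_le _ _).trans (add_le_add b2 b3)))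
  refine b.trans ?_
  calc _ ≤ 4 * Λ ^ 2 * N * (η₂ ^ 8 * (2 * Λ * ‖v‖) + (Λ * (η₁ ^ 8 * ‖v‖) +
        c.K * (η₁ ^ 8) ^ c.β * ‖v‖)) := mul_le_mul hN2 b4 (norm_nonneg _) (by positivity)
    _ = _ := by ring

end ChartLink

end Smooth

/-! ### The two graph transforms and the theorem -/

section Smooth

variable [IsContMDiffRiemannianBundle (𝓡 d) ∞ (Euc d) (fun x : M => TangentSpace (𝓡 d) x)]
  [IsRiemannianManifold (𝓡 d) M] {f : M → M} {A : FrameCover d M (singSet d f)} {c : Constants}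

namespace ChartLink

variable {C : ChartChoice d f} {δ ε ps pu qs qu η₁ η₂ : ℝ} {x z : Orbit f} {n m : ℕ}

theorem exists_chartData_map (h : ChartLink A c C δ ε x z ps pu qs qu η₁ η₂ n m)
    (S : SingularSystem d c f A) :
    ∃ n m, ChartData A f (x.pt 0) (z.shift.pt 0) (2 * pu) (η₂ ^ 8)
      (2 * Orbit.rho d x ^ (-c.a)) c.K c.β n m := by
  have hs := h.preScale
  have h1 := hs.radius_le
  have h0 := pow_pos hs.small.pos 10
  refine exists_chartData (U := ball (x.pt 0) (2 * S.τ (x.pt 0))) h.lebesgue h.x_notMem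
    (h.shift_z_summable.1 0)
    hs.P_pos hs.valid.β_pos hs.valid.β_le_one hs.one_le_Λ₀ hs.valid.one_lt_K.le ?_ ?_ ?_ ?_ ?_
    S.smooth.contMDiffOn (fun y hy => ?_) (S.df_holder _ h.x_notMem h.map_x_notMem)
  · linarith [hs.small.r_le]
  · have := A.one_le_L
    calc _ ≤ A.L * (10 * ε ^ 10) := by gcongr
      _ ≤ 1 := by
        have := hs.small.L_le
        have : 0 ≤ A.L * ε ^ 10 := by positivity
        linarith
  · linarith [hs.small.δ_le]
  · rw [dist_comm]; exact h.dist_map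
  · refine ball_subset_ball ?_
    have h2 := hs.radius_le_rpow
    have h3 := h.rho_lt_τ S
    have h4 : pu ≤ Orbit.rho d x ^ (-c.a) * pu := le_mul_of_one_le_left hs.P_pos.le hs.one_le_Λ₀
    linarith [hs.P_pos, pow_pos h.η₂_pos 8]
  · refine (S.df_bound _ h.x_notMem h.map_x_notMem y hy).2.trans (h.infDist_rpow_le.trans ?_)
    linarith [hs.one_le_Λ₀]

/-- The comparison frame at `f(x_0)` is the Lyapunov frame of the shifted orbit, for which `df` has
the hyperbolic matrix; the right overlap compares it with the frame at `y`. -/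
theorem graphTransform_map (h : ChartLink A c C δ ε x z ps pu qs qu η₁ η₂ n m)
    (S : SingularSystem d c f A) {k : ℕ} (hk : Orbit.ds d x = k) (hkd : k ≤ d)
    {G : Euc (d - k) → Euc k} (hG : DoubleChart.IsRepresenting c.β η₁ pu G) :
    GraphTransform (splitLow hkd) f (C x) (C z.shift) c.β pu qu qs η₁ η₂ G := by
  subst hk
  obtain ⟨n', m', hc⟩ := h.exists_chartData_map S
  have hN := h.invNorm_shift_x S
  have hN0 := h.preScale.one_le_N
  have hx := (h.norm_le (C := C) h.x_summable)
  have e : f (x.pt 0) = x.shift.pt 0 := x.map_pt 0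
  refine hc.graphTransform (C' := castFrame e.symm (C x.shift))
    (D := C.stepMatrix h.x_notMem) (m₀ := m) (ρ' := Orbit.rho d z.shift)
    h.dim_pos h.preScale ?_ hx (h.norm_le h.shift_z_summable)
    (fun v => ?_) (fun v => ?_) ?_ ?_ h.shift_z_mem ?_ h.rho_z_pos (h.rho_le_one _) h.qu_le h.qs_le
    h.η₂_le_qu h.η₂_le_qs h.qu_le_ladder hG
  · rw [invNorm_castFrame]
    exact (h.pair_x S).splitHyp h.dim_pos hkd
  · rw [norm_castFrame]
    exact h.norm_le h.shift_x_summable v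
  · rw [castFrame_apply, C.apply_stepMatrix]
    have key : ∀ (p q : M) (e : p = q) (ξ : TangentSpace (𝓡 d) p),
        tangentCast d e.symm (tangentCast d e ξ) = ξ := by
      rintro p q rfl ξ; rfl
    exact key _ _ e _
  · rw [invNorm_castFrame]
    refine hN.trans ?_
    gcongr
    norm_num
  · rw [e]; exact h.shift_x_mem
  · rw [mat_castFrame]; exact h.right_mat

/-- By `inv_map` the image of `y_0` is `z_0`, where the comparison frame is that of `z = f̂⁻¹y`.
There the differential of the branch has the inverse step matrix of `z`, and the left overlap
compares that frame with the one at `x`. -/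
theorem graphTransform_inv (h : ChartLink A c C δ ε x z ps pu qs qu η₁ η₂ n m)
    (S : SingularSystem d c f A) {k : ℕ} (hk : Orbit.ds d z = k) (hkd : k ≤ d)
    {G : Euc k → Euc (d - k)} (hG : DoubleChart.IsRepresenting c.β η₂ qs G) :
    GraphTransform (splitLow hkd).swap (S.inv (x.pt 0)) (C z.shift) (C x) c.β qs ps pu η₂ η₁ G := by
  subst hk
  have hz : dist (z.pt 0) (x.pt 0) < η₁ ^ 8 := by rw [dist_comm]; exact h.left_dist
  obtain ⟨n', m', hc⟩ := h.exists_chartData_inv S (h.shift_z_summable.1 0) h.dist_map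
    (by rw [h.inv_map S]; exact hz)
  refine hc.graphTransform (C' := castFrame (h.inv_map S).symm (C z))
    (D := (C.stepMatrix (h.z_summable.1 0)).symm) (m₀ := n) (ρ' := Orbit.rho d x)
    h.dim_pos h.preScale' ?_ (h.norm_le h.shift_z_summable) (h.norm_le h.x_summable)
    (fun v => ?_) (fun v => ?_) ?_ ?_ h.x_mem ?_ h.rho_x_pos (h.rho_le_one _) h.ps_le h.pu_le
    h.η₁_le_ps h.η₁_le_pu h.ps_le_ladder hG
  · rw [invNorm_castFrame]
    exact (h.pair_z S).splitHyp_symm h.dim_pos hkd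
  · rw [norm_castFrame]
    exact h.norm_le h.z_summable v
  · obtain ⟨w, rfl⟩ := (C.stepMatrix (h.z_summable.1 0)).surjective v
    rw [castFrame_apply, ContinuousLinearEquiv.symm_apply_apply, C.apply_stepMatrix]
    have key : ∀ (y : M) (e : f (z.pt 0) = y) (hy : S.inv (x.pt 0) y = z.pt 0)
        (ξ : TangentSpace (𝓡 d) (z.pt 0)), tangentCast d hy.symm ξ =
          mfderiv (𝓡 d) (𝓡 d) (S.inv (x.pt 0)) y
            (tangentCast d e (mfderiv (𝓡 d) (𝓡 d) f (z.pt 0) ξ)) := by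
      rintro y rfl hy ξ
      exact (h.bounds_z S ξ).1
    exact key _ (z.map_pt 0) (h.inv_map S) _
  · rw [invNorm_castFrame]
    exact h.invNorm_z S
  · rw [h.inv_map S]; exact h.z_mem
  · rw [mat_castFrame, norm_sub_rev]; exact h.left_mat

theorem chartGraph_subset (h : ChartLink A c C δ ε x z ps pu qs qu η₁ η₂ n m)
    (S : SingularSystem d c f A) {k l : ℕ} (J : CoordSplit d k l) {G : Euc l → Euc k}
    (hG : DoubleChart.IsRepresenting c.β η₂ qs G) :
    chartGraph J (C z.shift) qs G ⊆ ball (f (x.pt 0)) (2 * S.τ (x.pt 0)) := by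
  have hs := h.preScale'
  rintro _ ⟨v, hv, rfl⟩
  have hv' := mem_ball_zero_iff.1 hv
  have h1 := hG.norm_le hv'
  have h2 : η₂ ^ 2 ≤ η₂ := by nlinarith [hs.η₁_le_one, h.η₂_pos]
  have h3 : ‖J.join (G v) v‖ < 2 * qs := by
    have : ‖J.join (G v) v‖ ≤ ‖G v‖ + ‖v‖ :=
      (norm_add_le _ _).trans (add_le_add (J.norm_iE _) (J.norm_iU v))
    linarith [h.η₂_le_qs, hs.P_pos]
  have h4 := (h.norm_le h.shift_z_summable (J.join (G v) v)).trans_lt h3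
  have h5 : 2 * qs < A.r := by
    have := hs.P_le_eps
    have := hs.small.r_le
    have := pow_pos hs.small.pos 10
    linarith
  have h6 := A.exp_lip (z.shift.pt 0) _ (mem_ball_zero_iff.2 (h4.trans h5)) 0
    (mem_ball_self A.r_pos)
  rw [expMap_zero, sub_zero] at h6
  refine mem_ball.2 ((dist_triangle _ _ _).trans_lt (add_lt_add_of_le_of_lt h6 h.dist_map |>.trans ?_))
  linarith [(h.ball_subset S).2, hs.η₁_pow_le, hs.P_pos]

end ChartLink

theorem DoubleChart.Arrow.exists_chartLink [CompactSpace M] (hd : 0 < d)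
    (hdiam : diam (univ : Set M) < 1) (hc : c.Valid) (S : SingularSystem d c f A) {δ ε : ℝ}
    (hδ : ∀ y ∉ singSet d f, ∃ n, ball y δ ⊆ ball (A.center n) (A.radius n))
    (hε : SmallEps c A.L A.r δ ε) {C : ChartChoice d f} (hC : C.Valid) {x z : Orbit f}
    {ps pu qs qu : ℝ} (h₁ : DoubleChart.Valid C c ε ⟨x, ps, pu⟩)
    (h₂ : DoubleChart.Valid C c ε ⟨z.shift, qs, qu⟩)
    (h : DoubleChart.Arrow C c ε A ⟨x, ps, pu⟩ ⟨z.shift, qs, qu⟩) :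
    ∃ n m, ChartLink A c C δ ε x z ps pu qs qu (min ps pu) (min qs qu) n m := by
  have hf : MDifferentiable (𝓡 d) (𝓡 d) f := S.smooth.mdifferentiable (by simp)
  have hl := h.overlap_left
  have hr := h.overlap_right
  simp only [Orbit.shiftInv_shift] at hl
  obtain ⟨-, n, hn, hn', hl⟩ := hl
  obtain ⟨-, m, hm, hm', hr⟩ := hr
  -- Each overlap is between charts of equal size `η`, so its bound `η⁴ η⁴` is `η⁸`.
  rw [← pow_add] at hl hr
  have hQ₁ := ChartChoice.Q_le_Qtilde h₁.Q_pos
  have hQ₂ := ChartChoice.Q_le_Qtilde h₂.Q_pos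
  refine ⟨n, m,
    { dim_pos := hd
      valid := hc
      small := hε
      lebesgue := hδ
      infDist_le := infDist_le_one hdiam S.singular
      frames := hC
      x_summable := h₁.summable
      z_summable := Orbit.isSummable_of_shift hf h₂.summable
      shift_x_summable := Orbit.isSummable_shift hf h₁.summable
      shift_z_summable := h₂.summable
      rho_x_pos := ChartChoice.rho_pos hc h₁.Q_pos
      rho_z_pos := ChartChoice.rho_pos hc h₂.Q_pos
      ps_le := h₁.ps_le.trans hQ₁
      pu_le := h₁.pu_le.trans hQ₁
      qs_le := h₂.ps_le.trans hQ₂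
      qu_le := h₂.pu_le.trans hQ₂
      η₁_pos := h₁.size_pos
      η₂_pos := h₂.size_pos
      η₁_le_ps := min_le_left _ _
      η₁_le_pu := min_le_right _ _
      η₂_le_qs := min_le_left _ _
      η₂_le_qu := min_le_right _ _
      close := h.ladderClose hc h₁ h₂
      ps_le_ladder := h.ps_le
      qu_le_ladder := h.qu_le
      x_mem := hn
      z_mem := hn'
      left_dist := lt_of_le_of_lt (le_add_of_nonneg_right (norm_nonneg _)) hl
      left_mat := (le_add_of_nonneg_left dist_nonneg).trans hl.le
      shift_x_mem := hm
      shift_z_mem := hm'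
      right_dist := lt_of_le_of_lt (le_add_of_nonneg_right (norm_nonneg _)) hr
      right_mat := (le_add_of_nonneg_left dist_nonneg).trans hr.le }⟩

theorem GraphTransform.isSAdmissible {C : ChartChoice d f} {w : DoubleChart f} {k : ℕ}
    (hw : w.x.ds d = k) {hk : k ≤ d} {g : M → M} {p : M} {Cp : Euc d ≃L[ℝ] TangentSpace (𝓡 d) p}
    {P η : ℝ} {G : Euc k → Euc (d - k)}
    (h : GraphTransform (splitLow hk).swap g Cp (C w.x) c.β P w.ps w.pu η w.size G) :
    (∃ W : Set M, (w.IsSAdmissible C c W ∧ W ⊆ g '' chartGraph (splitLow hk).swap Cp P G) ∧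
      (∀ W' : Set M, w.IsSAdmissible C c W' →
        W' ⊆ g '' chartGraph (splitLow hk).swap Cp P G → W' = W) ∧
      g (expMap d p (Cp (joinVec 0 (G 0)))) ∈ W) ∧
    (∀ U : Set M, w.IsUAdmissible C c U →
      ∃! z : M, z ∈ (g '' chartGraph (splitLow hk).swap Cp P G) ∩ U) := by
  obtain ⟨⟨G', hG', hsub, huniq, hmem⟩, hinter⟩ := h
  refine ⟨⟨_, ⟨(DoubleChart.isSAdmissible_iff hw hk _).2 ⟨G', hG', rfl⟩, hsub⟩,
    fun W' hW' hsub' => ?_, ?_⟩, fun U hU => ?_⟩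
  · obtain ⟨G'', hG'', rfl⟩ := (DoubleChart.isSAdmissible_iff hw hk _).1 hW'
    exact huniq G'' hG'' hsub'
  · rwa [CoordSplit.swap_join, splitLow_join] at hmem
  · obtain ⟨N, hN, rfl⟩ := (DoubleChart.isUAdmissible_iff hw hk _).1 hU
    have h1 := hinter N hN
    simp only [CoordSplit.swap_join] at h1
    exact h1

theorem GraphTransform.isUAdmissible {C : ChartChoice d f} {w : DoubleChart f} {k : ℕ}
    (hw : w.x.ds d = k) {hk : k ≤ d} {g : M → M} {p : M} {Cp : Euc d ≃L[ℝ] TangentSpace (𝓡 d) p}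
    {P η : ℝ} {G : Euc (d - k) → Euc k}
    (h : GraphTransform (splitLow hk) g Cp (C w.x) c.β P w.pu w.ps η w.size G) :
    (∃ W : Set M, (w.IsUAdmissible C c W ∧ W ⊆ g '' chartGraph (splitLow hk) Cp P G) ∧
      (∀ W' : Set M, w.IsUAdmissible C c W' →
        W' ⊆ g '' chartGraph (splitLow hk) Cp P G → W' = W) ∧
      g (expMap d p (Cp (joinVec (G 0) 0))) ∈ W) ∧
    (∀ U : Set M, w.IsSAdmissible C c U →
      ∃! z : M, z ∈ (g '' chartGraph (splitLow hk) Cp P G) ∩ U) := by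
  obtain ⟨⟨G', hG', hsub, huniq, hmem⟩, hinter⟩ := h
  refine ⟨⟨_, ⟨(DoubleChart.isUAdmissible_iff hw hk _).2 ⟨G', hG', rfl⟩, hsub⟩,
    fun W' hW' hsub' => ?_, ?_⟩, fun U hU => ?_⟩
  · obtain ⟨G'', hG'', rfl⟩ := (DoubleChart.isUAdmissible_iff hw hk _).1 hW'
    exact huniq G'' hG'' hsub'
  · rwa [splitLow_join] at hmem
  · obtain ⟨N, hN, rfl⟩ := (DoubleChart.isSAdmissible_iff hw hk _).1 hU
    simpa only [chartGraph, CoordSplit.swap_join] using hinter N hN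

theorem graph_transforms_of_arrow [CompactSpace M] (hd : 0 < d)
    (hdiam : diam (univ : Set M) < 1) (hc : c.Valid) (S : SingularSystem d c f A) {δ ε : ℝ}
    (hδ : ∀ y ∉ singSet d f, ∃ n, ball y δ ⊆ ball (A.center n) (A.radius n))
    (hε : SmallEps c A.L A.r δ ε) {C : ChartChoice d f} (hC : C.Valid) {w₁ w₂ : DoubleChart f}
    (h₁ : w₁.Valid C c ε) (h₂ : w₂.Valid C c ε) (h : w₁.Arrow C c ε A w₂) :
    (∀ G : Euc (w₂.x.ds d) → Euc (d - w₂.x.ds d),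
        DoubleChart.IsRepresenting c.β w₂.size w₂.ps G →
        w₂.sGraph C G ⊆ ball (f (w₁.x.pt 0)) (2 * S.τ (w₁.x.pt 0)) ∧
        (∃ W : Set M,
          (w₁.IsSAdmissible C c W ∧ W ⊆ S.inv (w₁.x.pt 0) '' w₂.sGraph C G) ∧
          (∀ W' : Set M,
            w₁.IsSAdmissible C c W' → W' ⊆ S.inv (w₁.x.pt 0) '' w₂.sGraph C G → W' = W) ∧
          S.inv (w₁.x.pt 0) (C.psi w₂.x (joinVec 0 (G 0))) ∈ W) ∧
        (∀ U : Set M, w₁.IsUAdmissible C c U →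
          ∃! z : M, z ∈ (S.inv (w₁.x.pt 0) '' w₂.sGraph C G) ∩ U)) ∧
      (∀ G : Euc (d - w₁.x.ds d) → Euc (w₁.x.ds d),
        DoubleChart.IsRepresenting c.β w₁.size w₁.pu G →
        (∃ W : Set M,
          (w₂.IsUAdmissible C c W ∧ W ⊆ f '' w₁.uGraph C G) ∧
          (∀ W' : Set M, w₂.IsUAdmissible C c W' → W' ⊆ f '' w₁.uGraph C G → W' = W) ∧
          f (C.psi w₁.x (joinVec (G 0) 0)) ∈ W) ∧
        (∀ U : Set M, w₂.IsSAdmissible C c U →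
          ∃! z : M, z ∈ (f '' w₁.uGraph C G) ∩ U)) := by
  obtain ⟨x, ps, pu⟩ := w₁
  obtain ⟨y, qs, qu⟩ := w₂
  -- With `f̂⁻¹y` as the basic variable, its frames and differentials need no transport along
  -- `f̂(f̂⁻¹y) = y`.
  obtain ⟨z, rfl⟩ : ∃ z : Orbit f, y = z.shift := ⟨y.shiftInv, (Orbit.shift_shiftInv y).symm⟩
  obtain ⟨n, m, hL⟩ := h.exists_chartLink hd hdiam hc S hδ hε hC h₁ h₂
  have hz : Orbit.ds d z.shift = Orbit.ds d z :=
    Orbit.ds_shift (S.smooth.mdifferentiable (by simp)) hL.z_summable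
  have hx := hL.ds_eq S
  refine ⟨fun G hG => ?_, fun G hG => ?_⟩
  · have hk := Orbit.ds_le C z.shift
    have key := hL.graphTransform_inv S hz.symm hk hG
    rw [DoubleChart.sGraph_eq (w := ⟨z.shift, qs, qu⟩) hk]
    exact ⟨hL.chartGraph_subset S _ hG,
      key.isSAdmissible (w := ⟨x, ps, pu⟩) (hx.trans hz.symm)⟩
  · have hk := Orbit.ds_le C x
    have key := hL.graphTransform_map S rfl hk hG
    rw [DoubleChart.uGraph_eq (w := ⟨x, ps, pu⟩) hk]
    exact key.isUAdmissible (w := ⟨z.shift, qs, qu⟩) (hz.trans hx.symm)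

end Smooth

end Geometry

end

theorem mainTheorem7 {d : ℕ} (hd : 2 ≤ d) {M : Type*} [MetricSpace M] [CompactSpace M]
    [ChartedSpace (Euc d) M] [IsManifold (𝓡 d) ∞ M]
    [RiemannianBundle (fun x : M => TangentSpace (𝓡 d) x)]
    [IsContMDiffRiemannianBundle (𝓡 d) ∞ (Euc d) (fun x : M => TangentSpace (𝓡 d) x)]
    [IsRiemannianManifold (𝓡 d) M] (hdiam : diam (univ : Set M) < 1)
    (c : Constants) (hc : c.Valid) (f : M → M) (A : FrameCover d M (singSet d f))
    (S : SingularSystem d c f A) :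
    ∃ ε₀ > 0, ∀ ε : ℝ, 0 < ε → ε < ε₀ →
    ∀ C : ChartChoice d f, C.Valid →
    ∀ w₁ w₂ : DoubleChart f, w₁.Valid C c ε → w₂.Valid C c ε → w₁.Arrow C c ε A w₂ →
      (∀ G : Euc (w₂.x.ds d) → Euc (d - w₂.x.ds d),
        DoubleChart.IsRepresenting c.β w₂.size w₂.ps G →
        w₂.sGraph C G ⊆ ball (f (w₁.x.pt 0)) (2 * S.τ (w₁.x.pt 0)) ∧
        (∃ W : Set M,
          (w₁.IsSAdmissible C c W ∧ W ⊆ S.inv (w₁.x.pt 0) '' w₂.sGraph C G) ∧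
          (∀ W' : Set M,
            w₁.IsSAdmissible C c W' → W' ⊆ S.inv (w₁.x.pt 0) '' w₂.sGraph C G → W' = W) ∧
          S.inv (w₁.x.pt 0) (C.psi w₂.x (joinVec 0 (G 0))) ∈ W) ∧
        (∀ U : Set M, w₁.IsUAdmissible C c U →
          ∃! z : M, z ∈ (S.inv (w₁.x.pt 0) '' w₂.sGraph C G) ∩ U)) ∧
      (∀ G : Euc (d - w₁.x.ds d) → Euc (w₁.x.ds d),
        DoubleChart.IsRepresenting c.β w₁.size w₁.pu G →
        (∃ W : Set M,
          (w₂.IsUAdmissible C c W ∧ W ⊆ f '' w₁.uGraph C G) ∧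
          (∀ W' : Set M, w₂.IsUAdmissible C c W' → W' ⊆ f '' w₁.uGraph C G → W' = W) ∧
          f (C.psi w₁.x (joinVec (G 0) 0)) ∈ W) ∧
        (∀ U : Set M, w₂.IsSAdmissible C c U →
          ∃! z : M, z ∈ (f '' w₁.uGraph C G) ∩ U)) := by
  obtain ⟨δ, hδ, hA⟩ := A.lebesgue
  obtain ⟨ε₀, hε₀, hε⟩ := exists_smallEps (L := A.L) hc A.r_pos hδ
  exact ⟨ε₀, hε₀, fun ε h1 h2 C hC w₁ w₂ hw₁ hw₂ h =>
    graph_transforms_of_arrow (by omega) hdiam hc S hA (hε ε h1 h2) hC hw₁ hw₂ h⟩
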